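/- **Setting.** Let $d\ge 5$, let $|\cdot|$ be the Euclidean norm and $|||x|||=\max\{|x|,1\}$. A function $f$ on $\mathbb Z^d$ is *$\mathbb Z^d$-symmetric* if $f(Tx)=f(x)$ for every automorphism $T$ of the nearest-neighbour graph $\mathbb Z^d$ fixing $0$. Let $J\colon\mathbb Z^d\to\mathbb R$ be $\mathbb Z^d$-symmetric and of finite range, with $J(x)\ge 0$ for $x\ne 0$, $J(0)=-\sum_{x\neq 0}J(x)$, and such that $\{x: J(x)>0\}$ generates $\mathbb Z^d$. Put $\hat J=-J(0)$ and $J_+(x)=J(x)\mathbb 1_{x\ne 0}$. Let $P_a$ (with expectation $E_a$) be the law, on càdlàg paths $[0,\infty)\to\mathbb Z^d$, of the continuous-time random walk $X$ started at $a$ with generator $\Delta_{x,y}=J(y-x)$, and let $S(x)=\int_0^\infty P_0(X_\ell=x)\,d\ell$. For finite $\Lambda\subset\mathbb Z^d$ let $X^{(\Lambda)}$ be $X$ killed (sent to a cemetery state $*\notin\mathbb Z^d$) on first exit from $\Lambda$, and let $\tau^{(\Lambda)}_{[s,t]}\in[0,\infty)^\Lambda$, $\tau^{(\Lambda)}_{[s,t],x}=\int_s^t\mathbb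 1_{X^{(\Lambda)}_\ell=x}\,d\ell$, be its local times. For each finite $\Lambda\subset\mathbb Z^d$ let $Z^{(\Lambda)}\colon[0,\infty)^\Lambda\to(0,\infty)$, and define $$G^{(\Lambda)}_{t}(a,b)=\int_0^\infty d\ell\;E_a\Big[\frac{Z^{(\Lambda)}_{t+\tau^{(\Lambda)}_{[0,\ell]}}}{Z^{(\Lambda)}_{t}}\mathbb 1_{X^{(\Lambda)}_\ell=b}\Big],\qquad G(x,y)=\sup_\Lambda G^{(\Lambda)}_0(x,y),\qquad G(x)=G(0,x).$$ **Hypotheses.** Let $K>0$ and $\eta>0$. Derivatives of $Z^{(\Lambda)}$ at the boundary of $[0,\infty)^\Lambda$ are extensions by continuity. Assume, for all finite $\Lambda$: * $Z^{(\Lambda)}$ is strictly positive, continuous and $C^2$ on $[0,\infty)^\Lambda$; * $Z^{(T\Lambda)}_{t\circ T^{-1}}/Z^{(T\Lambda)}_{0}=Z^{(\Lambda)}_{t}/Z^{(\Lambda)}_0$ for every automorphism $T$ of $\mathbb Z^d$ and $t\in[0,\infty)^\Lambda$; * $G^{(\Lambda)}_t\le G^{(\Lambda)}_0$ for all $t\in[0,\infty)^\Lambda$;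 * $G^{(\Lambda')}_0(x,y)\le G^{(\Lambda)}_0(x,y)$ for $\Lambda'\subset\Lambda$ and $x,y\in\Lambda'$; * for all $0\le u<v<\infty$, all $x,y\in\Lambda$ and all càdlàg paths, $$\big|\partial_{t_x}\partial_{t_y}\log Z^{(\Lambda)}_t\big|_{t=\tau^{(\Lambda)}_{[u,v]}}\le\eta\big(\mathbb 1_{x=y}+G^{(\Lambda)}_0(x,y)^2\big);$$ * ($K$-infrared bound) $G(x,y)\le K\,S(y-x)$ for all $x,y\in\mathbb Z^d$; * the numbers $\Pi^{(\Lambda)}_{0,x}=\lim_{t\downarrow0}\partial_{t_x}\log Z^{(\Lambda)}_t$ (for $x\in\Lambda$) are bounded uniformly in $x$ and $\Lambda$, and $\Pi_0=\lim_{\Lambda\uparrow\mathbb Z^d}\Pi^{(\Lambda)}_{0,x}$ exists and does not depend on $x$. **Lace expansion coefficient.** Let $Y_{s,t}=Z^{(\Lambda)}_{\tau^{(\Lambda)}_{[s,t]}}/Z^{(\Lambda)}_0$ and $V_{s,t}=-\partial_s\partial_t\log Y_{s,t}$ (right derivatives). For $m\ge1$ let $\mathcal L_m(0)\subset\mathbb{R}^{2m-1}$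 be the set of laces $L=(s_1,s_1',s_2,s_2',\dots,s_{m-1}',s_m)$ with $0=s_0=s_0'<s_1<s_1'<s_2<s_2'<\dots<s_{m-1}'<s_m=s_m'$, with Lebesgue measure $dL$, let $$w(L)=\prod_{i=0}^{m-1}V_{s_i,s_{i+1}'}\cdot Y_{s_0',s_1'}\prod_{i=0}^{m-2}\frac{Y_{s_i',s_{i+2}'}}{Y_{s_i',s_{i+1}'}},$$ $$\Pi_m^{(\Lambda)}(x,y)=\int_{\mathcal L_m(0)}dL\,E_x\big[w(L)\mathbb 1_{X^{(\Lambda)}_{s_m'}=y}\big],\qquad \Psi^{(\Lambda)}(x,y)=\sum_{m\ge1}\Pi^{(\Lambda)}_m(x,y).$$ **Proposition.** There exist $\alpha>0$, $\eta_0>0$ and $C>0$, depending only on $d$, $J$ and $K$, such that if the hypotheses hold with some $\eta\in(0,\eta_0)$, then the integrals and the series defining $\Psi^{(\Lambda)}(x,y)$ converge absolutely for all finite $\Lambda$ and $x,y\in\Lambda$, and there is a function $\Psi^{(\infty)}\colon\mathbb Z^d\to\mathbb R$ such that 1. $\lim_{\Lambda\uparrow\mathbb Z^d}\Psi^{(\Lambda)}(x,y)=\Psi^{(\infty)}(y-x)$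 for all $x,y\in\mathbb Z^d$, and $\Psi^{(\infty)}$ is $\mathbb Z^d$-symmetric; 2. $|\Psi^{(\infty)}(x)|\le\alpha\,\eta\,|||x|||^{-3(d-2)}$ for all $x\in\mathbb Z^d$; 3. $(\hat J-\Pi_0)\,G(x)=\mathbb 1_{x=0}+J_+*G(x)+\Psi^{(\infty)}*G(x)$ for all $x\in\mathbb Z^d$, with absolutely convergent convolutions; 4. $\hat J-\Pi_0\ge\dfrac{1-C\eta}{K\,S(0)}$. -/

import Mathlib

open MeasureTheory Filter Topology
open scoped NNReal ENNReal

noncomputable section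

/-! ### The lattice -/

/-- The vertex set of `ℤ^d`. -/
abbrev Site (d : ℕ) : Type := Fin d → ℤ

/-- The nearest-neighbour graph `ℤ^d`. -/
def latticeGraph (d : ℕ) : SimpleGraph (Site d) where
  Adj x y := ∑ i, |x i - y i| = 1
  symm := ⟨fun x y h => by
    rw [← h]; exact Finset.sum_congr rfl (fun i _ => abs_sub_comm _ _)⟩
  loopless := ⟨fun x h => by simp at h⟩

/-- Automorphisms of the graph `ℤ^d`. -/
abbrev LatticeAut (d : ℕ) : Type := latticeGraph d ≃g latticeGraph d

/-- A function of one variable is `ℤ^d`-symmetric if it is invariant under all automorphisms of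
`ℤ^d` that fix the origin. -/
def IsLatticeSymmetric {d : ℕ} (f : Site d → ℝ) : Prop :=
  ∀ T : LatticeAut d, T 0 = 0 → ∀ x, f (T x) = f x

/-- Euclidean norm of a lattice point. -/
def euclNorm {d : ℕ} (x : Site d) : ℝ := Real.sqrt (∑ i, (x i : ℝ) ^ 2)

/-- `max {|x|, 1}`. -/
def mnorm {d : ℕ} (x : Site d) : ℝ := max (euclNorm x) 1

/-- Discrete convolution `(f * h)(x) = ∑_y f(y) h(x - y)`. -/
def conv {d : ℕ} (f h : Site d → ℝ) (x : Site d) : ℝ := ∑' y, f y * h (x - y)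

/-- The `n`-fold convolution of `f` with itself. -/
def convPow {d : ℕ} (f : Site d → ℝ) : ℕ → Site d → ℝ
  | 0 => fun x => if x = 0 then 1 else 0
  | n + 1 => conv f (convPow f n)

/-! ### Jump rates and the continuous-time random walk -/

/-- The off-diagonal jump rates `J₊`. -/
def Jplus {d : ℕ} (J : Site d → ℝ) (y : Site d) : ℝ := if y = 0 then 0 else J y

/-- The total jump rate `Ĵ = -J(0)`. -/
def Jhat {d : ℕ} (J : Site d → ℝ) : ℝ := -J 0

/-- The standing assumptions on the jump rates. -/
structure IsJumpRate {d : ℕ} (J : Site d → ℝ) : Prop where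
  nonneg : ∀ x, x ≠ 0 → 0 ≤ J x
  zero_eq : HasSum (Jplus J) (-J 0)
  generates : AddSubgroup.closure {x | 0 < J x} = ⊤
  symmetric : IsLatticeSymmetric J
  finite_range : ∃ R : ℝ, 0 < R ∧ ∀ x, R ≤ euclNorm x → J x = 0

/-- Càdlàg paths `[0,∞) → ℤ^d` (`ℤ^d` carries the discrete topology). -/
structure CadlagPath (d : ℕ) where
  /-- the path -/
  toFun : ℝ≥0 → Site d
  right_continuous : ∀ t, ContinuousWithinAt toFun (Set.Ici t) t
  left_limit : ∀ t, 0 < t → ∃ l, Tendsto toFun (𝓝[<] t) (𝓝 l)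

instance (d : ℕ) : CoeFun (CadlagPath d) (fun _ => ℝ≥0 → Site d) := ⟨CadlagPath.toFun⟩

/-- The σ-algebra on path space generated by all coordinate maps. -/
instance (d : ℕ) : MeasurableSpace (CadlagPath d) :=
  ⨆ t : ℝ≥0, MeasurableSpace.comap (fun ω : CadlagPath d => ω t) inferInstance

/-- The entry `(a, a + x)` of `exp (t Δ)`, where `Δ_{x,y} = J (y - x)`. -/
def transition {d : ℕ} (J : Site d → ℝ) (t : ℝ) (x : Site d) : ℝ :=
  ∑' n : ℕ, t ^ n / (n.factorial : ℝ) * convPow J n x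

/-- `P` is the law on path space of the continuous-time random walk with generator `Δ` started at
`a`: the Markov chain with transition matrices `exp (t Δ)`, described by its finite-dimensional
distributions. Such a law is unique. -/
structure IsWalkLaw {d : ℕ} (J : Site d → ℝ) (a : Site d) (P : Measure (CadlagPath d)) :
    Prop where
  isProbabilityMeasure : IsProbabilityMeasure P
  finite_dimensional : ∀ (n : ℕ) (t : Fin (n + 1) → ℝ≥0) (x : Fin (n + 1) → Site d),
    t 0 = 0 → Monotone t →
    P {ω | ∀ i, ω (t i) = x i} =
      if x 0 = a then
        ENNReal.ofReal
          (∏ i : Fin n, transition J ((t i.succ : ℝ) - t i.castSucc) (x i.succ - x i.castSucc))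
      else 0

/-- The infinite-volume free Green's function `S(x)`: the expected total time that the walk
started at `0` spends at `x`. -/
def freeGreen {d : ℕ} (P : Site d → Measure (CadlagPath d)) (x : Site d) : ℝ≥0∞ :=
  ∫⁻ ω, volume {r : ℝ | 0 ≤ r ∧ ω r.toNNReal = x} ∂(P 0)

/-- The first exit time from `Λ`. -/
def exitTime {d : ℕ} (Λ : Finset (Site d)) (ω : CadlagPath d) : ℝ≥0∞ :=
  ⨅ (t : ℝ≥0) (_ : ω t ∉ Λ), (t : ℝ≥0∞)

open Classical in
/-- The walk killed on exiting `Λ`; `none` is the cemetery state. -/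
def killed {d : ℕ} (Λ : Finset (Site d)) (ω : CadlagPath d) (t : ℝ≥0) : Option (Site d) :=
  if (t : ℝ≥0∞) < exitTime Λ ω then some (ω t) else none

/-- The vector of local times in `Λ` of the killed walk during `[s,t]`, for `0 ≤ s ≤ t`. -/
def localTime {d : ℕ} (Λ : Finset (Site d)) (ω : CadlagPath d) (s t : ℝ) : Λ → ℝ :=
  fun x => volume.real {r : ℝ | r ∈ Set.Icc s t ∧ killed Λ ω r.toNNReal = some x.1}

/-! ### The weights `Z` and the Green's function

A model is a family of functions `Z Λ` on `[0,∞)^Λ`. The value of `Z Λ` outside of the orthant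
`[0,∞)^Λ = Set.Ici 0` never matters. -/

/-- Families of functions `Z Λ`, one for each finite volume `Λ`. -/
abbrev WeightFamily (d : ℕ) : Type := (Λ : Finset (Site d)) → (Λ → ℝ) → ℝ

open Classical in
/-- The Green's function
`G_t(a,b) = ∫₀^∞ dℓ E_a[ Z_{t + τ_[0,ℓ]} / Z_t ; X_ℓ = b ]` in the finite volume `Λ`. -/
def green {d : ℕ} (P : Site d → Measure (CadlagPath d)) (Z : WeightFamily d)
    (Λ : Finset (Site d)) (t : Λ → ℝ) (a b : Site d) : ℝ≥0∞ :=
  ∫⁻ l in Set.Ici (0 : ℝ), ∫⁻ ω,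
    (if killed Λ ω l.toNNReal = some b then
      ENNReal.ofReal (Z Λ (t + localTime Λ ω 0 l) / Z Λ t) else 0) ∂(P a)

/-- The infinite-volume Green's function `sup_Λ G_0(x,y)`. -/
def greenInf {d : ℕ} (P : Site d → Measure (CadlagPath d)) (Z : WeightFamily d)
    (x y : Site d) : ℝ≥0∞ :=
  ⨆ Λ : Finset (Site d), green P Z Λ 0 x y

/-- `∂_{t_x} ∂_{t_y} log Z_t`; on the boundary of `[0,∞)^Λ` the derivatives are the one-sided
ones, that is, the continuous extensions of those in the interior. -/
def logDeriv₂ {d : ℕ} (Z : WeightFamily d) (Λ : Finset (Site d)) (t : Λ → ℝ) (x y : Λ) : ℝ :=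
  fderivWithin ℝ
    (fun s => fderivWithin ℝ (fun r => Real.log (Z Λ r)) (Set.Ici 0) s (Pi.single y 1))
    (Set.Ici 0) t (Pi.single x 1)

/-- The finite-volume self-loop `lim_{t ↓ 0} ∂_{t_x} log Z_t`, with the same convention on
derivatives at the boundary; it is set to `0` if `x ∉ Λ`. -/
def selfLoop {d : ℕ} (Z : WeightFamily d) (Λ : Finset (Site d)) (x : Site d) : ℝ :=
  if h : x ∈ Λ then
    fderivWithin ℝ (fun r => Real.log (Z Λ r)) (Set.Ici 0) 0 (Pi.single ⟨x, h⟩ 1)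
  else 0

/-! ### Hypotheses on the model -/

/-- `Z Λ` is strictly positive and continuous on `[0,∞)^Λ`. -/
def WeightPosCont {d : ℕ} (Z : WeightFamily d) : Prop :=
  ∀ Λ : Finset (Site d), (∀ t ∈ Set.Ici (0 : Λ → ℝ), 0 < Z Λ t) ∧ ContinuousOn (Z Λ) (Set.Ici 0)

/-- `Z Λ` is `C²` on `[0,∞)^Λ` (up to the boundary). -/
def WeightC2 {d : ℕ} (Z : WeightFamily d) : Prop :=
  ∀ Λ : Finset (Site d), ContDiffOn ℝ 2 (Z Λ) (Set.Ici 0)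

/-- The normalised weights `Z_t / Z_0` are covariant under the automorphisms of `ℤ^d`. -/
def WeightCovariant {d : ℕ} (Z : WeightFamily d) : Prop :=
  ∀ (T : LatticeAut d) (Λ : Finset (Site d)) (t : Site d → ℝ), (∀ x, 0 ≤ t x) →
    Z (Λ.map T.toEquiv.toEmbedding) (fun y => t (T.symm y.1)) /
        Z (Λ.map T.toEquiv.toEmbedding) 0 =
      Z Λ (fun x => t x.1) / Z Λ 0

/-- `G_t ≤ G_0` for all `t ∈ [0,∞)^Λ`. -/
def GreenLeZero {d : ℕ} (P : Site d → Measure (CadlagPath d)) (Z : WeightFamily d) : Prop :=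
  ∀ Λ : Finset (Site d), ∀ t ∈ Set.Ici (0 : Λ → ℝ), ∀ a ∈ Λ, ∀ b ∈ Λ, green P Z Λ t a b ≤ green P Z Λ 0 a b

/-- `G_0` is non-decreasing in the volume. -/
def GreenMono {d : ℕ} (P : Site d → Measure (CadlagPath d)) (Z : WeightFamily d) : Prop :=
  ∀ Λ' Λ : Finset (Site d), Λ' ⊆ Λ → ∀ x ∈ Λ', ∀ y ∈ Λ',
    green P Z Λ' 0 x y ≤ green P Z Λ 0 x y

/-- The vertex bound with constant `η`, uniform in the volume: for all paths and `0 ≤ u < v`,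
`|∂_{t_x} ∂_{t_y} log Z_t| ≤ η (1{x = y} + G_0(x,y)²)` at `t = τ_[u,v]`. -/
def VertexBound {d : ℕ} (P : Site d → Measure (CadlagPath d)) (Z : WeightFamily d)
    (η : ℝ) : Prop :=
  ∀ (Λ : Finset (Site d)) (ω : CadlagPath d) (u v : ℝ), 0 ≤ u → u < v → ∀ x y : Λ,
    ENNReal.ofReal |logDeriv₂ Z Λ (localTime Λ ω u v) x y| ≤
      ENNReal.ofReal η * ((if x = y then 1 else 0) + green P Z Λ 0 x.1 y.1 ^ 2)

/-- The `K`-infrared bound `sup_Λ G_0(x,y) ≤ K S(y - x)`. -/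
def InfraredBound {d : ℕ} (P : Site d → Measure (CadlagPath d)) (Z : WeightFamily d)
    (K : ℝ) : Prop :=
  ∀ x y, greenInf P Z x y ≤ ENNReal.ofReal K * freeGreen P (y - x)

/-- If a `K`-infrared bound holds, then the finite-volume self-loops are bounded uniformly in the
point and the volume, and they converge to the number `p`, independent of the point, as
`Λ ↑ ℤ^d`. -/
def SelfLoopLimit {d : ℕ} (P : Site d → Measure (CadlagPath d)) (Z : WeightFamily d)
    (K p : ℝ) : Prop :=
  InfraredBound P Z K →
    (∃ B : ℝ, ∀ (Λ : Finset (Site d)) (x : Site d), |selfLoop Z Λ x| ≤ B) ∧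
      ∀ x, Tendsto (fun Λ : Finset (Site d) => selfLoop Z Λ x) atTop (𝓝 p)

/-! ### The lace expansion in finite volume -/

/-- The random function `Y_{s,t} = Z_{τ_[s,t]} / Z_0`. -/
def lrY {d : ℕ} (Z : WeightFamily d) (Λ : Finset (Site d)) (ω : CadlagPath d) (s t : ℝ) : ℝ :=
  Z Λ (localTime Λ ω s t) / Z Λ 0

/-- The vertex function `-∂₁ ∂₂ log Y_{s,t}`. As paths are right continuous, the right derivatives
exist for all `0 ≤ s < t`; two-sided derivatives exist only for almost every `(s,t)`, where they
agree with the right ones. At `s = 0` the right derivative is the extension by continuity. -/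
def vertexFn {d : ℕ} (Z : WeightFamily d) (Λ : Finset (Site d)) (ω : CadlagPath d)
    (s t : ℝ) : ℝ :=
  -derivWithin (fun s' => derivWithin (fun t' => Real.log (lrY Z Λ ω s' t')) (Set.Ici t) t)
    (Set.Ici s) s

/-- The laces with `m ≥ 1` intervals that start at time `0`, in the coordinates
`0 < s₁ < s₁' < s₂ < ⋯ < s_{m-1}' < s_m`, as a subset of `ℝ^{2m-1}`. -/
def laceSet (m : ℕ) : Set (Fin (2 * m - 1) → ℝ) := {r | StrictMono r ∧ ∀ i, 0 < r i}

/-- The list of times `0, s₁, s₁', s₂, …, s_m` of a lace, indexed from `0` to `2m - 1`. -/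
def laceTime {m : ℕ} (r : Fin (2 * m - 1) → ℝ) (k : ℕ) : ℝ :=
  if h : 0 < k ∧ k - 1 < 2 * m - 1 then r ⟨k - 1, h.2⟩ else 0

/-- The time `s_i` for `0 ≤ i ≤ m`; here `s_0 = 0`. -/
def laceS {m : ℕ} (r : Fin (2 * m - 1) → ℝ) (i : ℕ) : ℝ := laceTime r (2 * i - 1)

/-- The time `s_i'` for `0 ≤ i ≤ m`; here `s_0' = s_0 = 0` and `s_m' = s_m`. -/
def laceS' {m : ℕ} (r : Fin (2 * m - 1) → ℝ) (i : ℕ) : ℝ :=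
  laceTime r (min (2 * i) (2 * m - 1))

/-- The weight `w(L)` of a lace with `m ≥ 1` intervals `(s_i, s_{i+1}')`, `0 ≤ i ≤ m - 1`. -/
def laceWeight {d : ℕ} (Z : WeightFamily d) (Λ : Finset (Site d)) (ω : CadlagPath d) {m : ℕ}
    (r : Fin (2 * m - 1) → ℝ) : ℝ :=
  (∏ i ∈ Finset.range m, vertexFn Z Λ ω (laceS r i) (laceS' r (i + 1))) *
    (lrY Z Λ ω (laceS' r 0) (laceS' r 1) *
      ∏ i ∈ Finset.range (m - 1),
        lrY Z Λ ω (laceS' r i) (laceS' r (i + 2)) / lrY Z Λ ω (laceS' r i) (laceS' r (i + 1)))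

open Classical in
/-- `w(L) 1{X_{s_m'} = y}`. -/
def laceIntegrand {d : ℕ} (Z : WeightFamily d) (Λ : Finset (Site d)) (y : Site d) (m : ℕ)
    (r : Fin (2 * m - 1) → ℝ) (ω : CadlagPath d) : ℝ :=
  if killed Λ ω (laceS' r m).toNNReal = some y then laceWeight Z Λ ω r else 0

/-- The `m`-th lace-expansion term
`Π_m(x,y) = ∫_{L_m(0)} dL E_x[ w(L) 1{X_{s_m'} = y} ]`, for `m ≥ 1`. -/
def lacePi {d : ℕ} (P : Site d → Measure (CadlagPath d)) (Z : WeightFamily d)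
    (Λ : Finset (Site d)) (m : ℕ) (x y : Site d) : ℝ :=
  ∫ r in laceSet m, ∫ ω, laceIntegrand Z Λ y m r ω ∂(P x)

/-- `Ψ(x,y) = ∑_{m ≥ 1} Π_m(x,y)` in the finite volume `Λ`. -/
def lacePsi {d : ℕ} (P : Site d → Measure (CadlagPath d)) (Z : WeightFamily d)
    (Λ : Finset (Site d)) (x y : Site d) : ℝ :=
  ∑' n : ℕ, lacePi P Z Λ (n + 1) x y

/-- The integrals and the series that define `Ψ(x,y)` in the finite volume `Λ` converge
absolutely. -/
def LacePsiConverges {d : ℕ} (P : Site d → Measure (CadlagPath d)) (Z : WeightFamily d)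
    (Λ : Finset (Site d)) (x y : Site d) : Prop :=
  (∀ m, 1 ≤ m →
    Integrable (fun q : (Fin (2 * m - 1) → ℝ) × CadlagPath d => laceIntegrand Z Λ y m q.1 q.2)
      ((volume.restrict (laceSet m)).prod (P x))) ∧
  Summable (fun n : ℕ => lacePi P Z Λ (n + 1) x y)

end

noncomputable section

/-! ### Measurability of path functionals -/

section PathMeasurability

variable {d : ℕ}

/-! The lace coefficient is read off from an exact equation for the Green's function in finite
volume. Absolute convergence comes from diagrammatic bounds, and the infinite-volume limit from a
compactness and uniqueness argument.

Finite-volume equation. Fix Λ and move the starting time of the path by h. In the limit h → 0 the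
killed walk contributes the rates J, the lost initial interval contributes 1_{a=b}, and the weight
contributes its logarithmic derivative in the direction of the starting point. At local time
τ_{[0,l]} this derivative is its value at 0, the self-loop, plus ∫_0^l V_{0,t} dt
(`integral_vertexFn_right`). Hence `green_equation`: -∑_c J(c-a) G(c,b) = 1_{a=b} + Π_{0,a} G(a,b) +
R(a,b), where R(a,b) integrates V_{0,t} Y_{0,l} over 0 < t < l.

Lace expansion of R. Write Y_{0,l} = Y_{0,t} · (Y_{0,l}/Y_{0,t}). If the quotient were Y_{t,l}, the
Markov property at t would give exactly Π_1 G. By `lrY_div_expansion` the difference between the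
quotient and Y_{t,l} is an integral over one more vertex straddling t, that is, over one more
interval of the lace. Iterating this (`remInt_main`, `remInt_succ`) gives R = ∑_{k<n} Π_{k+1} G plus
a remainder of the same form with n + 1 intervals.

Bounds. By the Markov property each stretch of the walk, given its past, contributes some G_t, and
G_t ≤ G_0 replaces it by G_0 (`markov_weight_le`). Each vertex contributes at most η(1 + G²). The
infrared bound together with S(x) ≤ C |||x|||^{-(d-2)} (`freeGreen_le`, proved with an explicit
supersolution) turns all lines of the diagrams into powers of |||x|||. The convolution estimate
`sum_diagram_le`, where d ≥ 5 enters through square summability of |||x|||^{-(d-2)}, reproduces the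
shape of the diagram at the cost of a factor cη. So Π_{k+1}(x,y) is at most (cη)^{k+1}
|||x-y|||^{-3(d-2)}; for small η the series converges and the remainder vanishes (`remInt_zero_eq`).

Infinite volume. Rows of Ψ^{(Λ)} are dominated by a summable function, so they converge along every
ultrafilter finer than Λ ↑ ℤ^d, and by dominated convergence every such limit solves the limiting
equation `RowEq`. Its solution is unique (`rowEq_unique`): if φ annihilates all columns of the
symmetric kernel G, pairing φ with the row equation at x gives φ(x) = 0. Uniqueness yields
convergence along the full net, translation invariance and lattice symmetry at once. Finally the
equation at x = 0, with J₊ * G ≥ 0, |Ψ * G(0)| ≤ Cη and G(0) ≤ K S(0), gives the lower bound on Ĵ -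
Π_0. -/

theorem CadlagPath.measurable_eval (t : ℝ≥0) : Measurable (fun ω : CadlagPath d => ω t) :=
  Measurable.of_comap_le (le_iSup (fun t : ℝ≥0 =>
    MeasurableSpace.comap (fun ω : CadlagPath d => ω t) inferInstance) t)

theorem CadlagPath.measurable_of_eval {α : Type*} [MeasurableSpace α] {f : α → CadlagPath d}
    (h : ∀ t : ℝ≥0, Measurable fun a => f a t) : Measurable f := by
  refine Measurable.of_le_map (iSup_le fun t => ?_)
  rw [← measurable_iff_le_map, measurable_comap_iff]
  exact h t

theorem CadlagPath.eventually_eq_right (ω : CadlagPath d) (t : ℝ≥0) :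
    ∀ᶠ r in 𝓝[≥] t, ω r = ω t := by
  have h := ω.right_continuous t
  rw [ContinuousWithinAt, nhds_discrete] at h
  exact tendsto_pure.1 h

/-- Evaluating the path at the first point to the right of t on a grid of mesh 1/(n+1) is jointly
measurable because the grid is countable. Right continuity gives pointwise convergence as n → ∞. -/
theorem CadlagPath.measurable_uncurry :
    Measurable (fun p : ℝ≥0 × CadlagPath d => p.2 p.1) := by
  have hm : ∀ n : ℕ, Measurable fun p : ℝ≥0 × CadlagPath d =>
      p.2 (((⌊((n : ℝ≥0) + 1) * p.1⌋₊ : ℝ≥0) + 1) / ((n : ℝ≥0) + 1)) := by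
    intro n
    have h1 : Measurable fun q : ℕ × CadlagPath d =>
        q.2 (((q.1 : ℝ≥0) + 1) / ((n : ℝ≥0) + 1)) :=
      measurable_from_prod_countable_right fun k =>
        CadlagPath.measurable_eval (((k : ℝ≥0) + 1) / ((n : ℝ≥0) + 1))
    have h2 : Measurable fun p : ℝ≥0 × CadlagPath d =>
        ((⌊((n : ℝ≥0) + 1) * p.1⌋₊, p.2) : ℕ × CadlagPath d) :=
      (Nat.measurable_floor.comp (measurable_fst.const_mul _)).prodMk measurable_snd
    exact h1.comp h2
  refine measurable_of_tendsto_metrizable hm ?_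
  rw [tendsto_pi_nhds]
  rintro ⟨t, ω⟩
  have key : Tendsto (fun n : ℕ => ((⌊((n : ℝ≥0) + 1) * t⌋₊ : ℝ≥0) + 1) / ((n : ℝ≥0) + 1))
      atTop (𝓝[≥] t) := by
    have hlow : ∀ n : ℕ, t ≤ ((⌊((n : ℝ≥0) + 1) * t⌋₊ : ℝ≥0) + 1) / ((n : ℝ≥0) + 1) := by
      intro n
      rw [le_div_iff₀ (by positivity), mul_comm]
      exact (Nat.lt_floor_add_one _).le
    have hup : ∀ n : ℕ, ((⌊((n : ℝ≥0) + 1) * t⌋₊ : ℝ≥0) + 1) / ((n : ℝ≥0) + 1)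
        ≤ t + 1 / ((n : ℝ≥0) + 1) := by
      intro n
      have h0 : ((n : ℝ≥0) + 1) ≠ 0 := by positivity
      rw [div_le_iff₀ (by positivity), add_mul (t : ℝ≥0), one_div, inv_mul_cancel₀ h0, mul_comm t]
      gcongr
      exact Nat.floor_le (by positivity)
    refine tendsto_nhdsWithin_iff.2 ⟨?_, Eventually.of_forall hlow⟩
    refine tendsto_of_tendsto_of_tendsto_of_le_of_le tendsto_const_nhds ?_ hlow hup
    have : Tendsto (fun n : ℕ => t + 1 / ((n : ℝ≥0) + 1)) atTop (𝓝 (t + 0)) :=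
      tendsto_const_nhds.add tendsto_one_div_add_atTop_nhds_zero_nat
    simpa using this
  exact (ω.right_continuous t).tendsto.comp key

theorem exitTime_le_of_notMem {Λ : Finset (Site d)} {ω : CadlagPath d} {t : ℝ≥0} (h : ω t ∉ Λ) :
    exitTime Λ ω ≤ t := iInf₂_le t h

theorem mem_of_lt_exitTime {Λ : Finset (Site d)} {ω : CadlagPath d} {t : ℝ≥0}
    (h : (t : ℝ≥0∞) < exitTime Λ ω) : ω t ∈ Λ := by
  by_contra hc
  exact absurd (exitTime_le_of_notMem hc) (not_le.2 h)

/-- A path outside Λ at time t stays where it is for a short while after t, so rational times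
suffice to detect an exit. This makes the exit time measurable although it is an infimum over an
uncountable set. -/
theorem exitTime_lt_iff {Λ : Finset (Site d)} {ω : CadlagPath d} {c : ℝ≥0∞} :
    exitTime Λ ω < c ↔ ∃ n : ℕ × ℕ, ((((n.1 : ℝ≥0) / (n.2 + 1) : ℝ≥0)) : ℝ≥0∞) < c ∧
      ω ((n.1 : ℝ≥0) / (n.2 + 1)) ∉ Λ := by
  constructor
  · intro h
    obtain ⟨t, ht, htc⟩ : ∃ t : ℝ≥0, ω t ∉ Λ ∧ (t : ℝ≥0∞) < c := by
      simpa [exitTime, iInf_lt_iff] using h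
    have h1 : ∀ᶠ r in 𝓝[≥] t, ω r = ω t ∧ (r : ℝ≥0∞) < c := by
      refine (ω.eventually_eq_right t).and (nhdsWithin_le_nhds ?_)
      exact (ENNReal.continuous_coe.tendsto t).eventually (gt_mem_nhds htc)
    obtain ⟨u, hu, hsub⟩ := (mem_nhdsGE_iff_exists_Ico_subset).1 h1
    obtain ⟨q, hq0, hq1, hq2⟩ : ∃ q : ℚ, 0 ≤ q ∧ (t : ℝ) < q ∧ (q : ℝ) < u := by
      obtain ⟨q, h1, h2⟩ := exists_rat_btwn (show (t : ℝ) < u from hu)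
      refine ⟨q, ?_, h1, h2⟩
      have : (0 : ℝ) < q := lt_of_le_of_lt t.2 h1
      exact_mod_cast this.le
    obtain ⟨q', rfl⟩ : ∃ q' : ℚ≥0, (q' : ℚ) = q := ⟨⟨q, hq0⟩, rfl⟩
    have hqe : ((q'.num : ℝ≥0) / ((q'.den - 1 : ℕ) + 1) : ℝ≥0) = (q' : ℝ≥0) := by
      have : ((q'.den - 1 : ℕ) : ℝ≥0) + 1 = q'.den := by
        have := q'.den_pos
        exact_mod_cast Nat.sub_add_cancel this
      rw [this]
      exact (NNRat.cast_def q').symm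
    have hmem : (q' : ℝ≥0) ∈ Set.Ico t u := by
      constructor
      · exact NNReal.coe_le_coe.1 (by push_cast at hq1 ⊢; exact hq1.le)
      · exact NNReal.coe_lt_coe.1 (by push_cast at hq2 ⊢; exact hq2)
    have := hsub hmem
    refine ⟨(q'.num, q'.den - 1), ?_, ?_⟩
    · simp only []
      rw [hqe]; exact this.2
    · simp only []
      rw [hqe, this.1]; exact ht
  · rintro ⟨n, h1, h2⟩
    exact lt_of_le_of_lt (exitTime_le_of_notMem h2) h1

theorem measurable_exitTime (Λ : Finset (Site d)) : Measurable (exitTime Λ) := by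
  refine measurable_of_Iio fun c => ?_
  have : exitTime Λ ⁻¹' Set.Iio c = ⋃ n : ℕ × ℕ,
      {ω | ((((n.1 : ℝ≥0) / (n.2 + 1) : ℝ≥0)) : ℝ≥0∞) < c ∧ ω ((n.1 : ℝ≥0) / (n.2 + 1)) ∉ Λ} := by
    ext ω
    simp only [Set.mem_preimage, Set.mem_Iio, exitTime_lt_iff, Set.mem_iUnion, Set.mem_ofPred_eq]
  rw [this]
  refine MeasurableSet.iUnion fun n => ?_
  by_cases h : ((((n.1 : ℝ≥0) / (n.2 + 1) : ℝ≥0)) : ℝ≥0∞) < c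
  · simp only [h, true_and]
    exact (CadlagPath.measurable_eval _) (Λ.countable_toSet.measurableSet.compl)
  · convert MeasurableSet.empty using 1
    exact Set.eq_empty_of_forall_notMem (fun ω hω => h hω.1)

theorem measurableSet_killed_eq (Λ : Finset (Site d)) (x : Site d) :
    MeasurableSet {p : ℝ≥0 × CadlagPath d | killed Λ p.2 p.1 = some x} := by
  have : {p : ℝ≥0 × CadlagPath d | killed Λ p.2 p.1 = some x} =
      {p | (p.1 : ℝ≥0∞) < exitTime Λ p.2} ∩ {p | p.2 p.1 = x} := by
    ext p
    simp only [killed, Set.mem_ofPred_eq, Set.mem_inter_iff]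
    split_ifs with h <;> simp [h]
  rw [this]
  refine MeasurableSet.inter ?_ ?_
  · exact measurableSet_lt (measurable_coe_nnreal_ennreal.comp measurable_fst)
      ((measurable_exitTime Λ).comp measurable_snd)
  · exact CadlagPath.measurable_uncurry (measurableSet_singleton x)

theorem measurableSet_killed_comp {α : Type*} [MeasurableSpace α] (Λ : Finset (Site d))
    (x : Site d) {f : α → ℝ} {g : α → CadlagPath d} (hf : Measurable f) (hg : Measurable g) :
    MeasurableSet {a | killed Λ (g a) (f a).toNNReal = some x} :=
  ((hf.real_toNNReal).prodMk hg) (measurableSet_killed_eq Λ x)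

/-- A local time is the length of a section of a measurable subset of α × ℝ, so Tonelli's theorem
gives measurability jointly in both endpoints and the path. -/
theorem measurable_localTime {α : Type*} [MeasurableSpace α] (Λ : Finset (Site d))
    {f g : α → ℝ} {w : α → CadlagPath d} (hf : Measurable f) (hg : Measurable g)
    (hw : Measurable w) :
    Measurable fun a => localTime Λ (w a) (f a) (g a) := by
  refine measurable_pi_iff.2 fun x => ?_
  have hs : MeasurableSet {p : α × ℝ | (f p.1 ≤ p.2 ∧ p.2 ≤ g p.1) ∧
      killed Λ (w p.1) p.2.toNNReal = some x.1} := by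
    refine ((measurableSet_le (hf.comp measurable_fst) measurable_snd).inter
      (measurableSet_le measurable_snd (hg.comp measurable_fst))).inter ?_
    exact measurableSet_killed_comp Λ x.1 measurable_snd (hw.comp measurable_fst)
  exact (measurable_measure_prodMk_left (ν := (volume : Measure ℝ)) hs).ennreal_toReal

end PathMeasurability

/-! ### Local times along a path -/

section LocalTime

variable {d : ℕ} (Λ : Finset (Site d)) (ω : CadlagPath d)

theorem killed_eq_some_iff {Λ : Finset (Site d)} {ω : CadlagPath d} {t : ℝ≥0} {x : Site d} :
    killed Λ ω t = some x ↔ (t : ℝ≥0∞) < exitTime Λ ω ∧ ω t = x := by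
  unfold killed; split_ifs with h <;> simp [h]

theorem mem_of_killed_eq_some {Λ : Finset (Site d)} {ω : CadlagPath d} {t : ℝ≥0} {x : Site d}
    (h : killed Λ ω t = some x) : x ∈ Λ := by
  rw [killed_eq_some_iff] at h
  exact h.2 ▸ mem_of_lt_exitTime h.1

/-- The path is right continuous in a discrete space and death is irreversible. Consequently local
times are affine to the right of every time, and each right derivative along the path is a
directional derivative along `posVec`. -/
theorem killed_eventually_eq (t : ℝ) :
    ∃ ε > 0, ∀ r, t ≤ r → r < t + ε → killed Λ ω r.toNNReal = killed Λ ω t.toNNReal := by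
  have h1 : ∀ᶠ r in 𝓝[≥] t.toNNReal, killed Λ ω r = killed Λ ω t.toNNReal := by
    by_cases h : (t.toNNReal : ℝ≥0∞) < exitTime Λ ω
    · filter_upwards [ω.eventually_eq_right t.toNNReal, nhdsWithin_le_nhds
        ((ENNReal.continuous_coe.tendsto t.toNNReal).eventually (gt_mem_nhds h))] with r h1 h2
      simp [killed, h, h2, h1]
    · filter_upwards [self_mem_nhdsWithin] with r hr
      have : ¬ ((r : ℝ≥0∞) < exitTime Λ ω) := fun hc =>
        h (lt_of_le_of_lt (ENNReal.coe_le_coe.2 hr) hc)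
      simp [killed, h, this]
  have h2 : Tendsto Real.toNNReal (𝓝[≥] t) (𝓝[≥] t.toNNReal) := by
    refine tendsto_nhdsWithin_iff.2 ⟨(continuous_real_toNNReal.tendsto t).mono_left
      nhdsWithin_le_nhds, ?_⟩
    filter_upwards [self_mem_nhdsWithin] with r hr
    exact Real.toNNReal_le_toNNReal hr
  obtain ⟨u, hu, hsub⟩ := (mem_nhdsGE_iff_exists_Ico_subset).1 (h2 h1)
  exact ⟨u - t, sub_pos.2 hu, fun r h1 h2 => hsub ⟨h1, by linarith⟩⟩

/-- The unit vector in direction of the current position of the killed walk, and `0` if the walk is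
dead. -/
def posVec (t : ℝ) : Λ → ℝ := fun x => Set.indicator {r | killed Λ ω r.toNNReal = some x.1} 1 t

theorem measurableSet_killedTimes (x : Site d) :
    MeasurableSet {r : ℝ | killed Λ ω r.toNNReal = some x} :=
  measurableSet_killed_comp Λ x measurable_id measurable_const

theorem posVec_of_some {t : ℝ} {x : Λ} (h : killed Λ ω t.toNNReal = some x.1) :
    posVec Λ ω t = Pi.single x 1 := by
  ext y
  simp only [posVec, Set.indicator_apply, Set.mem_ofPred_eq, h, Option.some.injEq, Pi.single_apply,
    Pi.one_apply]
  by_cases hxy : y = x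
  · simp [hxy]
  · have : ¬ (x.1 = y.1) := fun hc => hxy (Subtype.ext hc.symm)
    simp [hxy, this]

theorem posVec_of_none {t : ℝ} (h : killed Λ ω t.toNNReal = none) : posVec Λ ω t = 0 := by
  ext y; simp [posVec, h]

theorem posVec_apply (t : ℝ) (x : Λ) :
    posVec Λ ω t x = if killed Λ ω t.toNNReal = some x.1 then 1 else 0 := by
  simp [posVec, Set.indicator_apply]

theorem localTime_nonneg (s t : ℝ) : localTime Λ ω s t ∈ Set.Ici (0 : Λ → ℝ) :=
  fun _ => measureReal_nonneg

theorem localTime_add {s t u : ℝ} (h1 : s ≤ t) (h2 : t ≤ u) :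
    localTime Λ ω s u = localTime Λ ω s t + localTime Λ ω t u := by
  ext x
  have hO := measurableSet_killedTimes Λ ω x.1
  simp only [localTime, Pi.add_apply]
  have e1 : {r : ℝ | r ∈ Set.Icc s u ∧ killed Λ ω r.toNNReal = some x.1} =
      (Set.Ico s t ∩ {r | killed Λ ω r.toNNReal = some x.1}) ∪
      (Set.Icc t u ∩ {r | killed Λ ω r.toNNReal = some x.1}) := by
    rw [← Set.union_inter_distrib_right, Set.Ico_union_Icc_eq_Icc h1 h2]; rfl
  have e2 : volume.real {r : ℝ | r ∈ Set.Icc s t ∧ killed Λ ω r.toNNReal = some x.1} =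
      volume.real (Set.Ico s t ∩ {r | killed Λ ω r.toNNReal = some x.1}) := by
    refine measureReal_congr ?_
    exact (Ico_ae_eq_Icc.symm).inter (ae_eq_refl _)
  have f1 : volume (Set.Ico s t ∩ {r | killed Λ ω r.toNNReal = some x.1}) ≠ ⊤ :=
    ((measure_mono Set.inter_subset_left).trans_lt (by simp)).ne
  have f2 : volume (Set.Icc t u ∩ {r | killed Λ ω r.toNNReal = some x.1}) ≠ ⊤ :=
    ((measure_mono Set.inter_subset_left).trans_lt (by simp)).ne
  rw [e2, e1, measureReal_union (h₁ := f1) (h₂ := f2)]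
  · rfl
  · exact Set.disjoint_left.2 fun r hr hr' => absurd hr.1.2 (not_lt.2 hr'.1.1)
  · exact measurableSet_Icc.inter hO

theorem localTime_self (s : ℝ) : localTime Λ ω s s = 0 := by
  ext x
  simp only [localTime, Set.Icc_self, Pi.zero_apply]
  refine (measureReal_eq_zero_iff ?_).2 ?_
  · exact ((measure_mono (fun r hr => hr.1)).trans_lt (by simp : volume ({s} : Set ℝ) < ⊤)).ne
  · exact measure_mono_null (fun r hr => hr.1) (by simp : volume ({s} : Set ℝ) = 0)

theorem localTime_of_const {s t : ℝ} (hst : s ≤ t)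
    (h : ∀ r, s ≤ r → r < t → killed Λ ω r.toNNReal = killed Λ ω s.toNNReal) :
    localTime Λ ω s t = (t - s) • posVec Λ ω s := by
  ext x
  have e : localTime Λ ω s t x =
      volume.real (Set.Ico s t ∩ {r | killed Λ ω r.toNNReal = some x.1}) := by
    refine measureReal_congr ?_
    exact (Ico_ae_eq_Icc.symm).inter (ae_eq_refl _)
  rw [e, Pi.smul_apply, posVec_apply, smul_eq_mul]
  split_ifs with hk
  · rw [Set.inter_eq_left.2]
    · simp [hst]
    · intro r hr; simp [h r hr.1 hr.2, hk]
  · rw [Set.eq_empty_of_forall_notMem (s := Set.Ico s t ∩ _)]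
    · simp
    · rintro r ⟨hr, hr2⟩; exact hk (by rw [← h r hr.1 hr.2]; exact hr2)

theorem localTime_apply_le (s t : ℝ) (hst : s ≤ t) (x : Λ) : localTime Λ ω s t x ≤ t - s := by
  have : localTime Λ ω s t x ≤ volume.real (Set.Icc s t) :=
    measureReal_mono (fun r hr => hr.1) (by simp)
  simpa [hst] using this

/-- Right derivative in the second time argument. -/
theorem localTime_right {s t : ℝ} (hst : s ≤ t) (ht : 0 ≤ t) :
    ∃ ε > 0, ∀ r, t ≤ r → r < t + ε →
      localTime Λ ω s r = localTime Λ ω s t + (r - t) • posVec Λ ω t ∧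
      killed Λ ω r.toNNReal = killed Λ ω t.toNNReal := by
  obtain ⟨ε, hε, h⟩ := killed_eventually_eq Λ ω t
  refine ⟨ε, hε, fun r h1 h2 => ⟨?_, h r h1 h2⟩⟩
  rw [localTime_add Λ ω hst h1, localTime_of_const Λ ω h1]
  intro r' h3 h4; exact h r' h3 (h4.trans h2)

theorem localTime_left {s t : ℝ} (hst : s < t) (hs : 0 ≤ s) :
    ∃ ε > 0, ∀ r, s ≤ r → r < s + ε →
      localTime Λ ω r t = localTime Λ ω s t - (r - s) • posVec Λ ω s ∧ r < t ∧
      killed Λ ω r.toNNReal = killed Λ ω s.toNNReal := by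
  obtain ⟨ε, hε, h⟩ := killed_eventually_eq Λ ω s
  refine ⟨min ε (t - s), lt_min hε (sub_pos.2 hst), fun r h1 h2 => ⟨?_, ?_, ?_⟩⟩
  · have hrt : r ≤ t := by have := min_le_right ε (t - s); linarith
    rw [localTime_add Λ ω h1 hrt, localTime_of_const Λ ω h1]
    · simp
    · intro r' h3 h4; exact h r' h3 (by have := min_le_left ε (t - s); linarith)
  · have := min_le_right ε (t - s); linarith
  · exact h r h1 (by have := min_le_left ε (t - s); linarith)

theorem continuousOn_localTime_right (s : ℝ) :
    ContinuousOn (fun t => localTime Λ ω s t) (Set.Ici s) := by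
  refine continuousOn_pi.2 fun x => ?_
  have : LipschitzOnWith 1 (fun t => localTime Λ ω s t x) (Set.Ici s) := by
    refine LipschitzOnWith.of_le_add fun a ha b hb => ?_
    rcases le_total a b with hab | hab
    · have := congrFun (localTime_add Λ ω ha hab) x
      have h2 : 0 ≤ localTime Λ ω a b x := localTime_nonneg Λ ω a b x
      have := dist_nonneg (x := a) (y := b)
      simp only [Pi.add_apply] at *
      linarith
    · have := congrFun (localTime_add Λ ω hb hab) x
      have h2 := localTime_apply_le Λ ω b a hab x
      simp only [Pi.add_apply] at *
      rw [Real.dist_eq, abs_of_nonneg (by linarith)]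
      linarith
  exact this.continuousOn

theorem continuousOn_localTime_left (t : ℝ) :
    ContinuousOn (fun s => localTime Λ ω s t) (Set.Iic t) := by
  refine continuousOn_pi.2 fun x => ?_
  have : LipschitzOnWith 1 (fun s => localTime Λ ω s t x) (Set.Iic t) := by
    refine LipschitzOnWith.of_le_add fun a ha b hb => ?_
    rcases le_total a b with hab | hab
    · have := congrFun (localTime_add Λ ω hab hb) x
      have h2 := localTime_apply_le Λ ω a b hab x
      simp only [Pi.add_apply] at *
      rw [Real.dist_eq, abs_of_nonpos (by linarith)]
      linarith
    · have := congrFun (localTime_add Λ ω hab ha) x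
      have h2 : 0 ≤ localTime Λ ω b a x := localTime_nonneg Λ ω b a x
      have := dist_nonneg (x := a) (y := b)
      simp only [Pi.add_apply] at *
      linarith
  exact this.continuousOn

end LocalTime

end

noncomputable section

/-! ### Calculus of the weights along a path -/

section Orthant

variable {ι : Type*} [Fintype ι]

omit [Fintype ι] in
theorem orthant_eq_pi : Set.Ici (0 : ι → ℝ) = Set.univ.pi fun _ => Set.Ici (0 : ℝ) := by
  ext x; simp [Pi.le_def]

theorem interior_orthant : interior (Set.Ici (0 : ι → ℝ)) = Set.univ.pi fun _ => Set.Ioi (0 : ℝ) := by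
  rw [orthant_eq_pi, interior_pi_set Set.finite_univ]; simp

theorem uniqueDiffOn_orthant : UniqueDiffOn ℝ (Set.Ici (0 : ι → ℝ)) :=
  uniqueDiffOn_convex (convex_Ici _) ⟨fun _ => 1, by rw [interior_orthant]; simp⟩

theorem mem_closure_interior_orthant {x : ι → ℝ} (hx : x ∈ Set.Ici (0 : ι → ℝ)) :
    x ∈ closure (interior (Set.Ici (0 : ι → ℝ))) := by
  rw [interior_orthant, closure_pi_set]
  simpa [Pi.le_def] using hx

end Orthant

section Calculus

variable {d : ℕ} (Z : WeightFamily d) (Λ : Finset (Site d)) (ω : CadlagPath d)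

/-- The derivative of `log Z` at `t` in direction `v`. -/
def logD (t v : Λ → ℝ) : ℝ := fderivWithin ℝ (fun r => Real.log (Z Λ r)) (Set.Ici 0) t v

/-- The second derivative of `log Z` at `t`, first in direction `v`, then in direction `u`. -/
def logH (t u v : Λ → ℝ) : ℝ := fderivWithin ℝ (fun s => logD Z Λ s v) (Set.Ici 0) t u

theorem logH_single (t : Λ → ℝ) (x y : Λ) :
    logH Z Λ t (Pi.single x 1) (Pi.single y 1) = logDeriv₂ Z Λ t x y := rfl

/-- The regularity of the weight in a fixed volume. -/
structure SmoothWeight : Prop where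
  pos : ∀ t ∈ Set.Ici (0 : Λ → ℝ), 0 < Z Λ t
  contDiffOn : ContDiffOn ℝ 2 (Z Λ) (Set.Ici 0)

variable {Z Λ}

namespace SmoothWeight

variable (hZ : SmoothWeight Z Λ)

include hZ

theorem log_contDiffOn : ContDiffOn ℝ 2 (fun r => Real.log (Z Λ r)) (Set.Ici 0) :=
  hZ.contDiffOn.log fun x hx => (hZ.pos x hx).ne'

theorem fderiv_contDiffOn :
    ContDiffOn ℝ 1 (fderivWithin ℝ (fun r => Real.log (Z Λ r)) (Set.Ici 0)) (Set.Ici 0) :=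
  hZ.log_contDiffOn.fderivWithin uniqueDiffOn_orthant (by norm_num)

theorem logD_contDiffOn (v : Λ → ℝ) : ContDiffOn ℝ 1 (fun t => logD Z Λ t v) (Set.Ici 0) :=
  hZ.fderiv_contDiffOn.clm_apply contDiffOn_const

theorem continuousOn_logD (v : Λ → ℝ) : ContinuousOn (fun t => logD Z Λ t v) (Set.Ici 0) :=
  (hZ.logD_contDiffOn v).continuousOn

theorem continuousOn_logH (u v : Λ → ℝ) : ContinuousOn (fun t => logH Z Λ t u v) (Set.Ici 0) :=
  ((hZ.logD_contDiffOn v).continuousOn_fderivWithin uniqueDiffOn_orthant le_rfl).clm_apply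
    continuousOn_const

/-- Local times usually lie on the boundary of the orthant, since sites not yet visited have local
time 0. Symmetry persists there because the orthant is the closure of its interior. It is what
allows the vertex function to be integrated in its second argument as well as its first. -/
theorem logH_symm {t : Λ → ℝ} (ht : t ∈ Set.Ici (0 : Λ → ℝ)) (u v : Λ → ℝ) :
    logH Z Λ t u v = logH Z Λ t v u := by
  have h := (hZ.log_contDiffOn t ht).isSymmSndFDerivWithinAt (by simp) uniqueDiffOn_orthant
    (mem_closure_interior_orthant ht) ht u v
  have e : ∀ u v : Λ → ℝ, logH Z Λ t u v = fderivWithin ℝ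
      (fderivWithin ℝ (fun r => Real.log (Z Λ r)) (Set.Ici 0)) (Set.Ici 0) t u v := by
    intro u v
    have hd : DifferentiableWithinAt ℝ (fderivWithin ℝ (fun r => Real.log (Z Λ r)) (Set.Ici 0))
      (Set.Ici 0) t := (hZ.fderiv_contDiffOn.differentiableOn (by norm_num)) t ht
    have := (hd.hasFDerivWithinAt.clm_apply
      (hasFDerivWithinAt_const v t _)).fderivWithin (uniqueDiffOn_orthant t ht)
    simp only [logH, logD]
    rw [this]
    simp
  rw [e, e, h]

theorem lrY_pos (s t : ℝ) : 0 < lrY Z Λ ω s t :=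
  div_pos (hZ.pos _ (localTime_nonneg Λ ω s t)) (hZ.pos _ (Set.mem_Ici.2 le_rfl))

theorem lrY_self (s : ℝ) : lrY Z Λ ω s s = 1 := by
  rw [lrY, localTime_self]; exact div_self (hZ.pos _ (Set.mem_Ici.2 le_rfl)).ne'

theorem log_lrY (s t : ℝ) :
    Real.log (lrY Z Λ ω s t) = Real.log (Z Λ (localTime Λ ω s t)) - Real.log (Z Λ 0) :=
  Real.log_div (hZ.pos _ (localTime_nonneg Λ ω s t)).ne' (hZ.pos _ (Set.mem_Ici.2 le_rfl)).ne'

omit hZ in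
theorem comp_localTime_right {f : (Λ → ℝ) → ℝ} (hf : DifferentiableOn ℝ f (Set.Ici 0))
    {s t : ℝ} (hst : s ≤ t) (ht : 0 ≤ t) :
    HasDerivWithinAt (fun t' => f (localTime Λ ω s t'))
      (fderivWithin ℝ f (Set.Ici 0) (localTime Λ ω s t) (posVec Λ ω t)) (Set.Ici t) t := by
  obtain ⟨ε, hε, h⟩ := localTime_right Λ ω hst ht
  have hτ : HasDerivWithinAt (fun t' => localTime Λ ω s t') (posVec Λ ω t) (Set.Ici t) t := by
    have h1 : HasDerivWithinAt (fun t' : ℝ => localTime Λ ω s t + (t' - t) • posVec Λ ω t)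
        (posVec Λ ω t) (Set.Ici t) t := by
      have := (((hasDerivWithinAt_id t (Set.Ici t)).sub_const t).smul_const
        (posVec Λ ω t)).const_add (localTime Λ ω s t)
      simpa using this
    refine h1.congr_of_eventuallyEq ?_ (by simp)
    filter_upwards [Ico_mem_nhdsGE (show t < t + ε by linarith)] with r hr
    exact (h r hr.1 hr.2).1
  have hf' := (hf _ (localTime_nonneg Λ ω s t)).hasFDerivWithinAt
  exact hf'.comp_hasDerivWithinAt t hτ fun r _ => localTime_nonneg Λ ω s r

omit hZ in
theorem comp_localTime_left {f : (Λ → ℝ) → ℝ} (hf : DifferentiableOn ℝ f (Set.Ici 0))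
    {s t : ℝ} (hst : s < t) (hs : 0 ≤ s) :
    HasDerivWithinAt (fun s' => f (localTime Λ ω s' t))
      (-fderivWithin ℝ f (Set.Ici 0) (localTime Λ ω s t) (posVec Λ ω s)) (Set.Ici s) s := by
  obtain ⟨ε, hε, h⟩ := localTime_left Λ ω hst hs
  have hτ : HasDerivWithinAt (fun s' => localTime Λ ω s' t) (-posVec Λ ω s) (Set.Ici s) s := by
    have h1 : HasDerivWithinAt (fun s' : ℝ => localTime Λ ω s t - (s' - s) • posVec Λ ω s)
        (-posVec Λ ω s) (Set.Ici s) s := by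
      have := (((hasDerivWithinAt_id s (Set.Ici s)).sub_const s).smul_const
        (posVec Λ ω s)).const_sub (localTime Λ ω s t)
      simpa using this
    refine h1.congr_of_eventuallyEq ?_ (by simp)
    filter_upwards [Ico_mem_nhdsGE (show s < s + ε by linarith)] with r hr
    exact (h r hr.1 hr.2).1
  have hf' := (hf _ (localTime_nonneg Λ ω s t)).hasFDerivWithinAt
  have := hf'.comp_hasDerivWithinAt s hτ fun r _ => localTime_nonneg Λ ω r t
  rwa [map_neg] at this

/-- Increasing t adds local time at the position at time t, increasing s removes it at the position
at time s. The resulting minus sign cancels the one in the definition of the vertex function. -/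
theorem vertexFn_eq {s t : ℝ} (hs : 0 ≤ s) (hst : s < t) :
    vertexFn Z Λ ω s t = logH Z Λ (localTime Λ ω s t) (posVec Λ ω s) (posVec Λ ω t) := by
  have h1 : ∀ s' ≤ t, derivWithin (fun t' => Real.log (lrY Z Λ ω s' t')) (Set.Ici t) t =
      logD Z Λ (localTime Λ ω s' t) (posVec Λ ω t) := by
    intro s' hs'
    have h := comp_localTime_right ω (hZ.log_contDiffOn.differentiableOn (by norm_num)) hs'
      (hs.trans hst.le)
    simp only [hZ.log_lrY]
    exact (h.sub_const _).derivWithin (uniqueDiffOn_Ici t t Set.self_mem_Ici)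
  have h2 := comp_localTime_left ω
    ((hZ.logD_contDiffOn (posVec Λ ω t)).differentiableOn (by norm_num)) hst hs
  -- The formula for the inner derivative is available only for starting times up to t. Since s < t
  -- this covers a right neighbourhood of s, which is all the outer derivative sees.
  rw [vertexFn, Filter.EventuallyEq.derivWithin_eq
    (f := fun s' => logD Z Λ (localTime Λ ω s' t) (posVec Λ ω t)) _ (h1 s hst.le),
    h2.derivWithin (uniqueDiffOn_Ici s s Set.self_mem_Ici), neg_neg]
  · rfl
  · filter_upwards [Ico_mem_nhdsGE hst] with r hr
    exact h1 r hr.2.le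

omit hZ in
theorem logH_zero_right (t u : Λ → ℝ) : logH Z Λ t u 0 = 0 := by
  simp [logH, logD]

omit hZ in
theorem logH_zero_left (t v : Λ → ℝ) : logH Z Λ t 0 v = 0 := by
  simp [logH]

omit hZ in
theorem logD_posVec (t : Λ → ℝ) (r : ℝ) : logD Z Λ t (posVec Λ ω r) =
    ∑ x, posVec Λ ω r x * logD Z Λ t (Pi.single x 1) := by
  conv_lhs => rw [← Finset.univ_sum_single (posVec Λ ω r)]
  simp only [logD, map_sum]
  refine Finset.sum_congr rfl fun x _ => ?_
  rw [← smul_eq_mul, ← map_smul, ← Pi.single_smul', smul_eq_mul, mul_one]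

omit hZ in
theorem logH_posVec (t : Λ → ℝ) (r r' : ℝ) : logH Z Λ t (posVec Λ ω r) (posVec Λ ω r') =
    ∑ x, ∑ y, posVec Λ ω r x * posVec Λ ω r' y * logDeriv₂ Z Λ t x y := by
  rcases hk : killed Λ ω r.toNNReal with _ | x
  · simp [posVec_of_none Λ ω hk, logH_zero_left]
  rcases hk' : killed Λ ω r'.toNNReal with _ | y
  · simp [posVec_of_none Λ ω hk', logH_zero_right]
  obtain ⟨x, rfl⟩ : ∃ x' : Λ, x'.1 = x := ⟨⟨x, mem_of_killed_eq_some hk⟩, rfl⟩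
  obtain ⟨y, rfl⟩ : ∃ x' : Λ, x'.1 = y := ⟨⟨y, mem_of_killed_eq_some hk'⟩, rfl⟩
  rw [posVec_of_some Λ ω hk, posVec_of_some Λ ω hk', logH_single]
  simp [Pi.single_apply]

end SmoothWeight

theorem measurable_posVec {α : Type*} [MeasurableSpace α] {f : α → ℝ} {w : α → CadlagPath d}
    (hf : Measurable f) (hw : Measurable w) : Measurable fun a => posVec Λ (w a) (f a) := by
  refine measurable_pi_iff.2 fun x => ?_
  simp only [posVec_apply]
  exact Measurable.ite (measurableSet_killed_comp Λ x.1 hf hw) measurable_const measurable_const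

/-- Quantities evaluated at the moving position are discontinuous in time. Decomposing by position
makes them finite sums of indicators times continuous functions, hence integrable. -/
theorem intervalIntegrable_posVec_sum {a b : ℝ} (hab : a ≤ b) {f : Λ → ℝ → ℝ}
    (hf : ∀ x, ContinuousOn (f x) (Set.Icc a b)) :
    IntervalIntegrable (fun t => ∑ x, posVec Λ ω t x * f x t) volume a b := by
  rw [intervalIntegrable_iff_integrableOn_Icc_of_le hab]
  refine integrable_finsetSum _ fun x _ => ?_
  have h1 : IntegrableOn (f x) (Set.Icc a b) := (hf x).integrableOn_Icc
  have h2 : (fun t => posVec Λ ω t x * f x t) =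
      Set.indicator {r : ℝ | killed Λ ω r.toNNReal = some x.1} (f x) := by
    ext t; simp [posVec_apply, Set.indicator_apply]
  rw [h2]
  exact h1.indicator (measurableSet_killedTimes Λ ω x.1)

namespace SmoothWeight

variable (hZ : SmoothWeight Z Λ)

include hZ

omit hZ in
theorem continuousOn_comp_right {f : (Λ → ℝ) → ℝ} (hf : ContinuousOn f (Set.Ici 0)) (s : ℝ) :
    ContinuousOn (fun t => f (localTime Λ ω s t)) (Set.Ici s) :=
  hf.comp (continuousOn_localTime_right Λ ω s) fun _ _ => localTime_nonneg Λ ω _ _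

omit hZ in
theorem continuousOn_comp_left {f : (Λ → ℝ) → ℝ} (hf : ContinuousOn f (Set.Ici 0)) (t : ℝ) :
    ContinuousOn (fun s => f (localTime Λ ω s t)) (Set.Iic t) :=
  hf.comp (continuousOn_localTime_left Λ ω t) fun _ _ => localTime_nonneg Λ ω _ _

theorem intervalIntegrable_vertexFn_left {a b t : ℝ} (ha : 0 ≤ a) (hab : a ≤ b) (hbt : b < t) :
    IntervalIntegrable (fun s => vertexFn Z Λ ω s t) volume a b := by
  have h := intervalIntegrable_posVec_sum ω hab (Λ := Λ)
    (f := fun x s => ∑ y, posVec Λ ω t y * logDeriv₂ Z Λ (localTime Λ ω s t) x y) (fun x =>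
      continuousOn_finsetSum _ fun y _ => continuousOn_const.mul
        ((continuousOn_comp_left ω (hZ.continuousOn_logH (Pi.single x 1) (Pi.single y 1)) t).mono
          fun s hs => hs.2.trans hbt.le))
  refine h.congr fun s hs => ?_
  rw [Set.uIoc_of_le hab] at hs
  rw [hZ.vertexFn_eq ω (ha.trans hs.1.le) (hs.2.trans_lt hbt), logH_posVec]
  simp only [Finset.mul_sum, mul_assoc]

theorem integral_vertexFn_left {a b t : ℝ} (ha : 0 ≤ a) (hab : a ≤ b) (hbt : b < t) :
    ∫ s in a..b, vertexFn Z Λ ω s t = logD Z Λ (localTime Λ ω a t) (posVec Λ ω t) -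
      logD Z Λ (localTime Λ ω b t) (posVec Λ ω t) := by
  have h := intervalIntegral.integral_eq_sub_of_hasDeriv_right_of_le
    (f := fun s => -logD Z Λ (localTime Λ ω s t) (posVec Λ ω t))
    (f' := fun s => vertexFn Z Λ ω s t) hab
    ((continuousOn_comp_left ω (hZ.continuousOn_logD (posVec Λ ω t)) t).neg.mono
      fun s hs => hs.2.trans hbt.le) (fun s hs => ?_)
    (hZ.intervalIntegrable_vertexFn_left ω ha hab hbt)
  · rw [h]; ring
  · have := (comp_localTime_left ω
      ((hZ.logD_contDiffOn (posVec Λ ω t)).differentiableOn (by norm_num)) (hs.2.trans hbt)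
      (ha.trans hs.1.le)).neg.mono Set.Ioi_subset_Ici_self
    rw [neg_neg] at this
    rw [hZ.vertexFn_eq ω (ha.trans hs.1.le) (hs.2.trans hbt)]
    exact this

theorem intervalIntegrable_vertexFn_right {l : ℝ} (hl : 0 ≤ l) :
    IntervalIntegrable (fun u => vertexFn Z Λ ω 0 u) volume 0 l := by
  have h := intervalIntegrable_posVec_sum ω hl (Λ := Λ)
    (f := fun y u => ∑ x, posVec Λ ω 0 x * logDeriv₂ Z Λ (localTime Λ ω 0 u) x y) (fun y =>
      continuousOn_finsetSum _ fun x _ => continuousOn_const.mul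
        ((continuousOn_comp_right ω (hZ.continuousOn_logH (Pi.single x 1) (Pi.single y 1)) 0).mono
          fun s hs => hs.1))
  refine h.congr fun u hu => ?_
  rw [Set.uIoc_of_le hl] at hu
  rw [hZ.vertexFn_eq ω le_rfl hu.1, logH_posVec, Finset.sum_comm]
  simp only [Finset.mul_sum]
  refine Finset.sum_congr rfl fun x _ => Finset.sum_congr rfl fun y _ => ?_
  ring

/-- This splits the logarithmic derivative at the starting point into the self-loop and the integral
of the vertex function, which starts the lace expansion. -/
theorem integral_vertexFn_right {l : ℝ} (hl : 0 ≤ l) :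
    ∫ u in 0..l, vertexFn Z Λ ω 0 u = logD Z Λ (localTime Λ ω 0 l) (posVec Λ ω 0) -
      logD Z Λ 0 (posVec Λ ω 0) := by
  have h := intervalIntegral.integral_eq_sub_of_hasDeriv_right_of_le
    (f := fun u => logD Z Λ (localTime Λ ω 0 u) (posVec Λ ω 0))
    (f' := fun u => vertexFn Z Λ ω 0 u) hl
    ((continuousOn_comp_right ω (hZ.continuousOn_logD (posVec Λ ω 0)) 0).mono
      fun s hs => hs.1) (fun u hu => ?_)
    (hZ.intervalIntegrable_vertexFn_right ω hl)
  · rw [h, localTime_self]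
  · have := (comp_localTime_right ω
      ((hZ.logD_contDiffOn (posVec Λ ω 0)).differentiableOn (by norm_num)) hu.1.le
      hu.1.le).mono Set.Ioi_subset_Ici_self
    rw [hZ.vertexFn_eq ω le_rfl hu.1, hZ.logH_symm (localTime_nonneg Λ ω 0 u)]
    exact this

theorem lrY_eq_exp (s t : ℝ) : lrY Z Λ ω s t =
    Real.exp (Real.log (Z Λ (localTime Λ ω s t)) - Real.log (Z Λ 0)) := by
  rw [← hZ.log_lrY, Real.exp_log (hZ.lrY_pos ω s t)]

theorem lrY_hasDeriv_right {s t : ℝ} (hst : s ≤ t) (ht : 0 ≤ t) :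
    HasDerivWithinAt (fun t' => lrY Z Λ ω s t')
      (lrY Z Λ ω s t * logD Z Λ (localTime Λ ω s t) (posVec Λ ω t)) (Set.Ici t) t := by
  have h := ((comp_localTime_right ω (hZ.log_contDiffOn.differentiableOn (by norm_num)) hst
      ht).sub_const (Real.log (Z Λ 0))).exp
  simp only [← hZ.lrY_eq_exp] at h
  exact h

theorem lrY_hasDeriv_left {s t : ℝ} (hst : s < t) (hs : 0 ≤ s) :
    HasDerivWithinAt (fun s' => lrY Z Λ ω s' t)
      (lrY Z Λ ω s t * -logD Z Λ (localTime Λ ω s t) (posVec Λ ω s)) (Set.Ici s) s := by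
  have h := ((comp_localTime_left ω (hZ.log_contDiffOn.differentiableOn (by norm_num)) hst
      hs).sub_const (Real.log (Z Λ 0))).exp
  simp only [← hZ.lrY_eq_exp] at h
  exact h

theorem continuousOn_lrY_right (s : ℝ) : ContinuousOn (fun t => lrY Z Λ ω s t) (Set.Ici s) :=
  (continuousOn_comp_right ω hZ.contDiffOn.continuousOn s).div_const _

theorem continuousOn_lrY_left (t : ℝ) : ContinuousOn (fun s => lrY Z Λ ω s t) (Set.Iic t) :=
  (continuousOn_comp_left ω hZ.contDiffOn.continuousOn t).div_const _

/-- First-order expansion of the weight at the start of the path. -/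
theorem lrY_sub_eq_integral {h l : ℝ} (hh : 0 ≤ h) (hl : h ≤ l) :
    lrY Z Λ ω 0 l - lrY Z Λ ω h l =
      ∫ s in 0..h, lrY Z Λ ω s l * logD Z Λ (localTime Λ ω s l) (posVec Λ ω s) := by
  have := intervalIntegral.integral_eq_sub_of_hasDeriv_right_of_le
    (f := fun s => -lrY Z Λ ω s l)
    (f' := fun s => lrY Z Λ ω s l * logD Z Λ (localTime Λ ω s l) (posVec Λ ω s)) hh
    ((hZ.continuousOn_lrY_left ω l).neg.mono fun s hs => hs.2.trans hl) (fun s hs => ?_) ?_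
  · rw [this]; ring
  · have := (hZ.lrY_hasDeriv_left ω (hs.2.trans_le hl) hs.1.le).neg.mono Set.Ioi_subset_Ici_self
    rw [← mul_neg, neg_neg] at this
    exact this
  · have h := intervalIntegrable_posVec_sum ω hh (Λ := Λ)
      (f := fun x s => lrY Z Λ ω s l * logD Z Λ (localTime Λ ω s l) (Pi.single x 1)) (fun x =>
      ((hZ.continuousOn_lrY_left ω l).mul
        (continuousOn_comp_left ω (hZ.continuousOn_logD (Pi.single x 1)) l)).mono
          fun s hs => hs.2.trans hl)
    refine h.congr fun s _ => ?_
    rw [logD_posVec, Finset.mul_sum]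
    refine Finset.sum_congr rfl fun x _ => ?_
    ring

/-- The expansion of the interaction across a time `b`. -/
theorem lrY_div_expansion {a b l : ℝ} (ha : 0 ≤ a) (hab : a ≤ b) (hbl : b ≤ l) :
    lrY Z Λ ω a l / lrY Z Λ ω a b = lrY Z Λ ω b l +
      ∫ t in b..l, ∫ s in a..b, vertexFn Z Λ ω s t *
        (lrY Z Λ ω a t / lrY Z Λ ω a b) * (lrY Z Λ ω b l / lrY Z Λ ω b t) := by
  have hY := fun s t => (hZ.lrY_pos ω s t).ne'
  have hcont : ContinuousOn (fun t => lrY Z Λ ω a t / lrY Z Λ ω b t) (Set.Ici b) :=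
    ((hZ.continuousOn_lrY_right ω a).mono fun t ht => hab.trans ht).div
      (hZ.continuousOn_lrY_right ω b) fun t _ => hY b t
  -- The function t ↦ Y_{a,t}/Y_{b,t} has right derivative equal to itself times ∫_a^b V_{s,t} ds.
  -- Integrating from b to l, where Y_{b,b} = 1, and multiplying by Y_{b,l}/Y_{a,b} gives the claim.
  have key := intervalIntegral.integral_eq_sub_of_hasDeriv_right_of_le
    (f := fun t => lrY Z Λ ω a t / lrY Z Λ ω b t)
    (f' := fun t => (lrY Z Λ ω a t / lrY Z Λ ω b t) * ∫ s in a..b, vertexFn Z Λ ω s t) hbl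
    (hcont.mono fun t ht => ht.1) (fun t ht => ?_) ?_
  · simp only [hZ.lrY_self, div_one] at key
    have e : ∀ t, ∫ s in a..b, vertexFn Z Λ ω s t *
        (lrY Z Λ ω a t / lrY Z Λ ω a b) * (lrY Z Λ ω b l / lrY Z Λ ω b t) =
        (lrY Z Λ ω a t / lrY Z Λ ω b t * ∫ s in a..b, vertexFn Z Λ ω s t) *
          (lrY Z Λ ω b l / lrY Z Λ ω a b) := by
      intro t
      simp only [mul_assoc]
      rw [intervalIntegral.integral_mul_const]
      field_simp
    simp only [e]
    rw [intervalIntegral.integral_mul_const, key]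
    have := hY a b; have := hY b l
    field_simp
    ring
  · rw [hZ.integral_vertexFn_left ω ha hab ht.1]
    have h0 : 0 ≤ t := ha.trans (hab.trans ht.1.le)
    have h1 := hZ.lrY_hasDeriv_right ω (hab.trans ht.1.le) h0
    have h2 := hZ.lrY_hasDeriv_right ω ht.1.le h0
    have h3 := (h1.div h2 (hY b t)).mono Set.Ioi_subset_Ici_self
    have hb := hY b t
    have e : ∀ Y Y' p q : ℝ, Y' ≠ 0 → Y / Y' * (p - q) = (Y * p * Y' - Y * (Y' * q)) / Y' ^ 2 := by
      intro Y Y' p q h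
      field_simp
    rw [e _ _ _ _ hb]
    exact h3
  · have h := intervalIntegrable_posVec_sum ω hbl (Λ := Λ)
      (f := fun x t => (lrY Z Λ ω a t / lrY Z Λ ω b t) *
        (logD Z Λ (localTime Λ ω a t) (Pi.single x 1) -
          logD Z Λ (localTime Λ ω b t) (Pi.single x 1))) (fun x =>
      ((hcont.mul (((continuousOn_comp_right ω
        (hZ.continuousOn_logD (Pi.single x 1)) a).mono fun t ht => hab.trans ht).sub
        (continuousOn_comp_right ω (hZ.continuousOn_logD (Pi.single x 1)) b)))).mono
          fun s hs => hs.1)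
    refine h.congr fun t ht => ?_
    rw [Set.uIoc_of_le hbl] at ht
    rw [hZ.integral_vertexFn_left ω ha hab ht.1, logD_posVec, logD_posVec,
      ← Finset.sum_sub_distrib, Finset.mul_sum]
    refine Finset.sum_congr rfl fun x _ => ?_
    ring

end SmoothWeight

end Calculus

end

noncomputable section

/-! ### The transition semigroup as an operator exponential -/

section Semigroup

variable {d : ℕ}

theorem abs_coord_le_euclNorm (x : Site d) (i : Fin d) : |(x i : ℝ)| ≤ euclNorm x := by
  rw [← Real.sqrt_sq_eq_abs]
  exact Real.sqrt_le_sqrt (Finset.single_le_sum (f := fun i => (x i : ℝ) ^ 2)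
    (fun _ _ => sq_nonneg _) (Finset.mem_univ i))

theorem IsJumpRate.support_finite {J : Site d → ℝ} (hJ : IsJumpRate J) :
    (Function.support J).Finite := by
  obtain ⟨R, _, hR⟩ := hJ.finite_range
  refine (Set.finite_Icc (fun _ => -(⌈R⌉ : ℤ) : Site d) (fun _ => (⌈R⌉ : ℤ))).subset ?_
  intro x hx
  have hlt : euclNorm x < R := by
    by_contra h
    exact hx (hR x (not_lt.1 h))
  have : ∀ i, |(x i : ℝ)| ≤ ⌈R⌉ := fun i =>
    (abs_coord_le_euclNorm x i).trans (hlt.le.trans (Int.le_ceil R))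
  have h2 : ∀ i, |x i| ≤ ⌈R⌉ := fun i => by exact_mod_cast this i
  exact ⟨fun i => (abs_le.1 (h2 i)).1, fun i => (abs_le.1 (h2 i)).2⟩

/-- The finite set of `x` with `J x ≠ 0`. -/
def IsJumpRate.supp {J : Site d → ℝ} (hJ : IsJumpRate J) : Finset (Site d) :=
  hJ.support_finite.toFinset

theorem IsJumpRate.eq_zero_of_notMem {J : Site d → ℝ} (hJ : IsJumpRate J) {x : Site d}
    (hx : x ∉ hJ.supp) : J x = 0 := by
  by_contra h
  exact hx (by simpa [IsJumpRate.supp] using h)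

theorem IsJumpRate.sum_supp_eq_zero {J : Site d → ℝ} (hJ : IsJumpRate J) :
    ∑ y ∈ hJ.supp, J y = 0 := by
  have h1 : HasSum J (J 0 + -J 0) := by
    have h2 : J = fun y => (if y = 0 then J 0 else 0) + Jplus J y := by
      ext y; by_cases hy : y = 0 <;> simp [Jplus, hy]
    have := (hasSum_ite_eq (0 : Site d) (J 0)).add hJ.zero_eq
    rwa [← h2] at this
  have h3 : HasSum J (∑ y ∈ hJ.supp, J y) :=
    hasSum_sum_of_ne_finset_zero fun y hy => hJ.eq_zero_of_notMem hy
  have := h1.unique h3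
  linarith

theorem IsJumpRate.conv_eq_sum {J : Site d → ℝ} (hJ : IsJumpRate J) (h : Site d → ℝ) (x : Site d) :
    conv J h x = ∑ y ∈ hJ.supp, J y * h (x - y) :=
  tsum_eq_sum fun y hy => by rw [hJ.eq_zero_of_notMem hy, zero_mul]

/-- Bounded functions on the lattice. -/
def LatFun (d : ℕ) : Type := BoundedContinuousFunction (Site d) ℝ

namespace LatFun

instance : NormedAddCommGroup (LatFun d) :=
  inferInstanceAs (NormedAddCommGroup (BoundedContinuousFunction (Site d) ℝ))

instance : NormedSpace ℝ (LatFun d) :=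
  inferInstanceAs (NormedSpace ℝ (BoundedContinuousFunction (Site d) ℝ))

instance : CompleteSpace (LatFun d) :=
  inferInstanceAs (CompleteSpace (BoundedContinuousFunction (Site d) ℝ))

/-- Evaluation at a point. -/
def eval (x : Site d) : LatFun d →L[ℝ] ℝ :=
  BoundedContinuousFunction.evalCLM (α := Site d) (β := ℝ) ℝ x

instance : CoeFun (LatFun d) (fun _ => Site d → ℝ) := ⟨fun f x => eval x f⟩

theorem ext_eval {f g : LatFun d} (h : ∀ x, f x = g x) : f = g :=
  BoundedContinuousFunction.ext h

theorem norm_le {f : LatFun d} {C : ℝ} (hC : 0 ≤ C) : ‖f‖ ≤ C ↔ ∀ x, |f x| ≤ C :=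
  BoundedContinuousFunction.norm_le (α := Site d) (β := ℝ) (f := f) hC

theorem abs_le_norm (f : LatFun d) (x : Site d) : |f x| ≤ ‖f‖ := (norm_le (norm_nonneg f)).1 le_rfl x

/-- A bounded function from its values. -/
def mk (f : Site d → ℝ) (C : ℝ) (h : ∀ x, |f x| ≤ C) : LatFun d :=
  BoundedContinuousFunction.ofNormedAddCommGroupDiscrete f C h

@[simp] theorem mk_apply (f : Site d → ℝ) (C : ℝ) (h : ∀ x, |f x| ≤ C) (x : Site d) :
    mk f C h x = f x := rfl

/-- Translation of a bounded function by `y`. -/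
def translate (y : Site d) : LatFun d →L[ℝ] LatFun d :=
  LinearMap.mkContinuous
    { toFun := fun f => mk (fun x => f (x + y)) ‖f‖ fun x => abs_le_norm f _
      map_add' := fun f g => ext_eval fun x => by simp
      map_smul' := fun c f => ext_eval fun x => by simp } 1 (fun f => by
        rw [one_mul]
        exact (norm_le (norm_nonneg f)).2 fun x => abs_le_norm f _)

@[simp] theorem translate_apply (y : Site d) (f : LatFun d) (x : Site d) :
    translate y f x = f (x + y) := rfl

end LatFun

open LatFun

/-- The operator `f ↦ ∑ y ∈ s, J y f(· + y)`. -/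
def jumpOp (J : Site d → ℝ) (s : Finset (Site d)) : LatFun d →L[ℝ] LatFun d :=
  ∑ y ∈ s, J y • LatFun.translate y

theorem jumpOp_apply (J : Site d → ℝ) (s : Finset (Site d)) (f : LatFun d) (x : Site d) :
    jumpOp J s f x = ∑ y ∈ s, J y * f (x + y) := by
  simp [jumpOp]

/-- The indicator function of the point `b`. -/
def pointFun (b : Site d) : LatFun d :=
  LatFun.mk (fun x => if x = b then 1 else 0) 1 (fun x => by split_ifs <;> simp)

@[simp] theorem pointFun_apply (b x : Site d) : pointFun b x = if x = b then 1 else 0 := rfl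

/-- This identifies the power series defining `transition` with the exponential of a bounded
operator, so that calculus in a Banach algebra applies to it. -/
theorem jumpOp_pow_pointFun {J : Site d → ℝ} (hJ : IsJumpRate J) (n : ℕ) (b x : Site d) :
    (jumpOp J hJ.supp ^ n) (pointFun b) x = convPow J n (b - x) := by
  induction n generalizing x with
  | zero => simp [convPow, sub_eq_zero, eq_comm]
  | succ n ih =>
    rw [pow_succ', mul_apply_eq_comp, jumpOp_apply, convPow, hJ.conv_eq_sum]
    refine Finset.sum_congr rfl fun y _ => ?_
    rw [ih, sub_sub]

theorem hasSum_exp_apply (A : LatFun d →L[ℝ] LatFun d) (t : ℝ) (f : LatFun d) (x : Site d) :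
    HasSum (fun n : ℕ => t ^ n / (n.factorial : ℝ) * (A ^ n) f x)
      (NormedSpace.exp (t • A) f x) := by
  have h := NormedSpace.exp_series_hasSum_exp' (𝕂 := ℝ) (t • A)
  have h2 := h.mapL ((ContinuousLinearMap.apply ℝ (LatFun d)) f)
  have h3 := h2.mapL (LatFun.eval x)
  have e : ∀ n : ℕ, t ^ n / (n.factorial : ℝ) * (A ^ n) f x = LatFun.eval x
      (((ContinuousLinearMap.apply ℝ (LatFun d)) f) ((n.factorial : ℝ)⁻¹ • (t • A) ^ n)) := by
    intro n
    beta_reduce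
    rw [smul_pow, smul_smul, map_smul, map_smul, smul_eq_mul,
      ContinuousLinearMap.apply_apply]
    ring
  simp only [e]
  exact h3

theorem transition_eq_exp {J : Site d → ℝ} (hJ : IsJumpRate J) (t : ℝ) (b x : Site d) :
    transition J t (b - x) = NormedSpace.exp (t • jumpOp J hJ.supp) (pointFun b) x := by
  rw [← (hasSum_exp_apply _ t (pointFun b) x).tsum_eq, transition]
  simp only [jumpOp_pow_pointFun hJ]

/-- The generator is a positivity-preserving operator with rates J₊ plus the scalar J(0). The scalar
commutes and contributes the positive factor e^{tJ(0)}; the exponential of the rest is a series of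
nonnegative terms. -/
theorem exp_jumpOp_nonneg {J : Site d → ℝ} (hJ : IsJumpRate J) {t : ℝ} (ht : 0 ≤ t)
    {f : LatFun d} (hf : ∀ x, 0 ≤ f x) (x : Site d) :
    0 ≤ NormedSpace.exp (t • jumpOp J hJ.supp) f x := by
  have hB : ∀ n : ℕ, ∀ x, 0 ≤ (jumpOp (Jplus J) hJ.supp ^ n) f x := by
    intro n
    induction n with
    | zero => simpa using hf
    | succ n ih =>
      intro x
      rw [pow_succ', mul_apply_eq_comp, jumpOp_apply]
      refine Finset.sum_nonneg fun y _ => mul_nonneg ?_ (ih _)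
      unfold Jplus; split_ifs with h
      · exact le_rfl
      · exact hJ.nonneg y h
  have hA : jumpOp J hJ.supp = jumpOp (Jplus J) hJ.supp + (J 0) • 1 := by
    ext1 f
    refine ext_eval fun x => ?_
    have h1 : (jumpOp (Jplus J) hJ.supp + (J 0) • 1) f x =
        jumpOp (Jplus J) hJ.supp f x + J 0 * f x := by
      simp
    rw [h1, jumpOp_apply, jumpOp_apply]
    have : ∀ y, J y * f (x + y) = Jplus J y * f (x + y) + if y = 0 then J 0 * f x else 0 := by
      intro y; by_cases h : y = 0 <;> simp [Jplus, h]
    simp only [this, Finset.sum_add_distrib, Finset.sum_ite_eq']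
    congr 1
    split_ifs with h
    · rfl
    · rw [hJ.eq_zero_of_notMem h, zero_mul]
  let : NormedAlgebra ℚ (LatFun d →L[ℝ] LatFun d) := NormedAlgebra.restrictScalars ℚ ℝ _
  have hexp : NormedSpace.exp (t • jumpOp J hJ.supp) =
      Real.exp (t * J 0) • NormedSpace.exp (t • jumpOp (Jplus J) hJ.supp) := by
    have h1 : t • jumpOp J hJ.supp = t • jumpOp (Jplus J) hJ.supp +
        algebraMap ℝ (LatFun d →L[ℝ] LatFun d) (t * J 0) := by
      rw [hA, smul_add, Algebra.algebraMap_eq_smul_one, smul_smul]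
    rw [h1, NormedSpace.exp_add_of_commute (Algebra.commutes' _ _).symm,
      ← NormedSpace.algebraMap_exp_comm, Algebra.algebraMap_eq_smul_one, Real.exp_eq_exp_ℝ]
    simp
  rw [hexp, smul_apply]
  beta_reduce
  rw [map_smul, smul_eq_mul]
  refine mul_nonneg (Real.exp_pos _).le ?_
  exact (hasSum_exp_apply _ t f x).nonneg fun n => mul_nonneg (by positivity) (hB n x)

theorem transition_eq_exp_zero {J : Site d → ℝ} (hJ : IsJumpRate J) (t : ℝ) (x : Site d) :
    transition J t x = NormedSpace.exp (t • jumpOp J hJ.supp) (pointFun x) 0 := by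
  rw [← transition_eq_exp, sub_zero]

theorem transition_nonneg {J : Site d → ℝ} (hJ : IsJumpRate J) {t : ℝ} (ht : 0 ≤ t) (x : Site d) :
    0 ≤ transition J t x := by
  rw [transition_eq_exp_zero hJ]
  exact exp_jumpOp_nonneg hJ ht (fun y => by rw [pointFun_apply]; split_ifs <;> norm_num) 0

theorem hasDerivAt_exp_apply (A : LatFun d →L[ℝ] LatFun d) (t : ℝ) (f : LatFun d) (x : Site d) :
    HasDerivAt (fun u : ℝ => NormedSpace.exp (u • A) f x) (NormedSpace.exp (t • A) (A f) x) t := by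
  have h := hasDerivAt_exp_smul_const (𝕂 := ℝ) A t
  have h2 := (((LatFun.eval x).comp
    ((ContinuousLinearMap.apply ℝ (LatFun d)) f)).hasFDerivAt
      (x := NormedSpace.exp (t • A))).comp_hasDerivAt t h
  exact h2

theorem hasDerivAt_transition_zero {J : Site d → ℝ} (hJ : IsJumpRate J) (x : Site d) :
    HasDerivAt (fun t => transition J t x) (J x) 0 := by
  have h := hasDerivAt_exp_apply (jumpOp J hJ.supp) 0 (pointFun x) 0
  have e : NormedSpace.exp ((0 : ℝ) • jumpOp J hJ.supp) (jumpOp J hJ.supp (pointFun x)) 0 = J x := by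
    rw [zero_smul, NormedSpace.exp_zero, one_apply_eq_self, jumpOp_apply]
    simp only [zero_add, pointFun_apply, mul_ite, mul_one, mul_zero, Finset.sum_ite_eq']
    split_ifs with h
    · rfl
    · rw [hJ.eq_zero_of_notMem h]
  rw [e] at h
  simp only [transition_eq_exp_zero hJ]
  exact h

theorem transition_zero {J : Site d → ℝ} (hJ : IsJumpRate J) (x : Site d) :
    transition J 0 x = if x = 0 then 1 else 0 := by
  rw [transition_eq_exp_zero hJ, zero_smul, NormedSpace.exp_zero, one_apply_eq_self, pointFun_apply]
  simp [eq_comm]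

theorem continuous_transition {J : Site d → ℝ} (hJ : IsJumpRate J) (x : Site d) :
    Continuous fun t => transition J t x := by
  simp only [transition_eq_exp_zero hJ]
  exact continuous_iff_continuousAt.2 fun t => (hasDerivAt_exp_apply _ t _ _).continuousAt

/-- Off-diagonal transition probabilities are at most linear in time, uniformly in the point. -/
theorem transition_le_linear {J : Site d → ℝ} (hJ : IsJumpRate J) :
    ∃ C : ℝ, 0 ≤ C ∧ ∃ ε > 0, ∀ t, 0 ≤ t → t < ε → ∀ x, x ≠ 0 → transition J t x ≤ C * t := by
  have h := (hasDerivAt_exp_smul_const (𝕂 := ℝ) (jumpOp J hJ.supp) 0).isBigO_sub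
  obtain ⟨C, hC⟩ := h.bound
  obtain ⟨ε, hε, hb⟩ := Metric.eventually_nhds_iff.1 hC
  refine ⟨|C|, abs_nonneg _, ε, hε, fun t ht htε x hx => ?_⟩
  have h1 := hb (y := t) (by simpa [abs_of_nonneg ht] using htε)
  rw [zero_smul, NormedSpace.exp_zero, sub_zero, Real.norm_of_nonneg ht] at h1
  have e2 : transition J t x = (NormedSpace.exp (t • jumpOp J hJ.supp) - 1) (pointFun x) 0 := by
    have h2 : (NormedSpace.exp (t • jumpOp J hJ.supp) - 1) (pointFun x) 0 =
        NormedSpace.exp (t • jumpOp J hJ.supp) (pointFun x) 0 - pointFun x 0 := by simp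
    rw [transition_eq_exp_zero hJ, h2, pointFun_apply x 0, if_neg hx.symm, sub_zero]
  have hn : ‖pointFun x‖ ≤ 1 := (LatFun.norm_le zero_le_one).2 fun y => by
    rw [pointFun_apply]; split_ifs <;> simp
  calc transition J t x ≤ |(NormedSpace.exp (t • jumpOp J hJ.supp) - 1) (pointFun x) 0| := by
        rw [e2]; exact le_abs_self _
    _ ≤ ‖(NormedSpace.exp (t • jumpOp J hJ.supp) - 1) (pointFun x)‖ := LatFun.abs_le_norm _ _
    _ ≤ ‖NormedSpace.exp (t • jumpOp J hJ.supp) - 1‖ * ‖pointFun x‖ :=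
        ContinuousLinearMap.le_opNorm _ _
    _ ≤ ‖NormedSpace.exp (t • jumpOp J hJ.supp) - 1‖ * 1 := by gcongr
    _ ≤ |C| * t := by
        rw [mul_one]; exact h1.trans (mul_le_mul_of_nonneg_right (le_abs_self C) ht)

end Semigroup

/-! ### Path transformations and uniqueness of laws -/

section Paths

variable {d : ℕ}

/-- The path stopped at time `s`. -/
def CadlagPath.stopAt (s : ℝ≥0) (ω : CadlagPath d) : CadlagPath d where
  toFun r := ω (min r s)
  right_continuous t := by
    refine (ω.right_continuous (min t s)).comp (t := Set.Ici (min t s)) ?_ ?_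
    · exact (continuous_id.min continuous_const).continuousWithinAt
    · intro r hr; exact min_le_min_right s hr
  left_limit t ht := by
    rcases le_or_gt t s with h | h
    · obtain ⟨l, hl⟩ := ω.left_limit t ht
      refine ⟨l, hl.congr' ?_⟩
      filter_upwards [self_mem_nhdsWithin] with r hr
      rw [min_eq_left ((le_of_lt hr).trans h)]
    · refine ⟨ω s, tendsto_const_nhds.congr' ?_⟩
      filter_upwards [nhdsWithin_le_nhds (lt_mem_nhds h)] with r hr
      rw [min_eq_right (le_of_lt hr)]

/-- The path seen from time `s` on. -/
def CadlagPath.shift (s : ℝ≥0) (ω : CadlagPath d) : CadlagPath d where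
  toFun r := ω (s + r)
  right_continuous t := by
    refine (ω.right_continuous (s + t)).comp (t := Set.Ici (s + t)) ?_ ?_
    · exact (continuous_const.add continuous_id).continuousWithinAt
    · intro r hr
      rw [Set.mem_Ici] at hr ⊢
      gcongr
  left_limit t ht := by
    obtain ⟨l, hl⟩ := ω.left_limit (s + t) (by positivity)
    refine ⟨l, hl.comp (f := fun r => s + r) ?_⟩
    refine tendsto_nhdsWithin_iff.2 ⟨?_, ?_⟩
    · exact (continuous_const.add continuous_id).continuousAt.mono_left nhdsWithin_le_nhds
    · filter_upwards [self_mem_nhdsWithin] with r hr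
      rw [Set.mem_Iio] at hr ⊢
      gcongr

@[simp] theorem CadlagPath.stopAt_apply (s r : ℝ≥0) (ω : CadlagPath d) : ω.stopAt s r = ω (min r s) := rfl

@[simp] theorem CadlagPath.shift_apply (s r : ℝ≥0) (ω : CadlagPath d) :
    ω.shift s r = ω (s + r) := rfl

theorem CadlagPath.measurable_stopAt (s : ℝ≥0) : Measurable (CadlagPath.stopAt (d := d) s) :=
  CadlagPath.measurable_of_eval fun _ => CadlagPath.measurable_eval _

theorem CadlagPath.measurable_shift (s : ℝ≥0) : Measurable (CadlagPath.shift (d := d) s) :=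
  CadlagPath.measurable_of_eval fun _ => CadlagPath.measurable_eval _

/-- Finite-dimensional cylinder sets whose times include `0`. -/
def cylinders (d : ℕ) : Set (Set (CadlagPath d)) :=
  {S | ∃ (I : Finset ℝ≥0) (x : ℝ≥0 → Site d), 0 ∈ I ∧ S = {ω | ∀ t ∈ I, ω t = x t}}

theorem measurableSet_cylinder (I : Finset ℝ≥0) (x : ℝ≥0 → Site d) :
    MeasurableSet {ω : CadlagPath d | ∀ t ∈ I, ω t = x t} := by
  have : {ω : CadlagPath d | ∀ t ∈ I, ω t = x t} = ⋂ t ∈ I, {ω | ω t = x t} := by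
    ext ω; simp
  rw [this]
  exact Finset.measurableSet_biInter I fun t _ =>
    CadlagPath.measurable_eval t (measurableSet_singleton (x t))

theorem isPiSystem_cylinders : IsPiSystem (cylinders d) := by
  rintro _ ⟨I, x, hI, rfl⟩ _ ⟨I', y, hI', rfl⟩ ⟨ω, h1, h2⟩
  -- Any path in the intersection supplies consistent prescribed values on the union of the two sets
  -- of times.
  refine ⟨I ∪ I', ω, by simp [hI], ?_⟩
  ext ω'
  simp only [Set.mem_inter_iff, Set.mem_ofPred_eq, Finset.mem_union]
  constructor
  · rintro ⟨g1, g2⟩ t (ht | ht)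
    · rw [g1 t ht, h1 t ht]
    · rw [g2 t ht, h2 t ht]
  · intro g
    exact ⟨fun t ht => (g t (Or.inl ht)).trans (h1 t ht),
      fun t ht => (g t (Or.inr ht)).trans (h2 t ht)⟩

/-- The laws are prescribed only on cylinders containing time 0. A constraint at a single time t is
a countable union of these, over the possible values at 0. -/
theorem generateFrom_cylinders :
    (inferInstance : MeasurableSpace (CadlagPath d)) = MeasurableSpace.generateFrom (cylinders d) := by
  refine le_antisymm (iSup_le fun t => ?_) (MeasurableSpace.generateFrom_le ?_)
  · rw [← measurable_iff_comap_le]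
    refine @measurable_to_countable' _ _ _ _ (MeasurableSpace.generateFrom (cylinders d)) _ fun z => ?_
    have : (fun ω : CadlagPath d => ω t) ⁻¹' {z} =
        ⋃ z' : Site d, {ω | ∀ r ∈ ({0, t} : Finset ℝ≥0), ω r = if r = t then z else z'} := by
      ext ω
      simp only [Set.mem_preimage, Set.mem_singleton_iff, Set.mem_iUnion, Set.mem_ofPred_eq,
        Finset.mem_insert, Finset.mem_singleton, forall_eq_or_imp, forall_eq, if_true]
      constructor
      · intro h
        refine ⟨ω 0, ?_, h⟩
        split_ifs with h0
        · rw [h0, h]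
        · rfl
      · rintro ⟨z', _, h⟩; exact h
    rw [this]
    refine @MeasurableSet.iUnion _ _ (MeasurableSpace.generateFrom (cylinders d)) _ _ fun z' => ?_
    exact MeasurableSpace.measurableSet_generateFrom ⟨{0, t}, _, by simp, rfl⟩
  · rintro _ ⟨I, x, _, rfl⟩
    exact measurableSet_cylinder I x

/-- Finite measures on path space are determined by their finite-dimensional marginals. -/
theorem path_measure_ext {μ ν : Measure (CadlagPath d)} [IsFiniteMeasure μ]
    (h : ∀ (n : ℕ) (t : Fin (n + 1) → ℝ≥0) (x : Fin (n + 1) → Site d), t 0 = 0 → Monotone t →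
      μ {ω | ∀ i, ω (t i) = x i} = ν {ω | ∀ i, ω (t i) = x i}) : μ = ν := by
  refine ext_of_generate_finite (cylinders d) generateFrom_cylinders isPiSystem_cylinders ?_ ?_
  · rintro _ ⟨I, x, h0, rfl⟩
    obtain ⟨n, hn⟩ : ∃ n, I.card = n + 1 :=
      Nat.exists_eq_succ_of_ne_zero (Finset.card_ne_zero_of_mem h0)
    have key := h n (I.orderEmbOfFin hn) (fun i => x (I.orderEmbOfFin hn i)) ?_
      (I.orderEmbOfFin hn).monotone
    · have e : {ω : CadlagPath d | ∀ t ∈ I, ω t = x t} =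
          {ω | ∀ i, ω (I.orderEmbOfFin hn i) = x (I.orderEmbOfFin hn i)} := by
        ext ω
        constructor
        · intro hω i; exact hω _ (Finset.orderEmbOfFin_mem I hn i)
        · intro hω t ht
          have : t ∈ Set.range (I.orderEmbOfFin hn) := by
            rw [Finset.range_orderEmbOfFin]; exact ht
          obtain ⟨i, rfl⟩ := this
          exact hω i
      rw [e]; exact key
    · have := Finset.orderEmbOfFin_zero hn (Nat.succ_pos n)
      rw [show (0 : Fin (n + 1)) = ⟨0, Nat.succ_pos n⟩ from rfl, this]
      exact le_antisymm (Finset.min'_le I 0 h0) zero_le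
  -- Equality of the total masses is not assumed; it follows by summing over the position at time 0.
  · have hU : (Set.univ : Set (CadlagPath d)) = ⋃ z : Site d, {ω | ω 0 = z} := by ext; simp
    have hm : ∀ z : Site d, MeasurableSet {ω : CadlagPath d | ω 0 = z} := fun z =>
      CadlagPath.measurable_eval 0 (measurableSet_singleton z)
    have hd : Pairwise (Function.onFun Disjoint fun z : Site d => {ω : CadlagPath d | ω 0 = z}) := by
      intro z z' hz
      refine Set.disjoint_left.2 fun ω h1 h2 => hz ?_
      exact (show ω 0 = z from h1).symm.trans h2
    rw [hU, measure_iUnion hd hm, measure_iUnion hd hm]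
    congr 1
    ext1 z
    have := h 0 (fun _ => 0) (fun _ => z) rfl monotone_const
    simpa using this

end Paths

end

noncomputable section

/-! ### The Markov property -/

section Markov

open ProbabilityTheory

variable {d : ℕ} {J : Site d → ℝ} {P : Site d → Measure (CadlagPath d)}

/-- The finite-dimensional law is a product over increments, so a further time splits off one
factor. All forms of the Markov property below are built from this. -/
theorem IsWalkLaw.cylinder_succ (hJ : IsJumpRate J) {a : Site d} {μ : Measure (CadlagPath d)}
    (hP : IsWalkLaw J a μ) (n : ℕ) (t : Fin (n + 1) → ℝ≥0) (x : Fin (n + 1) → Site d)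
    (h0 : t 0 = 0) (ht : Monotone t) (r : ℝ≥0) (hr : t (Fin.last n) ≤ r) (y : Site d) :
    μ ({ω | ∀ i, ω (t i) = x i} ∩ {ω | ω r = y}) = μ {ω | ∀ i, ω (t i) = x i} *
      ENNReal.ofReal (transition J ((r : ℝ) - t (Fin.last n)) (y - x (Fin.last n))) := by
  have hmono : Monotone (Fin.snoc (α := fun _ => ℝ≥0) t r : Fin (n + 2) → ℝ≥0) := by
    intro i j hij
    induction j using Fin.lastCases with
    | last =>
      induction i using Fin.lastCases with
      | last => exact le_rfl
      | cast i => simpa using (ht (Fin.le_last i)).trans hr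
    | cast j =>
      induction i using Fin.lastCases with
      | last => exact absurd (lt_of_lt_of_le (Fin.castSucc_lt_last j) hij) (lt_irrefl _)
      | cast i => simpa using ht (Fin.castSucc_le_castSucc_iff.1 hij)
  have h0' : (Fin.snoc (α := fun _ => ℝ≥0) t r : Fin (n + 2) → ℝ≥0) 0 = 0 := by
    have : (0 : Fin (n + 2)) = Fin.castSucc 0 := rfl
    rw [this, Fin.snoc_castSucc, h0]
  have key := hP.finite_dimensional (n + 1) (Fin.snoc (α := fun _ => ℝ≥0) t r)
    (Fin.snoc (α := fun _ => Site d) x y) h0' hmono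
  have e : {ω : CadlagPath d | ∀ i, ω (t i) = x i} ∩ {ω | ω r = y} =
      {ω | ∀ i, ω ((Fin.snoc (α := fun _ => ℝ≥0) t r : Fin (n + 2) → ℝ≥0) i) =
        (Fin.snoc (α := fun _ => Site d) x y : Fin (n + 2) → Site d) i} := by
    ext ω
    simp [Fin.forall_fin_succ']
  rw [e, key, hP.finite_dimensional n t x h0 ht]
  have : (0 : Fin (n + 2)) = Fin.castSucc 0 := rfl
  rw [this, Fin.snoc_castSucc]
  split_ifs with hx
  · rw [Fin.prod_univ_castSucc, ENNReal.ofReal_mul]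
    · congr 1
      · simp only [Fin.snoc_castSucc, ← Fin.castSucc_succ]
      · simp
    · refine Finset.prod_nonneg fun i _ => transition_nonneg hJ ?_ _
      simp only [Fin.snoc_castSucc, ← Fin.castSucc_succ]
      exact sub_nonneg.2 (ht (Fin.castSucc_lt_succ).le)
  · simp

theorem IsWalkLaw.ae_start {a : Site d} {μ : Measure (CadlagPath d)}
    (hP : IsWalkLaw J a μ) : ∀ᵐ ω ∂μ, ω 0 = a := by
  have := hP.isProbabilityMeasure
  have h := hP.finite_dimensional 0 (fun _ => 0) (fun _ => a) rfl monotone_const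
  simp only [if_true, Finset.univ_eq_empty, Finset.prod_empty, ENNReal.ofReal_one,
    forall_const] at h
  rw [ae_iff, ← Set.compl_ofPred, prob_compl_eq_zero_iff]
  · exact h
  · exact CadlagPath.measurable_eval 0 (measurableSet_singleton a)

theorem IsWalkLaw.marginal (hJ : IsJumpRate J) {a : Site d} {μ : Measure (CadlagPath d)}
    (hP : IsWalkLaw J a μ) (t : ℝ≥0) (x : Site d) :
    μ {ω | ω t = x} = ENNReal.ofReal (transition J t (x - a)) := by
  have := hP.isProbabilityMeasure
  have h := hP.cylinder_succ hJ 0 (fun _ => 0) (fun _ => a) rfl monotone_const t zero_le x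
  have h2 := hP.finite_dimensional 0 (fun _ => 0) (fun _ => a) rfl monotone_const
  simp only [if_true, Finset.univ_eq_empty, Finset.prod_empty, ENNReal.ofReal_one] at h2
  rw [h2, one_mul] at h
  simp only [NNReal.coe_zero, sub_zero, forall_const] at h
  rw [← h]
  refine measure_congr ?_
  filter_upwards [hP.ae_start] with ω hω
  refine propext ⟨fun hx => ⟨hω, hx⟩, fun hx => hx.2⟩

/-- One-step Markov property. -/
theorem IsWalkLaw.markov_step (hJ : IsJumpRate J) {a : Site d} {μ : Measure (CadlagPath d)}
    (hP : IsWalkLaw J a μ) (s h : ℝ≥0) (z w : Site d) {A : Set (CadlagPath d)}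
    (hA : MeasurableSet A) :
    μ (CadlagPath.stopAt s ⁻¹' A ∩ {ω | ω s = z} ∩ {ω | ω (s + h) = w}) =
      μ (CadlagPath.stopAt s ⁻¹' A ∩ {ω | ω s = z}) * ENNReal.ofReal (transition J h (w - z)) := by
  have := hP.isProbabilityMeasure
  have hmz : MeasurableSet {ω : CadlagPath d | ω s = z} :=
    CadlagPath.measurable_eval s (measurableSet_singleton z)
  have hmw : MeasurableSet {ω : CadlagPath d | ω (s + h) = w} :=
    CadlagPath.measurable_eval (s + h) (measurableSet_singleton w)
  have hms := CadlagPath.measurable_stopAt (d := d) s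
  -- For general past events it is enough to compare two laws of the stopped path, hence their
  -- cylinders. Such a cylinder constrains the path at the times min(t_i, s), to which s and then s
  -- + h are appended.
  have key : (μ.restrict ({ω | ω s = z} ∩ {ω | ω (s + h) = w})).map (CadlagPath.stopAt s) =
      ENNReal.ofReal (transition J h (w - z)) •
        (μ.restrict {ω | ω s = z}).map (CadlagPath.stopAt s) := by
    have : IsFiniteMeasure ((μ.restrict ({ω | ω s = z} ∩ {ω | ω (s + h) = w})).map
      (CadlagPath.stopAt s)) := by infer_instance
    refine path_measure_ext fun n t x h0 ht => ?_
    have hC : MeasurableSet {ω : CadlagPath d | ∀ i, ω (t i) = x i} := by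
      rw [Set.ofPred_forall]
      exact MeasurableSet.iInter fun i => CadlagPath.measurable_eval _ (measurableSet_singleton _)
    rw [Measure.smul_apply, Measure.map_apply hms hC, Measure.map_apply hms hC,
      Measure.restrict_apply (hms hC), Measure.restrict_apply (hms hC)]
    have hsn : Monotone (Fin.snoc (α := fun _ => ℝ≥0) (fun i => min (t i) s) s :
        Fin (n + 2) → ℝ≥0) := by
      intro i j hij
      induction j using Fin.lastCases with
      | last =>
        induction i using Fin.lastCases with
        | last => exact le_rfl
        | cast i => simp
      | cast j =>
        induction i using Fin.lastCases with
        | last => exact absurd (lt_of_lt_of_le (Fin.castSucc_lt_last j) hij) (lt_irrefl _)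
        | cast i =>
          have := ht (Fin.castSucc_le_castSucc_iff.1 hij)
          simp only [Fin.snoc_castSucc]
          exact min_le_min_right s this
    have h0' : (Fin.snoc (α := fun _ => ℝ≥0) (fun i => min (t i) s) s : Fin (n + 2) → ℝ≥0) 0
        = 0 := by
      have : (0 : Fin (n + 2)) = Fin.castSucc 0 := rfl
      rw [this, Fin.snoc_castSucc, h0]; simp
    have h1 := hP.cylinder_succ hJ (n + 1) (Fin.snoc (α := fun _ => ℝ≥0) (fun i => min (t i) s) s)
      (Fin.snoc (α := fun _ => Site d) x z) h0' hsn (s + h) (by simp) w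
    have e : {ω : CadlagPath d | ∀ i, ω ((Fin.snoc (α := fun _ => ℝ≥0) (fun i => min (t i) s) s :
        Fin (n + 2) → ℝ≥0) i) = (Fin.snoc (α := fun _ => Site d) x z : Fin (n + 2) → Site d) i} =
        CadlagPath.stopAt s ⁻¹' {ω | ∀ i, ω (t i) = x i} ∩ {ω | ω s = z} := by
      ext ω
      simp [Fin.forall_fin_succ']
    rw [e] at h1
    rw [← Set.inter_assoc, h1, smul_eq_mul, mul_comm]
    simp
  have h2 := congrArg (fun ν => ν A) key
  simp only [Measure.smul_apply, Measure.map_apply hms hA, Measure.restrict_apply (hms hA),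
    smul_eq_mul] at h2
  rw [Set.inter_assoc, h2, mul_comm]

theorem CadlagPath.stopAt_stopAt (ω : CadlagPath d) (s r : ℝ≥0) (h : s ≤ r) :
    (ω.stopAt r).stopAt s = ω.stopAt s := by
  have : ∀ u, (ω.stopAt r).stopAt s u = ω.stopAt s u := fun u => by
    simp [min_assoc, min_eq_left h]
  cases h1 : (ω.stopAt r).stopAt s; cases h2 : ω.stopAt s
  simp only [CadlagPath.mk.injEq]
  funext u
  have := this u
  rwa [h1, h2] at this

/-- Induction on the number of future times: the one-step property at the penultimate time removes
the last factor, and everything before that time counts as past. -/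
theorem IsWalkLaw.markov_cylinder (hJ : IsJumpRate J) (hP : ∀ a, IsWalkLaw J a (P a))
    (a : Site d) (s : ℝ≥0) {A : Set (CadlagPath d)} (hA : MeasurableSet A)
    (n : ℕ) (t : Fin (n + 1) → ℝ≥0) (x : Fin (n + 1) → Site d) (h0 : t 0 = 0) (ht : Monotone t) :
    P a (CadlagPath.stopAt s ⁻¹' A ∩ CadlagPath.shift s ⁻¹' {ω | ∀ i, ω (t i) = x i}) =
      P a (CadlagPath.stopAt s ⁻¹' A ∩ {ω | ω s = x 0}) * P (x 0) {ω | ∀ i, ω (t i) = x i} := by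
  induction n with
  | zero =>
    have h := (hP (x 0)).finite_dimensional 0 t x h0 ht
    rw [if_pos rfl] at h
    rw [h]
    simp [h0, Set.preimage_ofPred_eq]
  | succ n ih =>
    have ht' : Monotone fun i : Fin (n + 1) => t i.castSucc := fun i j hij =>
      ht (Fin.castSucc_le_castSucc_iff.2 hij)
    have ih' := ih (fun i => t i.castSucc) (fun i => x i.castSucc) h0 ht'
    have hlast : t (Fin.last n).castSucc ≤ t (Fin.last (n + 1)) := ht (Fin.le_last _)
    have h1 := (hP (x 0)).cylinder_succ hJ n (fun i => t i.castSucc) (fun i => x i.castSucc) h0 ht'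
      (t (Fin.last (n + 1))) hlast (x (Fin.last (n + 1)))
    have e1 : {ω : CadlagPath d | ∀ i, ω (t i) = x i} =
        {ω | ∀ i : Fin (n + 1), ω (t i.castSucc) = x i.castSucc} ∩
          {ω | ω (t (Fin.last (n + 1))) = x (Fin.last (n + 1))} := by
      ext ω; simp [Fin.forall_fin_succ']
    obtain ⟨h, hh⟩ := exists_add_of_le hlast
    have hC : MeasurableSet {ω : CadlagPath d | ∀ i : Fin (n + 1), ω (t i.castSucc) = x i.castSucc} := by
      rw [Set.ofPred_forall]
      exact MeasurableSet.iInter fun i => CadlagPath.measurable_eval _ (measurableSet_singleton _)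
    set u := s + t (Fin.last n).castSucc with hu
    have hmin : ∀ i : Fin (n + 1), s + t i.castSucc ≤ u := fun i => by
      rw [hu]; gcongr; exact ht' (Fin.le_last i)
    have h2 := (hP a).markov_step hJ u h (x (Fin.last n).castSucc) (x (Fin.last (n + 1)))
      (A := CadlagPath.stopAt s ⁻¹' A ∩
        CadlagPath.shift s ⁻¹' {ω | ∀ i : Fin (n + 1), ω (t i.castSucc) = x i.castSucc})
      ((CadlagPath.measurable_stopAt s hA).inter (CadlagPath.measurable_shift s hC))
    have e2 : CadlagPath.stopAt u ⁻¹' (CadlagPath.stopAt s ⁻¹' A ∩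
        CadlagPath.shift s ⁻¹' {ω | ∀ i : Fin (n + 1), ω (t i.castSucc) = x i.castSucc}) ∩
        {ω | ω u = x (Fin.last n).castSucc} = CadlagPath.stopAt s ⁻¹' A ∩
        CadlagPath.shift s ⁻¹' {ω | ∀ i : Fin (n + 1), ω (t i.castSucc) = x i.castSucc} := by
      ext ω
      simp only [Set.mem_inter_iff, Set.mem_preimage, Set.mem_ofPred_eq,
        CadlagPath.stopAt_stopAt ω s u (by rw [hu]; exact le_self_add), CadlagPath.shift_apply,
        CadlagPath.stopAt_apply, min_eq_left (hmin _)]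
      constructor
      · exact fun h => h.1
      · exact fun h => ⟨h, h.2 (Fin.last n)⟩
    rw [e2, ih'] at h2
    have e3 : CadlagPath.stopAt s ⁻¹' A ∩ CadlagPath.shift s ⁻¹' {ω | ∀ i, ω (t i) = x i} =
        CadlagPath.stopAt s ⁻¹' A ∩
        CadlagPath.shift s ⁻¹' {ω | ∀ i : Fin (n + 1), ω (t i.castSucc) = x i.castSucc} ∩
        {ω | ω (u + h) = x (Fin.last (n + 1))} := by
      rw [e1, Set.preimage_inter, ← Set.inter_assoc]
      ext ω
      simp [hu, hh, add_assoc]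
    rw [e3, h2, e1, h1, mul_assoc]
    have : ((t (Fin.last (n + 1)) : ℝ) - t (Fin.last n).castSucc) = h := by
      rw [hh]; push_cast; ring
    rw [this]
    rfl

/-- The law of the walk as a kernel of its starting point. -/
def walkKernel (P : Site d → Measure (CadlagPath d)) : Kernel (Site d) (CadlagPath d) :=
  ⟨P, measurable_of_countable P⟩

/-- The **Markov property** at a fixed time. -/
theorem markov_property (hJ : IsJumpRate J) (hP : ∀ a, IsWalkLaw J a (P a)) (a : Site d) (s : ℝ≥0)
    {Φ : CadlagPath d × CadlagPath d → ℝ≥0∞} (hΦ : Measurable Φ) :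
    ∫⁻ ω, Φ (ω.stopAt s, ω.shift s) ∂P a = ∫⁻ ω, ∫⁻ ω', Φ (ω.stopAt s, ω') ∂P (ω s) ∂P a := by
  have hprob : ∀ a, IsProbabilityMeasure (P a) := fun a => (hP a).isProbabilityMeasure
  have hms := CadlagPath.measurable_stopAt (d := d) s
  have hmsh := CadlagPath.measurable_shift (d := d) s
  have hmev := CadlagPath.measurable_eval (d := d) s
  have : IsMarkovKernel (walkKernel P) := ⟨hprob⟩
  set κ : Kernel (CadlagPath d) (CadlagPath d) :=
    (walkKernel P).comap (fun ω : CadlagPath d => ω s) hmev with hκ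
  have hκa : ∀ ω, κ ω = P (ω s) := fun ω => rfl
  -- The property amounts to a disintegration: given the stopped path, the shifted path has the law
  -- of the walk started at the endpoint. It is checked on rectangles, where the future event may be
  -- taken to be a cylinder.
  have key : (P a).map (fun ω => (ω.stopAt s, ω.shift s)) = ((P a).map (CadlagPath.stopAt s)) ⊗ₘ κ := by
    have : IsProbabilityMeasure ((P a).map (CadlagPath.stopAt (d := d) s)) :=
      Measure.isProbabilityMeasure_map hms.aemeasurable
    refine Measure.ext_prod fun {A B} hA hB => ?_
    rw [Measure.map_apply (hms.prodMk hmsh) (hA.prod hB), Measure.compProd_apply_prod hA hB,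
      setLIntegral_map hA (Kernel.measurable_coe κ hB) hms]
    have e0 : (fun ω : CadlagPath d => (ω.stopAt s, ω.shift s)) ⁻¹' A ×ˢ B =
        CadlagPath.stopAt s ⁻¹' A ∩ CadlagPath.shift s ⁻¹' B := rfl
    rw [e0]
    simp only [hκa, CadlagPath.stopAt_apply, min_self]
    have hb : AEMeasurable (fun ω : CadlagPath d => P (ω s))
        ((P a).restrict (CadlagPath.stopAt s ⁻¹' A)) :=
      ((measurable_of_countable P).comp hmev).aemeasurable
    have hmeas : ((P a).restrict (CadlagPath.stopAt s ⁻¹' A)).map (CadlagPath.shift s) =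
        ((P a).restrict (CadlagPath.stopAt s ⁻¹' A)).bind (fun ω => P (ω s)) := by
      refine path_measure_ext fun n t x h0 ht => ?_
      have hC : MeasurableSet {ω : CadlagPath d | ∀ i, ω (t i) = x i} := by
        rw [Set.ofPred_forall]
        exact MeasurableSet.iInter fun i => CadlagPath.measurable_eval _ (measurableSet_singleton _)
      rw [Measure.map_apply hmsh hC, Measure.restrict_apply (hmsh hC), Set.inter_comm,
        IsWalkLaw.markov_cylinder hJ hP a s hA n t x h0 ht, Measure.bind_apply hC hb]
      have hx0 : MeasurableSet {ω : CadlagPath d | ω s = x 0} := hmev (measurableSet_singleton _)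
      have e1 : ∀ ω : CadlagPath d, P (ω s) {ω | ∀ i, ω (t i) = x i} =
          {ω : CadlagPath d | ω s = x 0}.indicator
            (fun _ => P (x 0) {ω | ∀ i, ω (t i) = x i}) ω := by
        intro ω
        by_cases h : ω s = x 0
        · rw [Set.indicator_of_mem (show ω ∈ {ω : CadlagPath d | ω s = x 0} from h), h]
        · rw [Set.indicator_of_notMem (show ω ∉ {ω : CadlagPath d | ω s = x 0} from h),
            (hP (ω s)).finite_dimensional n t x h0 ht, if_neg (fun hc => h hc.symm)]
      simp only [e1]
      rw [lintegral_indicator_const hx0, Measure.restrict_apply hx0, Set.inter_comm, mul_comm]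
    have h3 := congrArg (fun ν => ν B) hmeas
    simp only [Measure.map_apply hmsh hB, Measure.restrict_apply (hmsh hB)] at h3
    rw [Measure.bind_apply hB hb] at h3
    rw [Set.inter_comm, h3]
  calc ∫⁻ ω, Φ (ω.stopAt s, ω.shift s) ∂P a
      = ∫⁻ p, Φ p ∂((P a).map (fun ω => (ω.stopAt s, ω.shift s))) :=
        (lintegral_map hΦ (hms.prodMk hmsh)).symm
    _ = ∫⁻ ω, ∫⁻ ω', Φ (ω.stopAt s, ω') ∂P (ω s) ∂P a := by
        have : IsProbabilityMeasure ((P a).map (CadlagPath.stopAt (d := d) s)) :=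
          Measure.isProbabilityMeasure_map hms.aemeasurable
        rw [key, Measure.lintegral_compProd hΦ, lintegral_map _ hms]
        · simp only [hκa, CadlagPath.stopAt_apply, min_self]
        · exact hΦ.lintegral_kernel_prod_right'

end Markov

end

noncomputable section

/-! ### Killed paths under stopping and shifting -/

section StopShift

variable {d : ℕ} {Λ : Finset (Site d)} {ω : CadlagPath d}

/-- A path in Λ up to and including t remains at its position for a positive time, so the inequality
is strict. This turns statements about killing into statements about path values, which behave well
under stopping and shifting. -/
theorem lt_exitTime_iff {t : ℝ≥0} : (t : ℝ≥0∞) < exitTime Λ ω ↔ ∀ r ≤ t, ω r ∈ Λ := by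
  constructor
  · intro h r hr
    exact mem_of_lt_exitTime ((ENNReal.coe_le_coe.2 hr).trans_lt h)
  · intro h
    obtain ⟨u, hu, hsub⟩ := (mem_nhdsGE_iff_exists_Ico_subset).1 (ω.eventually_eq_right t)
    refine lt_of_lt_of_le (ENNReal.coe_lt_coe.2 hu) (le_iInf₂ fun r hr => ?_)
    refine ENNReal.coe_le_coe.2 (not_lt.1 fun hru => hr ?_)
    rcases le_total r t with hrt | hrt
    · exact h r hrt
    · have : ω r = ω t := hsub ⟨hrt, hru⟩
      rw [this]; exact h t le_rfl

theorem killed_eq_some_iff' {t : ℝ≥0} {x : Site d} :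
    killed Λ ω t = some x ↔ (∀ r ≤ t, ω r ∈ Λ) ∧ ω t = x := by
  rw [killed_eq_some_iff, lt_exitTime_iff]

theorem killed_stop {s t : ℝ≥0} (h : t ≤ s) : killed Λ (ω.stopAt s) t = killed Λ ω t := by
  ext x
  rw [killed_eq_some_iff', killed_eq_some_iff']
  simp only [CadlagPath.stopAt_apply, min_eq_left h]
  refine and_congr (forall₂_congr fun r hr => ?_) Iff.rfl
  rw [min_eq_left (hr.trans h)]

theorem killed_shift {s t : ℝ≥0} {c : Site d} (h : killed Λ ω s = some c) :
    killed Λ ω (s + t) = killed Λ (ω.shift s) t := by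
  rw [killed_eq_some_iff'] at h
  ext x
  rw [killed_eq_some_iff', killed_eq_some_iff']
  simp only [CadlagPath.shift_apply]
  refine and_congr ⟨fun H r hr => H _ (by gcongr), fun H r hr => ?_⟩ Iff.rfl
  rcases le_total r s with hrs | hrs
  · exact h.1 r hrs
  · obtain ⟨r', rfl⟩ := exists_add_of_le hrs
    exact H r' (le_of_add_le_add_left hr)

theorem killed_eq_some_of_le {s t : ℝ≥0} (hst : s ≤ t) {y : Site d} (h : killed Λ ω t = some y) :
    killed Λ ω s = some (ω s) := by
  rw [killed_eq_some_iff'] at h ⊢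
  exact ⟨fun r hr => h.1 r (hr.trans hst), rfl⟩

theorem localTime_stop {u v : ℝ} {s : ℝ≥0} (h : v ≤ s) :
    localTime Λ (ω.stopAt s) u v = localTime Λ ω u v := by
  ext x
  simp only [localTime]
  congr 1
  ext r
  simp only [Set.mem_ofPred_eq, Set.mem_Icc]
  refine and_congr_right fun hr => ?_
  rw [killed_stop (Real.toNNReal_le_iff_le_coe.2 (hr.2.trans h))]

theorem posVec_stop {t : ℝ} {s : ℝ≥0} (h : t ≤ s) : posVec Λ (ω.stopAt s) t = posVec Λ ω t := by
  ext x
  rw [posVec_apply, posVec_apply, killed_stop (Real.toNNReal_le_iff_le_coe.2 h)]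

theorem localTime_shift {s : ℝ≥0} {c : Site d} (h : killed Λ ω s = some c) {l l' : ℝ}
    (hl : 0 ≤ l) :
    localTime Λ ω (s + l) (s + l') = localTime Λ (ω.shift s) l l' := by
  ext x
  simp only [localTime]
  have e : {r : ℝ | r ∈ Set.Icc l l' ∧ killed Λ (ω.shift s) r.toNNReal = some x.1} =
      (fun r => (s : ℝ) + r) ⁻¹' {r : ℝ | r ∈ Set.Icc ((s : ℝ) + l) (s + l') ∧
        killed Λ ω r.toNNReal = some x.1} := by
    ext r
    simp only [Set.mem_preimage, Set.mem_ofPred_eq, Set.mem_Icc, add_le_add_iff_left]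
    refine and_congr_right fun hr => ?_
    rw [Real.toNNReal_add s.coe_nonneg (hl.trans hr.1), Real.toNNReal_coe, killed_shift h]
  rw [e]
  simp only [Measure.real, measure_preimage_add]

theorem posVec_shift {s : ℝ≥0} {c : Site d} (h : killed Λ ω s = some c) {l : ℝ}
    (hl : 0 ≤ l) : posVec Λ ω (s + l) = posVec Λ (ω.shift s) l := by
  ext x
  rw [posVec_apply, posVec_apply, Real.toNNReal_add s.coe_nonneg hl, Real.toNNReal_coe, killed_shift h]

end StopShift

/-! ### Measurability of weights -/

section WeightMeasurability

variable {d : ℕ} {Z : WeightFamily d} {Λ : Finset (Site d)} {α : Type*} [MeasurableSpace α]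

open Classical in
theorem measurable_comp_of_continuousOn_orthant {f : (Λ → ℝ) → ℝ}
    (hf : ContinuousOn f (Set.Ici 0)) {g : α → (Λ → ℝ)} (hg : Measurable g)
    (h0 : ∀ a, g a ∈ Set.Ici (0 : Λ → ℝ)) : Measurable fun a => f (g a) := by
  have hS : MeasurableSet (Set.Ici (0 : Λ → ℝ)) := isClosed_Ici.measurableSet
  have h1 : Measurable ((Set.Ici (0 : Λ → ℝ)).piecewise f 0) :=
    hf.measurable_piecewise continuousOn_const hS
  have h2 : (fun a => f (g a)) = fun a => (Set.Ici (0 : Λ → ℝ)).piecewise f 0 (g a) := by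
    ext a; rw [Set.piecewise_eq_of_mem _ _ _ (h0 a)]
  rw [h2]
  exact h1.comp hg

/-- The vertex function in terms of the second derivatives of `log Z`. -/
def vtx (Z : WeightFamily d) (Λ : Finset (Site d)) (ω : CadlagPath d) (s t : ℝ) : ℝ :=
  logH Z Λ (localTime Λ ω s t) (posVec Λ ω s) (posVec Λ ω t)

namespace SmoothWeight

variable (hZ : SmoothWeight Z Λ)

include hZ

theorem measurable_weight {g : α → (Λ → ℝ)} (hg : Measurable g)
    (h0 : ∀ a, g a ∈ Set.Ici (0 : Λ → ℝ)) : Measurable fun a => Z Λ (g a) :=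
  measurable_comp_of_continuousOn_orthant hZ.contDiffOn.continuousOn hg h0

theorem measurable_lrY {f g : α → ℝ} {w : α → CadlagPath d} (hf : Measurable f) (hg : Measurable g)
    (hw : Measurable w) : Measurable fun a => lrY Z Λ (w a) (f a) (g a) :=
  (hZ.measurable_weight (measurable_localTime Λ hf hg hw)
    fun _ => localTime_nonneg Λ _ _ _).div_const _

theorem measurable_vtx {f g : α → ℝ} {w : α → CadlagPath d} (hf : Measurable f) (hg : Measurable g)
    (hw : Measurable w) : Measurable fun a => vtx Z Λ (w a) (f a) (g a) := by
  simp only [vtx, logH_posVec]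
  refine Finset.measurable_sum _ fun x _ => Finset.measurable_sum _ fun y _ => ?_
  refine Measurable.mul (Measurable.mul ?_ ?_) ?_
  · exact (measurable_pi_apply x).comp (measurable_posVec hf hw)
  · exact (measurable_pi_apply y).comp (measurable_posVec hg hw)
  · exact measurable_comp_of_continuousOn_orthant
      (hZ.continuousOn_logH (Pi.single x 1) (Pi.single y 1))
      (measurable_localTime Λ hf hg hw) fun _ => localTime_nonneg Λ _ _ _

theorem measurable_logD {f g p : α → ℝ} {w : α → CadlagPath d} (hf : Measurable f)
    (hg : Measurable g) (hp : Measurable p) (hw : Measurable w) :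
    Measurable fun a => logD Z Λ (localTime Λ (w a) (f a) (g a)) (posVec Λ (w a) (p a)) := by
  simp only [logD_posVec]
  refine Finset.measurable_sum _ fun x _ => Measurable.mul ?_ ?_
  · exact (measurable_pi_apply x).comp (measurable_posVec hp hw)
  · exact measurable_comp_of_continuousOn_orthant
      (hZ.continuousOn_logD (Pi.single x 1))
      (measurable_localTime Λ hf hg hw) fun _ => localTime_nonneg Λ _ _ _

theorem vertexFn_eq_vtx (ω : CadlagPath d) {s t : ℝ} (hs : 0 ≤ s) (hst : s < t) :
    vertexFn Z Λ ω s t = vtx Z Λ ω s t := hZ.vertexFn_eq ω hs hst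

theorem lrY_div (ω : CadlagPath d) (u s t : ℝ) : lrY Z Λ ω u t / lrY Z Λ ω u s =
    Z Λ (localTime Λ ω u t) / Z Λ (localTime Λ ω u s) := by
  have h0 := (hZ.pos 0 (Set.mem_Ici.2 le_rfl)).ne'
  have := (hZ.pos _ (localTime_nonneg Λ ω u s)).ne'
  rw [lrY, lrY]
  field_simp

end SmoothWeight

theorem lrY_stop {ω : CadlagPath d} {u v : ℝ} {s : ℝ≥0} (h : v ≤ s) :
    lrY Z Λ (ω.stopAt s) u v = lrY Z Λ ω u v := by rw [lrY, lrY, localTime_stop h]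

theorem vtx_stop {ω : CadlagPath d} {u v : ℝ} {s : ℝ≥0} (huv : u ≤ v) (h : v ≤ s) :
    vtx Z Λ (ω.stopAt s) u v = vtx Z Λ ω u v := by
  rw [vtx, vtx, localTime_stop h, posVec_stop h, posVec_stop (huv.trans h)]

end WeightMeasurability

/-! ### The Markov property for weighted killed walks -/

section MarkovWeight

variable {d : ℕ} {J : Site d → ℝ} {P : Site d → Measure (CadlagPath d)} {Z : WeightFamily d}
  {Λ : Finset (Site d)}

/-- Indicator of the event that the killed walk is at `x` at time `t`. -/
def atPos (Λ : Finset (Site d)) (ω : CadlagPath d) (t : ℝ) (x : Site d) : ℝ≥0∞ :=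
  Set.indicator {r : ℝ | killed Λ ω r.toNNReal = some x} 1 t

theorem atPos_of_eq {ω : CadlagPath d} {t : ℝ} {x : Site d}
    (h : killed Λ ω t.toNNReal = some x) : atPos Λ ω t x = 1 :=
  Set.indicator_of_mem (show t ∈ {r : ℝ | killed Λ ω r.toNNReal = some x} from h) 1

theorem atPos_of_ne {ω : CadlagPath d} {t : ℝ} {x : Site d}
    (h : killed Λ ω t.toNNReal ≠ some x) : atPos Λ ω t x = 0 :=
  Set.indicator_of_notMem (show t ∉ {r : ℝ | killed Λ ω r.toNNReal = some x} from h) 1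

theorem measurable_atPos {α : Type*} [MeasurableSpace α] (x : Site d) {f : α → ℝ}
    {w : α → CadlagPath d} (hf : Measurable f) (hw : Measurable w) :
    Measurable fun a => atPos Λ (w a) (f a) x := by
  have e : (fun a => atPos Λ (w a) (f a) x) =
      Set.indicator {a | killed Λ (w a) (f a).toNNReal = some x} 1 := by
    ext a
    by_cases h : killed Λ (w a) (f a).toNNReal = some x
    · rw [atPos_of_eq h,
        Set.indicator_of_mem (show a ∈ {a | killed Λ (w a) (f a).toNNReal = some x} from h)]; rfl
    · rw [atPos_of_ne h,
        Set.indicator_of_notMem (show a ∉ {a | killed Λ (w a) (f a).toNNReal = some x} from h)]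
  rw [e]
  exact measurable_one.indicator (measurableSet_killed_comp Λ x hf hw)

theorem atPos_stop {ω : CadlagPath d} {t : ℝ} {s : ℝ≥0} (h : t ≤ s) (x : Site d) :
    atPos Λ (ω.stopAt s) t x = atPos Λ ω t x := by
  by_cases hk : killed Λ ω t.toNNReal = some x
  · rw [atPos_of_eq hk, atPos_of_eq]; rwa [killed_stop (Real.toNNReal_le_iff_le_coe.2 h)]
  · rw [atPos_of_ne hk, atPos_of_ne]; rwa [killed_stop (Real.toNNReal_le_iff_le_coe.2 h)]

theorem green_eq (P : Site d → Measure (CadlagPath d)) (t : Λ → ℝ) (a b : Site d) :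
    green P Z Λ t a b = ∫⁻ l in Set.Ici (0 : ℝ), ∫⁻ ω,
      atPos Λ ω l b * ENNReal.ofReal (Z Λ (t + localTime Λ ω 0 l) / Z Λ t) ∂(P a) := by
  unfold green
  refine lintegral_congr fun l => lintegral_congr fun ω => ?_
  by_cases h : killed Λ ω l.toNNReal = some b
  · rw [if_pos h, atPos_of_eq h, one_mul]
  · rw [if_neg h, atPos_of_ne h, zero_mul]

theorem lintegral_Ioi_shift (f : ℝ → ℝ≥0∞) (s : ℝ) :
    ∫⁻ l in Set.Ioi s, f l = ∫⁻ l in Set.Ici (0 : ℝ), f (s + l) := by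
  rw [setLIntegral_congr Ioi_ae_eq_Ici]
  rw [← lintegral_indicator measurableSet_Ici, ← lintegral_indicator measurableSet_Ici,
    ← lintegral_add_left_eq_self _ s]
  refine lintegral_congr fun l => ?_
  simp only [Set.indicator_apply, Set.mem_Ici, le_add_iff_nonneg_right]

/-- With t = τ_{[u,s]}, the quotient Y_{u,l}/Y_{u,s} equals Z_{t+τ'}/Z_t, where τ' is the local time
of the shifted path. Given the past, integrating over l therefore yields the Green's function G_t at
the random local time t; this is why Green's functions with t ≠ 0 enter at all. -/
theorem SmoothWeight.markov_weight (hZ : SmoothWeight Z Λ) (hJ : IsJumpRate J)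
    (hP : ∀ a, IsWalkLaw J a (P a)) (a : Site d) (s : ℝ≥0) {u : ℝ} (hu : u ≤ s)
    {Φ : CadlagPath d → ℝ≥0∞} (hΦ : Measurable Φ) (hΦs : ∀ ω, Φ (ω.stopAt s) = Φ ω) (c b : Site d) :
    ∫⁻ ω, (∫⁻ l in Set.Ioi (s : ℝ), Φ ω * atPos Λ ω s c *
        (atPos Λ ω l b * ENNReal.ofReal (lrY Z Λ ω u l / lrY Z Λ ω u s))) ∂P a =
      ∫⁻ ω, Φ ω * atPos Λ ω s c * green P Z Λ (localTime Λ ω u s) c b ∂P a := by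
  have hprob : ∀ a, IsProbabilityMeasure (P a) := fun a => (hP a).isProbabilityMeasure
  set K : CadlagPath d → CadlagPath d → ℝ → ℝ≥0∞ := fun ω ω' l => Φ ω * atPos Λ ω s c *
    (atPos Λ ω' l b * ENNReal.ofReal (Z Λ (localTime Λ ω u s + localTime Λ ω' 0 l) /
      Z Λ (localTime Λ ω u s))) with hK
  have hKm : Measurable fun p : (CadlagPath d × CadlagPath d) × ℝ => K p.1.1 p.1.2 p.2 := by
    have h1 : Measurable fun p : (CadlagPath d × CadlagPath d) × ℝ => p.1.1 :=
      measurable_fst.fst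
    have h2 : Measurable fun p : (CadlagPath d × CadlagPath d) × ℝ => p.1.2 :=
      measurable_fst.snd
    have hl1 := measurable_localTime (Λ := Λ) (f := fun _ => u) (g := fun _ => (s : ℝ))
      measurable_const measurable_const h1
    have hl2 := measurable_localTime (Λ := Λ) (f := fun _ => 0)
      (g := fun p : (CadlagPath d × CadlagPath d) × ℝ => p.2)
      measurable_const measurable_snd h2
    refine ((hΦ.comp h1).mul (measurable_atPos c measurable_const h1)).mul
      ((measurable_atPos b measurable_snd h2).mul (Measurable.ennreal_ofReal ?_))
    refine Measurable.div ?_ ?_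
    · exact hZ.measurable_weight (hl1.add hl2) fun _ =>
        Set.mem_Ici.2 (add_nonneg (localTime_nonneg Λ _ _ _) (localTime_nonneg Λ _ _ _))
    · exact hZ.measurable_weight hl1 fun _ => localTime_nonneg Λ _ _ _
  have step1 : ∀ ω : CadlagPath d, ∫⁻ l in Set.Ioi (s : ℝ), Φ ω * atPos Λ ω s c *
        (atPos Λ ω l b * ENNReal.ofReal (lrY Z Λ ω u l / lrY Z Λ ω u s)) =
      ∫⁻ l in Set.Ici (0 : ℝ), K (ω.stopAt s) (ω.shift s) l := by
    intro ω
    rw [lintegral_Ioi_shift]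
    refine setLIntegral_congr_fun measurableSet_Ici fun l hl => ?_
    have hl0 : (0 : ℝ) ≤ l := hl
    simp only [hK, hΦs, atPos_stop le_rfl, localTime_stop (le_refl (s : ℝ)), hZ.lrY_div]
    by_cases hk : killed Λ ω ((s : ℝ)).toNNReal = some c
    · have hk' : killed Λ ω s = some c := by simpa using hk
      have h1 : atPos Λ ω (s + l) b = atPos Λ (ω.shift s) l b := by
        have : killed Λ ω ((s : ℝ) + l).toNNReal = killed Λ (ω.shift s) l.toNNReal := by
          rw [Real.toNNReal_add s.coe_nonneg hl0, Real.toNNReal_coe, killed_shift hk']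
        by_cases hb : killed Λ (ω.shift s) l.toNNReal = some b
        · rw [atPos_of_eq hb, atPos_of_eq (this.trans hb)]
        · rw [atPos_of_ne hb, atPos_of_ne (fun h => hb (this.symm.trans h))]
      rw [h1, localTime_add Λ ω hu (le_add_of_nonneg_right hl0)]
      have h2 := localTime_shift hk' (l' := l) (le_refl (0 : ℝ))
      rw [add_zero] at h2
      rw [h2]
    · rw [atPos_of_ne hk]; simp
  simp only [step1]
  -- After the shift of the time variable the integrand depends on the path only through its stopped
  -- and its shifted version.
  rw [markov_property hJ hP a s (Φ := fun p => ∫⁻ l in Set.Ici (0 : ℝ), K p.1 p.2 l)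
    hKm.lintegral_prod_right']
  refine lintegral_congr fun ω => ?_
  rw [lintegral_lintegral_swap]
  · simp only [hK, hΦs, atPos_stop le_rfl, localTime_stop (le_refl (s : ℝ))]
    by_cases hk : killed Λ ω ((s : ℝ)).toNNReal = some c
    · have hk' : ω s = c := by
        have := (killed_eq_some_iff'.1 hk).2
        simpa using this
      have hm1 : ∀ l : ℝ, Measurable fun ω' : CadlagPath d => atPos Λ ω' l b *
          ENNReal.ofReal (Z Λ (localTime Λ ω u s + localTime Λ ω' 0 l) /
            Z Λ (localTime Λ ω u s)) := fun l =>
        (measurable_atPos b measurable_const measurable_id).mul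
          (((hZ.measurable_weight (measurable_const.add
            (measurable_localTime Λ measurable_const measurable_const measurable_id)) fun _ =>
            Set.mem_Ici.2 (add_nonneg (localTime_nonneg Λ _ _ _) (localTime_nonneg Λ _ _ _))).div_const
              _).ennreal_ofReal)
      have hm2 : Measurable fun l : ℝ => ∫⁻ ω', atPos Λ ω' l b *
          ENNReal.ofReal (Z Λ (localTime Λ ω u s + localTime Λ ω' 0 l) /
            Z Λ (localTime Λ ω u s)) ∂P c := by
        refine Measurable.lintegral_prod_right' (f := fun p : ℝ × CadlagPath d =>
          atPos Λ p.2 p.1 b * ENNReal.ofReal (Z Λ (localTime Λ ω u s + localTime Λ p.2 0 p.1) /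
            Z Λ (localTime Λ ω u s))) ?_
        exact (measurable_atPos b measurable_fst measurable_snd).mul
          (((hZ.measurable_weight (measurable_const.add
            (measurable_localTime Λ measurable_const measurable_fst measurable_snd)) fun _ =>
            Set.mem_Ici.2 (add_nonneg (localTime_nonneg Λ _ _ _) (localTime_nonneg Λ _ _ _))).div_const
              _).ennreal_ofReal)
      simp only [lintegral_const_mul _ (hm1 _), hk']
      rw [lintegral_const_mul _ hm2, green_eq]
    · simp [atPos_of_ne hk]
  · have : Measurable fun p : CadlagPath d × ℝ => K (ω.stopAt s) p.1 p.2 := by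
      exact hKm.comp ((measurable_const.prodMk measurable_fst).prodMk measurable_snd)
    exact this.aemeasurable

theorem SmoothWeight.markov_weight_le (hZ : SmoothWeight Z Λ) (hJ : IsJumpRate J)
    (hP : ∀ a, IsWalkLaw J a (P a)) (hG : GreenLeZero P Z) (a : Site d) (s : ℝ≥0) {u : ℝ}
    (hu : u ≤ s) {Φ : CadlagPath d → ℝ≥0∞} (hΦ : Measurable Φ) (hΦs : ∀ ω, Φ (ω.stopAt s) = Φ ω)
    {c b : Site d} (hc : c ∈ Λ) (hb : b ∈ Λ) :
    ∫⁻ ω, (∫⁻ l in Set.Ioi (s : ℝ), Φ ω * atPos Λ ω s c *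
        (atPos Λ ω l b * ENNReal.ofReal (lrY Z Λ ω u l / lrY Z Λ ω u s))) ∂P a ≤
      (∫⁻ ω, Φ ω * atPos Λ ω s c ∂P a) * green P Z Λ 0 c b := by
  rw [hZ.markov_weight hJ hP a s hu hΦ hΦs]
  have hm : Measurable fun ω => Φ ω * atPos Λ ω s c :=
    hΦ.mul (measurable_atPos c measurable_const measurable_id)
  rw [← lintegral_mul_const _ hm]
  refine lintegral_mono fun ω => ?_
  gcongr
  exact hG Λ _ (localTime_nonneg Λ ω u s) c hc b hb

/-- If the weight forgets everything before s, the accumulated local time is 0 and the bound by G_0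
becomes an identity. This exactness is what produces the convolutions Π_m G. -/
theorem SmoothWeight.markov_weight_self (hZ : SmoothWeight Z Λ) (hJ : IsJumpRate J)
    (hP : ∀ a, IsWalkLaw J a (P a)) (a : Site d) (s : ℝ≥0)
    {Φ : CadlagPath d → ℝ≥0∞} (hΦ : Measurable Φ) (hΦs : ∀ ω, Φ (ω.stopAt s) = Φ ω)
    (c b : Site d) :
    ∫⁻ ω, (∫⁻ l in Set.Ioi (s : ℝ), Φ ω * atPos Λ ω s c *
        (atPos Λ ω l b * ENNReal.ofReal (lrY Z Λ ω s l))) ∂P a =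
      (∫⁻ ω, Φ ω * atPos Λ ω s c ∂P a) * green P Z Λ 0 c b := by
  have h := hZ.markov_weight hJ hP a s (le_refl (s : ℝ)) hΦ hΦs c b
  simp only [hZ.lrY_self, div_one, localTime_self] at h
  have hm : Measurable fun ω => Φ ω * atPos Λ ω s c :=
    hΦ.mul (measurable_atPos c measurable_const measurable_id)
  rw [h, lintegral_mul_const _ hm]

end MarkovWeight

end

noncomputable section

/-! ### Increasing sequences of times -/

section Times

/-- The list `0, r 0, r 1, …` of times, extended by `0`. -/
def timesOf {n : ℕ} (r : Fin n → ℝ) (k : ℕ) : ℝ :=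
  if h : 0 < k ∧ k - 1 < n then r ⟨k - 1, h.2⟩ else 0

/-- Increasing sequences of `n` positive times. -/
def incSet (n : ℕ) : Set (Fin n → ℝ) := {r | StrictMono r ∧ ∀ i, 0 < r i}

/-- Appending a time at the end. -/
def snocT {n : ℕ} (r : Fin n → ℝ) (t : ℝ) : Fin (n + 1) → ℝ := Fin.snoc (α := fun _ => ℝ) r t

variable {n : ℕ}

@[simp] theorem timesOf_zero (r : Fin n → ℝ) : timesOf r 0 = 0 := by simp [timesOf]

theorem timesOf_succ (r : Fin n → ℝ) {k : ℕ} (hk : k < n) : timesOf r (k + 1) = r ⟨k, hk⟩ := by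
  simp [timesOf, hk]

theorem timesOf_snocT_of_le (r : Fin n → ℝ) (t : ℝ) {k : ℕ} (hk : k ≤ n) :
    timesOf (snocT r t) k = timesOf r k := by
  rcases k with _ | k
  · simp
  · rw [timesOf_succ r hk, timesOf_succ _ (by omega)]
    exact Fin.snoc_castSucc (α := fun _ => ℝ) t r ⟨k, hk⟩

theorem timesOf_snocT_last (r : Fin n → ℝ) (t : ℝ) : timesOf (snocT r t) (n + 1) = t := by
  rw [timesOf_succ _ (by omega)]
  exact Fin.snoc_last (α := fun _ => ℝ) t r

theorem measurable_timesOf (k : ℕ) : Measurable fun r : Fin n → ℝ => timesOf r k := by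
  unfold timesOf
  split_ifs with h
  · exact measurable_pi_apply _
  · exact measurable_const

theorem measurable_snocT : Measurable fun p : (Fin n → ℝ) × ℝ => snocT p.1 p.2 := by
  refine measurable_pi_iff.2 fun i => ?_
  induction i using Fin.lastCases with
  | last => simpa [snocT] using measurable_snd
  | cast i =>
    simp only [snocT, Fin.snoc_castSucc]
    exact (measurable_pi_apply i).comp measurable_fst

theorem measurableSet_incSet (n : ℕ) : MeasurableSet (incSet n) := by
  have : incSet n = (⋂ i : Fin n, ⋂ j : Fin n, ⋂ _ : i < j, {r | r i < r j}) ∩ ⋂ i, {r | 0 < r i} := by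
    ext r; simp [incSet, StrictMono]
  rw [this]
  refine MeasurableSet.inter ?_ ?_
  · refine MeasurableSet.iInter fun i => MeasurableSet.iInter fun j => MeasurableSet.iInter fun _ => ?_
    exact measurableSet_lt (measurable_pi_apply i) (measurable_pi_apply j)
  · exact MeasurableSet.iInter fun i => measurableSet_lt measurable_const (measurable_pi_apply i)

theorem timesOf_lt {r : Fin n → ℝ} (hr : r ∈ incSet n) {i j : ℕ} (hij : i < j) (hj : j ≤ n) :
    timesOf r i < timesOf r j := by
  obtain ⟨j, rfl⟩ : ∃ j', j = j' + 1 := ⟨j - 1, by omega⟩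
  rw [timesOf_succ r hj]
  rcases i with _ | i
  · simpa using hr.2 _
  · rw [timesOf_succ r (by omega)]
    exact hr.1 (by simpa using hij)

theorem timesOf_le {r : Fin n → ℝ} (hr : r ∈ incSet n) {i j : ℕ} (hij : i ≤ j) (hj : j ≤ n) :
    timesOf r i ≤ timesOf r j := by
  rcases hij.eq_or_lt with rfl | h
  · exact le_rfl
  · exact (timesOf_lt hr h hj).le

theorem timesOf_nonneg {r : Fin n → ℝ} (hr : r ∈ incSet n) {j : ℕ} (hj : j ≤ n) :
    0 ≤ timesOf r j := by simpa using timesOf_le hr (Nat.zero_le j) hj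

theorem snocT_mem_incSet {r : Fin n → ℝ} {t : ℝ} :
    snocT r t ∈ incSet (n + 1) ↔ r ∈ incSet n ∧ timesOf r n < t := by
  constructor
  · intro h
    refine ⟨⟨fun i j hij => ?_, fun i => ?_⟩, ?_⟩
    · have := h.1 (Fin.castSucc_lt_castSucc_iff.2 hij)
      simpa [snocT] using this
    · simpa [snocT] using h.2 i.castSucc
    · have := timesOf_lt h (Nat.lt_succ_self n) le_rfl
      rwa [timesOf_snocT_of_le r t le_rfl, Nat.succ_eq_add_one, timesOf_snocT_last] at this
  · rintro ⟨h, ht⟩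
    have hlt : ∀ i : Fin n, r i < t := fun i => by
      have := timesOf_le h (show i.1 + 1 ≤ n from i.2) le_rfl
      rw [timesOf_succ r i.2] at this
      exact this.trans_lt ht
    refine ⟨fun i j hij => ?_, fun i => ?_⟩
    · induction j using Fin.lastCases with
      | last =>
        induction i using Fin.lastCases with
        | last => exact absurd hij (lt_irrefl _)
        | cast i => simpa [snocT] using hlt i
      | cast j =>
        induction i using Fin.lastCases with
        | last => exact absurd (hij.trans (Fin.castSucc_lt_last j)) (lt_irrefl _)
        | cast i => simpa [snocT] using h.1 (Fin.castSucc_lt_castSucc_iff.1 hij)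
    · induction i using Fin.lastCases with
      | last => simpa [snocT] using (timesOf_nonneg h le_rfl).trans_lt ht
      | cast i => simpa [snocT] using h.2 i

theorem measurePreserving_snocT :
    MeasurePreserving (fun p : (Fin n → ℝ) × ℝ => snocT p.1 p.2) (volume.prod volume) volume := by
  have h1 := (volume_preserving_piFinSuccAbove (fun _ : Fin (n + 1) => ℝ) (Fin.last n)).symm
  have h2 : MeasurePreserving (Prod.swap : (Fin n → ℝ) × ℝ → ℝ × (Fin n → ℝ))
      (volume.prod volume) (volume.prod volume) := Measure.measurePreserving_swap
  have h3 := h1.comp h2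
  have e : (fun p : (Fin n → ℝ) × ℝ => snocT p.1 p.2) =
      (MeasurableEquiv.piFinSuccAbove (fun _ : Fin (n + 1) => ℝ) (Fin.last n)).symm ∘ Prod.swap := by
    funext p
    exact (Fin.insertNth_last' p.2 p.1).symm
  rw [e]
  exact h3

theorem lintegral_snocT {f : (Fin (n + 1) → ℝ) → ℝ≥0∞} (hf : Measurable f) :
    ∫⁻ r, f r = ∫⁻ r : Fin n → ℝ, ∫⁻ t : ℝ, f (snocT r t) := by
  rw [← measurePreserving_snocT.lintegral_comp hf, lintegral_prod]
  exact (hf.comp measurable_snocT).aemeasurable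

theorem lintegral_incSet_succ {f : (Fin (n + 1) → ℝ) → ℝ≥0∞} (hf : Measurable f) :
    ∫⁻ r in incSet (n + 1), f r =
      ∫⁻ q in incSet n, ∫⁻ t in Set.Ioi (timesOf q n), f (snocT q t) := by
  rw [← lintegral_indicator (measurableSet_incSet _), ← lintegral_indicator (measurableSet_incSet _),
    lintegral_snocT (hf.indicator (measurableSet_incSet _))]
  refine lintegral_congr fun q => ?_
  by_cases hq : q ∈ incSet n
  · rw [Set.indicator_of_mem hq, ← lintegral_indicator measurableSet_Ioi]
    refine lintegral_congr fun t => ?_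
    by_cases ht : timesOf q n < t
    · rw [Set.indicator_of_mem (snocT_mem_incSet.2 ⟨hq, ht⟩), Set.indicator_of_mem (Set.mem_Ioi.2 ht)]
    · rw [Set.indicator_of_notMem fun h => ht (snocT_mem_incSet.1 h).2,
        Set.indicator_of_notMem (by simpa using ht)]
  · rw [Set.indicator_of_notMem hq]
    refine (lintegral_congr fun t => ?_).trans lintegral_zero
    exact Set.indicator_of_notMem (fun h => hq (snocT_mem_incSet.1 h).1) _

end Times

/-! ### Lace weights -/

section LaceWeights

variable {d : ℕ} (Z : WeightFamily d) (Λ : Finset (Site d)) (ω : CadlagPath d)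

/-- The factor of a lace contributed by one vertex and the corresponding change of the weight. -/
def laceFactor (τ : ℕ → ℝ) (k : ℕ) (t : ℝ) : ℝ :=
  vtx Z Λ ω (τ (2 * k - 1)) t *
    (lrY Z Λ ω (τ (2 * (k - 1))) t / lrY Z Λ ω (τ (2 * (k - 1))) (τ (2 * k)))

/-- The weight of the first `k` intervals of a lace. -/
def partialWeight (τ : ℕ → ℝ) (k : ℕ) : ℝ :=
  ∏ i ∈ Finset.range k, laceFactor Z Λ ω τ i (τ (2 * i + 2))

theorem partialWeight_succ (τ : ℕ → ℝ) (k : ℕ) : partialWeight Z Λ ω τ (k + 1) =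
    partialWeight Z Λ ω τ k * laceFactor Z Λ ω τ k (τ (2 * k + 2)) :=
  Finset.prod_range_succ _ _

theorem laceFactor_congr {τ τ' : ℕ → ℝ} {k : ℕ} (h : ∀ j ≤ 2 * k, τ j = τ' j) (t : ℝ) :
    laceFactor Z Λ ω τ k t = laceFactor Z Λ ω τ' k t := by
  rw [laceFactor, laceFactor, h _ (by omega), h (2 * (k - 1)) (by omega), h (2 * k) (by omega)]

theorem partialWeight_congr {τ τ' : ℕ → ℝ} {k : ℕ} (h : ∀ j ≤ 2 * k, τ j = τ' j) :
    partialWeight Z Λ ω τ k = partialWeight Z Λ ω τ' k := by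
  refine Finset.prod_congr rfl fun i hi => ?_
  have hi := Finset.mem_range.1 hi
  rw [h (2 * i + 2) (by omega)]
  exact laceFactor_congr Z Λ ω (fun j hj => h j (by omega)) _

variable {Z Λ}

theorem laceFactor_stop {n k : ℕ} {r : Fin n → ℝ} (hr : r ∈ incSet n) (hk : 2 * k ≤ n) {t : ℝ}
    {c : ℝ≥0} (h1 : timesOf r (2 * k) ≤ t) (h2 : t ≤ c) :
    laceFactor Z Λ (ω.stopAt c) (timesOf r) k t = laceFactor Z Λ ω (timesOf r) k t := by
  rw [laceFactor, laceFactor, vtx_stop ((timesOf_le hr (by omega) hk).trans h1) h2, lrY_stop h2,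
    lrY_stop (h1.trans h2)]

theorem partialWeight_stop {n k : ℕ} {r : Fin n → ℝ} (hr : r ∈ incSet n) (hk : 2 * k ≤ n)
    {c : ℝ≥0} (h2 : timesOf r (2 * k) ≤ c) :
    partialWeight Z Λ (ω.stopAt c) (timesOf r) k = partialWeight Z Λ ω (timesOf r) k := by
  refine Finset.prod_congr rfl fun i hi => ?_
  have hi := Finset.mem_range.1 hi
  refine laceFactor_stop ω hr (by omega) (timesOf_le hr (by omega) (by omega)) ?_
  exact (timesOf_le hr (by omega) (by omega)).trans h2

/-- The weight is regrouped so that each interval carries its vertex and its own quotient of Y's; in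
`timesOf`, index 2i - 1 is s_i and index 2i is s_i'. The last interval is kept apart because it ends
at s_{k+1}' = s_{k+1}, at index 2k + 1 instead of 2k + 2. -/
theorem SmoothWeight.laceWeight_eq (hZ : SmoothWeight Z Λ) (k : ℕ) {r : Fin (2 * (k + 1) - 1) → ℝ}
    (hr : r ∈ laceSet (k + 1)) : laceWeight Z Λ ω r =
      partialWeight Z Λ ω (timesOf r) k * laceFactor Z Λ ω (timesOf r) k (timesOf r (2 * k + 1)) := by
  have hr' : r ∈ incSet (2 * (k + 1) - 1) := hr
  have hS : ∀ i, laceS r i = timesOf r (2 * i - 1) := fun i => rfl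
  have hS' : ∀ i ≤ k, laceS' r i = timesOf r (2 * i) := fun i hi => by
    show timesOf r (min (2 * i) (2 * (k + 1) - 1)) = _
    rw [min_eq_left (by omega)]
  have hSl : laceS' r (k + 1) = timesOf r (2 * k + 1) := by
    show timesOf r (min (2 * (k + 1)) (2 * (k + 1) - 1)) = _
    rw [min_eq_right (by omega)]; rfl
  have hV : ∀ i < k, vertexFn Z Λ ω (laceS r i) (laceS' r (i + 1)) =
      vtx Z Λ ω (timesOf r (2 * i - 1)) (timesOf r (2 * i + 2)) := fun i hi => by
    rw [hS, hS' (i + 1) (by omega)]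
    exact hZ.vertexFn_eq_vtx ω (timesOf_nonneg hr' (by omega)) (timesOf_lt hr' (by omega) (by omega))
  have hVl : vertexFn Z Λ ω (laceS r k) (laceS' r (k + 1)) =
      vtx Z Λ ω (timesOf r (2 * k - 1)) (timesOf r (2 * k + 1)) := by
    rw [hS, hSl]
    exact hZ.vertexFn_eq_vtx ω (timesOf_nonneg hr' (by omega)) (timesOf_lt hr' (by omega) (by omega))
  -- The isolated factor Y_{s_0',s_1'} becomes the i = 0 term: truncated subtraction makes i - 1
  -- equal to 0 there, and the denominator is Y_{0,0} = 1.
  have hY : lrY Z Λ ω (laceS' r 0) (laceS' r 1) * ∏ i ∈ Finset.range (k + 1 - 1),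
        lrY Z Λ ω (laceS' r i) (laceS' r (i + 2)) / lrY Z Λ ω (laceS' r i) (laceS' r (i + 1)) =
      ∏ i ∈ Finset.range (k + 1), lrY Z Λ ω (laceS' r (i - 1)) (laceS' r (i + 1)) /
        lrY Z Λ ω (laceS' r (i - 1)) (laceS' r i) := by
    rw [Finset.prod_range_succ', mul_comm]
    simp only [Nat.add_sub_cancel, Nat.zero_sub, Nat.zero_add, hZ.lrY_self, div_one]
  rw [laceWeight, hY, ← Finset.prod_mul_distrib, Finset.prod_range_succ, partialWeight, laceFactor]
  congr 1
  · refine Finset.prod_congr rfl fun i hi => ?_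
    have hi := Finset.mem_range.1 hi
    rw [hV i hi, laceFactor, hS' (i - 1) (by omega), hS' (i + 1) (by omega), hS' i (by omega)]
    rfl
  · rw [hVl, hS' (k - 1) (by omega), hSl, hS' k le_rfl]

theorem SmoothWeight.measurable_laceFactor (hZ : SmoothWeight Z Λ) {α : Type*} [MeasurableSpace α]
    {τ : α → ℕ → ℝ} (hτ : ∀ j, Measurable fun a => τ a j) {t : α → ℝ} (ht : Measurable t)
    {w : α → CadlagPath d} (hw : Measurable w) (k : ℕ) :
    Measurable fun a => laceFactor Z Λ (w a) (τ a) k (t a) :=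
  (hZ.measurable_vtx (hτ _) ht hw).mul
    ((hZ.measurable_lrY (hτ _) ht hw).div (hZ.measurable_lrY (hτ _) (hτ _) hw))

theorem SmoothWeight.measurable_partialWeight (hZ : SmoothWeight Z Λ) {α : Type*}
    [MeasurableSpace α] {τ : α → ℕ → ℝ} (hτ : ∀ j, Measurable fun a => τ a j)
    {w : α → CadlagPath d} (hw : Measurable w) (k : ℕ) :
    Measurable fun a => partialWeight Z Λ (w a) (τ a) k :=
  Finset.measurable_prod _ fun _ _ => hZ.measurable_laceFactor hτ (hτ _) hw _

end LaceWeights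

/-! ### Diagrammatic bounds -/

section Diagrams

variable {d : ℕ} {J : Site d → ℝ} {P : Site d → Measure (CadlagPath d)} {Z : WeightFamily d}
  {Λ : Finset (Site d)}

/-- The bound on the vertex function. -/
def vertexBd (P : Site d → Measure (CadlagPath d)) (Z : WeightFamily d) (η : ℝ)
    (Λ : Finset (Site d)) (u v : Site d) : ℝ≥0∞ :=
  ENNReal.ofReal η * ((if u = v then 1 else 0) + green P Z Λ 0 u v ^ 2)

theorem SmoothWeight.vtx_le (hV : VertexBound P Z η) (ω : CadlagPath d)
    {s t : ℝ} (hs : 0 ≤ s) (hst : s < t) {x y : Site d}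
    (hx : killed Λ ω s.toNNReal = some x) (hy : killed Λ ω t.toNNReal = some y) :
    ENNReal.ofReal |vtx Z Λ ω s t| ≤ vertexBd P Z η Λ x y := by
  have hxΛ := mem_of_killed_eq_some hx
  have hyΛ := mem_of_killed_eq_some hy
  have := hV Λ ω s t hs hst ⟨x, hxΛ⟩ ⟨y, hyΛ⟩
  rw [vtx, posVec_of_some Λ ω (x := ⟨x, hxΛ⟩) hx, posVec_of_some Λ ω (x := ⟨y, hyΛ⟩) hy, logH_single]
  simpa [vertexBd] using this

variable (hZ : SmoothWeight Z Λ) (hJ : IsJumpRate J) (hP : ∀ a, IsWalkLaw J a (P a))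
  (hG : GreenLeZero P Z)

include hZ hJ hP hG

theorem SmoothWeight.one_step_le (a : Site d) {s : ℝ} (hs : 0 ≤ s) {u : ℝ} (hu : u ≤ s)
    {Φ : CadlagPath d → ℝ≥0∞} (hΦ : Measurable Φ) (hΦs : ∀ ω, Φ (ω.stopAt s.toNNReal) = Φ ω)
    {c b : Site d} (hc : c ∈ Λ) (hb : b ∈ Λ) :
    ∫⁻ l in Set.Ioi s, (∫⁻ ω, Φ ω * atPos Λ ω s c *
        (atPos Λ ω l b * ENNReal.ofReal (lrY Z Λ ω u l / lrY Z Λ ω u s)) ∂P a) ≤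
      (∫⁻ ω, Φ ω * atPos Λ ω s c ∂P a) * green P Z Λ 0 c b := by
  have : IsProbabilityMeasure (P a) := (hP a).isProbabilityMeasure
  have h := hZ.markov_weight_le hJ hP hG a s.toNNReal (u := u) (by simpa [hs] using hu) hΦ hΦs hc hb
  rw [Real.coe_toNNReal s hs] at h
  rw [lintegral_lintegral_swap]
  · exact h
  · refine Measurable.aemeasurable ?_
    refine ((hΦ.comp measurable_snd).mul (measurable_atPos c measurable_const measurable_snd)).mul
      ((measurable_atPos b measurable_fst measurable_snd).mul (Measurable.ennreal_ofReal ?_))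
    exact (hZ.measurable_lrY measurable_const measurable_fst measurable_snd).div
      (hZ.measurable_lrY measurable_const measurable_const measurable_snd)

/-- The quotient Y_{u,l}/Y_{u,s} factors through the intermediate time t, so the one-step bound
applies first after t and then between s and t, with the same base time u. -/
theorem SmoothWeight.two_step_le (a : Site d) {s : ℝ} (hs : 0 ≤ s) {u : ℝ} (hu : u ≤ s)
    {Φ : CadlagPath d → ℝ≥0∞} (hΦ : Measurable Φ) (hΦs : ∀ ω, Φ (ω.stopAt s.toNNReal) = Φ ω)
    (hΦt : ∀ t, s ≤ t → ∀ ω, Φ (ω.stopAt t.toNNReal) = Φ ω)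
    {c b b' : Site d} (hc : c ∈ Λ) (hb : b ∈ Λ) (hb' : b' ∈ Λ) :
    ∫⁻ t in Set.Ioi s, ∫⁻ l in Set.Ioi t, (∫⁻ ω, Φ ω * atPos Λ ω s c * atPos Λ ω t b *
        (atPos Λ ω l b' * ENNReal.ofReal (lrY Z Λ ω u l / lrY Z Λ ω u s)) ∂P a) ≤
      (∫⁻ ω, Φ ω * atPos Λ ω s c ∂P a) * green P Z Λ 0 c b * green P Z Λ 0 b b' := by
  have : IsProbabilityMeasure (P a) := (hP a).isProbabilityMeasure
  have h1 : ∀ t ∈ Set.Ioi s, ∫⁻ l in Set.Ioi t, (∫⁻ ω, Φ ω * atPos Λ ω s c * atPos Λ ω t b *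
        (atPos Λ ω l b' * ENNReal.ofReal (lrY Z Λ ω u l / lrY Z Λ ω u s)) ∂P a) ≤
      (∫⁻ ω, Φ ω * atPos Λ ω s c * (atPos Λ ω t b *
        ENNReal.ofReal (lrY Z Λ ω u t / lrY Z Λ ω u s)) ∂P a) * green P Z Λ 0 b b' := by
    intro t ht
    have hst : s ≤ t := le_of_lt ht
    have ht0 : 0 ≤ t := hs.trans hst
    have h := hZ.one_step_le hJ hP hG a ht0 (u := u) (hu.trans hst)
      (Φ := fun ω => Φ ω * atPos Λ ω s c * ENNReal.ofReal (lrY Z Λ ω u t / lrY Z Λ ω u s))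
      ((hΦ.mul (measurable_atPos c measurable_const measurable_id)).mul
        ((hZ.measurable_lrY measurable_const measurable_const measurable_id).div
          (hZ.measurable_lrY measurable_const measurable_const measurable_id)).ennreal_ofReal)
      (fun ω => ?_) hb hb'
    · refine le_trans (le_of_eq ?_) (h.trans (le_of_eq ?_))
      · refine lintegral_congr fun l => lintegral_congr fun ω => ?_
        have e : lrY Z Λ ω u l / lrY Z Λ ω u s =
            (lrY Z Λ ω u t / lrY Z Λ ω u s) * (lrY Z Λ ω u l / lrY Z Λ ω u t) := by
          have h1 := (hZ.lrY_pos ω u t).ne'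
          have h2 := (hZ.lrY_pos ω u s).ne'
          field_simp
        rw [e, ENNReal.ofReal_mul (div_pos (hZ.lrY_pos ω u t) (hZ.lrY_pos ω u s)).le]
        ring
      · congr 1
        refine lintegral_congr fun ω => ?_
        ring
    · have hst' : s ≤ t.toNNReal := by rwa [Real.coe_toNNReal t ht0]
      have htt' : t ≤ t.toNNReal := Real.le_coe_toNNReal t
      rw [hΦt t hst, atPos_stop hst', lrY_stop hst', lrY_stop htt']
  calc _ ≤ ∫⁻ t in Set.Ioi s, (∫⁻ ω, Φ ω * atPos Λ ω s c * (atPos Λ ω t b *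
        ENNReal.ofReal (lrY Z Λ ω u t / lrY Z Λ ω u s)) ∂P a) * green P Z Λ 0 b b' :=
        setLIntegral_mono' measurableSet_Ioi h1
    _ = (∫⁻ t in Set.Ioi s, (∫⁻ ω, Φ ω * atPos Λ ω s c * (atPos Λ ω t b *
        ENNReal.ofReal (lrY Z Λ ω u t / lrY Z Λ ω u s)) ∂P a)) * green P Z Λ 0 b b' := by
        refine lintegral_mul_const _ ?_
        refine Measurable.lintegral_prod_right' (f := fun p : ℝ × CadlagPath d =>
          Φ p.2 * atPos Λ p.2 s c * (atPos Λ p.2 p.1 b *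
            ENNReal.ofReal (lrY Z Λ p.2 u p.1 / lrY Z Λ p.2 u s))) ?_
        refine ((hΦ.comp measurable_snd).mul
          (measurable_atPos c measurable_const measurable_snd)).mul
          ((measurable_atPos b measurable_fst measurable_snd).mul (Measurable.ennreal_ofReal ?_))
        exact (hZ.measurable_lrY measurable_const measurable_fst measurable_snd).div
          (hZ.measurable_lrY measurable_const measurable_const measurable_snd)
    _ ≤ _ := by
        gcongr
        exact hZ.one_step_le hJ hP hG a hs hu hΦ hΦs hc hb

end Diagrams

end

noncomputable section

/-! ### Recursive bounds on the absolute mass of laces -/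

section Masses

variable {d : ℕ} {J : Site d → ℝ} {P : Site d → Measure (CadlagPath d)} {Z : WeightFamily d}
  {Λ : Finset (Site d)}

/-- The expected absolute weight of the first `k` intervals of a lace with given final positions,
for fixed times. -/
def chainAt (P : Site d → Measure (CadlagPath d)) (Z : WeightFamily d) (Λ : Finset (Site d))
    (x : Site d) (k : ℕ) (τ : ℕ → ℝ) (u v : Site d) : ℝ≥0∞ :=
  ∫⁻ ω, ENNReal.ofReal |partialWeight Z Λ ω τ k| * atPos Λ ω (τ (2 * k - 1)) u *
    atPos Λ ω (τ (2 * k)) v ∂P x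

/-- The integral of `chainAt` over all times. -/
def chainMass (P : Site d → Measure (CadlagPath d)) (Z : WeightFamily d) (Λ : Finset (Site d))
    (x : Site d) (k : ℕ) (u v : Site d) : ℝ≥0∞ :=
  ∫⁻ q in incSet (2 * k), chainAt P Z Λ x k (timesOf q) u v

/-- The absolute weight of a lace with `k + 1` intervals whose last time is `t`. -/
def laceAbs (Z : WeightFamily d) (Λ : Finset (Site d)) (ω : CadlagPath d) (τ : ℕ → ℝ) (k : ℕ)
    (t : ℝ) : ℝ≥0∞ :=
  ENNReal.ofReal |partialWeight Z Λ ω τ k * laceFactor Z Λ ω τ k t|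

/-- The total absolute mass of laces with `k + 1` intervals ending at `y`. -/
def laceMass (P : Site d → Measure (CadlagPath d)) (Z : WeightFamily d) (Λ : Finset (Site d))
    (x : Site d) (k : ℕ) (y : Site d) : ℝ≥0∞ :=
  ∫⁻ q : Fin (2 * k) → ℝ in incSet (2 * k), ∫⁻ t in Set.Ioi (timesOf q (2 * k)),
    (∫⁻ ω, laceAbs Z Λ ω (timesOf q) k t * atPos Λ ω t y ∂P x)

/-- The absolute weight of `k` intervals of a lace, restricted to the position before the last
time. -/
def headWeight (Z : WeightFamily d) (Λ : Finset (Site d)) (τ : ℕ → ℝ) (k : ℕ) (u : Site d)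
    (ω : CadlagPath d) : ℝ≥0∞ :=
  ENNReal.ofReal |partialWeight Z Λ ω τ k| * atPos Λ ω (τ (2 * k - 1)) u

/-- The change of the weight when a lace is extended to the time `t`. -/
def stepWeight (Z : WeightFamily d) (Λ : Finset (Site d)) (τ : ℕ → ℝ) (k : ℕ) (y : Site d)
    (t : ℝ) (ω : CadlagPath d) : ℝ≥0∞ :=
  atPos Λ ω t y * ENNReal.ofReal
    (lrY Z Λ ω (τ (2 * (k - 1))) t / lrY Z Λ ω (τ (2 * (k - 1))) (τ (2 * k)))

theorem measurable_setLIntegral_Ioi {α : Type*} [MeasurableSpace α] {f : α × ℝ → ℝ≥0∞}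
    (hf : Measurable f) {g : α → ℝ} (hg : Measurable g) :
    Measurable fun a => ∫⁻ t in Set.Ioi (g a), f (a, t) := by
  have : ∀ a, ∫⁻ t in Set.Ioi (g a), f (a, t) =
      ∫⁻ t, {p : α × ℝ | g p.1 < p.2}.indicator f (a, t) := by
    intro a
    rw [← lintegral_indicator measurableSet_Ioi]
    rfl
  simp only [this]
  exact (hf.indicator (measurableSet_lt
    (hg.comp measurable_fst) measurable_snd)).lintegral_prod_right'

theorem atPos_le_one (ω : CadlagPath d) (t : ℝ) (x : Site d) : atPos Λ ω t x ≤ 1 := by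
  by_cases h : killed Λ ω t.toNNReal = some x
  · rw [atPos_of_eq h]
  · rw [atPos_of_ne h]; exact zero_le

theorem exists_pos_of_killed {ω : CadlagPath d} {s t : ℝ} (hst : s ≤ t)
    {y : Site d} (h : killed Λ ω t.toNNReal = some y) :
    ∃ x ∈ Λ, killed Λ ω s.toNNReal = some x := by
  have h1 := killed_eq_some_of_le (Real.toNNReal_le_toNNReal hst) h
  exact ⟨_, mem_of_killed_eq_some h1, h1⟩

/-- A walk alive at t was alive before, so it had some position u at s_k and some position w at
s_k'. With u and y fixed the vertex is bounded by a deterministic quantity and leaves the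
expectation. -/
theorem laceAbs_le_sum {η : ℝ} (hZ : SmoothWeight Z Λ) (hV : VertexBound P Z η) (ω : CadlagPath d)
    {k : ℕ} {q : Fin (2 * k) → ℝ} (hq : q ∈ incSet (2 * k)) {t : ℝ} (ht : timesOf q (2 * k) < t)
    (y : Site d) :
    laceAbs Z Λ ω (timesOf q) k t * atPos Λ ω t y ≤ ∑ u ∈ Λ, ∑ w ∈ Λ,
      (headWeight Z Λ (timesOf q) k u ω * atPos Λ ω (timesOf q (2 * k)) w *
        stepWeight Z Λ (timesOf q) k y t ω) * vertexBd P Z η Λ u y := by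
  by_cases hy : killed Λ ω t.toNNReal = some y
  · have h0 : 0 ≤ timesOf q (2 * k - 1) := timesOf_nonneg hq (by omega)
    have h1 : timesOf q (2 * k - 1) ≤ timesOf q (2 * k) := timesOf_le hq (by omega) le_rfl
    obtain ⟨u, hu, hku⟩ := exists_pos_of_killed (h1.trans ht.le) hy
    obtain ⟨w, hw, hkw⟩ := exists_pos_of_killed ht.le hy
    refine le_trans ?_ (Finset.single_le_sum (fun _ _ => zero_le) hu)
    refine le_trans ?_ (Finset.single_le_sum (fun _ _ => zero_le) hw)
    rw [headWeight, stepWeight, atPos_of_eq hy, atPos_of_eq hku, atPos_of_eq hkw, laceAbs, laceFactor, abs_mul, abs_mul,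
      ENNReal.ofReal_mul (abs_nonneg _), ENNReal.ofReal_mul (abs_nonneg _),
      abs_of_pos (div_pos (hZ.lrY_pos _ _ _) (hZ.lrY_pos _ _ _))]
    have hv := SmoothWeight.vtx_le hV ω h0 (h1.trans_lt ht) hku hy
    simp only [mul_one, one_mul]
    rw [mul_assoc, mul_comm (ENNReal.ofReal |vtx Z Λ ω (timesOf q (2 * k - 1)) t|)]
    gcongr
  · rw [atPos_of_ne hy, mul_zero]; exact zero_le

section

variable {η : ℝ} (hZ : SmoothWeight Z Λ) (hJ : IsJumpRate J) (hP : ∀ a, IsWalkLaw J a (P a))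
  (hG : GreenLeZero P Z) (hV : VertexBound P Z η)

include hZ in
theorem measurable_chainIntegrand {α : Type*} [MeasurableSpace α] {τ : α → ℕ → ℝ}
    (hτ : ∀ j, Measurable fun a => τ a j)
    {w : α → CadlagPath d} (hw : Measurable w) (k : ℕ) (u v : Site d) :
    Measurable fun a => ENNReal.ofReal |partialWeight Z Λ (w a) (τ a) k| *
      atPos Λ (w a) (τ a (2 * k - 1)) u * atPos Λ (w a) (τ a (2 * k)) v :=
  ((measurable_abs.comp (hZ.measurable_partialWeight hτ hw k)).ennreal_ofReal.mul
    (measurable_atPos u (hτ _) hw)).mul (measurable_atPos v (hτ _) hw)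

include hZ hP in
theorem measurable_chainAt (x : Site d) (k : ℕ) (u v : Site d) :
    Measurable fun q : Fin (2 * k) → ℝ => chainAt P Z Λ x k (timesOf q) u v := by
  have : IsProbabilityMeasure (P x) := (hP x).isProbabilityMeasure
  exact Measurable.lintegral_prod_right' (measurable_chainIntegrand hZ
    (α := (Fin (2 * k) → ℝ) × CadlagPath d) (τ := fun a => timesOf a.1)
    (fun j => (measurable_timesOf j).comp measurable_fst) measurable_snd k u v)

include hZ hJ hP hG hV

omit hZ hJ hP hG hV in
theorem lintegral_sum_sum_mul {α ι : Type*} [MeasurableSpace α] (μ : Measure α) (A : Finset ι)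
    {f : ι → ι → α → ℝ≥0∞} (hf : ∀ u w, Measurable (f u w)) (c : ι → ι → ℝ≥0∞) :
    ∫⁻ a, ∑ u ∈ A, ∑ w ∈ A, f u w a * c u w ∂μ = ∑ u ∈ A, ∑ w ∈ A, (∫⁻ a, f u w a ∂μ) * c u w := by
  rw [lintegral_finsetSum _ fun u _ => Finset.measurable_sum _ fun w _ => (hf u w).mul_const _]
  refine Finset.sum_congr rfl fun u _ => ?_
  rw [lintegral_finsetSum _ fun w _ => (hf u w).mul_const _]
  exact Finset.sum_congr rfl fun w _ => lintegral_mul_const _ (hf u w)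

omit hJ hP hG hV in
theorem measurable_stepWeight {α : Type*} [MeasurableSpace α] {k : ℕ} (q : Fin (2 * k) → ℝ)
    {t : α → ℝ} (ht : Measurable t) {w : α → CadlagPath d} (hw : Measurable w) (y : Site d) :
    Measurable fun a => stepWeight Z Λ (timesOf q) k y (t a) (w a) := by
  refine (measurable_atPos y ht hw).mul (Measurable.ennreal_ofReal ?_)
  exact (hZ.measurable_lrY measurable_const ht hw).div
      (hZ.measurable_lrY measurable_const measurable_const hw)

omit hJ hP hG hV in
theorem measurable_headWeight {k : ℕ} (q : Fin (2 * k) → ℝ) (u : Site d) :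
    Measurable fun ω => headWeight Z Λ (timesOf q) k u ω :=
  (measurable_abs.comp (hZ.measurable_partialWeight (τ := fun _ => timesOf q) (w := fun ω => ω)
    (fun _ => measurable_const) measurable_id k)).ennreal_ofReal.mul
    (measurable_atPos u measurable_const measurable_id)

omit hZ hJ hP hG hV in
theorem headWeight_stop {k : ℕ} {q : Fin (2 * k) → ℝ} (hq : q ∈ incSet (2 * k)) (u : Site d)
    {t : ℝ} (ht : timesOf q (2 * k) ≤ t) (ω : CadlagPath d) :
    headWeight Z Λ (timesOf q) k u (ω.stopAt t.toNNReal) = headWeight Z Λ (timesOf q) k u ω := by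
  have hc : timesOf q (2 * k) ≤ t.toNNReal := ht.trans (Real.le_coe_toNNReal _)
  have hc' : timesOf q (2 * k - 1) ≤ t.toNNReal :=
    (timesOf_le hq (Nat.sub_le _ _) (Nat.le_refl _)).trans hc
  unfold headWeight
  rw [partialWeight_stop (k := k) ω hq (Nat.le_refl _) hc, atPos_stop hc']

/-- This closes a lace: the final time is integrated out, and the walk from w at s_k' to y costs one
Green's function. -/
theorem inner_one_le (x : Site d) {k : ℕ} {q : Fin (2 * k) → ℝ} (hq : q ∈ incSet (2 * k))
    {y : Site d} (hy : y ∈ Λ) :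
    ∫⁻ t in Set.Ioi (timesOf q (2 * k)),
      (∫⁻ ω, laceAbs Z Λ ω (timesOf q) k t * atPos Λ ω t y ∂P x) ≤
    ∑ u ∈ Λ, ∑ w ∈ Λ, chainAt P Z Λ x k (timesOf q) u w *
      (green P Z Λ 0 w y * vertexBd P Z η Λ u y) := by
  have : IsProbabilityMeasure (P x) := (hP x).isProbabilityMeasure
  have hm : ∀ u w, Measurable fun p : ℝ × CadlagPath d => headWeight Z Λ (timesOf q) k u p.2 *
      atPos Λ p.2 (timesOf q (2 * k)) w * stepWeight Z Λ (timesOf q) k y p.1 p.2 := fun u w =>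
    (((measurable_headWeight hZ q u).comp measurable_snd).mul
      (measurable_atPos w measurable_const measurable_snd)).mul
        (measurable_stepWeight hZ q measurable_fst measurable_snd y)
  have hm2 : ∀ u w, Measurable fun t : ℝ =>
      ∫⁻ ω, headWeight Z Λ (timesOf q) k u ω * atPos Λ ω (timesOf q (2 * k)) w *
        stepWeight Z Λ (timesOf q) k y t ω ∂P x := fun u w =>
    Measurable.lintegral_prod_right' (f := fun p : ℝ × CadlagPath d =>
      headWeight Z Λ (timesOf q) k u p.2 * atPos Λ p.2 (timesOf q (2 * k)) w *
        stepWeight Z Λ (timesOf q) k y p.1 p.2) (hm u w)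
  have hm1 : ∀ t u w, Measurable fun ω => headWeight Z Λ (timesOf q) k u ω *
      atPos Λ ω (timesOf q (2 * k)) w * stepWeight Z Λ (timesOf q) k y t ω := fun t u w =>
    ((measurable_headWeight hZ q u).mul
      (measurable_atPos w measurable_const measurable_id)).mul
        (measurable_stepWeight hZ q measurable_const measurable_id y)
  have h0 : 0 ≤ timesOf q (2 * k) := timesOf_nonneg hq le_rfl
  have h1 : ∀ t ∈ Set.Ioi (timesOf q (2 * k)),
      (∫⁻ ω, laceAbs Z Λ ω (timesOf q) k t * atPos Λ ω t y ∂P x) ≤ ∑ u ∈ Λ, ∑ w ∈ Λ,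
        (∫⁻ ω, headWeight Z Λ (timesOf q) k u ω * atPos Λ ω (timesOf q (2 * k)) w *
          stepWeight Z Λ (timesOf q) k y t ω ∂P x) * vertexBd P Z η Λ u y := fun t ht => by
    rw [← lintegral_sum_sum_mul (P x) Λ (f := fun u w ω => headWeight Z Λ (timesOf q) k u ω *
        atPos Λ ω (timesOf q (2 * k)) w * stepWeight Z Λ (timesOf q) k y t ω)
        (hm1 t) fun u _ => vertexBd P Z η Λ u y]
    exact lintegral_mono fun ω => laceAbs_le_sum hZ hV ω hq ht y
  refine (setLIntegral_mono' measurableSet_Ioi h1).trans ?_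
  rw [lintegral_sum_sum_mul _ Λ (f := fun u w t => ∫⁻ ω, headWeight Z Λ (timesOf q) k u ω *
        atPos Λ ω (timesOf q (2 * k)) w * stepWeight Z Λ (timesOf q) k y t ω ∂P x)
    hm2 fun u _ => vertexBd P Z η Λ u y]
  refine Finset.sum_le_sum fun u _ => Finset.sum_le_sum fun w hw => ?_
  rw [← mul_assoc]
  refine mul_le_mul_left ?_ _
  have h3 : timesOf q (2 * (k - 1)) ≤ timesOf q (2 * k) :=
    timesOf_le hq (Nat.mul_le_mul_left 2 (Nat.sub_le k 1)) (Nat.le_refl _)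
  exact hZ.one_step_le hJ hP hG x h0 h3
    (Φ := headWeight Z Λ (timesOf q) k u)
    (measurable_headWeight hZ q u) (headWeight_stop hq u le_rfl) hw hy

/-- This extends a lace: both s_{k+1} and s_{k+1}' are integrated out. The walk runs from w through
u' to y, which costs two Green's functions, while the new vertex joins u to y. -/
theorem inner_two_le (x : Site d) {k : ℕ} {q : Fin (2 * k) → ℝ} (hq : q ∈ incSet (2 * k))
    {u' y : Site d} (hu' : u' ∈ Λ) (hy : y ∈ Λ) :
    ∫⁻ s in Set.Ioi (timesOf q (2 * k)), ∫⁻ t in Set.Ioi s,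
      (∫⁻ ω, laceAbs Z Λ ω (timesOf q) k t * atPos Λ ω s u' * atPos Λ ω t y ∂P x) ≤
    ∑ u ∈ Λ, ∑ w ∈ Λ, chainAt P Z Λ x k (timesOf q) u w *
      (green P Z Λ 0 w u' * green P Z Λ 0 u' y * vertexBd P Z η Λ u y) := by
  have : IsProbabilityMeasure (P x) := (hP x).isProbabilityMeasure
  have hm : ∀ u w, Measurable fun p : (ℝ × ℝ) × CadlagPath d =>
      headWeight Z Λ (timesOf q) k u p.2 * atPos Λ p.2 (timesOf q (2 * k)) w *
        atPos Λ p.2 p.1.1 u' * stepWeight Z Λ (timesOf q) k y p.1.2 p.2 := fun u w =>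
    ((((measurable_headWeight hZ q u).comp measurable_snd).mul
      (measurable_atPos w measurable_const measurable_snd)).mul
      (measurable_atPos u' measurable_fst.fst measurable_snd)).mul
        (measurable_stepWeight hZ q measurable_fst.snd measurable_snd y)
  have hm2 : ∀ u w, Measurable fun p : ℝ × ℝ =>
      ∫⁻ ω, headWeight Z Λ (timesOf q) k u ω * atPos Λ ω (timesOf q (2 * k)) w *
        atPos Λ ω p.1 u' * stepWeight Z Λ (timesOf q) k y p.2 ω ∂P x := fun u w =>
    Measurable.lintegral_prod_right' (f := fun p : (ℝ × ℝ) × CadlagPath d =>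
      headWeight Z Λ (timesOf q) k u p.2 * atPos Λ p.2 (timesOf q (2 * k)) w *
        atPos Λ p.2 p.1.1 u' * stepWeight Z Λ (timesOf q) k y p.1.2 p.2) (hm u w)
  have hm1 : ∀ s t u w, Measurable fun ω => headWeight Z Λ (timesOf q) k u ω *
      atPos Λ ω (timesOf q (2 * k)) w * atPos Λ ω s u' * stepWeight Z Λ (timesOf q) k y t ω :=
    fun s t u w => (((measurable_headWeight hZ q u).mul
      (measurable_atPos w measurable_const measurable_id)).mul
      (measurable_atPos u' measurable_const measurable_id)).mul
        (measurable_stepWeight hZ q measurable_const measurable_id y)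
  have hm3 : ∀ s u w, Measurable fun t : ℝ =>
      ∫⁻ ω, headWeight Z Λ (timesOf q) k u ω * atPos Λ ω (timesOf q (2 * k)) w *
        atPos Λ ω s u' * stepWeight Z Λ (timesOf q) k y t ω ∂P x := fun s u w =>
    Measurable.lintegral_prod_right' (f := fun p : ℝ × CadlagPath d =>
      headWeight Z Λ (timesOf q) k u p.2 * atPos Λ p.2 (timesOf q (2 * k)) w *
        atPos Λ p.2 s u' * stepWeight Z Λ (timesOf q) k y p.1 p.2)
      (((((measurable_headWeight hZ q u).comp measurable_snd).mul
      (measurable_atPos w measurable_const measurable_snd)).mul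
      (measurable_atPos u' measurable_const measurable_snd)).mul
        (measurable_stepWeight hZ q measurable_fst measurable_snd y))
  have hm4 : ∀ u w, Measurable fun s : ℝ => ∫⁻ t in Set.Ioi s,
      (∫⁻ ω, headWeight Z Λ (timesOf q) k u ω * atPos Λ ω (timesOf q (2 * k)) w *
        atPos Λ ω s u' * stepWeight Z Λ (timesOf q) k y t ω ∂P x) := fun u w =>
    measurable_setLIntegral_Ioi (f := fun p : ℝ × ℝ =>
      ∫⁻ ω, headWeight Z Λ (timesOf q) k u ω * atPos Λ ω (timesOf q (2 * k)) w *
        atPos Λ ω p.1 u' * stepWeight Z Λ (timesOf q) k y p.2 ω ∂P x) (hm2 u w)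
      (g := fun s => s) measurable_id
  have h0 : 0 ≤ timesOf q (2 * k) := timesOf_nonneg hq le_rfl
  have h1 : ∀ s ∈ Set.Ioi (timesOf q (2 * k)), ∀ t ∈ Set.Ioi s,
      (∫⁻ ω, laceAbs Z Λ ω (timesOf q) k t * atPos Λ ω s u' * atPos Λ ω t y ∂P x) ≤
        ∑ u ∈ Λ, ∑ w ∈ Λ, (∫⁻ ω, headWeight Z Λ (timesOf q) k u ω *
          atPos Λ ω (timesOf q (2 * k)) w * atPos Λ ω s u' *
          stepWeight Z Λ (timesOf q) k y t ω ∂P x) * vertexBd P Z η Λ u y := fun s hs t ht => by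
    rw [← lintegral_sum_sum_mul (P x) Λ (f := fun u w ω => headWeight Z Λ (timesOf q) k u ω *
        atPos Λ ω (timesOf q (2 * k)) w * atPos Λ ω s u' * stepWeight Z Λ (timesOf q) k y t ω)
        (hm1 s t)
        fun u _ => vertexBd P Z η Λ u y]
    refine lintegral_mono fun ω => ?_
    have h := mul_le_mul_left (laceAbs_le_sum hZ hV ω hq (lt_trans hs ht) y) (atPos Λ ω s u')
    rw [mul_right_comm]
    refine h.trans (le_of_eq ?_)
    simp only [Finset.sum_mul]
    refine Finset.sum_congr rfl fun u _ => Finset.sum_congr rfl fun w _ => ?_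
    ring
  have h2 : ∀ s ∈ Set.Ioi (timesOf q (2 * k)), ∫⁻ t in Set.Ioi s,
      (∫⁻ ω, laceAbs Z Λ ω (timesOf q) k t * atPos Λ ω s u' * atPos Λ ω t y ∂P x) ≤
        ∑ u ∈ Λ, ∑ w ∈ Λ, (∫⁻ t in Set.Ioi s, (∫⁻ ω, headWeight Z Λ (timesOf q) k u ω *
          atPos Λ ω (timesOf q (2 * k)) w * atPos Λ ω s u' *
          stepWeight Z Λ (timesOf q) k y t ω ∂P x)) * vertexBd P Z η Λ u y := fun s hs => by
    rw [← lintegral_sum_sum_mul _ Λ (f := fun u w t => ∫⁻ ω, headWeight Z Λ (timesOf q) k u ω *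
        atPos Λ ω (timesOf q (2 * k)) w * atPos Λ ω s u' * stepWeight Z Λ (timesOf q) k y t ω ∂P x)
        (hm3 s) fun u _ => vertexBd P Z η Λ u y]
    exact setLIntegral_mono' measurableSet_Ioi (h1 s hs)
  refine (setLIntegral_mono' measurableSet_Ioi h2).trans ?_
  rw [lintegral_sum_sum_mul _ Λ (f := fun u w s => ∫⁻ t in Set.Ioi s, (∫⁻ ω,
      headWeight Z Λ (timesOf q) k u ω * atPos Λ ω (timesOf q (2 * k)) w * atPos Λ ω s u' *
        stepWeight Z Λ (timesOf q) k y t ω ∂P x))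
    hm4
    fun u _ => vertexBd P Z η Λ u y]
  refine Finset.sum_le_sum fun u _ => Finset.sum_le_sum fun w hw => ?_
  rw [← mul_assoc, ← mul_assoc]
  refine mul_le_mul_left ?_ _
  have h3 : timesOf q (2 * (k - 1)) ≤ timesOf q (2 * k) :=
    timesOf_le hq (Nat.mul_le_mul_left 2 (Nat.sub_le k 1)) (Nat.le_refl _)
  exact hZ.two_step_le hJ hP hG x h0 h3
    (Φ := headWeight Z Λ (timesOf q) k u)
    (measurable_headWeight hZ q u) (headWeight_stop hq u le_rfl)
    (fun t ht => headWeight_stop hq u ht) hw hu' hy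

omit hJ hG hV in
theorem lintegral_chain_sum (x : Site d) (k : ℕ) (c : Site d → Site d → ℝ≥0∞) :
    ∫⁻ q : Fin (2 * k) → ℝ in incSet (2 * k),
      ∑ u ∈ Λ, ∑ w ∈ Λ, chainAt P Z Λ x k (timesOf q) u w * c u w =
    ∑ u ∈ Λ, ∑ w ∈ Λ, chainMass P Z Λ x k u w * c u w := by
  have hm := fun u w => measurable_chainAt hZ hP x k u w
  rw [lintegral_finsetSum _ fun u _ => Finset.measurable_sum _ fun w _ => (hm u w).mul_const _]
  refine Finset.sum_congr rfl fun u _ => ?_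
  rw [lintegral_finsetSum _ fun w _ => (hm u w).mul_const _]
  exact Finset.sum_congr rfl fun w _ => lintegral_mul_const _ (hm u w)

theorem laceMass_le (x : Site d) (k : ℕ) {y : Site d} (hy : y ∈ Λ) :
    laceMass P Z Λ x k y ≤ ∑ u ∈ Λ, ∑ w ∈ Λ, chainMass P Z Λ x k u w *
      (green P Z Λ 0 w y * vertexBd P Z η Λ u y) := by
  rw [← lintegral_chain_sum hZ hP]
  exact setLIntegral_mono' (measurableSet_incSet _) fun q hq =>
    inner_one_le hZ hJ hP hG hV x hq hy

theorem chainMass_succ_le (x : Site d) (k : ℕ) {u' y : Site d} (hu' : u' ∈ Λ) (hy : y ∈ Λ) :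
    chainMass P Z Λ x (k + 1) u' y ≤ ∑ u ∈ Λ, ∑ w ∈ Λ, chainMass P Z Λ x k u w *
      (green P Z Λ 0 w u' * green P Z Λ 0 u' y * vertexBd P Z η Λ u y) := by
  rw [← lintegral_chain_sum hZ hP]
  have hm := measurable_chainAt hZ hP x (k + 1) u' y
  have : IsProbabilityMeasure (P x) := (hP x).isProbabilityMeasure
  -- The two largest times, indices 2k + 1 and 2k + 2, are split off and integrated innermost.
  have e1 : chainMass P Z Λ x (k + 1) u' y =
      ∫⁻ q : Fin (2 * k) → ℝ in incSet (2 * k), ∫⁻ s in Set.Ioi (timesOf q (2 * k)),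
        ∫⁻ t in Set.Ioi s, chainAt P Z Λ x (k + 1) (timesOf (snocT (snocT q s) t)) u' y := by
    have h1 := lintegral_incSet_succ (n := 2 * k + 1)
      (f := fun q => chainAt P Z Λ x (k + 1) (timesOf q) u' y) hm
    refine h1.trans ?_
    have hm' : Measurable fun r : Fin (2 * k + 1) → ℝ => ∫⁻ t in Set.Ioi (timesOf r (2 * k + 1)),
        chainAt P Z Λ x (k + 1) (timesOf (snocT r t)) u' y :=
      measurable_setLIntegral_Ioi (hm.comp measurable_snocT) (measurable_timesOf _)
    rw [lintegral_incSet_succ hm']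
    refine setLIntegral_congr_fun (measurableSet_incSet _) fun q _ => ?_
    refine setLIntegral_congr_fun measurableSet_Ioi fun s _ => ?_
    simp only [timesOf_snocT_last]
  rw [e1]
  refine setLIntegral_mono' (measurableSet_incSet _) fun q hq => ?_
  refine le_trans (le_of_eq ?_) (inner_two_le hZ hJ hP hG hV x hq hu' hy)
  refine lintegral_congr fun s => lintegral_congr fun t => lintegral_congr fun ω => ?_
  have t1 : ∀ j ≤ 2 * k, timesOf (snocT (snocT q s) t) j = timesOf q j := fun j hj => by
    rw [timesOf_snocT_of_le _ _ (by omega), timesOf_snocT_of_le _ _ hj]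
  have t2 : timesOf (snocT (snocT q s) t) (2 * (k + 1) - 1) = s := by
    rw [timesOf_snocT_of_le _ _ (by omega)]
    exact timesOf_snocT_last q s
  have t3 : timesOf (snocT (snocT q s) t) (2 * (k + 1)) = t :=
    timesOf_snocT_last (snocT q s) t
  have t3' : timesOf (snocT (snocT q s) t) (2 * k + 2) = t := t3
  rw [t2, t3, partialWeight_succ, partialWeight_congr Z Λ ω t1, laceFactor_congr Z Λ ω t1, laceAbs,
    t3']

omit hZ hJ hG hV in
-- No times remain: the integral is over a one-point space of mass 1, and both positions are read at
-- time 0 since 2·0 - 1 truncates to 0.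
theorem chainMass_zero_le (x u v : Site d) :
    chainMass P Z Λ x 0 u v ≤ if u = x ∧ v = x then 1 else 0 := by
  have : IsProbabilityMeasure (P x) := (hP x).isProbabilityMeasure
  have h1 : ∀ q : Fin (2 * 0) → ℝ, chainAt P Z Λ x 0 (timesOf q) u v ≤
      if u = x ∧ v = x then 1 else 0 := by
    intro q
    have h2 : ∀ᵐ ω ∂P x, ENNReal.ofReal |partialWeight Z Λ ω (timesOf q) 0| *
        atPos Λ ω (timesOf q (2 * 0 - 1)) u * atPos Λ ω (timesOf q (2 * 0)) v ≤
        if u = x ∧ v = x then 1 else 0 := by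
      filter_upwards [(hP x).ae_start] with ω hω
      simp only [partialWeight, Finset.range_zero, Finset.prod_empty, abs_one, ENNReal.ofReal_one,
        one_mul, mul_zero, Nat.zero_sub, timesOf_zero]
      split_ifs with h
      · exact mul_le_one' (atPos_le_one _ _ _) (atPos_le_one _ _ _)
      · have h3 : ∀ z, z ≠ x → atPos Λ ω 0 z = 0 := fun z hz => by
          refine atPos_of_ne fun hk => hz ?_
          have := (killed_eq_some_iff'.1 hk).2
          rw [Real.toNNReal_zero, hω] at this
          exact this.symm
        rcases not_and_or.1 h with h | h
        · rw [h3 u h, zero_mul]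
        · rw [h3 v h, mul_zero]
    calc _ ≤ ∫⁻ _ω, (if u = x ∧ v = x then 1 else 0 : ℝ≥0∞) ∂P x := lintegral_mono_ae h2
      _ = _ := by simp
  calc chainMass P Z Λ x 0 u v
      ≤ ∫⁻ q : Fin (2 * 0) → ℝ, chainAt P Z Λ x 0 (timesOf q) u v := setLIntegral_le_lintegral _ _
    _ ≤ ∫⁻ _q : Fin (2 * 0) → ℝ, (if u = x ∧ v = x then 1 else 0 : ℝ≥0∞) := lintegral_mono h1
    _ = _ := by
        rw [lintegral_const]
        have : (volume : Measure (Fin (2 * 0) → ℝ)) Set.univ = 1 := by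
          rw [volume_pi, Measure.pi_univ]; simp
        rw [this, mul_one]

end

end Masses

end

noncomputable section

/-! ### The decay function `|||x|||^{-(d-2)}` -/

section Decay

variable {d : ℕ}

/-- The function `|||x|||^{-(d-2)}`. -/
def decay (x : Site d) : ℝ := (mnorm x ^ (d - 2))⁻¹

theorem euclNorm_eq_norm (x : Site d) : euclNorm x = ‖WithLp.toLp 2 fun i => (x i : ℝ)‖ := by
  rw [EuclideanSpace.norm_eq, euclNorm]
  simp

theorem euclNorm_nonneg (x : Site d) : 0 ≤ euclNorm x := Real.sqrt_nonneg _

theorem euclNorm_sq (x : Site d) : euclNorm x ^ 2 = ∑ i, (x i : ℝ) ^ 2 :=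
  Real.sq_sqrt (Finset.sum_nonneg fun _ _ => sq_nonneg _)

theorem euclNorm_neg (x : Site d) : euclNorm (-x) = euclNorm x := by simp [euclNorm]

theorem euclNorm_zero : euclNorm (0 : Site d) = 0 := by simp [euclNorm]

theorem euclNorm_add_le (x y : Site d) : euclNorm (x + y) ≤ euclNorm x + euclNorm y := by
  simp only [euclNorm_eq_norm]
  refine le_trans (le_of_eq ?_) (norm_add_le _ _)
  congr 1
  ext i
  simp

theorem one_le_mnorm (x : Site d) : 1 ≤ mnorm x := le_max_right _ _

theorem mnorm_pos (x : Site d) : 0 < mnorm x := one_pos.trans_le (one_le_mnorm x)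

theorem mnorm_neg (x : Site d) : mnorm (-x) = mnorm x := by rw [mnorm, mnorm, euclNorm_neg]

theorem mnorm_add_le (x y : Site d) : mnorm (x + y) ≤ 2 * max (mnorm x) (mnorm y) := by
  have h1 : euclNorm x ≤ max (mnorm x) (mnorm y) := (le_max_left _ _).trans (le_max_left _ _)
  have h2 : euclNorm y ≤ max (mnorm x) (mnorm y) := (le_max_left _ _).trans (le_max_right _ _)
  have h3 : 1 ≤ max (mnorm x) (mnorm y) := (one_le_mnorm x).trans (le_max_left _ _)
  refine max_le ?_ (by linarith)
  linarith [euclNorm_add_le x y]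

theorem decay_pos (x : Site d) : 0 < decay x := inv_pos.2 (pow_pos (mnorm_pos x) _)

theorem decay_nonneg (x : Site d) : 0 ≤ decay x := (decay_pos x).le

theorem decay_le_one (x : Site d) : decay x ≤ 1 := inv_le_one_of_one_le₀ (one_le_pow₀ (one_le_mnorm x))

theorem decay_zero : decay (0 : Site d) = 1 := by simp [decay, mnorm, euclNorm_zero]

theorem decay_neg (x : Site d) : decay (-x) = decay x := by rw [decay, decay, mnorm_neg]

theorem decay_sub_comm (x y : Site d) : decay (x - y) = decay (y - x) := by
  rw [← decay_neg, neg_sub]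

/-- The longer of the two vectors has norm at least half that of the sum, so the smaller of the two
factors is at most 2^{d-2} times the decay at x + y. -/
theorem decay_mul_le (x y : Site d) :
    decay x * decay y ≤ 2 ^ (d - 2) * decay (x + y) * (decay x + decay y) := by
  have key : ∀ x y : Site d, mnorm x ≤ mnorm y →
      decay x * decay y ≤ 2 ^ (d - 2) * decay (x + y) * (decay x + decay y) := by
    intro x y h
    have h1 : decay y ≤ 2 ^ (d - 2) * decay (x + y) := by
      have h2 := mnorm_add_le x y
      rw [max_eq_right h] at h2
      have h3 : mnorm (x + y) ^ (d - 2) ≤ 2 ^ (d - 2) * mnorm y ^ (d - 2) := by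
        rw [← mul_pow]
        exact pow_le_pow_left₀ (mnorm_pos _).le h2 _
      rw [decay, decay, ← div_eq_mul_inv, le_div_iff₀ (pow_pos (mnorm_pos _) _),
        inv_mul_le_iff₀ (pow_pos (mnorm_pos _) _), mul_comm]
      exact h3
    have h4 : 0 ≤ 2 ^ (d - 2) * decay (x + y) := mul_nonneg (by positivity) (decay_nonneg _)
    nlinarith [mul_le_mul_of_nonneg_left h1 (decay_nonneg x), mul_nonneg h4 (decay_nonneg y)]
  rcases le_total (mnorm x) (mnorm y) with h | h
  · exact key x y h
  · have := key y x h
    rw [add_comm y x, add_comm (decay y), mul_comm (decay y)] at this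
    exact this

theorem decay_mul_sub_le (a v b : Site d) : decay (a - v) * decay (v - b) ≤
    2 ^ (d - 2) * decay (a - b) * (decay (a - v) + decay (v - b)) := by
  have := decay_mul_le (a - v) (v - b)
  rwa [sub_add_sub_cancel] at this

/-- Comparison with lattice sums for the sup norm, which the Euclidean norm dominates; the origin is
added by hand because the lattice sum does not control it. -/
theorem summable_mnorm_inv {n : ℕ} (hn : d < n) :
    Summable fun x : Site d => (mnorm x ^ n)⁻¹ := by
  classical
  let b := Pi.basisFun ℝ (Fin d)
  let L : Submodule ℤ (Fin d → ℝ) := Submodule.span ℤ (Set.range b)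
  have hfr : Module.finrank ℤ L = d := by
    rw [ZLattice.rank ℝ L]
    simp
  have hs := ZLattice.summable_norm_pow_inv L n (by rw [hfr]; exact hn)
  have hmem : ∀ x : Site d, (fun i => (x i : ℝ)) ∈ L := by
    intro x
    have : (fun i => (x i : ℝ)) = ∑ i, x i • b i := by
      ext j
      simp [b, Finset.sum_apply, Pi.single_apply]
    rw [this]
    exact Submodule.sum_mem _ fun i _ => Submodule.smul_mem _ _ (Submodule.subset_span ⟨i, rfl⟩)
  let e : Site d → L := fun x => ⟨fun i => (x i : ℝ), hmem x⟩
  have he : Function.Injective e := by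
    intro x y h
    have h1 := congrArg Subtype.val h
    ext i
    have h2 : (x i : ℝ) = y i := congrFun h1 i
    exact_mod_cast h2
  have h1 := hs.comp_injective he
  have h2 : Summable fun x : Site d => ‖e x‖⁻¹ ^ n + if x = 0 then (1 : ℝ) else 0 :=
    h1.add (hasSum_ite_eq (0 : Site d) (1 : ℝ)).summable
  refine Summable.of_nonneg_of_le (fun x => inv_nonneg.2 (pow_nonneg (mnorm_pos x).le _))
    (fun x => ?_) h2
  by_cases hx : x = 0
  · have : (0 : ℝ) ≤ ‖e x‖⁻¹ ^ n := by positivity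
    simp only [hx, if_true]
    have h3 : (mnorm (0 : Site d) ^ n)⁻¹ = 1 := by simp [mnorm, euclNorm_zero]
    rw [h3]
    subst hx
    linarith
  · simp only [hx, if_false, add_zero]
    have hpos : 0 < ‖e x‖ := norm_pos_iff.2 fun h => hx (he (by rw [h]; ext i; simp [e]))
    rw [inv_pow]
    refine inv_anti₀ (pow_pos hpos _) (pow_le_pow_left₀ hpos.le ?_ _)
    refine le_trans ?_ (le_max_left _ _)
    refine (pi_norm_le_iff_of_nonneg (euclNorm_nonneg x)).2 fun i => ?_
    exact abs_coord_le_euclNorm x i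

/-- The condition 2(d - 2) > d is exactly d > 4; all diagram estimates rest on this convergence. -/
theorem summable_decay_sq (hd : 5 ≤ d) : Summable fun x : Site d => decay x ^ 2 := by
  have := summable_mnorm_inv (d := d) (n := 2 * (d - 2)) (by omega)
  refine this.congr fun x => ?_
  rw [decay, inv_pow, ← pow_mul, mul_comm]

theorem sum_decay_sq_le (hd : 5 ≤ d) (a : Site d) (Λ : Finset (Site d)) :
    ∑ v ∈ Λ, decay (a - v) ^ 2 ≤ ∑' x : Site d, decay x ^ 2 := by
  have h := ((Equiv.subLeft a).summable_iff (f := fun x : Site d => decay x ^ 2)).2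
    (summable_decay_sq hd)
  have h2 := (Equiv.subLeft a).tsum_eq (fun x : Site d => decay x ^ 2)
  rw [← h2]
  exact h.sum_le_tsum _ fun _ _ => sq_nonneg _

/-- The sum of `decay ^ 2`. -/
def decaySum (d : ℕ) : ℝ := ∑' x : Site d, decay x ^ 2

theorem decaySum_nonneg : 0 ≤ decaySum d := tsum_nonneg fun _ => sq_nonneg _

/-- The constant of `sum_diagram_le`. -/
def diagConst (d : ℕ) : ℝ := (4 * (2 ^ (d - 2)) ^ 2 * decaySum d) ^ 2

/-- The squared factor provides one copy of the decay at x - w for each of the two other lines. Each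
pair is split by `decay_mul_sub_le`, which pulls out the lines from x to u and to u'. What remains
is bounded by squares with total coefficient 2 + 1 + 1, each having a finite sum over w. -/
theorem sum_bubble_le (hd : 5 ≤ d) (x u u' : Site d) (Λ : Finset (Site d)) :
    ∑ w ∈ Λ, decay (x - w) ^ 2 * decay (u - w) * decay (w - u') ≤
      4 * (2 ^ (d - 2)) ^ 2 * decaySum d * (decay (x - u) * decay (x - u')) := by
  set c : ℝ := 2 ^ (d - 2) with hc
  have hcp : 0 ≤ c := by positivity
  have h1 : ∀ w, decay (x - w) ^ 2 * decay (u - w) * decay (w - u') ≤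
      c ^ 2 * (decay (x - u) * decay (x - u')) *
        (2 * decay (x - w) ^ 2 + decay (u - w) ^ 2 + decay (u' - w) ^ 2) := by
    intro w
    have e1 := decay_mul_sub_le x w u
    have e2 := decay_mul_sub_le x w u'
    rw [decay_sub_comm w u] at e1
    rw [decay_sub_comm w u'] at e2 ⊢
    rw [← hc] at e1 e2
    have p1 := decay_nonneg (x - w)
    have p2 := decay_nonneg (u - w)
    have p3 := decay_nonneg (u' - w)
    have p4 := decay_nonneg (x - u)
    have p5 := decay_nonneg (x - u')
    generalize decay (x - w) = A at *
    generalize decay (u - w) = B at *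
    generalize decay (u' - w) = D at *
    generalize decay (x - u) = E at *
    generalize decay (x - u') = F at *
    have e3 : (A * B) * (A * D) ≤ (c * E * (A + B)) * (c * F * (A + D)) :=
      mul_le_mul e1 e2 (mul_nonneg p1 p3) (by positivity)
    have e4 : (A + B) * (A + D) ≤ 2 * A ^ 2 + B ^ 2 + D ^ 2 := by
      nlinarith [sq_nonneg (A - B), sq_nonneg (A - D), sq_nonneg (B - D)]
    calc A ^ 2 * B * D = (A * B) * (A * D) := by ring
      _ ≤ _ := e3
      _ = c ^ 2 * (E * F) * ((A + B) * (A + D)) := by ring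
      _ ≤ _ := mul_le_mul_of_nonneg_left e4 (by positivity)
  refine (Finset.sum_le_sum fun w _ => h1 w).trans ?_
  rw [← Finset.mul_sum, Finset.sum_add_distrib, Finset.sum_add_distrib, ← Finset.mul_sum]
  have s1 := sum_decay_sq_le hd x Λ
  have s2 := sum_decay_sq_le hd u Λ
  have s3 := sum_decay_sq_le hd u' Λ
  have : 2 * ∑ v ∈ Λ, decay (x - v) ^ 2 + ∑ v ∈ Λ, decay (u - v) ^ 2 +
      ∑ v ∈ Λ, decay (u' - v) ^ 2 ≤ 4 * decaySum d := by
    unfold decaySum; linarith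
  calc _ ≤ c ^ 2 * (decay (x - u) * decay (x - u')) * (4 * decaySum d) :=
        mul_le_mul_of_nonneg_left this (mul_nonneg (by positivity)
          (mul_nonneg (decay_nonneg _) (decay_nonneg _)))
    _ = _ := by ring

/-- Summing over w first replaces the lines through w by direct lines from x to u and to u'. The
remaining sum over u is again a bubble, with both outer points equal to y. Each of the two sums
costs one factor, hence the square in `diagConst`. -/
theorem sum_diagram_le (hd : 5 ≤ d) (x u' y : Site d) (Λ : Finset (Site d)) :
    ∑ u ∈ Λ, ∑ w ∈ Λ, decay (x - u) * decay (u - w) * decay (x - w) ^ 2 * decay (w - u') *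
      decay (u - y) ^ 2 ≤ diagConst d * (decay (x - u') * decay (x - y) ^ 2) := by
  have hD : 0 ≤ 4 * (2 ^ (d - 2)) ^ 2 * decaySum d := mul_nonneg (by positivity) decaySum_nonneg
  set D := 4 * (2 ^ (d - 2)) ^ 2 * decaySum d with hDd
  have h1 : ∀ u ∈ Λ, ∑ w ∈ Λ, decay (x - u) * decay (u - w) * decay (x - w) ^ 2 * decay (w - u') *
      decay (u - y) ^ 2 ≤ D * decay (x - u') * (decay (x - u) ^ 2 * decay (u - y) ^ 2) := by
    intro u _
    have h2 := sum_bubble_le hd x u u' Λ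
    have h3 : ∑ w ∈ Λ, decay (x - u) * decay (u - w) * decay (x - w) ^ 2 * decay (w - u') *
      decay (u - y) ^ 2 = (decay (x - u) * decay (u - y) ^ 2) *
        ∑ w ∈ Λ, decay (x - w) ^ 2 * decay (u - w) * decay (w - u') := by
      rw [Finset.mul_sum]
      exact Finset.sum_congr rfl fun w _ => by ring
    rw [h3]
    refine (mul_le_mul_of_nonneg_left h2 (mul_nonneg (decay_nonneg _) (sq_nonneg _))).trans ?_
    apply le_of_eq
    ring
  refine (Finset.sum_le_sum h1).trans ?_
  rw [← Finset.mul_sum]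
  have h4 : ∑ u ∈ Λ, decay (x - u) ^ 2 * decay (u - y) ^ 2 ≤ D * decay (x - y) ^ 2 := by
    have h5 := sum_bubble_le hd x y y Λ
    have h6 : ∀ u ∈ Λ, decay (x - u) ^ 2 * decay (u - y) ^ 2 =
        decay (x - u) ^ 2 * decay (y - u) * decay (u - y) := by
      intro u _
      rw [decay_sub_comm y u]; ring
    rw [Finset.sum_congr rfl h6]
    refine h5.trans (le_of_eq ?_)
    ring
  refine (mul_le_mul_of_nonneg_left h4 (mul_nonneg hD (decay_nonneg _))).trans (le_of_eq ?_)
  rw [diagConst]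
  ring

end Decay

/-! ### Bounds on the lace expansion -/

section DiagramBounds

variable {d : ℕ} {J : Site d → ℝ} {P : Site d → Measure (CadlagPath d)} {Z : WeightFamily d}
  {Λ : Finset (Site d)} {η κ : ℝ}

/-- The ratio of the geometric series bounding the lace expansion is `laceConst d κ * η`. -/
def laceConst (d : ℕ) (κ : ℝ) : ℝ := κ ^ 2 * (1 + κ ^ 2) * diagConst d

/-- The diagonal term is absorbed because the decay function equals 1 at the origin. -/
theorem vertexBd_le (hη : 0 ≤ η) (hκ : 0 ≤ κ)
    (hg : ∀ x y, green P Z Λ 0 x y ≤ ENNReal.ofReal (κ * decay (x - y))) (u v : Site d) :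
    vertexBd P Z η Λ u v ≤ ENNReal.ofReal (η * (1 + κ ^ 2) * decay (u - v) ^ 2) := by
  have h1 : (if u = v then 1 else 0 : ℝ≥0∞) ≤ ENNReal.ofReal (decay (u - v) ^ 2) := by
    split_ifs with h
    · rw [h, sub_self, decay_zero]; simp
    · exact zero_le
  rw [vertexBd, mul_assoc η, ENNReal.ofReal_mul hη]
  gcongr
  have h2 : green P Z Λ 0 u v ^ 2 ≤ ENNReal.ofReal (κ ^ 2 * decay (u - v) ^ 2) := by
    rw [← mul_pow, ENNReal.ofReal_pow (mul_nonneg hκ (decay_nonneg _))]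
    exact pow_le_pow_left' (hg u v) 2
  rw [add_mul, one_mul, ENNReal.ofReal_add (sq_nonneg _) (by positivity)]
  exact add_le_add h1 h2

variable (hd : 5 ≤ d) (hZ : SmoothWeight Z Λ) (hJ : IsJumpRate J)
  (hP : ∀ a, IsWalkLaw J a (P a)) (hG : GreenLeZero P Z) (hV : VertexBound P Z η)
  (hη : 0 ≤ η) (hκ : 1 ≤ κ) (hg : ∀ x y, green P Z Λ 0 x y ≤ ENNReal.ofReal (κ * decay (x - y)))

theorem laceConst_nonneg : 0 ≤ laceConst d κ := by
  unfold laceConst diagConst; positivity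

include hd hη hκ hg in
-- The common core of extending and of closing a lace: one Green's function gives κ, one vertex
-- gives η(1 + κ²), and the double sum gives `diagConst`.
theorem sum_chain_le {A : ℝ} (hA : 0 ≤ A) {T : Site d → Site d → ℝ≥0∞} {x : Site d}
    (hT : ∀ u ∈ Λ, ∀ w ∈ Λ,
      T u w ≤ ENNReal.ofReal (A * (decay (x - u) * decay (u - w) * decay (x - w) ^ 2)))
    (u' y : Site d) :
    ∑ u ∈ Λ, ∑ w ∈ Λ, T u w * (green P Z Λ 0 w u' * vertexBd P Z η Λ u y) ≤
      ENNReal.ofReal (A * (κ * η * (1 + κ ^ 2) * diagConst d) *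
        (decay (x - u') * decay (x - y) ^ 2)) := by
  have hκ0 : 0 ≤ κ := zero_le_one.trans hκ
  have hβ := vertexBd_le hη hκ0 hg
  have h1 : ∀ u ∈ Λ, ∀ w ∈ Λ, T u w * (green P Z Λ 0 w u' * vertexBd P Z η Λ u y) ≤
      ENNReal.ofReal (A * (κ * η * (1 + κ ^ 2)) * (decay (x - u) * decay (u - w) *
        decay (x - w) ^ 2 * decay (w - u') * decay (u - y) ^ 2)) := by
    intro u hu w hw
    have p1 := decay_nonneg (x - u)
    have p2 := decay_nonneg (u - w)
    have p4 := decay_nonneg (w - u')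
    refine (mul_le_mul' (hT u hu w hw) (mul_le_mul' (hg w u') (hβ u y))).trans ?_
    rw [← ENNReal.ofReal_mul (by positivity), ← ENNReal.ofReal_mul (by positivity)]
    apply le_of_eq
    congr 1
    ring
  refine (Finset.sum_le_sum fun u hu => Finset.sum_le_sum fun w hw => h1 u hu w hw).trans ?_
  have h2 : ∀ u w : Site d, 0 ≤ A * (κ * η * (1 + κ ^ 2)) * (decay (x - u) * decay (u - w) *
        decay (x - w) ^ 2 * decay (w - u') * decay (u - y) ^ 2) := fun u w => by
    have p1 := decay_nonneg (x - u)
    have p2 := decay_nonneg (u - w)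
    have p4 := decay_nonneg (w - u')
    positivity
  have h3 : ∀ u ∈ Λ, ∑ w ∈ Λ, ENNReal.ofReal (A * (κ * η * (1 + κ ^ 2)) * (decay (x - u) *
      decay (u - w) * decay (x - w) ^ 2 * decay (w - u') * decay (u - y) ^ 2)) =
      ENNReal.ofReal (∑ w ∈ Λ, A * (κ * η * (1 + κ ^ 2)) * (decay (x - u) *
      decay (u - w) * decay (x - w) ^ 2 * decay (w - u') * decay (u - y) ^ 2)) := fun u _ =>
    (ENNReal.ofReal_sum_of_nonneg fun w _ => h2 u w).symm
  rw [Finset.sum_congr rfl h3, ← ENNReal.ofReal_sum_of_nonneg fun u _ =>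
    Finset.sum_nonneg fun w _ => h2 u w]
  refine ENNReal.ofReal_le_ofReal ?_
  simp only [← Finset.mul_sum]
  refine (mul_le_mul_of_nonneg_left (sum_diagram_le hd x u' y Λ) (by positivity)).trans
    (le_of_eq ?_)
  ring

include hd hZ hJ hP hG hV hη hκ hg

/-- The profile is chosen so that the recursion reproduces it: `sum_chain_le` returns the lines from
x to u' and, squared, from x to y, and the second Green's function adds the line from u' to y. At k
= 0 the mass sits at u = w = x, where the profile equals 1. -/
theorem chainMass_le (x : Site d) (k : ℕ) : ∀ u ∈ Λ, ∀ w ∈ Λ, chainMass P Z Λ x k u w ≤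
    ENNReal.ofReal ((laceConst d κ * η) ^ k *
      (decay (x - u) * decay (u - w) * decay (x - w) ^ 2)) := by
  have hκ0 : 0 ≤ κ := zero_le_one.trans hκ
  have hc : 0 ≤ laceConst d κ * η := mul_nonneg laceConst_nonneg hη
  induction k with
  | zero =>
    intro u _ w _
    refine (chainMass_zero_le hP x u w).trans ?_
    split_ifs with h
    · rw [h.1, h.2, sub_self, decay_zero]; simp
    · exact zero_le
  | succ k ih =>
    intro u' hu' y hy
    refine (chainMass_succ_le hZ hJ hP hG hV x k hu' hy).trans ?_
    have h1 : ∑ u ∈ Λ, ∑ w ∈ Λ, chainMass P Z Λ x k u w *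
        (green P Z Λ 0 w u' * green P Z Λ 0 u' y * vertexBd P Z η Λ u y) =
        (∑ u ∈ Λ, ∑ w ∈ Λ, chainMass P Z Λ x k u w *
        (green P Z Λ 0 w u' * vertexBd P Z η Λ u y)) * green P Z Λ 0 u' y := by
      simp only [Finset.sum_mul]
      exact Finset.sum_congr rfl fun u _ => Finset.sum_congr rfl fun w _ => by ring
    rw [h1]
    refine (mul_le_mul' (sum_chain_le hd hη hκ hg (pow_nonneg hc k) ih u' y) (hg u' y)).trans ?_
    have p1 := decay_nonneg (x - u')
    have p3 : 0 ≤ diagConst d := by unfold diagConst; positivity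
    rw [← ENNReal.ofReal_mul (by positivity)]
    apply le_of_eq
    congr 1
    rw [pow_succ, laceConst]
    ring

/-- Closing the lace is `sum_chain_le` with u' = y, so the line from x to u' joins the squared line
from x to y and gives a cube. Only one factor κ arises here; κ ≥ 1 allows the same ratio as in the
extension step. -/
theorem laceMass_le_decay (x : Site d) (k : ℕ) {y : Site d} (hy : y ∈ Λ) :
    laceMass P Z Λ x k y ≤
      ENNReal.ofReal ((laceConst d κ * η) ^ (k + 1) * decay (x - y) ^ 3) := by
  have hκ0 : 0 ≤ κ := zero_le_one.trans hκ
  have hc : 0 ≤ laceConst d κ * η := mul_nonneg laceConst_nonneg hη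
  refine (laceMass_le hZ hJ hP hG hV x k hy).trans ?_
  refine (sum_chain_le hd hη hκ hg (pow_nonneg hc k)
    (chainMass_le hd hZ hJ hP hG hV hη hκ hg x k) y y).trans (ENNReal.ofReal_le_ofReal ?_)
  have p3 : 0 ≤ diagConst d := by unfold diagConst; positivity
  have p4 := decay_nonneg (x - y)
  have h1 : κ * η * (1 + κ ^ 2) * diagConst d ≤ laceConst d κ * η := by
    rw [laceConst]
    have : κ ≤ κ ^ 2 := by nlinarith
    calc κ * η * (1 + κ ^ 2) * diagConst d = κ * ((1 + κ ^ 2) * diagConst d * η) := by ring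
      _ ≤ κ ^ 2 * ((1 + κ ^ 2) * diagConst d * η) :=
        mul_le_mul_of_nonneg_right this (by positivity)
      _ = _ := by ring
  rw [pow_succ (laceConst d κ * η) k, mul_assoc (_ ^ k), mul_assoc (_ ^ k)]
  refine mul_le_mul_of_nonneg_left ?_ (pow_nonneg hc k)
  calc _ = κ * η * (1 + κ ^ 2) * diagConst d * decay (x - y) ^ 3 := by ring
    _ ≤ _ := mul_le_mul_of_nonneg_right h1 (by positivity)

end DiagramBounds

end

noncomputable section

/-! ### Decay of the free Green's function -/

section Supersolution

variable {d : ℕ}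

/-- The binomial series through third order. With relative increments of order u^{-1/2}, a
fourth-order error is of order u^{-2}, which is the precision the supersolution needs. -/
theorem one_add_rpow_neg_le (s : ℝ) : ∃ C : ℝ, 0 ≤ C ∧ ∃ ε : ℝ, 0 < ε ∧ ∀ r : ℝ, |r| < ε →
    (1 + r) ^ (-s) ≤
      1 - s * r + s * (s + 1) / 2 * r ^ 2 - s * (s + 1) * (s + 2) / 6 * r ^ 3 + C * r ^ 4 := by
  have h := (Real.one_add_rpow_hasFPowerSeriesAt_zero (a := -s)).isBigO_sub_partialSum_pow 4
  obtain ⟨C, hC⟩ := h.bound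
  obtain ⟨ε, hε, hb⟩ := Metric.eventually_nhds_iff.1 hC
  refine ⟨|C|, abs_nonneg _, ε, hε, fun r hr => ?_⟩
  have h1 := hb (y := r) (by simpa using hr)
  have h2 : (binomialSeries ℝ (-s)).partialSum 4 r =
      1 - s * r + s * (s + 1) / 2 * r ^ 2 - s * (s + 1) * (s + 2) / 6 * r ^ 3 := by
    have h2 : Polynomial.smeval (2 : Polynomial ℤ) (-s) = 2 := by
      have := Polynomial.smeval_natCast ℤ (-s) 2
      simpa using this
    simp [-FormalMultilinearSeries.apply_eq_prod_smul_coeff, FormalMultilinearSeries.partialSum,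
      Finset.sum_range_succ, binomialSeries_apply, Ring.choose_eq_smul, descPochhammer_succ_right,
      Polynomial.smeval_mul, Polynomial.smeval_sub, Nat.factorial, h2]
    ring
  rw [h2, zero_add] at h1
  have h3 := (le_abs_self _).trans h1
  have h4 : C * ‖‖r‖ ^ 4‖ ≤ |C| * r ^ 4 := by
    rw [norm_pow, norm_norm, Real.norm_eq_abs, pow_abs, abs_of_nonneg (by positivity : 0 ≤ r ^ 4)]
    exact mul_le_mul_of_nonneg_right (le_abs_self C) (by positivity)
  linarith

/-- The automorphism that maps `x` to `-x`. -/
def negAut (d : ℕ) : LatticeAut d where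
  toEquiv := Equiv.neg (Site d)
  map_rel_iff' := by
    intro x y
    show ∑ i, |(-x) i - (-y) i| = 1 ↔ ∑ i, |x i - y i| = 1
    have : ∀ i, |(-x) i - (-y) i| = |x i - y i| := fun i => by
      rw [Pi.neg_apply, Pi.neg_apply, ← abs_neg]; congr 1; ring
    simp only [this]

/-- The automorphism that changes the sign of one coordinate. -/
def flipAut (i : Fin d) : LatticeAut d where
  toFun x j := if j = i then -x j else x j
  invFun x j := if j = i then -x j else x j
  left_inv x := by ext j; by_cases h : j = i <;> simp [h]
  right_inv x := by ext j; by_cases h : j = i <;> simp [h]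
  map_rel_iff' := by
    intro x y
    show ∑ j, |(if j = i then -x j else x j) - (if j = i then -y j else y j)| = 1 ↔
      ∑ i, |x i - y i| = 1
    have : ∀ j, |(if j = i then -x j else x j) - (if j = i then -y j else y j)| = |x j - y j| := by
      intro j
      split_ifs
      · rw [← abs_neg]; congr 1; ring
      · rfl
    simp only [this]

/-- The automorphism that permutes the coordinates. -/
def permAut (σ : Equiv.Perm (Fin d)) : LatticeAut d where
  toEquiv := Equiv.arrowCongr σ (Equiv.refl ℤ)
  map_rel_iff' := by
    intro x y
    show ∑ i, |x (σ.symm i) - y (σ.symm i)| = 1 ↔ ∑ i, |x i - y i| = 1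
    rw [Equiv.sum_comp σ.symm fun i => |x i - y i|]

/-- The scalar product of two lattice points. -/
def dotp (x y : Site d) : ℝ := ∑ i, (x i : ℝ) * y i

theorem dotp_neg (x y : Site d) : dotp x (-y) = -dotp x y := by simp [dotp]

theorem abs_dotp_le (x y : Site d) : |dotp x y| ≤ euclNorm x * euclNorm y := by
  rw [← Real.sqrt_sq_eq_abs, euclNorm, euclNorm, ← Real.sqrt_mul
    (Finset.sum_nonneg fun _ _ => sq_nonneg _)]
  exact Real.sqrt_le_sqrt (Finset.sum_mul_sq_le_sq_mul_sq _ _ _)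

theorem euclNorm_add_sq (x y : Site d) :
    euclNorm (x + y) ^ 2 = euclNorm x ^ 2 + (2 * dotp x y + euclNorm y ^ 2) := by
  simp only [euclNorm_sq, dotp, Finset.mul_sum, ← Finset.sum_add_distrib]
  exact Finset.sum_congr rfl fun i _ => by rw [Pi.add_apply]; push_cast; ring

variable {w : Site d → ℝ} {S : Finset (Site d)}

theorem sum_aut (hsym : IsLatticeSymmetric w) (hS : ∀ y, y ∉ S → w y = 0) {T : LatticeAut d}
    (hT : T 0 = 0) (F : Site d → ℝ) : ∑ y ∈ S, w y * F (T y) = ∑ y ∈ S, w y * F y := by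
  have h1 : ∀ F : Site d → ℝ, ∑ y ∈ S, w y * F y = ∑' y, w y * F y := fun F =>
    (tsum_eq_sum fun y hy => by rw [hS y hy, zero_mul]).symm
  rw [h1, h1 F, ← T.toEquiv.tsum_eq fun y => w y * F y]
  refine tsum_congr fun y => ?_
  show _ = w (T y) * F (T y)
  rw [hsym T hT]

/-- The covariance matrix of a lattice-symmetric weight is a multiple of the identity: sign flips of
a coordinate kill the off-diagonal entries and transpositions make the diagonal entries equal. -/
theorem sum_dotp_sq (hsym : IsLatticeSymmetric w) (hS : ∀ y, y ∉ S → w y = 0) (x : Site d) :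
    d * ∑ y ∈ S, w y * dotp x y ^ 2 = euclNorm x ^ 2 * ∑ y ∈ S, w y * euclNorm y ^ 2 := by
  have hoff : ∀ i j : Fin d, i ≠ j → ∑ y ∈ S, w y * ((y i : ℝ) * y j) = 0 := by
    intro i j hij
    have h := sum_aut hsym hS (T := flipAut i) (by ext j; simp [flipAut])
      (fun y => (y i : ℝ) * y j)
    have h2 : ∀ y : Site d, (((flipAut i) y i : ℤ) : ℝ) * ((flipAut i) y j : ℤ) =
        -((y i : ℝ) * y j) := by
      intro y
      have e1 : (flipAut i) y i = -y i := by simp [flipAut]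
      have e2 : (flipAut i) y j = y j := by simp [flipAut, hij.symm]
      rw [e1, e2]; push_cast; ring
    simp only [h2, mul_neg, Finset.sum_neg_distrib] at h
    linarith
  have hdiag : ∀ i j : Fin d, ∑ y ∈ S, w y * (y i : ℝ) ^ 2 = ∑ y ∈ S, w y * (y j : ℝ) ^ 2 := by
    intro i j
    have h := sum_aut hsym hS (T := permAut (Equiv.swap i j)) (by ext j; rfl)
      (fun y => (y i : ℝ) ^ 2)
    rw [← h]
    refine Finset.sum_congr rfl fun y _ => ?_
    have : (permAut (Equiv.swap i j)) y i = y j := by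
      show y ((Equiv.swap i j).symm i) = y j
      simp
    rw [this]
  have h1 : ∑ y ∈ S, w y * dotp x y ^ 2 =
      ∑ i, (x i : ℝ) ^ 2 * ∑ y ∈ S, w y * (y i : ℝ) ^ 2 := by
    have e : ∀ y, w y * dotp x y ^ 2 =
        ∑ i, ∑ j, (x i : ℝ) * x j * (w y * ((y i : ℝ) * y j)) := by
      intro y
      rw [sq, dotp, Finset.sum_mul_sum, Finset.mul_sum]
      refine Finset.sum_congr rfl fun i _ => ?_
      rw [Finset.mul_sum]
      exact Finset.sum_congr rfl fun j _ => by ring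
    simp only [e]
    rw [Finset.sum_comm]
    refine Finset.sum_congr rfl fun i _ => ?_
    rw [Finset.sum_comm, Finset.sum_eq_single i]
    · rw [← Finset.mul_sum, sq]
      congr 1
      exact Finset.sum_congr rfl fun y _ => by ring
    · intro j _ hj
      rw [← Finset.mul_sum, hoff i j hj.symm, mul_zero]
    · simp
  have h2 : ∀ i : Fin d, ∑ y ∈ S, w y * euclNorm y ^ 2 = d * ∑ y ∈ S, w y * (y i : ℝ) ^ 2 := by
    intro i
    simp only [euclNorm_sq, Finset.mul_sum]
    rw [Finset.sum_comm]
    have : ∀ j ∈ Finset.univ, ∑ y ∈ S, w y * (y j : ℝ) ^ 2 = ∑ y ∈ S, w y * (y i : ℝ) ^ 2 :=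
      fun j _ => hdiag j i
    rw [Finset.sum_congr rfl this]
    simp [Finset.mul_sum]
  rw [h1, euclNorm_sq, Finset.sum_mul, Finset.mul_sum]
  refine Finset.sum_congr rfl fun i _ => ?_
  rw [h2 i]; ring

theorem Jplus_symmetric {J : Site d → ℝ} (hJ : IsJumpRate J) : IsLatticeSymmetric (Jplus J) := by
  intro T hT x
  have h : T x = 0 ↔ x = 0 := ⟨fun h => T.injective (h.trans hT.symm), fun h => by rw [h, hT]⟩
  simp only [Jplus, h, hJ.symmetric T hT x]

theorem IsJumpRate.jplus_nonneg {J : Site d → ℝ} (hJ : IsJumpRate J) (y : Site d) :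
    0 ≤ Jplus J y := by
  unfold Jplus; split_ifs with h
  · exact le_rfl
  · exact hJ.nonneg y h

theorem IsJumpRate.jplus_eq_zero {J : Site d → ℝ} (hJ : IsJumpRate J) (y : Site d)
    (hy : y ∉ hJ.supp) : Jplus J y = 0 := by
  unfold Jplus; split_ifs with h
  · rfl
  · exact hJ.eq_zero_of_notMem hy

/-- Otherwise no x ≠ 0 has positive rate, and the positive rates could not generate the lattice. -/
theorem IsJumpRate.second_moment_pos {J : Site d → ℝ} (hJ : IsJumpRate J) (hd : 0 < d) :
    0 < ∑ y ∈ hJ.supp, Jplus J y * euclNorm y ^ 2 := by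
  refine lt_of_le_of_ne (Finset.sum_nonneg fun y _ => mul_nonneg (hJ.jplus_nonneg y) (sq_nonneg _))
    fun h => ?_
  have h1 := (Finset.sum_eq_zero_iff_of_nonneg fun y _ =>
    mul_nonneg (hJ.jplus_nonneg y) (sq_nonneg (euclNorm y))).1 h.symm
  have h2 : {x | 0 < J x} ⊆ {0} := by
    intro x hx
    by_contra hx0
    have hx0 : x ≠ 0 := hx0
    have hxs : x ∈ hJ.supp := by
      by_contra hn
      exact (ne_of_gt hx) (hJ.eq_zero_of_notMem hn)
    have h3 := h1 x hxs
    rw [Jplus, if_neg hx0] at h3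
    rcases mul_eq_zero.1 h3 with h4 | h4
    · exact (ne_of_gt hx) h4
    · refine hx0 (funext fun i => ?_)
      have h5 := abs_coord_le_euclNorm x i
      rw [pow_eq_zero_iff two_ne_zero] at h4
      rw [h4] at h5
      exact_mod_cast abs_nonpos_iff.1 h5
  have h3 := (AddSubgroup.closure_mono h2).trans (le_of_eq AddSubgroup.closure_singleton_zero)
  rw [hJ.generates] at h3
  have h4 : (fun _ => 1 : Site d) ∈ (⊥ : AddSubgroup (Site d)) := h3 (AddSubgroup.mem_top _)
  have h5 := congrFun (AddSubgroup.mem_bot.1 h4) ⟨0, hd⟩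
  simp at h5

theorem pow_four_le {c b q u R : ℝ} (hb : |b| ≤ 2 * (Real.sqrt u * R)) (hq : |q| ≤ R ^ 2)
    (hu : 1 ≤ u) (hc : c = (b + q) / u) :
    c ^ 2 ≤ (2 * R + R ^ 2) ^ 2 / u := by
  have hu0 : 0 < u := by linarith
  have hs : 1 ≤ Real.sqrt u := Real.one_le_sqrt.2 hu
  have h1 : |b + q| ≤ (2 * R + R ^ 2) * Real.sqrt u := by
    refine (abs_add_le _ _).trans ?_
    nlinarith [sq_nonneg R, mul_le_mul_of_nonneg_left hs (sq_nonneg R)]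
  have h2 : (b + q) ^ 2 ≤ (2 * R + R ^ 2) ^ 2 * u := by
    calc (b + q) ^ 2 = |b + q| ^ 2 := (sq_abs _).symm
      _ ≤ ((2 * R + R ^ 2) * Real.sqrt u) ^ 2 := pow_le_pow_left₀ (abs_nonneg _) h1 2
      _ = _ := by rw [mul_pow, Real.sq_sqrt hu0.le]
  rw [hc, div_pow, div_le_div_iff₀ (by positivity) hu0]
  nlinarith

/-- Here b = 2⟨x,y⟩ and q = |y|², and the two terms belong to y and -y. The pairing cancels the
contribution of b to the linear term, and the sum of the cubes is nonnegative, so that the cubic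
term, which has a negative coefficient, can be dropped. -/
theorem rpow_pair_le {s C ε B R u b q : ℝ} (hs : 0 < s) (hC : 0 ≤ C) (hε : 0 < ε)
    (hT : ∀ r : ℝ, |r| < ε → (1 + r) ^ (-s) ≤
      1 - s * r + s * (s + 1) / 2 * r ^ 2 - s * (s + 1) * (s + 2) / 6 * r ^ 3 + C * r ^ 4)
    (hu : 0 < u) (hBu : B / ε ^ 2 < u) (hq : 0 ≤ q) (hqR : q ≤ R ^ 2)
    (p1 : 0 ≤ 1 + (b + q) / u) (p2 : 0 ≤ 1 + (-b + q) / u)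
    (c1 : ((b + q) / u) ^ 2 ≤ B / u) (c2 : ((-b + q) / u) ^ 2 ≤ B / u) :
    ((u * (1 + (b + q) / u)) ^ (-s) - u ^ (-s)) + ((u * (1 + (-b + q) / u)) ^ (-s) - u ^ (-s)) ≤
      u ^ (-s) * (-(2 * s) * (q / u) + s * (s + 1) * ((b ^ 2 + R ^ 4) / u ^ 2) +
        2 * (C * (B ^ 2 / u ^ 2))) := by
  have hus : 0 ≤ u ^ (-s) := Real.rpow_nonneg hu.le _
  have hfac : ∀ c : ℝ, 0 ≤ 1 + c → c ^ 2 ≤ B / u →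
      (u * (1 + c)) ^ (-s) - u ^ (-s) ≤ u ^ (-s) * (-s * c + s * (s + 1) / 2 * c ^ 2 -
        s * (s + 1) * (s + 2) / 6 * c ^ 3 + C * (B ^ 2 / u ^ 2)) := by
    intro c hc0 hc
    have h1 : |c| < ε := by
      refine abs_lt_of_sq_lt_sq ?_ hε.le
      refine hc.trans_lt ((div_lt_iff₀ hu).2 ?_)
      rwa [div_lt_iff₀ (by positivity), mul_comm] at hBu
    have h2 := hT c h1
    have h3 : c ^ 4 ≤ B ^ 2 / u ^ 2 := by
      calc c ^ 4 = (c ^ 2) ^ 2 := by ring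
        _ ≤ (B / u) ^ 2 := pow_le_pow_left₀ (sq_nonneg c) hc 2
        _ = _ := by rw [div_pow]
    have h4 := mul_le_mul_of_nonneg_left h3 hC
    rw [Real.mul_rpow hu.le hc0]
    have h6 : (1 + c) ^ (-s) - 1 ≤ -s * c + s * (s + 1) / 2 * c ^ 2 -
        s * (s + 1) * (s + 2) / 6 * c ^ 3 + C * (B ^ 2 / u ^ 2) := by linarith
    have h7 := mul_le_mul_of_nonneg_left h6 hus
    linarith
  refine (add_le_add (hfac _ p1 c1) (hfac _ p2 c2)).trans ?_
  rw [← mul_add]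
  refine mul_le_mul_of_nonneg_left ?_ hus
  have g1 : (b + q) / u + (-b + q) / u = 2 * (q / u) := by ring
  have g2 : ((b + q) / u) ^ 2 + ((-b + q) / u) ^ 2 = 2 * ((b ^ 2 + q ^ 2) / u ^ 2) := by ring
  have g3 : 0 ≤ ((b + q) / u) ^ 3 + ((-b + q) / u) ^ 3 := by
    have : ((b + q) / u) ^ 3 + ((-b + q) / u) ^ 3 = (2 * q ^ 3 + 6 * b ^ 2 * q) / u ^ 3 := by ring
    rw [this]; positivity
  have g4 : (b ^ 2 + q ^ 2) / u ^ 2 ≤ (b ^ 2 + R ^ 4) / u ^ 2 := by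
    refine div_le_div_of_nonneg_right ?_ (by positivity)
    have : q ^ 2 ≤ (R ^ 2) ^ 2 := pow_le_pow_left₀ hq hqR 2
    linarith [show (R ^ 2) ^ 2 = R ^ 4 by ring]
  have g7 := mul_nonneg (show 0 ≤ s * (s + 1) * (s + 2) / 6 by positivity) g3
  have g8 := mul_le_mul_of_nonneg_left g4 (show 0 ≤ s * (s + 1) by positivity)
  generalize (b + q) / u = c1 at *
  generalize (-b + q) / u = c2 at *
  generalize (b ^ 2 + q ^ 2) / u ^ 2 = X at *
  generalize (b ^ 2 + R ^ 4) / u ^ 2 = Y at *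
  generalize C * (B ^ 2 / u ^ 2) = E at *
  generalize q / u = F at *
  linear_combination g8 + g7 - s * g1 + s * (s + 1) / 2 * g2

end Supersolution

/-! ### The supersolution and the bound on the free Green's function -/

section Decay

variable {d : ℕ} {J : Site d → ℝ}

/-- The function `(|x|^2 + A)^{-(d-2)/2}` is a strict supersolution if `A` is large. -/
theorem exists_supersolution (hJ : IsJumpRate J) (hd : 3 ≤ d) : ∃ A : ℝ, 1 ≤ A ∧ ∃ δ : ℝ, 0 < δ ∧
    ∀ x : Site d, ∑ y ∈ hJ.supp, J y * (euclNorm (x + y) ^ 2 + A) ^ (-((d : ℝ) - 2) / 2) ≤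
      -δ * if x = 0 then 1 else 0 := by
  set s : ℝ := ((d : ℝ) - 2) / 2 with hs
  have hdR : (3 : ℝ) ≤ d := by exact_mod_cast hd
  have hs0 : 0 < s := by rw [hs]; linarith
  obtain ⟨C, hC, ε, hε, hT⟩ := one_add_rpow_neg_le s
  set w := Jplus J with hw
  set S := hJ.supp with hS
  have hw0 : ∀ y, 0 ≤ w y := hJ.jplus_nonneg
  have hwS : ∀ y, y ∉ S → w y = 0 := hJ.jplus_eq_zero
  have hsym : IsLatticeSymmetric w := Jplus_symmetric hJ
  set m2 := ∑ y ∈ S, w y * euclNorm y ^ 2 with hm2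
  have hm2p : 0 < m2 := hJ.second_moment_pos (by omega)
  obtain ⟨R, hR0, hR⟩ := hJ.finite_range
  have hwR : ∀ y, w y ≠ 0 → euclNorm y ≤ R := by
    intro y hy
    by_contra hlt
    apply hy
    rw [hw, Jplus, hR y (not_le.1 hlt).le]
    simp
  set B := (2 * R + R ^ 2) ^ 2 with hB
  set W := ∑ y ∈ S, w y with hW
  have hW0 : 0 ≤ W := Finset.sum_nonneg fun y _ => hw0 y
  set M := s * (s + 1) / 2 * R ^ 4 * W + C * B ^ 2 * W with hM
  have hM0 : 0 ≤ M := by positivity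
  -- The second condition puts all relative increments within the range of the Taylor bound; the
  -- third makes the gain from the shift A beat all error terms, with 1 to spare.
  obtain ⟨A, hA1, hAε, hAM⟩ : ∃ A : ℝ, 1 ≤ A ∧ B / ε ^ 2 < A ∧ M + 1 ≤ s * A * m2 := by
    refine ⟨max 1 (max (B / ε ^ 2 + 1) ((M + 1) / (s * m2))), le_max_left _ _, ?_, ?_⟩
    · exact (lt_add_one _).trans_le ((le_max_left _ _).trans (le_max_right _ _))
    · have h1 : (M + 1) / (s * m2) ≤ max 1 (max (B / ε ^ 2 + 1) ((M + 1) / (s * m2))) :=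
        (le_max_right _ _).trans (le_max_right _ _)
      rw [div_le_iff₀ (by positivity)] at h1
      linarith
  refine ⟨A, hA1, A ^ (-s) / A ^ 2, by positivity, fun x => ?_⟩
  have hexp : -((d : ℝ) - 2) / 2 = -s := by rw [hs]; ring
  rw [hexp]
  set u := euclNorm x ^ 2 + A with hu
  have hu1 : 1 ≤ u := by rw [hu]; linarith [sq_nonneg (euclNorm x)]
  have hu0 : 0 < u := by linarith
  have hAu : A ≤ u := by rw [hu]; linarith [sq_nonneg (euclNorm x)]
  -- reduction to the rates `Jplus`
  have hJw : ∑ y ∈ S, J y * (euclNorm (x + y) ^ 2 + A) ^ (-s) =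
      ∑ y ∈ S, w y * ((euclNorm (x + y) ^ 2 + A) ^ (-s) - u ^ (-s)) := by
    have h1 : ∀ y ∈ S, w y * ((euclNorm (x + y) ^ 2 + A) ^ (-s) - u ^ (-s)) =
        J y * (euclNorm (x + y) ^ 2 + A) ^ (-s) - J y * u ^ (-s) := by
      intro y _
      by_cases hy : y = 0
      · simp [hy, hu]
      · rw [hw, Jplus, if_neg hy]; ring
    rw [Finset.sum_congr rfl h1, Finset.sum_sub_distrib, ← Finset.sum_mul, hS,
      hJ.sum_supp_eq_zero]
    ring
  -- the bound on symmetrised terms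
  have hpt : ∀ y, w y * (((euclNorm (x + y) ^ 2 + A) ^ (-s) - u ^ (-s)) +
      ((euclNorm (x + -y) ^ 2 + A) ^ (-s) - u ^ (-s))) ≤
      w y * (u ^ (-s) * (-(2 * s) * (euclNorm y ^ 2 / u) +
        s * (s + 1) * (((2 * dotp x y) ^ 2 + R ^ 4) / u ^ 2) + 2 * (C * (B ^ 2 / u ^ 2)))) := by
    intro y
    by_cases hy : w y = 0
    · simp [hy]
    have hyR := hwR y hy
    refine mul_le_mul_of_nonneg_left ?_ (hw0 y)
    have hyR2 : euclNorm y ^ 2 ≤ R ^ 2 := pow_le_pow_left₀ (euclNorm_nonneg y) hyR 2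
    have hxu : euclNorm x ≤ Real.sqrt u := by
      refine Real.le_sqrt_of_sq_le ?_
      rw [hu]; linarith
    have hbR : |2 * dotp x y| ≤ 2 * (Real.sqrt u * R) := by
      rw [abs_mul, abs_two]
      refine mul_le_mul_of_nonneg_left ((abs_dotp_le x y).trans ?_) zero_le_two
      exact mul_le_mul hxu hyR (euclNorm_nonneg y) (Real.sqrt_nonneg _)
    have hq0 : 0 ≤ euclNorm y ^ 2 := sq_nonneg _
    have habsq : |euclNorm y ^ 2| ≤ R ^ 2 := by rwa [abs_of_nonneg hq0]
    have e1 : euclNorm (x + y) ^ 2 + A = u * (1 + (2 * dotp x y + euclNorm y ^ 2) / u) := by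
      rw [euclNorm_add_sq, mul_add, mul_div_cancel₀ _ hu0.ne', hu]; ring
    have e2 : euclNorm (x + -y) ^ 2 + A = u * (1 + (-(2 * dotp x y) + euclNorm y ^ 2) / u) := by
      rw [euclNorm_add_sq, dotp_neg, euclNorm_neg, mul_add, mul_div_cancel₀ _ hu0.ne', hu]
      ring
    have hA0 : 0 ≤ A := by linarith
    have p1 : 0 ≤ 1 + (2 * dotp x y + euclNorm y ^ 2) / u := by
      refine (mul_nonneg_iff_of_pos_left hu0).1 ?_
      rw [← e1]; positivity
    have p2 : 0 ≤ 1 + (-(2 * dotp x y) + euclNorm y ^ 2) / u := by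
      refine (mul_nonneg_iff_of_pos_left hu0).1 ?_
      rw [← e2]; positivity
    rw [e1, e2]
    exact rpow_pair_le hs0 hC hε hT hu0 (hAε.trans_le hAu) hq0 hyR2 p1 p2
      (pow_four_le hbR habsq hu1 rfl) (pow_four_le (by rwa [abs_neg]) habsq hu1 rfl)
  have hus : 0 < u ^ (-s) := Real.rpow_pos_of_pos hu0 _
  have hsum := Finset.sum_le_sum fun y (_ : y ∈ S) => hpt y
  have haut := sum_aut hsym hwS (T := negAut d) (by ext i; simp [negAut])
    (fun y => (euclNorm (x + y) ^ 2 + A) ^ (-s) - u ^ (-s))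
  have haut' : ∑ y ∈ S, w y * ((euclNorm (x + -y) ^ 2 + A) ^ (-s) - u ^ (-s)) =
      ∑ y ∈ S, w y * ((euclNorm (x + y) ^ 2 + A) ^ (-s) - u ^ (-s)) := haut
  have hexpand : ∀ a b c e : ℝ, a * (u ^ (-s) * (b + c + e)) =
      a * (u ^ (-s) * b) + a * (u ^ (-s) * c) + a * (u ^ (-s) * e) := fun a b c e => by ring
  simp only [hexpand, Finset.sum_add_distrib] at hsum
  simp only [mul_add (w _), Finset.sum_add_distrib] at hsum
  rw [haut'] at hsum
  have hdot := sum_dotp_sq hsym hwS x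
  rw [← hm2] at hdot
  set D := ∑ y ∈ S, w y * dotp x y ^ 2 with hD
  have hx2 : euclNorm x ^ 2 = u - A := by rw [hu]; ring
  have t1 : ∑ y ∈ S, w y * (u ^ (-s) * (-(2 * s) * (euclNorm y ^ 2 / u))) =
      u ^ (-s) * (-(2 * s) * (m2 / u)) := by
    rw [hm2, Finset.sum_div, Finset.mul_sum, Finset.mul_sum]
    exact Finset.sum_congr rfl fun y _ => by ring
  have t2 : ∑ y ∈ S, w y * (u ^ (-s) * (s * (s + 1) * (((2 * dotp x y) ^ 2 + R ^ 4) / u ^ 2))) =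
      u ^ (-s) * (s * (s + 1) * (4 * D + R ^ 4 * W) / u ^ 2) := by
    rw [hD, hW, Finset.mul_sum, Finset.mul_sum, ← Finset.sum_add_distrib, Finset.mul_sum,
      Finset.sum_div, Finset.mul_sum]
    exact Finset.sum_congr rfl fun y _ => by ring
  have t3 : ∑ y ∈ S, w y * (u ^ (-s) * (2 * (C * (B ^ 2 / u ^ 2)))) =
      u ^ (-s) * (2 * C * B ^ 2 * W / u ^ 2) := by
    rw [← Finset.sum_mul, ← hW]; ring
  rw [t1, t2, t3] at hsum
  -- The exponent is critical: 2(s + 1) = d makes the second-order term cancel the linear one up to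
  -- a multiple of A/u², just as |x|^{-(d-2)} is harmonic in ℝ^d.
  have hD2 : s * (s + 1) * (4 * D) = 2 * s * m2 * (u - A) := by
    have h1 : 2 * (s + 1) = d := by rw [hs]; ring
    rw [hx2] at hdot
    calc s * (s + 1) * (4 * D) = 2 * s * ((2 * (s + 1)) * D) := by ring
      _ = 2 * s * (d * D) := by rw [h1]
      _ = _ := by rw [hdot]; ring
  -- What survives is -2s·A·m₂/u² against the error 2M/u². The factors 2 come from counting both y
  -- and -y.
  have hfin : -(2 * s) * (m2 / u) + s * (s + 1) * (4 * D + R ^ 4 * W) / u ^ 2 +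
      2 * C * B ^ 2 * W / u ^ 2 ≤ -2 / u ^ 2 := by
    have e : -(2 * s) * (m2 / u) = -(2 * s * m2 * u) / u ^ 2 := by field_simp
    rw [e, ← add_div, ← add_div]
    refine div_le_div_of_nonneg_right ?_ (by positivity)
    rw [hM] at hAM
    linear_combination hD2 + 2 * hAM
  rw [hJw]
  have hfin2 := mul_le_mul_of_nonneg_left hfin hus.le
  have hmain : ∑ y ∈ S, w y * ((euclNorm (x + y) ^ 2 + A) ^ (-s) - u ^ (-s)) ≤
      -(u ^ (-s) / u ^ 2) := by
    have e : u ^ (-s) * (-2 / u ^ 2) = -2 * (u ^ (-s) / u ^ 2) := by ring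
    rw [e] at hfin2
    rw [mul_add, mul_add] at hfin2
    linarith
  refine hmain.trans ?_
  by_cases hx : x = 0
  · have : u = A := by rw [hu, hx, euclNorm_zero]; ring
    rw [if_pos hx, this]; linarith
  · rw [if_neg hx, mul_zero, neg_nonpos]
    positivity

/-- Let h be the supersolution. The derivative of e^{tL}h is e^{tL}Lh, at most -δ times the
transition probability to the origin. Integrating gives δ∫p_t ≤ h - e^{TL}h ≤ h, and h is bounded by
the decay function because |x|² + A ≥ |||x|||². -/
theorem integral_transition_le (hJ : IsJumpRate J) (hd : 3 ≤ d) : ∃ C : ℝ, 0 < C ∧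
    ∀ (T : ℝ), 0 ≤ T → ∀ x : Site d, ∫ t in (0 : ℝ)..T, transition J t x ≤ C * decay x := by
  obtain ⟨A, hA, δ, hδ, hsup⟩ := exists_supersolution hJ hd
  have hdR : (3 : ℝ) ≤ d := by exact_mod_cast hd
  have hA0 : 0 < A := by linarith
  have hb : ∀ x : Site d, |(euclNorm x ^ 2 + A) ^ (-((d : ℝ) - 2) / 2)| ≤ 1 := fun x => by
    have h1 : 1 ≤ euclNorm x ^ 2 + A := by linarith [sq_nonneg (euclNorm x)]
    rw [abs_of_nonneg (Real.rpow_nonneg (by linarith) _)]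
    exact Real.rpow_le_one_of_one_le_of_nonpos h1 (by linarith)
  set h : LatFun d := LatFun.mk _ 1 hb with hh
  set L := jumpOp J hJ.supp with hL
  have hh0 : ∀ x, 0 ≤ h x := fun x =>
    Real.rpow_nonneg (by linarith [sq_nonneg (euclNorm x)]) _
  have hLh : ∀ x, L h x ≤ -δ * if x = 0 then 1 else 0 := fun x => by
    rw [hL, jumpOp_apply]
    exact hsup x
  refine ⟨1 / δ, by positivity, fun T hT x => ?_⟩
  -- The base point is -x because the transition from -x to the origin has increment x.
  have hder : ∀ t ∈ Set.uIcc 0 T, HasDerivAt (fun u : ℝ => NormedSpace.exp (u • L) h (-x))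
      (NormedSpace.exp (t • L) (L h) (-x)) t := fun t _ => hasDerivAt_exp_apply L t h (-x)
  have hcont : Continuous fun t : ℝ => NormedSpace.exp (t • L) (L h) (-x) :=
    continuous_iff_continuousAt.2 fun t => (hasDerivAt_exp_apply L t (L h) (-x)).continuousAt
  have hftc := intervalIntegral.integral_eq_sub_of_hasDerivAt hder
    (hcont.intervalIntegrable 0 T)
  have hle : ∀ t, 0 ≤ t → NormedSpace.exp (t • L) (L h) (-x) ≤ -δ * transition J t x := by
    intro t ht
    have h1 := exp_jumpOp_nonneg hJ ht (f := -δ • pointFun 0 - L h) (fun y => by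
      have e : LatFun.eval y (-δ • pointFun 0 - L h) = -δ * (if y = 0 then 1 else 0) - L h y := by
        rw [map_sub, map_smul]; rfl
      exact (sub_nonneg.2 (hLh y)).trans_eq e.symm) (-x)
    have h2 := transition_eq_exp hJ t 0 (-x)
    rw [sub_neg_eq_add, zero_add] at h2
    have h3 : NormedSpace.exp (t • L) (-δ • pointFun 0 - L h) (-x) =
        -δ * NormedSpace.exp (t • L) (pointFun 0) (-x) - NormedSpace.exp (t • L) (L h) (-x) := by
      simp
    rw [← hL, h3, ← h2] at h1
    linarith
  have hint : ∫ t in (0 : ℝ)..T, NormedSpace.exp (t • L) (L h) (-x) ≤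
      ∫ t in (0 : ℝ)..T, -δ * transition J t x :=
    intervalIntegral.integral_mono_on hT (hcont.intervalIntegrable 0 T)
      ((continuous_const.mul (continuous_transition hJ x)).intervalIntegrable 0 T)
      fun t ht => hle t ht.1
  rw [hftc, intervalIntegral.integral_const_mul, zero_smul, NormedSpace.exp_zero,
    one_apply_eq_self] at hint
  have hpos := exp_jumpOp_nonneg hJ hT hh0 (-x)
  rw [← hL] at hpos
  have hdec : h (-x) ≤ decay x := by
    show (euclNorm (-x) ^ 2 + A) ^ (-((d : ℝ) - 2) / 2) ≤ decay x
    have h1 : mnorm x ^ 2 ≤ euclNorm (-x) ^ 2 + A := by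
      rw [euclNorm_neg, mnorm]
      rcases max_choice (euclNorm x) 1 with h | h <;> rw [h]
      · linarith
      · linarith [sq_nonneg (euclNorm x)]
    have h2 := Real.rpow_le_rpow_of_nonpos (pow_pos (mnorm_pos x) 2) h1
      (show -((d : ℝ) - 2) / 2 ≤ 0 by linarith)
    refine h2.trans (le_of_eq ?_)
    rw [decay, ← Real.rpow_natCast (mnorm x) 2, ← Real.rpow_mul (mnorm_pos x).le,
      ← Real.rpow_natCast (mnorm x) (d - 2), ← Real.rpow_neg (mnorm_pos x).le, Nat.cast_sub (by omega)]
    congr 1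
    push_cast
    ring
  rw [one_div, inv_mul_eq_div, le_div_iff₀ hδ]
  linarith

theorem freeGreen_eq (hJ : IsJumpRate J) {P : Site d → Measure (CadlagPath d)}
    (hP : ∀ a, IsWalkLaw J a (P a)) (x : Site d) :
    freeGreen P x = ∫⁻ r in Set.Ici (0 : ℝ), ENNReal.ofReal (transition J r x) := by
  have : IsProbabilityMeasure (P 0) := (hP 0).isProbabilityMeasure
  have hm : MeasurableSet {p : CadlagPath d × ℝ | p.1 p.2.toNNReal = x} := by
    have h1 : Measurable fun p : CadlagPath d × ℝ => p.1 p.2.toNNReal :=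
      CadlagPath.measurable_uncurry.comp
        ((measurable_real_toNNReal.comp measurable_snd).prodMk measurable_fst)
    exact h1 (measurableSet_singleton x)
  have e1 : ∀ ω : CadlagPath d, volume {r : ℝ | 0 ≤ r ∧ ω r.toNNReal = x} =
      ∫⁻ r in Set.Ici (0 : ℝ), {p : CadlagPath d × ℝ | p.1 p.2.toNNReal = x}.indicator 1 (ω, r) := by
    intro ω
    have hm2 : MeasurableSet {r : ℝ | ω r.toNNReal = x} := hm.preimage measurable_prodMk_left
    have e : {r : ℝ | 0 ≤ r ∧ ω r.toNNReal = x} = {r : ℝ | ω r.toNNReal = x} ∩ Set.Ici 0 := by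
      ext r; simp [and_comm]
    rw [e, ← Measure.restrict_apply hm2, ← lintegral_indicator_one hm2]
    rfl
  simp only [freeGreen, e1]
  rw [lintegral_lintegral_swap (f := fun (ω : CadlagPath d) (r : ℝ) =>
    {p : CadlagPath d × ℝ | p.1 p.2.toNNReal = x}.indicator 1 (ω, r))
    (measurable_one.indicator hm).aemeasurable]
  refine setLIntegral_congr_fun measurableSet_Ici fun r hr => ?_
  have hm3 : MeasurableSet {ω : CadlagPath d | ω r.toNNReal = x} :=
    CadlagPath.measurable_eval _ (measurableSet_singleton x)
  have h2 := (hP 0).marginal hJ r.toNNReal x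
  rw [← lintegral_indicator_one hm3, Real.coe_toNNReal r hr, sub_zero] at h2
  exact h2

/-- The bound on time intervals [0,n] is uniform in n and passes to the monotone limit. -/
theorem freeGreen_le (hJ : IsJumpRate J) (hd : 3 ≤ d) : ∃ C : ℝ, 0 < C ∧
    ∀ P : Site d → Measure (CadlagPath d), (∀ a, IsWalkLaw J a (P a)) →
      ∀ x, freeGreen P x ≤ ENNReal.ofReal (C * decay x) := by
  obtain ⟨C, hC, h⟩ := integral_transition_le hJ hd
  refine ⟨C, hC, fun P hP x => ?_⟩
  rw [freeGreen_eq hJ hP, setLIntegral_congr Ioi_ae_eq_Ici.symm]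
  have hU : Set.Ioi (0 : ℝ) = ⋃ n : ℕ, Set.Ioc (0 : ℝ) n := by
    ext r
    simp only [Set.mem_Ioi, Set.mem_iUnion, Set.mem_Ioc]
    exact ⟨fun hr => (exists_nat_ge r).imp fun n hn => ⟨hr, hn⟩, fun ⟨n, hn⟩ => hn.1⟩
  rw [hU, setLIntegral_iUnion_of_directed _ (Monotone.directed_le fun m n hmn =>
    Set.Ioc_subset_Ioc_right (by exact_mod_cast hmn))]
  refine iSup_le fun n => ?_
  have hn : (0 : ℝ) ≤ n := Nat.cast_nonneg n
  rw [← ofReal_integral_eq_lintegral_ofReal]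
  · rw [← intervalIntegral.integral_of_le hn]
    exact ENNReal.ofReal_le_ofReal (h n hn x)
  · exact ((continuous_transition hJ x).integrableOn_Ioc)
  · refine (ae_restrict_iff' measurableSet_Ioc).2 (Eventually.of_forall fun r hr => ?_)
    exact transition_nonneg hJ hr.1.le x

end Decay

end

noncomputable section

/-! ### Signed lace weights and their integrability -/

section Laces

variable {d : ℕ} {J : Site d → ℝ} {P : Site d → Measure (CadlagPath d)} {Z : WeightFamily d}
  {Λ : Finset (Site d)} {η κ : ℝ}

/-- The weight of a lace with `k + 1` intervals, as a function of its times. -/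
def laceValue (Z : WeightFamily d) (Λ : Finset (Site d)) (k : ℕ) (r : Fin (2 * k + 1) → ℝ)
    (ω : CadlagPath d) : ℝ :=
  partialWeight Z Λ ω (timesOf r) k * laceFactor Z Λ ω (timesOf r) k (timesOf r (2 * k + 1))

/-- The real-valued indicator of the event that the killed walk is at `x` at time `t`. -/
def posInd (Λ : Finset (Site d)) (ω : CadlagPath d) (t : ℝ) (x : Site d) : ℝ :=
  (atPos Λ ω t x).toReal

theorem posInd_of_eq {ω : CadlagPath d} {t : ℝ} {x : Site d}
    (h : killed Λ ω t.toNNReal = some x) : posInd Λ ω t x = 1 := by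
  rw [posInd, atPos_of_eq h, ENNReal.toReal_one]

theorem posInd_of_ne {ω : CadlagPath d} {t : ℝ} {x : Site d}
    (h : killed Λ ω t.toNNReal ≠ some x) : posInd Λ ω t x = 0 := by
  rw [posInd, atPos_of_ne h, ENNReal.toReal_zero]

theorem posInd_nonneg (ω : CadlagPath d) (t : ℝ) (x : Site d) : 0 ≤ posInd Λ ω t x :=
  ENNReal.toReal_nonneg

theorem ofReal_posInd (ω : CadlagPath d) (t : ℝ) (x : Site d) :
    ENNReal.ofReal (posInd Λ ω t x) = atPos Λ ω t x :=
  ENNReal.ofReal_toReal ((atPos_le_one ω t x).trans_lt ENNReal.one_lt_top).ne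

theorem measurable_posInd {α : Type*} [MeasurableSpace α] (x : Site d) {f : α → ℝ}
    {w : α → CadlagPath d} (hf : Measurable f) (hw : Measurable w) :
    Measurable fun a => posInd Λ (w a) (f a) x :=
  (measurable_atPos x hf hw).ennreal_toReal

theorem SmoothWeight.measurable_laceValue (hZ : SmoothWeight Z Λ) (k : ℕ) {α : Type*}
    [MeasurableSpace α] {f : α → Fin (2 * k + 1) → ℝ} {w : α → CadlagPath d} (hf : Measurable f)
    (hw : Measurable w) : Measurable fun a => laceValue Z Λ k (f a) (w a) := by
  have hτ : ∀ j, Measurable fun a => timesOf (f a) j := fun j => (measurable_timesOf j).comp hf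
  exact (hZ.measurable_partialWeight (τ := fun a => timesOf (f a)) hτ hw k).mul
    (hZ.measurable_laceFactor (τ := fun a => timesOf (f a)) hτ (hτ _) hw k)

theorem laceValue_snocT (k : ℕ) (q : Fin (2 * k) → ℝ) (t : ℝ) (ω : CadlagPath d) :
    laceValue Z Λ k (snocT q t) ω =
      partialWeight Z Λ ω (timesOf q) k * laceFactor Z Λ ω (timesOf q) k t := by
  have t1 : ∀ j ≤ 2 * k, timesOf (snocT q t) j = timesOf q j := fun j hj =>
    timesOf_snocT_of_le q t hj
  have t2 : timesOf (snocT q t) (2 * k + 1) = t := timesOf_snocT_last q t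
  rw [laceValue, t2, partialWeight_congr Z Λ ω t1, laceFactor_congr Z Λ ω t1]

theorem laceValue_stop {k : ℕ} {r : Fin (2 * k + 1) → ℝ} (hr : r ∈ incSet (2 * k + 1))
    (ω : CadlagPath d) : laceValue Z Λ k r (ω.stopAt (timesOf r (2 * k + 1)).toNNReal) =
      laceValue Z Λ k r ω := by
  have h1 : timesOf r (2 * k + 1) ≤ (timesOf r (2 * k + 1)).toNNReal := Real.le_coe_toNNReal _
  have h2 : timesOf r (2 * k) ≤ timesOf r (2 * k + 1) :=
    timesOf_le hr (Nat.le_succ _) (Nat.le_refl _)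
  rw [laceValue, laceValue, partialWeight_stop ω hr (Nat.le_succ _) (h2.trans h1),
    laceFactor_stop ω hr (Nat.le_succ _) h2 h1]

theorem SmoothWeight.laceIntegrand_eq (hZ : SmoothWeight Z Λ) (y : Site d) (k : ℕ)
    {r : Fin (2 * (k + 1) - 1) → ℝ} (hr : r ∈ laceSet (k + 1)) (ω : CadlagPath d) :
    laceIntegrand Z Λ y (k + 1) r ω =
      laceValue Z Λ k r ω * posInd Λ ω (timesOf (n := 2 * k + 1) r (2 * k + 1)) y := by
  have h1 : laceS' r (k + 1) = timesOf (n := 2 * k + 1) r (2 * k + 1) := by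
    show timesOf r (min (2 * (k + 1)) (2 * (k + 1) - 1)) = _
    rw [min_eq_right (by omega)]; rfl
  have h2 : laceWeight Z Λ ω r = laceValue Z Λ k r ω := hZ.laceWeight_eq ω k hr
  rw [laceIntegrand, h1, h2]
  split_ifs with h
  · rw [posInd_of_eq h, mul_one]
  · rw [posInd_of_ne h, mul_zero]

/-- Integration of a function over laces with `k + 1` intervals that end at `y`. -/
def laceInt (P : Site d → Measure (CadlagPath d)) (Λ : Finset (Site d)) (x : Site d) (n : ℕ)
    (F : (Fin n → ℝ) → CadlagPath d → ℝ≥0∞) (y : Site d) : ℝ≥0∞ :=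
  ∫⁻ r in incSet n, (∫⁻ ω, F r ω * atPos Λ ω (timesOf r n) y ∂P x)

variable (hZ : SmoothWeight Z Λ) (hP : ∀ a, IsWalkLaw J a (P a))

theorem laceInt_mono {x : Site d} {n : ℕ} {F G : (Fin n → ℝ) → CadlagPath d → ℝ≥0∞}
    (h : ∀ r ω, F r ω ≤ G r ω) (y : Site d) : laceInt P Λ x n F y ≤ laceInt P Λ x n G y :=
  lintegral_mono fun r => lintegral_mono fun ω => mul_le_mul_left (h r ω) _

include hP in
theorem measurable_laceInt_inner (x : Site d) {n : ℕ} {F : (Fin n → ℝ) → CadlagPath d → ℝ≥0∞}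
    (hF : Measurable fun p : (Fin n → ℝ) × CadlagPath d => F p.1 p.2) (y : Site d) :
    Measurable fun r => ∫⁻ ω, F r ω * atPos Λ ω (timesOf r n) y ∂P x := by
  have : IsProbabilityMeasure (P x) := (hP x).isProbabilityMeasure
  exact Measurable.lintegral_prod_right' (f := fun p : (Fin n → ℝ) × CadlagPath d =>
    F p.1 p.2 * atPos Λ p.2 (timesOf p.1 n) y)
    (hF.mul (measurable_atPos y ((measurable_timesOf n).comp measurable_fst) measurable_snd))

include hZ hP in
theorem laceInt_abs_eq (x : Site d) (k : ℕ) (y : Site d) :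
    laceInt P Λ x (2 * k + 1) (fun r ω => ENNReal.ofReal |laceValue Z Λ k r ω|) y =
      laceMass P Z Λ x k y := by
  have hF : Measurable fun p : (Fin (2 * k + 1) → ℝ) × CadlagPath d =>
      ENNReal.ofReal |laceValue Z Λ k p.1 p.2| :=
    (measurable_abs.comp (hZ.measurable_laceValue k measurable_fst measurable_snd)).ennreal_ofReal
  rw [laceInt, lintegral_incSet_succ (measurable_laceInt_inner hP x hF y), laceMass]
  refine lintegral_congr fun q => lintegral_congr fun t => lintegral_congr fun ω => ?_
  rw [laceValue_snocT, timesOf_snocT_last, laceAbs]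

include hZ hP in
theorem lintegral_laceIntegrand (x : Site d) (k : ℕ) (y : Site d) :
    ∫⁻ q, ‖laceValue Z Λ k q.1 q.2 * posInd Λ q.2 (timesOf q.1 (2 * k + 1)) y‖ₑ
      ∂((volume.restrict (incSet (2 * k + 1))).prod (P x)) = laceMass P Z Λ x k y := by
  have : IsProbabilityMeasure (P x) := (hP x).isProbabilityMeasure
  rw [← laceInt_abs_eq hZ hP, lintegral_prod]
  · refine lintegral_congr fun r => lintegral_congr fun ω => ?_
    rw [enorm_mul, Real.enorm_eq_ofReal_abs, Real.enorm_of_nonneg (posInd_nonneg _ _ _),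
      ofReal_posInd]
  · exact ((hZ.measurable_laceValue k measurable_fst measurable_snd).mul
      (measurable_posInd y ((measurable_timesOf _).comp measurable_fst)
        measurable_snd)).enorm.aemeasurable

include hZ hP in
theorem integrable_laceValue {x : Site d} {k : ℕ} {y : Site d} (hfin : laceMass P Z Λ x k y ≠ ∞) :
    Integrable (fun q : (Fin (2 * k + 1) → ℝ) × CadlagPath d =>
      laceValue Z Λ k q.1 q.2 * posInd Λ q.2 (timesOf q.1 (2 * k + 1)) y)
      ((volume.restrict (incSet (2 * k + 1))).prod (P x)) := by
  refine ⟨((hZ.measurable_laceValue k measurable_fst measurable_snd).mul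
      (measurable_posInd y ((measurable_timesOf _).comp measurable_fst)
        measurable_snd)).aestronglyMeasurable, ?_⟩
  rw [HasFiniteIntegral, lintegral_laceIntegrand hZ hP]
  exact hfin.lt_top

include hZ hP in
theorem integrable_laceIntegrand {x : Site d} {k : ℕ} {y : Site d}
    (hfin : laceMass P Z Λ x k y ≠ ∞) :
    Integrable (fun q : (Fin (2 * (k + 1) - 1) → ℝ) × CadlagPath d =>
        laceIntegrand Z Λ y (k + 1) q.1 q.2)
      ((volume.restrict (laceSet (k + 1))).prod (P x)) := by
  have : IsProbabilityMeasure (P x) := (hP x).isProbabilityMeasure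
  refine (integrable_laceValue hZ hP hfin).congr ?_
  have h1 : ∀ᵐ q ∂((volume.restrict (laceSet (k + 1))).prod (P x)), q.1 ∈ laceSet (k + 1) :=
    Measure.quasiMeasurePreserving_fst.ae
      (ae_restrict_mem (measurableSet_incSet (2 * (k + 1) - 1)))
  filter_upwards [h1] with q hq
  exact (hZ.laceIntegrand_eq y k hq q.2).symm

include hZ hP in
theorem lacePi_succ_eq {x : Site d} {k : ℕ} {y : Site d} (hfin : laceMass P Z Λ x k y ≠ ∞) :
    lacePi P Z Λ (k + 1) x y = ∫ q, laceValue Z Λ k q.1 q.2 *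
      posInd Λ q.2 (timesOf q.1 (2 * k + 1)) y
      ∂((volume.restrict (incSet (2 * k + 1))).prod (P x)) := by
  have : IsProbabilityMeasure (P x) := (hP x).isProbabilityMeasure
  rw [integral_prod _ (integrable_laceValue hZ hP hfin), lacePi]
  refine setIntegral_congr_fun (measurableSet_incSet (2 * (k + 1) - 1)) fun r hr => ?_
  exact integral_congr_ae (Eventually.of_forall fun ω => hZ.laceIntegrand_eq y k hr ω)

include hZ hP in
theorem abs_lacePi_le {x : Site d} {k : ℕ} {y : Site d} (hfin : laceMass P Z Λ x k y ≠ ∞) :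
    |lacePi P Z Λ (k + 1) x y| ≤ (laceMass P Z Λ x k y).toReal := by
  rw [lacePi_succ_eq hZ hP hfin, ← lintegral_laceIntegrand hZ hP, ← Real.norm_eq_abs]
  refine (norm_integral_le_lintegral_norm _).trans (le_of_eq ?_)
  simp only [ofReal_norm]

include hZ hP in
-- The Markov identities are proved for nonnegative integrands. Splitting the signed weight into its
-- positive and negative part carries them over.
theorem lacePi_eq_sub {x : Site d} {k : ℕ} {y : Site d} (hfin : laceMass P Z Λ x k y ≠ ∞) :
    lacePi P Z Λ (k + 1) x y =
      (laceInt P Λ x (2 * k + 1) (fun r ω => ENNReal.ofReal (laceValue Z Λ k r ω)) y).toReal -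
      (laceInt P Λ x (2 * k + 1) (fun r ω => ENNReal.ofReal (-laceValue Z Λ k r ω)) y).toReal := by
  have : IsProbabilityMeasure (P x) := (hP x).isProbabilityMeasure
  have hm := hZ.measurable_laceValue k (f := fun q : (Fin (2 * k + 1) → ℝ) × CadlagPath d => q.1)
    measurable_fst measurable_snd
  have hm2 : Measurable fun q : (Fin (2 * k + 1) → ℝ) × CadlagPath d =>
      posInd Λ q.2 (timesOf q.1 (2 * k + 1)) y :=
    measurable_posInd y ((measurable_timesOf _).comp measurable_fst) measurable_snd
  rw [lacePi_succ_eq hZ hP hfin,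
    integral_eq_lintegral_pos_part_sub_lintegral_neg_part (integrable_laceValue hZ hP hfin)]
  congr 2
  · refine (lintegral_prod _ (hm.mul hm2).ennreal_ofReal.aemeasurable).trans ?_
    refine lintegral_congr fun r => lintegral_congr fun ω => ?_
    simp only [Pi.mul_apply]
    rw [ENNReal.ofReal_mul' (posInd_nonneg _ _ _), ofReal_posInd]
  · refine (lintegral_prod _ (hm.mul hm2).neg.ennreal_ofReal.aemeasurable).trans ?_
    refine lintegral_congr fun r => lintegral_congr fun ω => ?_
    simp only [Pi.neg_apply, Pi.mul_apply]
    rw [← neg_mul, ENNReal.ofReal_mul' (posInd_nonneg _ _ _), ofReal_posInd]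

end Laces

/-! ### Convergence of the lace series in finite volume -/

section Bounds

variable {d : ℕ} {J : Site d → ℝ} {P : Site d → Measure (CadlagPath d)} {Z : WeightFamily d}
  {Λ : Finset (Site d)} {η κ : ℝ}

variable (hd : 5 ≤ d) (hZ : SmoothWeight Z Λ) (hJ : IsJumpRate J)
  (hP : ∀ a, IsWalkLaw J a (P a)) (hG : GreenLeZero P Z) (hV : VertexBound P Z η)
  (hη : 0 ≤ η) (hκ : 1 ≤ κ) (hg : ∀ x y, green P Z Λ 0 x y ≤ ENNReal.ofReal (κ * decay (x - y)))

include hd hZ hJ hP hG hV hη hκ hg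

theorem laceMass_ne_top (x : Site d) (k : ℕ) {y : Site d} (hy : y ∈ Λ) :
    laceMass P Z Λ x k y ≠ ∞ :=
  ((laceMass_le_decay hd hZ hJ hP hG hV hη hκ hg x k hy).trans_lt ENNReal.ofReal_lt_top).ne

theorem toReal_laceMass_le (x : Site d) (k : ℕ) {y : Site d} (hy : y ∈ Λ) :
    (laceMass P Z Λ x k y).toReal ≤ (laceConst d κ * η) ^ (k + 1) * decay (x - y) ^ 3 := by
  refine ENNReal.toReal_le_of_le_ofReal ?_ (laceMass_le_decay hd hZ hJ hP hG hV hη hκ hg x k hy)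
  exact mul_nonneg (pow_nonneg (mul_nonneg laceConst_nonneg hη) _) (pow_nonneg (decay_nonneg _) _)

theorem abs_lacePi_le_decay (x : Site d) (k : ℕ) {y : Site d} (hy : y ∈ Λ) :
    |lacePi P Z Λ (k + 1) x y| ≤ (laceConst d κ * η) ^ (k + 1) * decay (x - y) ^ 3 :=
  (abs_lacePi_le hZ hP (laceMass_ne_top hd hZ hJ hP hG hV hη hκ hg x k hy)).trans
    (toReal_laceMass_le hd hZ hJ hP hG hV hη hκ hg x k hy)

variable (hsmall : laceConst d κ * η ≤ 1 / 2)

include hsmall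

theorem summable_lacePi (x : Site d) {y : Site d} (hy : y ∈ Λ) :
    Summable fun k : ℕ => lacePi P Z Λ (k + 1) x y := by
  have hθ : 0 ≤ laceConst d κ * η := mul_nonneg laceConst_nonneg hη
  have h1 : Summable fun k : ℕ => (laceConst d κ * η) ^ (k + 1) * decay (x - y) ^ 3 :=
    ((summable_nat_add_iff 1).2 (summable_geometric_of_lt_one hθ (by linarith))).mul_right _
  exact Summable.of_norm_bounded h1 fun k =>
    abs_lacePi_le_decay hd hZ hJ hP hG hV hη hκ hg x k hy

theorem lacePsiConverges (x : Site d) {y : Site d} (hy : y ∈ Λ) : LacePsiConverges P Z Λ x y := by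
  refine ⟨fun m hm => ?_, summable_lacePi hd hZ hJ hP hG hV hη hκ hg hsmall x hy⟩
  obtain ⟨k, rfl⟩ : ∃ k, m = k + 1 := ⟨m - 1, by omega⟩
  exact integrable_laceIntegrand hZ hP (laceMass_ne_top hd hZ hJ hP hG hV hη hκ hg x k hy)

theorem abs_lacePsi_le (x : Site d) {y : Site d} (hy : y ∈ Λ) :
    |lacePsi P Z Λ x y| ≤ 2 * laceConst d κ * η * decay (x - y) ^ 3 := by
  have hθ : 0 ≤ laceConst d κ * η := mul_nonneg laceConst_nonneg hη
  have h3 : HasSum (fun k : ℕ => (laceConst d κ * η) ^ (k + 1) * decay (x - y) ^ 3)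
      (laceConst d κ * η * (1 - laceConst d κ * η)⁻¹ * decay (x - y) ^ 3) := by
    have := ((hasSum_geometric_of_lt_one hθ (by linarith)).mul_left
      (laceConst d κ * η)).mul_right (decay (x - y) ^ 3)
    refine this.congr_fun ?_
    intro k
    rw [pow_succ, mul_comm (_ ^ k)]
  have h1 := tsum_of_norm_bounded (f := fun k : ℕ => lacePi P Z Λ (k + 1) x y) h3 fun k =>
    abs_lacePi_le_decay hd hZ hJ hP hG hV hη hκ hg x k hy
  rw [Real.norm_eq_abs] at h1
  refine h1.trans ?_
  -- A ratio of at most 1/2 is used so that the whole geometric series is at most twice its first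
  -- term.
  have h4 : (1 - laceConst d κ * η)⁻¹ ≤ 2 := by
    rw [inv_le_comm₀ (by linarith) two_pos]; linarith
  have h5 := mul_le_mul_of_nonneg_left h4 hθ
  have h6 := mul_le_mul_of_nonneg_right h5 (pow_nonneg (decay_nonneg (x - y)) 3)
  linarith

end Bounds

end

noncomputable section

/-! ### Inserting times -/

section Insert

variable {n : ℕ}

/-- Inserting a time before the last one. -/
def insT (r : Fin (n + 1) → ℝ) (s : ℝ) : Fin (n + 2) → ℝ :=
  Fin.insertNth (α := fun _ => ℝ) (Fin.last n).castSucc s r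

theorem insT_snocT (q : Fin n → ℝ) (v s : ℝ) : insT (snocT q v) s = snocT (snocT q s) v := by
  have h0 : (Fin.last n).castSucc.succAbove (Fin.last n) = Fin.last (n + 1) := by
    ext; simp [Fin.succAbove]
  have h1 : ∀ j : Fin n, (Fin.last n).castSucc.succAbove j.castSucc = j.castSucc.castSucc := by
    intro j
    ext
    simp [Fin.succAbove, Fin.lt_def]
  funext i
  induction i using Fin.lastCases with
  | last =>
    rw [← h0, insT, Fin.insertNth_apply_succAbove, h0]
    simp [snocT]
  | cast i =>
    induction i using Fin.lastCases with
    | last => rw [insT, Fin.insertNth_apply_same]; simp [snocT]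
    | cast i =>
      rw [← h1, insT, Fin.insertNth_apply_succAbove, h1]
      simp [snocT]

theorem exists_eq_snocT (r : Fin (n + 1) → ℝ) : ∃ q v, r = snocT q v :=
  ⟨Fin.init r, r (Fin.last n), (Fin.snoc_init_self r).symm⟩

theorem timesOf_insT_of_le (r : Fin (n + 1) → ℝ) (s : ℝ) {j : ℕ} (hj : j ≤ n) :
    timesOf (insT r s) j = timesOf r j := by
  obtain ⟨q, v, rfl⟩ := exists_eq_snocT r
  rw [insT_snocT, timesOf_snocT_of_le _ _ (hj.trans (Nat.le_succ n)), timesOf_snocT_of_le _ _ hj,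
    timesOf_snocT_of_le _ _ hj]

theorem timesOf_insT_same (r : Fin (n + 1) → ℝ) (s : ℝ) : timesOf (insT r s) (n + 1) = s := by
  obtain ⟨q, v, rfl⟩ := exists_eq_snocT r
  rw [insT_snocT, timesOf_snocT_of_le _ _ le_rfl, timesOf_snocT_last]

theorem timesOf_insT_last (r : Fin (n + 1) → ℝ) (s : ℝ) :
    timesOf (insT r s) (n + 2) = timesOf r (n + 1) := by
  obtain ⟨q, v, rfl⟩ := exists_eq_snocT r
  rw [insT_snocT, timesOf_snocT_last, timesOf_snocT_last]

theorem insT_mem_incSet {r : Fin (n + 1) → ℝ} {s : ℝ} : insT r s ∈ incSet (n + 2) ↔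
    r ∈ incSet (n + 1) ∧ timesOf r n < s ∧ s < timesOf r (n + 1) := by
  obtain ⟨q, v, rfl⟩ := exists_eq_snocT r
  rw [insT_snocT, snocT_mem_incSet, snocT_mem_incSet, snocT_mem_incSet, timesOf_snocT_last,
    timesOf_snocT_last, timesOf_snocT_of_le _ _ le_rfl]
  constructor
  · rintro ⟨⟨h1, h2⟩, h3⟩
    exact ⟨⟨h1, h2.trans h3⟩, h2, h3⟩
  · rintro ⟨⟨h1, _⟩, h2, h3⟩
    exact ⟨⟨h1, h2⟩, h3⟩

theorem measurePreserving_insT :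
    MeasurePreserving (fun p : (Fin (n + 1) → ℝ) × ℝ => insT p.1 p.2) (volume.prod volume)
      volume := by
  have h1 := (volume_preserving_piFinSuccAbove (fun _ : Fin (n + 2) => ℝ)
    (Fin.last n).castSucc).symm
  have h2 : MeasurePreserving (Prod.swap : (Fin (n + 1) → ℝ) × ℝ → ℝ × (Fin (n + 1) → ℝ))
      (volume.prod volume) (volume.prod volume) := Measure.measurePreserving_swap
  exact h1.comp h2

/-- Inserting a time before the last one, and appending another one. -/
def insSnoc (p : (Fin (n + 1) → ℝ) × (ℝ × ℝ)) : Fin (n + 3) → ℝ := snocT (insT p.1 p.2.2) p.2.1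

/-- Adding an interval to a lace inserts a time before its old endpoint and appends a new endpoint.
In coordinates this only relabels variables, so Lebesgue measure is preserved. -/
theorem measurePreserving_insSnoc :
    MeasurePreserving (insSnoc (n := n)) (volume.prod (volume.prod volume)) volume := by
  have h1 : MeasurePreserving (fun p : (Fin (n + 1) → ℝ) × (ℝ × ℝ) => (p.1, p.2.swap))
      (volume.prod (volume.prod volume)) (volume.prod (volume.prod volume)) :=
    (MeasurePreserving.id volume).prod Measure.measurePreserving_swap
  have h2 := (measurePreserving_prodAssoc (volume : Measure (Fin (n + 1) → ℝ))
    (volume : Measure ℝ) (volume : Measure ℝ)).symm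
  have h3 : MeasurePreserving (Prod.map (fun p : (Fin (n + 1) → ℝ) × ℝ => insT p.1 p.2) id)
      ((volume.prod volume).prod volume) (volume.prod (volume : Measure ℝ)) :=
    measurePreserving_insT.prod (MeasurePreserving.id volume)
  exact measurePreserving_snocT.comp (h3.comp (h2.comp h1))

end Insert

/-! ### The remainder of the expansion -/

section Remainder

variable {d : ℕ} {J : Site d → ℝ} {P : Site d → Measure (CadlagPath d)} {Z : WeightFamily d}
  {Λ : Finset (Site d)} {η κ : ℝ}

/-- Times, the final time, and the path. -/
abbrev RemSpace (d n : ℕ) : Type := (ℝ × CadlagPath d) × (Fin n → ℝ)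

/-- The reference measure on `RemSpace`. -/
def remMeasure (μ : Measure (CadlagPath d)) (n : ℕ) : Measure (RemSpace d n) :=
  (volume.prod μ).prod volume

/-- Increasing times that are smaller than the final time. -/
def remSet (d n : ℕ) : Set (RemSpace d n) := {p | p.2 ∈ incSet n ∧ timesOf p.2 n < p.1.1}

theorem measurableSet_remSet (n : ℕ) : MeasurableSet (remSet d n) :=
  (measurable_snd (measurableSet_incSet n)).inter
    (measurableSet_lt ((measurable_timesOf n).comp measurable_snd) measurable_fst.fst)

theorem lintegral_remSet (μ : Measure (CadlagPath d)) [IsProbabilityMeasure μ] {n : ℕ}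
    {h : RemSpace d n → ℝ≥0∞} (hh : Measurable h) :
    ∫⁻ p, (remSet d n).indicator h p ∂remMeasure μ n =
      ∫⁻ r in incSet n, ∫⁻ l in Set.Ioi (timesOf r n), ∫⁻ ω, h ((l, ω), r) ∂μ := by
  have hm := hh.indicator (measurableSet_remSet (d := d) n)
  rw [remMeasure, lintegral_prod_symm _ hm.aemeasurable,
    ← lintegral_indicator (measurableSet_incSet n)]
  refine lintegral_congr fun r => ?_
  have hm2 : Measurable fun z : ℝ × CadlagPath d => (remSet d n).indicator h (z, r) :=
    hm.comp measurable_prodMk_right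
  rw [lintegral_prod _ hm2.aemeasurable]
  by_cases hr : r ∈ incSet n
  · rw [Set.indicator_of_mem hr, ← lintegral_indicator measurableSet_Ioi]
    refine lintegral_congr fun l => ?_
    by_cases hl : timesOf r n < l
    · rw [Set.indicator_of_mem (Set.mem_Ioi.2 hl)]
      exact lintegral_congr fun ω => Set.indicator_of_mem (show ((l, ω), r) ∈ remSet d n from ⟨hr, hl⟩) h
    · rw [Set.indicator_of_notMem (by simpa using hl)]
      refine (lintegral_congr fun ω => ?_).trans lintegral_zero
      exact Set.indicator_of_notMem (fun h' : ((l, ω), r) ∈ remSet d n => hl h'.2) h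
  · rw [Set.indicator_of_notMem hr]
    refine (lintegral_congr fun l => (lintegral_congr fun ω => ?_).trans lintegral_zero).trans
      lintegral_zero
    exact Set.indicator_of_notMem (fun h' : ((l, ω), r) ∈ remSet d n => hr h'.1) h

theorem atPos_eq_sum (ω : CadlagPath d) {s t : ℝ} (hst : s ≤ t) (b : Site d) :
    atPos Λ ω t b = ∑ c ∈ Λ, atPos Λ ω s c * atPos Λ ω t b := by
  by_cases hb : killed Λ ω t.toNNReal = some b
  · obtain ⟨c, hc, hk⟩ := exists_pos_of_killed hst hb
    rw [Finset.sum_eq_single c, atPos_of_eq hk, one_mul]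
    · intro c' _ hc'
      rw [atPos_of_ne (fun h => hc' (Option.some_injective _ (h.symm.trans hk))), zero_mul]
    · exact fun h => absurd hc h
  · rw [atPos_of_ne hb]; simp

/-- The change of the weight with base time `u` between the times `v` and `l`. -/
def growth (Z : WeightFamily d) (Λ : Finset (Site d)) (u v l : ℝ) (ω : CadlagPath d) : ℝ :=
  lrY Z Λ ω u l / lrY Z Λ ω u v

theorem SmoothWeight.growth_pos (hZ : SmoothWeight Z Λ) (u v l : ℝ) (ω : CadlagPath d) :
    0 < growth Z Λ u v l ω := div_pos (hZ.lrY_pos _ _ _) (hZ.lrY_pos _ _ _)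

theorem SmoothWeight.measurable_growth (hZ : SmoothWeight Z Λ) {α : Type*} [MeasurableSpace α]
    {u v l : α → ℝ} (hu : Measurable u) (hv : Measurable v) (hl : Measurable l)
    {w : α → CadlagPath d} (hw : Measurable w) :
    Measurable fun a => growth Z Λ (u a) (v a) (l a) (w a) :=
  (hZ.measurable_lrY hu hl hw).div (hZ.measurable_lrY hu hv hw)

section Split

variable (hZ : SmoothWeight Z Λ) (hJ : IsJumpRate J) (hP : ∀ a, IsWalkLaw J a (P a))

include hZ hP in
theorem lintegral_split (a : Site d) (u s : ℝ) {F : CadlagPath d → ℝ≥0∞} (hF : Measurable F)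
    (b : Site d) :
    ∫⁻ l in Set.Ioi s, (∫⁻ ω, F ω * (atPos Λ ω l b * ENNReal.ofReal (growth Z Λ u s l ω)) ∂P a) =
      ∑ c ∈ Λ, ∫⁻ l in Set.Ioi s, (∫⁻ ω, F ω * atPos Λ ω s c *
        (atPos Λ ω l b * ENNReal.ofReal (growth Z Λ u s l ω)) ∂P a) := by
  have : IsProbabilityMeasure (P a) := (hP a).isProbabilityMeasure
  have hm : ∀ c, Measurable fun p : ℝ × CadlagPath d => F p.2 * atPos Λ p.2 s c *
        (atPos Λ p.2 p.1 b * ENNReal.ofReal (growth Z Λ u s p.1 p.2)) := fun c =>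
    ((hF.comp measurable_snd).mul (measurable_atPos c measurable_const measurable_snd)).mul
      ((measurable_atPos b measurable_fst measurable_snd).mul
        (hZ.measurable_growth measurable_const measurable_const measurable_fst
          measurable_snd).ennreal_ofReal)
  rw [← lintegral_finsetSum _ fun c _ => (hm c).lintegral_prod_right']
  refine setLIntegral_congr_fun measurableSet_Ioi fun l hl => ?_
  have hm2 : ∀ c, Measurable fun ω : CadlagPath d => F ω * atPos Λ ω s c *
        (atPos Λ ω l b * ENNReal.ofReal (growth Z Λ u s l ω)) := fun c =>
    (hm c).comp (measurable_prodMk_left (x := l))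
  refine Eq.trans ?_ (lintegral_finsetSum Λ fun c _ => hm2 c)
  refine lintegral_congr fun ω => ?_
  conv_lhs => rw [atPos_eq_sum ω (le_of_lt hl) b]
  rw [Finset.sum_mul, Finset.mul_sum]
  exact Finset.sum_congr rfl fun c _ => by ring

include hZ hJ hP in
-- The walk must be somewhere in Λ at time s in order to reach b later, so a sum over that position
-- reduces to the one-step bound.
theorem lintegral_growth_le (hG : GreenLeZero P Z) (a : Site d) {u s : ℝ} (hs : 0 ≤ s)
    (hu : u ≤ s) {F : CadlagPath d → ℝ≥0∞} (hF : Measurable F)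
    (hFs : ∀ ω, F (ω.stopAt s.toNNReal) = F ω) {b : Site d} (hb : b ∈ Λ) :
    ∫⁻ l in Set.Ioi s, (∫⁻ ω, F ω * (atPos Λ ω l b * ENNReal.ofReal (growth Z Λ u s l ω)) ∂P a) ≤
      ∑ c ∈ Λ, (∫⁻ ω, F ω * atPos Λ ω s c ∂P a) * green P Z Λ 0 c b := by
  rw [lintegral_split hZ hP a u s hF b]
  exact Finset.sum_le_sum fun c hc => hZ.one_step_le hJ hP hG a hs hu hF hFs hc hb

include hZ hJ hP in
theorem lintegral_growth_self (a : Site d) {s : ℝ} (hs : 0 ≤ s)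
    {F : CadlagPath d → ℝ≥0∞} (hF : Measurable F)
    (hFs : ∀ ω, F (ω.stopAt s.toNNReal) = F ω) (b : Site d) :
    ∫⁻ l in Set.Ioi s, (∫⁻ ω, F ω * (atPos Λ ω l b * ENNReal.ofReal (growth Z Λ s s l ω)) ∂P a) =
      ∑ c ∈ Λ, (∫⁻ ω, F ω * atPos Λ ω s c ∂P a) * green P Z Λ 0 c b := by
  have : IsProbabilityMeasure (P a) := (hP a).isProbabilityMeasure
  rw [lintegral_split hZ hP a s s hF b]
  refine Finset.sum_congr rfl fun c _ => ?_
  have h := hZ.markov_weight_self hJ hP a s.toNNReal hF hFs c b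
  rw [Real.coe_toNNReal s hs] at h
  rw [← h, lintegral_lintegral_swap]
  · refine lintegral_congr fun ω => lintegral_congr fun l => ?_
    rw [growth, hZ.lrY_self, div_one]
  · have hm : Measurable fun p : ℝ × CadlagPath d => F p.2 * atPos Λ p.2 s c *
        (atPos Λ p.2 p.1 b * ENNReal.ofReal (growth Z Λ s s p.1 p.2)) :=
      ((hF.comp measurable_snd).mul (measurable_atPos c measurable_const measurable_snd)).mul
        ((measurable_atPos b measurable_fst measurable_snd).mul
          (hZ.measurable_growth measurable_const measurable_const measurable_fst
            measurable_snd).ennreal_ofReal)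
    exact hm.aemeasurable

end Split

/-- The integrand of the remainder after `k` steps; the parameter `j` is `2 * k` for the remainder
itself and `2 * k + 1` for its main part. -/
def remIntegrand (Z : WeightFamily d) (Λ : Finset (Site d)) (b : Site d) (k j : ℕ)
    (p : RemSpace d (2 * k + 1)) : ℝ :=
  laceValue Z Λ k p.2 p.1.2 * (posInd Λ p.1.2 p.1.1 b *
    growth Z Λ (timesOf p.2 j) (timesOf p.2 (2 * k + 1)) p.1.1 p.1.2)

/-- The remainder after `k` steps. -/
def remInt (P : Site d → Measure (CadlagPath d)) (Z : WeightFamily d) (Λ : Finset (Site d))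
    (k j : ℕ) (a b : Site d) : ℝ :=
  ∫ p, (remSet d (2 * k + 1)).indicator (remIntegrand Z Λ b k j) p ∂remMeasure (P a) (2 * k + 1)

theorem SmoothWeight.measurable_remIntegrand (hZ : SmoothWeight Z Λ) (b : Site d) (k j : ℕ) :
    Measurable (remIntegrand Z Λ b k j) := by
  have hτ : ∀ i, Measurable fun p : RemSpace d (2 * k + 1) => timesOf p.2 i := fun i =>
    (measurable_timesOf i).comp measurable_snd
  exact (hZ.measurable_laceValue k measurable_snd measurable_fst.snd).mul
    ((measurable_posInd b measurable_fst.fst measurable_fst.snd).mul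
      (hZ.measurable_growth (hτ j) (hτ _) measurable_fst.fst measurable_fst.snd))

variable (hZ : SmoothWeight Z Λ) (hJ : IsJumpRate J) (hP : ∀ a, IsWalkLaw J a (P a))
  (hG : GreenLeZero P Z)

include hZ hP in
-- The function g stands for the positive part, the negative part or the absolute value; only its
-- homogeneity under nonnegative factors matters.
theorem lintegral_pos_remIntegrand (a b : Site d) (k j : ℕ) {g : ℝ → ℝ≥0∞} (hg : Measurable g)
    (hg2 : ∀ x y, 0 ≤ y → g (x * y) = g x * ENNReal.ofReal y) :
    ∫⁻ p, (remSet d (2 * k + 1)).indicator (fun p => g (remIntegrand Z Λ b k j p)) p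
        ∂remMeasure (P a) (2 * k + 1) =
      ∫⁻ r in incSet (2 * k + 1), ∫⁻ l in Set.Ioi (timesOf r (2 * k + 1)), (∫⁻ ω,
        g (laceValue Z Λ k r ω) * (atPos Λ ω l b * ENNReal.ofReal
          (growth Z Λ (timesOf r j) (timesOf r (2 * k + 1)) l ω)) ∂P a) := by
  have : IsProbabilityMeasure (P a) := (hP a).isProbabilityMeasure
  refine (lintegral_remSet (P a) (h := fun p => g (remIntegrand Z Λ b k j p))
    (hg.comp (hZ.measurable_remIntegrand b k j))).trans ?_
  refine lintegral_congr fun r => lintegral_congr fun l => lintegral_congr fun ω => ?_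
  rw [remIntegrand, hg2 _ _ (mul_nonneg (posInd_nonneg _ _ _) (hZ.growth_pos _ _ _ _).le),
    ENNReal.ofReal_mul (posInd_nonneg _ _ _), ofReal_posInd]

include hP in
theorem lintegral_sum_laceInt (a b : Site d) (n : ℕ) {F : (Fin n → ℝ) → CadlagPath d → ℝ≥0∞}
    (hF : Measurable fun p : (Fin n → ℝ) × CadlagPath d => F p.1 p.2) :
    ∫⁻ r in incSet n, ∑ c ∈ Λ, (∫⁻ ω, F r ω * atPos Λ ω (timesOf r n) c ∂P a) * green P Z Λ 0 c b =
      ∑ c ∈ Λ, laceInt P Λ a n F c * green P Z Λ 0 c b := by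
  have hm := fun c => measurable_laceInt_inner (Λ := Λ) hP a hF c
  rw [lintegral_finsetSum _ fun c _ => (hm c).mul_const _]
  exact Finset.sum_congr rfl fun c _ => lintegral_mul_const _ (hm c)

include hZ hJ hP hG in
theorem lintegral_remIntegrand_le (a : Site d) {b : Site d} (hb : b ∈ Λ) (k : ℕ) {j : ℕ}
    (hj : j ≤ 2 * k + 1) :
    ∫⁻ p, ‖(remSet d (2 * k + 1)).indicator (remIntegrand Z Λ b k j) p‖ₑ
        ∂remMeasure (P a) (2 * k + 1) ≤
      ∑ c ∈ Λ, laceMass P Z Λ a k c * green P Z Λ 0 c b := by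
  have hF : Measurable fun p : (Fin (2 * k + 1) → ℝ) × CadlagPath d =>
      ENNReal.ofReal |laceValue Z Λ k p.1 p.2| :=
    (measurable_abs.comp (hZ.measurable_laceValue k measurable_fst measurable_snd)).ennreal_ofReal
  have e : ∀ p, ‖(remSet d (2 * k + 1)).indicator (remIntegrand Z Λ b k j) p‖ₑ =
      (remSet d (2 * k + 1)).indicator (fun p => ENNReal.ofReal |remIntegrand Z Λ b k j p|) p := by
    intro p
    rw [enorm_indicator_eq_indicator_enorm]
    simp only [Real.enorm_eq_ofReal_abs]
  simp only [e]
  rw [lintegral_pos_remIntegrand hZ hP a b k j (g := fun x => ENNReal.ofReal |x|)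
    (measurable_abs.ennreal_ofReal) (fun x y hy => by
      rw [abs_mul, abs_of_nonneg hy, ENNReal.ofReal_mul (abs_nonneg x)])]
  simp only [← laceInt_abs_eq hZ hP]
  rw [← lintegral_sum_laceInt hP a b (2 * k + 1)
    (F := fun r ω => ENNReal.ofReal |laceValue Z Λ k r ω|) hF]
  refine setLIntegral_mono' (measurableSet_incSet _) fun r hr => ?_
  have hF2 : Measurable fun ω => ENNReal.ofReal |laceValue Z Λ k r ω| :=
    (measurable_abs.comp (hZ.measurable_laceValue k measurable_const measurable_id)).ennreal_ofReal
  refine lintegral_growth_le hZ hJ hP hG a (timesOf_nonneg hr le_rfl) (timesOf_le hr hj le_rfl)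
    hF2 (fun ω => ?_) hb
  rw [laceValue_stop hr]

include hZ hJ hP hG in
theorem integrable_remIntegrand {a b : Site d} (hb : b ∈ Λ) {k : ℕ} {j : ℕ}
    (hj : j ≤ 2 * k + 1) (hfin : ∀ c ∈ Λ, laceMass P Z Λ a k c ≠ ∞)
    (hfin' : ∀ c ∈ Λ, green P Z Λ 0 c b ≠ ∞) :
    Integrable ((remSet d (2 * k + 1)).indicator (remIntegrand Z Λ b k j))
      (remMeasure (P a) (2 * k + 1)) := by
  refine ⟨((hZ.measurable_remIntegrand b k j).indicator
    (measurableSet_remSet _)).aestronglyMeasurable, ?_⟩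
  refine (lintegral_remIntegrand_le hZ hJ hP hG a hb k hj).trans_lt ?_
  exact ENNReal.sum_lt_top.2 fun c hc => ENNReal.mul_lt_top (hfin c hc).lt_top (hfin' c hc).lt_top

include hZ hJ hP hG in
theorem abs_remInt_le {a b : Site d} (hb : b ∈ Λ) {k : ℕ} {j : ℕ}
    (hj : j ≤ 2 * k + 1) (hfin : ∀ c ∈ Λ, laceMass P Z Λ a k c ≠ ∞)
    (hfin' : ∀ c ∈ Λ, green P Z Λ 0 c b ≠ ∞) :
    |remInt P Z Λ k j a b| ≤
      ∑ c ∈ Λ, (laceMass P Z Λ a k c).toReal * (green P Z Λ 0 c b).toReal := by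
  rw [← Real.norm_eq_abs]
  refine (norm_integral_le_lintegral_norm _).trans ?_
  simp only [ofReal_norm]
  have h := lintegral_remIntegrand_le hZ hJ hP hG a hb k hj
  have hne : ∀ c ∈ Λ, laceMass P Z Λ a k c * green P Z Λ 0 c b ≠ ∞ := fun c hc =>
    ENNReal.mul_ne_top (hfin c hc) (hfin' c hc)
  refine (ENNReal.toReal_mono (ENNReal.sum_ne_top.2 hne) h).trans (le_of_eq ?_)
  rw [ENNReal.toReal_sum hne]
  simp only [ENNReal.toReal_mul]

include hZ hJ hP hG in
-- With the base time at the endpoint of the lace, the later weight ignores the past, so the Markov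
-- property factorises exactly into the lace term and the Green's function. This is shown for each
-- sign separately.
theorem remInt_main {a b : Site d} (hb : b ∈ Λ) {k : ℕ}
    (hfin : ∀ c ∈ Λ, laceMass P Z Λ a k c ≠ ∞) (hfin' : ∀ c ∈ Λ, green P Z Λ 0 c b ≠ ∞) :
    remInt P Z Λ k (2 * k + 1) a b =
      ∑ c ∈ Λ, lacePi P Z Λ (k + 1) a c * (green P Z Λ 0 c b).toReal := by
  have key : ∀ g : ℝ → ℝ≥0∞, Measurable g → (∀ x y, 0 ≤ y → g (x * y) = g x * ENNReal.ofReal y) →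
      (∀ x, g x ≤ ENNReal.ofReal |x|) → g 0 = 0 →
      (∫⁻ p, g ((remSet d (2 * k + 1)).indicator (remIntegrand Z Λ b k (2 * k + 1)) p)
        ∂remMeasure (P a) (2 * k + 1)).toReal =
      ∑ c ∈ Λ, (laceInt P Λ a (2 * k + 1) (fun r ω => g (laceValue Z Λ k r ω)) c).toReal *
        (green P Z Λ 0 c b).toReal := by
    intro g hg hg2 hg3 hg0
    have e : ∀ p, g ((remSet d (2 * k + 1)).indicator (remIntegrand Z Λ b k (2 * k + 1)) p) =
        (remSet d (2 * k + 1)).indicator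
          (fun p => g (remIntegrand Z Λ b k (2 * k + 1) p)) p := by
      intro p
      by_cases hp : p ∈ remSet d (2 * k + 1)
      · rw [Set.indicator_of_mem hp, Set.indicator_of_mem hp]
      · rw [Set.indicator_of_notMem hp, Set.indicator_of_notMem hp, hg0]
    have hF : Measurable fun p : (Fin (2 * k + 1) → ℝ) × CadlagPath d =>
        g (laceValue Z Λ k p.1 p.2) :=
      hg.comp (hZ.measurable_laceValue k measurable_fst measurable_snd)
    simp only [e]
    rw [lintegral_pos_remIntegrand hZ hP a b k (2 * k + 1) hg hg2]
    have e2 : ∀ r ∈ incSet (2 * k + 1), ∫⁻ l in Set.Ioi (timesOf r (2 * k + 1)), (∫⁻ ω,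
        g (laceValue Z Λ k r ω) * (atPos Λ ω l b * ENNReal.ofReal
          (growth Z Λ (timesOf r (2 * k + 1)) (timesOf r (2 * k + 1)) l ω)) ∂P a) =
        ∑ c ∈ Λ, (∫⁻ ω, g (laceValue Z Λ k r ω) * atPos Λ ω (timesOf r (2 * k + 1)) c ∂P a) *
          green P Z Λ 0 c b := by
      intro r hr
      have hF2 : Measurable fun ω => g (laceValue Z Λ k r ω) :=
        hg.comp (hZ.measurable_laceValue k measurable_const measurable_id)
      refine lintegral_growth_self hZ hJ hP a (timesOf_nonneg hr le_rfl) hF2 (fun ω => ?_) b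
      rw [laceValue_stop hr]
    rw [setLIntegral_congr_fun (measurableSet_incSet _) e2, lintegral_sum_laceInt hP a b
      (2 * k + 1) (F := fun r ω => g (laceValue Z Λ k r ω)) hF, ENNReal.toReal_sum]
    · simp only [ENNReal.toReal_mul]
    · intro c hc
      refine ENNReal.mul_ne_top (ne_top_of_le_ne_top (hfin c hc) ?_) (hfin' c hc)
      rw [← laceInt_abs_eq hZ hP]
      exact laceInt_mono (fun r ω => hg3 _) c
  rw [remInt, integral_eq_lintegral_pos_part_sub_lintegral_neg_part
    (integrable_remIntegrand hZ hJ hP hG hb le_rfl hfin hfin')]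
  have k1 := key (fun x => ENNReal.ofReal x) ENNReal.measurable_ofReal
    (fun x y hy => ENNReal.ofReal_mul' hy) (fun x => ENNReal.ofReal_le_ofReal (le_abs_self x))
    ENNReal.ofReal_zero
  have k2 := key (fun x => ENNReal.ofReal (-x)) (ENNReal.measurable_ofReal.comp measurable_neg)
    (fun x y hy => by rw [← neg_mul, ENNReal.ofReal_mul' hy])
    (fun x => ENNReal.ofReal_le_ofReal (neg_le_abs x)) (by simp)
  rw [k1, k2, ← Finset.sum_sub_distrib]
  refine Finset.sum_congr rfl fun c hc => ?_
  rw [lacePi_eq_sub hZ hP (hfin c hc)]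
  ring

end Remainder

end

noncomputable section

/-! ### One step of the lace expansion of the remainder -/

section Recursion

variable {d : ℕ} {J : Site d → ℝ} {P : Site d → Measure (CadlagPath d)} {Z : WeightFamily d}
  {Λ : Finset (Site d)} {η κ : ℝ}

theorem measurePreserving_remSpace (μ : Measure (CadlagPath d)) [IsProbabilityMeasure μ] (n : ℕ) :
    MeasurePreserving
      (fun p : RemSpace d (n + 1) × (ℝ × ℝ) => ((p.1.1, insSnoc (p.1.2, p.2)) : RemSpace d (n + 3)))
      ((remMeasure μ (n + 1)).prod (volume.prod volume)) (remMeasure μ (n + 3)) := by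
  have h1 := measurePreserving_prodAssoc ((volume : Measure ℝ).prod μ)
    (volume : Measure (Fin (n + 1) → ℝ)) ((volume : Measure ℝ).prod (volume : Measure ℝ))
  have h2 : MeasurePreserving (Prod.map id (insSnoc (n := n)))
      (((volume : Measure ℝ).prod μ).prod (volume.prod (volume.prod volume)))
      (((volume : Measure ℝ).prod μ).prod volume) :=
    (MeasurePreserving.id _).prod measurePreserving_insSnoc
  exact h2.comp h1

/-- The old endpoint, index 2k + 1, moves to index 2k + 2 and becomes s_{k+1}', so the old weight is
unchanged. The new factor is precisely the part of the integrand of `lrY_div_expansion` that depends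
on t and s but not on the final time. -/
theorem laceValue_insSnoc (k : ℕ) (r : Fin (2 * k + 1) → ℝ) (t s : ℝ) (ω : CadlagPath d) :
    laceValue Z Λ (k + 1) (insSnoc (r, (t, s))) ω = laceValue Z Λ k r ω * (vtx Z Λ ω s t *
      (lrY Z Λ ω (timesOf r (2 * k)) t /
        lrY Z Λ ω (timesOf r (2 * k)) (timesOf r (2 * k + 1)))) := by
  have t1 : ∀ j ≤ 2 * k, timesOf (insSnoc (r, (t, s))) j = timesOf r j := fun j hj => by
    rw [insSnoc, timesOf_snocT_of_le _ _ (by omega), timesOf_insT_of_le _ _ hj]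
  have t2 : timesOf (insSnoc (r, (t, s))) (2 * k + 1) = s := by
    rw [insSnoc, timesOf_snocT_of_le _ _ (by omega), timesOf_insT_same]
  have t3 : timesOf (insSnoc (r, (t, s))) (2 * k + 2) = timesOf r (2 * k + 1) := by
    rw [insSnoc, timesOf_snocT_of_le _ _ (by omega), timesOf_insT_last]
  have t4 : timesOf (insSnoc (r, (t, s))) (2 * k + 3) = t := by
    rw [insSnoc, timesOf_snocT_last]
  have e1 : 2 * (k + 1) - 1 = 2 * k + 1 := by omega
  have e2 : 2 * (k + 1) = 2 * k + 2 := by omega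
  unfold laceValue
  generalize timesOf (insSnoc (r, (t, s))) = τ at *
  rw [partialWeight_succ, partialWeight_congr _ _ _ t1,
    laceFactor_congr _ _ _ t1, t3]
  congr 1
  unfold laceFactor
  rw [e1, e2, t2, t3, Nat.add_sub_cancel, t1 _ le_rfl]
  rw [show 2 * k + 2 + 1 = 2 * k + 3 by omega, t4]

/-- For a fixed old lace the new pair of times ranges over a rectangle, the domain of the double
integral in `lrY_div_expansion`. -/
theorem insSnoc_mem_remSet {n : ℕ} {z : ℝ × CadlagPath d} {r : Fin (n + 1) → ℝ} {t s : ℝ} :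
    ((z, insSnoc (r, (t, s))) : RemSpace d (n + 3)) ∈ remSet d (n + 3) ↔
      ((z, r) : RemSpace d (n + 1)) ∈ remSet d (n + 1) ∧
        (t, s) ∈ Set.Ioo (timesOf r (n + 1)) z.1 ×ˢ Set.Ioo (timesOf r n) (timesOf r (n + 1)) := by
  simp only [remSet, Set.mem_ofPred_eq, insSnoc, snocT_mem_incSet, insT_mem_incSet,
    timesOf_snocT_last, timesOf_insT_last, Set.mem_prod, Set.mem_Ioo]
  constructor
  · rintro ⟨⟨⟨h1, h2, h3⟩, h4⟩, h5⟩
    exact ⟨⟨h1, h4.trans h5⟩, ⟨h4, h5⟩, h2, h3⟩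
  · rintro ⟨⟨h1, _⟩, ⟨h4, h5⟩, h2, h3⟩
    exact ⟨⟨⟨h1, h2, h3⟩, h4⟩, h5⟩

variable (hZ : SmoothWeight Z Λ) (hJ : IsJumpRate J) (hP : ∀ a, IsWalkLaw J a (P a))
  (hG : GreenLeZero P Z)

include hZ in
theorem remIntegrand_insSnoc (b : Site d) (k : ℕ) (p : RemSpace d (2 * k + 1))
    (hp : p ∈ remSet d (2 * k + 1)) (q : ℝ × ℝ) :
    (remSet d (2 * k + 3)).indicator (remIntegrand Z Λ b (k + 1) (2 * k + 2))
        (p.1, insSnoc (p.2, q)) =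
      laceValue Z Λ k p.2 p.1.2 * posInd Λ p.1.2 p.1.1 b *
        (Set.Ioo (timesOf p.2 (2 * k + 1)) p.1.1 ×ˢ
          Set.Ioo (timesOf p.2 (2 * k)) (timesOf p.2 (2 * k + 1))).indicator
        (fun q => vertexFn Z Λ p.1.2 q.2 q.1 * (lrY Z Λ p.1.2 (timesOf p.2 (2 * k)) q.1 /
          lrY Z Λ p.1.2 (timesOf p.2 (2 * k)) (timesOf p.2 (2 * k + 1))) *
          (lrY Z Λ p.1.2 (timesOf p.2 (2 * k + 1)) p.1.1 /
            lrY Z Λ p.1.2 (timesOf p.2 (2 * k + 1)) q.1)) q := by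
  obtain ⟨⟨l, ω⟩, r⟩ := p
  obtain ⟨t, s⟩ := q
  by_cases hq : (t, s) ∈ Set.Ioo (timesOf r (2 * k + 1)) l ×ˢ
      Set.Ioo (timesOf r (2 * k)) (timesOf r (2 * k + 1))
  · rw [Set.indicator_of_mem (insSnoc_mem_remSet.2 ⟨hp, hq⟩), Set.indicator_of_mem hq]
    have h0 : 0 ≤ s := (timesOf_nonneg hp.1 (by omega)).trans hq.2.1.le
    have hst : s < t := hq.2.2.trans hq.1.1
    unfold remIntegrand growth
    have t3 : timesOf (insSnoc (r, (t, s))) (2 * k + 2) = timesOf r (2 * k + 1) := by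
      rw [insSnoc, timesOf_snocT_of_le _ _ (by omega), timesOf_insT_last]
    have t4 : timesOf (insSnoc (r, (t, s))) (2 * (k + 1) + 1) = t := timesOf_snocT_last _ _
    simp only [laceValue_insSnoc, hZ.vertexFn_eq_vtx ω h0 hst]
    erw [t3, t4]
    ring
  · rw [Set.indicator_of_notMem (fun h => hq (insSnoc_mem_remSet.1 h).2),
      Set.indicator_of_notMem hq, mul_zero]

include hZ in
theorem setIntegral_expansion (ω : CadlagPath d) {a b l : ℝ} (ha : 0 ≤ a) (hab : a ≤ b)
    (hbl : b ≤ l)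
    (hint : IntegrableOn (fun q : ℝ × ℝ => vertexFn Z Λ ω q.2 q.1 *
      (lrY Z Λ ω a q.1 / lrY Z Λ ω a b) * (lrY Z Λ ω b l / lrY Z Λ ω b q.1))
      (Set.Ioo b l ×ˢ Set.Ioo a b) (volume.prod volume)) :
    ∫ q in Set.Ioo b l ×ˢ Set.Ioo a b, vertexFn Z Λ ω q.2 q.1 *
      (lrY Z Λ ω a q.1 / lrY Z Λ ω a b) * (lrY Z Λ ω b l / lrY Z Λ ω b q.1)
        ∂(volume.prod volume) =
      lrY Z Λ ω a l / lrY Z Λ ω a b - lrY Z Λ ω b l := by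
  rw [setIntegral_prod _ hint, hZ.lrY_div_expansion ω ha hab hbl, add_sub_cancel_left,
    intervalIntegral.integral_of_le hbl, integral_Ioc_eq_integral_Ioo]
  refine setIntegral_congr_fun measurableSet_Ioo fun t _ => ?_
  simp only
  rw [intervalIntegral.integral_of_le hab, integral_Ioc_eq_integral_Ioo]

include hZ hJ hP hG in
-- Fibrewise over the old lace, final time and path, this is `lrY_div_expansion` between s_k' and
-- the old endpoint: replacing the base time s_k' by that endpoint leaves exactly the integral over
-- the added interval. Absolute integrability justifies the use of Fubini's theorem.
theorem remInt_succ {a b : Site d} (hb : b ∈ Λ) (k : ℕ)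
    (hfin : ∀ k, ∀ c ∈ Λ, laceMass P Z Λ a k c ≠ ∞) (hfin' : ∀ c ∈ Λ, green P Z Λ 0 c b ≠ ∞) :
    remInt P Z Λ (k + 1) (2 * (k + 1)) a b =
      remInt P Z Λ k (2 * k) a b - remInt P Z Λ k (2 * k + 1) a b := by
  have : IsProbabilityMeasure (P a) := (hP a).isProbabilityMeasure
  have : SFinite (remMeasure (P a) (2 * k + 1)) := by unfold remMeasure; infer_instance
  have i1 := integrable_remIntegrand hZ hJ hP hG hb (k := k + 1) (j := 2 * (k + 1)) (by omega)
    (hfin (k + 1)) hfin'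
  have i2 := integrable_remIntegrand hZ hJ hP hG hb (k := k) (j := 2 * k) (by omega)
    (hfin k) hfin'
  have i3 := integrable_remIntegrand hZ hJ hP hG hb (k := k) (j := 2 * k + 1) (by omega)
    (hfin k) hfin'
  have hmp := measurePreserving_remSpace (P a) (2 * k)
  have i4 : Integrable (fun p : RemSpace d (2 * k + 1) × (ℝ × ℝ) =>
      (remSet d (2 * k + 3)).indicator (remIntegrand Z Λ b (k + 1) (2 * k + 2))
        (p.1.1, insSnoc (p.1.2, p.2)))
      ((remMeasure (P a) (2 * k + 1)).prod (volume.prod volume)) := hmp.integrable_comp_of_integrable i1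
  have e1 : remInt P Z Λ (k + 1) (2 * (k + 1)) a b = ∫ p : RemSpace d (2 * k + 1) × (ℝ × ℝ),
      (remSet d (2 * k + 3)).indicator (remIntegrand Z Λ b (k + 1) (2 * k + 2))
        (p.1.1, insSnoc (p.1.2, p.2)) ∂(remMeasure (P a) (2 * k + 1)).prod (volume.prod volume) := by
    have := integral_map hmp.measurable.aemeasurable
      (f := (remSet d (2 * k + 3)).indicator (remIntegrand Z Λ b (k + 1) (2 * k + 2)))
      (by rw [hmp.map_eq]; exact i1.aestronglyMeasurable)
    rw [hmp.map_eq] at this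
    exact this
  rw [e1, integral_prod _ i4, remInt, remInt, ← integral_sub i2 i3]
  refine integral_congr_ae ?_
  filter_upwards [i4.prod_right_ae] with p hp
  by_cases hps : p ∈ remSet d (2 * k + 1)
  · rw [Set.indicator_of_mem hps, Set.indicator_of_mem hps]
    simp only [remIntegrand_insSnoc hZ b k p hps] at hp ⊢
    rw [integral_const_mul, integral_indicator (measurableSet_Ioo.prod measurableSet_Ioo)]
    unfold remIntegrand
    -- Integrability of the inner integrand on the fibre follows from Fubini's theorem only where
    -- its prefactor does not vanish; otherwise both sides are 0.
    by_cases hz : laceValue Z Λ k p.2 p.1.2 * posInd Λ p.1.2 p.1.1 b = 0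
    · rw [hz, zero_mul, ← mul_assoc, ← mul_assoc, hz, zero_mul, zero_mul, sub_zero]
    · have hp' := (integrable_const_mul_iff (IsUnit.mk0 _ hz) _).1 hp
      rw [integrable_indicator_iff (measurableSet_Ioo.prod measurableSet_Ioo)] at hp'
      rw [setIntegral_expansion hZ p.1.2 (timesOf_nonneg hps.1 (by omega))
        (timesOf_le hps.1 (by omega) (by omega)) hps.2.le hp']
      rw [growth, growth, hZ.lrY_self, div_one]
      ring
  · rw [Set.indicator_of_notMem hps, Set.indicator_of_notMem hps, sub_zero]
    refine (integral_congr_ae (Eventually.of_forall fun q => ?_)).trans (integral_zero _ _)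
    exact Set.indicator_of_notMem (fun h => hps (insSnoc_mem_remSet.1 h).1) _

include hZ hJ hP hG in
theorem remInt_zero_eq_sum {a b : Site d} (hb : b ∈ Λ)
    (hfin : ∀ k, ∀ c ∈ Λ, laceMass P Z Λ a k c ≠ ∞) (hfin' : ∀ c ∈ Λ, green P Z Λ 0 c b ≠ ∞)
    (n : ℕ) :
    remInt P Z Λ 0 0 a b = ∑ k ∈ Finset.range n, ∑ c ∈ Λ,
      lacePi P Z Λ (k + 1) a c * (green P Z Λ 0 c b).toReal + remInt P Z Λ n (2 * n) a b := by
  induction n with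
  | zero => simp
  | succ n ih =>
    rw [ih, Finset.sum_range_succ, remInt_succ hZ hJ hP hG hb n hfin hfin',
      remInt_main hZ hJ hP hG hb (hfin n) hfin']
    ring

end Recursion

/-! ### Vanishing of the remainder -/

section Limit

variable {d : ℕ} {J : Site d → ℝ} {P : Site d → Measure (CadlagPath d)} {Z : WeightFamily d}
  {Λ : Finset (Site d)} {η κ : ℝ}

variable (hd : 5 ≤ d) (hZ : SmoothWeight Z Λ) (hJ : IsJumpRate J)
  (hP : ∀ a, IsWalkLaw J a (P a)) (hG : GreenLeZero P Z) (hV : VertexBound P Z η)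
  (hη : 0 ≤ η) (hκ : 1 ≤ κ) (hg : ∀ x y, green P Z Λ 0 x y ≤ ENNReal.ofReal (κ * decay (x - y)))
  (hsmall : laceConst d κ * η ≤ 1 / 2)

include hd hZ hJ hP hG hV hη hκ hg hsmall

/-- The recursion telescopes. The remainder after n steps obeys the same bound as a lace term
convolved with G, hence decays geometrically. -/
theorem remInt_zero_eq (a : Site d) {b : Site d} (hb : b ∈ Λ) :
    remInt P Z Λ 0 0 a b = ∑ c ∈ Λ, lacePsi P Z Λ a c * (green P Z Λ 0 c b).toReal := by
  have hfin : ∀ k, ∀ c ∈ Λ, laceMass P Z Λ a k c ≠ ∞ := fun k c hc =>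
    laceMass_ne_top hd hZ hJ hP hG hV hη hκ hg a k hc
  have hfin' : ∀ c ∈ Λ, green P Z Λ 0 c b ≠ ∞ := fun c _ =>
    ((hg c b).trans_lt ENNReal.ofReal_lt_top).ne
  have hθ : 0 ≤ laceConst d κ * η := mul_nonneg laceConst_nonneg hη
  have h1 : Tendsto (fun n => remInt P Z Λ n (2 * n) a b) atTop (𝓝 0) := by
    have h2 : Tendsto (fun n : ℕ => ∑ c ∈ Λ, (laceConst d κ * η) ^ (n + 1) * decay (a - c) ^ 3 *
        (green P Z Λ 0 c b).toReal) atTop (𝓝 0) := by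
      rw [show (0 : ℝ) = ∑ _c ∈ Λ, (0 : ℝ) by simp]
      refine tendsto_finsetSum _ fun c _ => ?_
      have := (((tendsto_pow_atTop_nhds_zero_of_lt_one hθ (by linarith)).comp
        (tendsto_add_atTop_nat 1)).mul_const (decay (a - c) ^ 3)).mul_const
        (green P Z Λ 0 c b).toReal
      simpa using this
    refine squeeze_zero_norm (fun n => ?_) h2
    rw [Real.norm_eq_abs]
    refine (abs_remInt_le hZ hJ hP hG hb (by omega) (hfin n) hfin').trans ?_
    refine Finset.sum_le_sum fun c hc => mul_le_mul_of_nonneg_right ?_ ENNReal.toReal_nonneg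
    exact toReal_laceMass_le hd hZ hJ hP hG hV hη hκ hg a n hc
  have h3 : Tendsto (fun n : ℕ => ∑ k ∈ Finset.range n, ∑ c ∈ Λ,
      lacePi P Z Λ (k + 1) a c * (green P Z Λ 0 c b).toReal) atTop
      (𝓝 (∑ c ∈ Λ, lacePsi P Z Λ a c * (green P Z Λ 0 c b).toReal)) := by
    simp only [Finset.sum_comm (s := Finset.range _), ← Finset.sum_mul]
    refine tendsto_finsetSum _ fun c hc => Tendsto.mul_const _ ?_
    exact (summable_lacePi hd hZ hJ hP hG hV hη hκ hg hsmall a hc).hasSum.tendsto_sum_nat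
  have h4 := h3.add h1
  rw [add_zero] at h4
  simp only [← remInt_zero_eq_sum hZ hJ hP hG hb hfin hfin'] at h4
  exact tendsto_nhds_unique tendsto_const_nhds h4

end Limit

end

noncomputable section

/-! ### Short-time behaviour of the killed walk -/

section ShortTime

variable {d : ℕ} {J : Site d → ℝ} {P : Site d → Measure (CadlagPath d)} {Λ : Finset (Site d)}

variable (hJ : IsJumpRate J) (hP : ∀ a, IsWalkLaw J a (P a))

include hJ hP in
-- The event D is determined by the path up to t, so the Markov property at t leaves one transition
-- to c, which B bounds.
theorem measure_inter_end_le (a c : Site d) {t h : ℝ≥0} (hth : t ≤ h) {D : Set (CadlagPath d)}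
    (hD : MeasurableSet D) (hDs : ∀ ω, ω.stopAt t ∈ D ↔ ω ∈ D) {B : ℝ≥0∞}
    (hB : ∀ ω ∈ D, ENNReal.ofReal (transition J ((h - t : ℝ≥0) : ℝ) (c - ω t)) ≤ B) :
    P a (D ∩ {ω | ω h = c}) ≤ B * P a D := by
  have hE : MeasurableSet {ω : CadlagPath d | ω (h - t) = c} :=
    CadlagPath.measurable_eval _ (measurableSet_singleton c)
  have hE' : MeasurableSet {ω : CadlagPath d | ω h = c} :=
    CadlagPath.measurable_eval _ (measurableSet_singleton c)
  have hDi : Measurable (D.indicator (1 : CadlagPath d → ℝ≥0∞)) := measurable_one.indicator hD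
  have hEi : Measurable ({ω : CadlagPath d | ω (h - t) = c}.indicator (1 : CadlagPath d → ℝ≥0∞)) :=
    measurable_one.indicator hE
  have hDs' : ∀ ω, D.indicator (1 : CadlagPath d → ℝ≥0∞) (ω.stopAt t) = D.indicator 1 ω := by
    intro ω
    by_cases hω : ω ∈ D
    · rw [Set.indicator_of_mem hω, Set.indicator_of_mem ((hDs ω).2 hω)]; rfl
    · rw [Set.indicator_of_notMem hω, Set.indicator_of_notMem (fun h => hω ((hDs ω).1 h))]
  have h1 := markov_property hJ hP a t
    (Φ := fun p => D.indicator 1 p.1 * {ω : CadlagPath d | ω (h - t) = c}.indicator 1 p.2)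
    ((hDi.comp measurable_fst).mul (hEi.comp measurable_snd))
  simp only [hDs'] at h1
  have e1 : ∫⁻ ω : CadlagPath d, D.indicator 1 ω *
      {ω : CadlagPath d | ω (h - t) = c}.indicator 1 (ω.shift t) ∂P a =
        P a (D ∩ {ω | ω h = c}) := by
    rw [← lintegral_indicator_one (hD.inter hE')]
    refine lintegral_congr fun ω => ?_
    rw [Set.inter_indicator_one, Pi.mul_apply]
    congr 1
    by_cases hω : ω h = c
    · rw [Set.indicator_of_mem (show ω ∈ {ω : CadlagPath d | ω h = c} from hω),
        Set.indicator_of_mem]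
      · rfl
      · simpa [add_tsub_cancel_of_le hth] using hω
    · rw [Set.indicator_of_notMem (show ω ∉ {ω : CadlagPath d | ω h = c} from hω),
        Set.indicator_of_notMem]
      simpa [add_tsub_cancel_of_le hth] using hω
  rw [← e1, h1, ← lintegral_indicator_one hD, ← lintegral_const_mul _ hDi]
  refine lintegral_mono fun ω => ?_
  beta_reduce
  rw [lintegral_const_mul _ hEi, lintegral_indicator_one hE, (hP (ω t)).marginal hJ, mul_comm]
  by_cases hω : ω ∈ D
  · gcongr
    exact hB ω hω
  · rw [Set.indicator_of_notMem hω, mul_zero, mul_zero]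

include hJ hP in
-- Decomposing according to the first grid time at which the walk is outside Λ gives disjoint
-- events, each determined by the path up to that time. This replaces a strong Markov property at
-- the exit time.
theorem measure_exit_grid_le (a c : Site d) {h : ℝ≥0} (F : Finset ℝ≥0) (hF : ∀ t ∈ F, t ≤ h)
    {B : ℝ≥0∞} (hB : ∀ t ≤ h, ∀ x ∉ Λ, ENNReal.ofReal (transition J (t : ℝ) (c - x)) ≤ B) :
    P a ((⋃ t ∈ F, {ω | ω t ∉ Λ}) ∩ {ω | ω h = c}) ≤ B * P a (⋃ t ∈ F, {ω | ω t ∉ Λ}) := by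
  set D : ℝ≥0 → Set (CadlagPath d) := fun t => {ω | ω t ∉ Λ ∧ ∀ s ∈ F, s < t → ω s ∈ Λ} with hDdef
  have hΛ : MeasurableSet (Λ : Set (Site d)) := Λ.countable_toSet.measurableSet
  have hDm : ∀ t, MeasurableSet (D t) := by
    intro t
    have : D t = (fun ω : CadlagPath d => ω t) ⁻¹' (Λ : Set (Site d))ᶜ ∩
        ⋂ s ∈ F.filter (· < t), (fun ω : CadlagPath d => ω s) ⁻¹' (Λ : Set (Site d)) := by
      ext ω
      simp [hDdef]
    rw [this]
    exact (CadlagPath.measurable_eval t hΛ.compl).inter (Finset.measurableSet_biInter _ fun s _ =>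
      CadlagPath.measurable_eval s hΛ)
  have hdisj : (F : Set ℝ≥0).PairwiseDisjoint D := by
    intro s hs t ht hst
    refine Set.disjoint_left.2 fun ω h1 h2 => ?_
    rcases lt_or_gt_of_ne hst with h | h
    · exact h1.1 (h2.2 s hs h)
    · exact h2.1 (h1.2 t ht h)
  have hU : (⋃ t ∈ F, {ω : CadlagPath d | ω t ∉ Λ}) = ⋃ t ∈ F, D t := by
    ext ω
    simp only [Set.mem_iUnion, Set.mem_ofPred_eq, exists_prop, hDdef]
    constructor
    · rintro ⟨t, ht, hω⟩
      have hne : (F.filter fun s => ω s ∉ Λ).Nonempty := ⟨t, Finset.mem_filter.2 ⟨ht, hω⟩⟩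
      have hmem := Finset.mem_filter.1 (Finset.min'_mem _ hne)
      refine ⟨_, hmem.1, hmem.2, fun s hs hlt => ?_⟩
      by_contra hc
      exact absurd (Finset.min'_le _ s (Finset.mem_filter.2 ⟨hs, hc⟩)) (not_le.2 hlt)
    · rintro ⟨t, ht, hω, _⟩
      exact ⟨t, ht, hω⟩
  rw [hU, Set.iUnion₂_inter]
  refine (measure_biUnion_finset_le _ _).trans ?_
  rw [measure_biUnion_finset hdisj fun t _ => hDm t, Finset.mul_sum]
  refine Finset.sum_le_sum fun t ht => measure_inter_end_le hJ hP a c (hF t ht) (hDm t) ?_ ?_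
  · intro ω
    simp only [hDdef, Set.mem_ofPred_eq, CadlagPath.stopAt_apply, min_self]
    refine and_congr_right fun _ => forall₃_congr fun s _ hst => ?_
    rw [min_eq_left hst.le]
  · exact fun ω hω => hB _ tsub_le_self _ hω.1

include hJ hP in
theorem measure_exit_le (a c : Site d) {h : ℝ≥0}
    {B : ℝ≥0∞} (hB : ∀ t ≤ h, ∀ x ∉ Λ, ENNReal.ofReal (transition J (t : ℝ) (c - x)) ≤ B) :
    P a ({ω | exitTime Λ ω < h} ∩ {ω | ω h = c}) ≤ B * P a {ω | exitTime Λ ω < h} := by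
  set S : Set ℝ≥0 := {t | t < h ∧ ∃ n : ℕ × ℕ, t = (n.1 : ℝ≥0) / (n.2 + 1)} with hS
  have hSc : S.Countable := by
    refine (Set.countable_range fun n : ℕ × ℕ => (n.1 : ℝ≥0) / (n.2 + 1)).mono ?_
    rintro t ⟨_, n, rfl⟩
    exact ⟨n, rfl⟩
  have hU : {ω : CadlagPath d | exitTime Λ ω < h} = ⋃ t ∈ S, {ω | ω t ∉ Λ} := by
    ext ω
    simp only [Set.mem_ofPred_eq, exitTime_lt_iff, Set.mem_iUnion, exists_prop, hS,
      ENNReal.coe_lt_coe]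
    constructor
    · rintro ⟨n, h1, h2⟩
      exact ⟨_, ⟨h1, n, rfl⟩, h2⟩
    · rintro ⟨_, ⟨h1, n, rfl⟩, h2⟩
      exact ⟨n, h1, h2⟩
  have : Countable S := hSc.to_subtype
  have hU2 : (⋃ t ∈ S, {ω : CadlagPath d | ω t ∉ Λ}) =
      ⋃ F : Finset S, ⋃ t ∈ F.map (Function.Embedding.subtype _), {ω : CadlagPath d | ω t ∉ Λ} := by
    ext ω
    simp only [Set.mem_iUnion, Finset.mem_map, Function.Embedding.subtype_apply, exists_prop]
    constructor
    · rintro ⟨t, ht, hω⟩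
      exact ⟨{⟨t, ht⟩}, t, ⟨⟨t, ht⟩, Finset.mem_singleton_self _, rfl⟩, hω⟩
    · rintro ⟨F, _, ⟨t, _, rfl⟩, hω⟩
      exact ⟨t, t.2, hω⟩
  rw [hU, hU2, Set.iUnion_inter, Directed.measure_iUnion]
  · refine iSup_le fun F => ?_
    refine (measure_exit_grid_le hJ hP a c _ (fun t ht => ?_) hB).trans ?_
    · obtain ⟨t, _, rfl⟩ := Finset.mem_map.1 ht
      exact t.2.1.le
    · gcongr
      exact Set.subset_iUnion (fun F : Finset S =>
        ⋃ t ∈ F.map (Function.Embedding.subtype _), {ω : CadlagPath d | ω t ∉ Λ}) F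
  · refine Monotone.directed_le fun F G hFG => ?_
    refine Set.inter_subset_inter_left _ (Set.biUnion_subset_biUnion_left ?_)
    exact Finset.map_subset_map.2 hFG

/-- The probability that the killed walk is at `c` at time `t`. -/
def aliveProb (P : Site d → Measure (CadlagPath d)) (Λ : Finset (Site d)) (a : Site d) (t : ℝ)
    (c : Site d) : ℝ≥0∞ := ∫⁻ ω, atPos Λ ω t c ∂P a

theorem aliveProb_eq (a : Site d) (t : ℝ) (c : Site d) :
    aliveProb P Λ a t c = P a {ω | killed Λ ω t.toNNReal = some c} := by
  have hm : MeasurableSet {ω : CadlagPath d | killed Λ ω t.toNNReal = some c} :=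
    measurableSet_killed_comp Λ c measurable_const measurable_id
  rw [aliveProb, ← lintegral_indicator_one hm]
  refine lintegral_congr fun ω => ?_
  by_cases h : killed Λ ω t.toNNReal = some c
  · rw [atPos_of_eq h]
    exact (Set.indicator_of_mem (s := {ω | killed Λ ω t.toNNReal = some c}) h
      (1 : CadlagPath d → ℝ≥0∞)).symm
  · rw [atPos_of_ne h]
    exact (Set.indicator_of_notMem (s := {ω | killed Λ ω t.toNNReal = some c}) h
      (1 : CadlagPath d → ℝ≥0∞)).symm

include hJ hP in
theorem aliveProb_le (a : Site d) {t : ℝ} (ht : 0 ≤ t) (c : Site d) :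
    aliveProb P Λ a t c ≤ ENNReal.ofReal (transition J t (c - a)) := by
  have h := (hP a).marginal hJ t.toNNReal c
  rw [Real.coe_toNNReal t ht] at h
  rw [← h, aliveProb_eq]
  exact measure_mono fun ω hω => (killed_eq_some_iff'.1 hω).2

include hJ hP in
-- A free path at c at time t that does not count as alive must have left Λ and come back, and the
-- return is a displacement by a nonzero vector.
theorem le_aliveProb_add (a : Site d) {t : ℝ} (ht : 0 ≤ t) {c : Site d} (hc : c ∈ Λ) {B : ℝ≥0∞}
    (hB : ∀ s, 0 ≤ s → s ≤ t → ∀ x ≠ 0, ENNReal.ofReal (transition J s x) ≤ B) :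
    ENNReal.ofReal (transition J t (c - a)) ≤
      aliveProb P Λ a t c + B * P a {ω | exitTime Λ ω < t.toNNReal} := by
  have h := (hP a).marginal hJ t.toNNReal c
  rw [Real.coe_toNNReal t ht] at h
  rw [← h, aliveProb_eq]
  have h2 := measure_exit_le (Λ := Λ) hJ hP a c (h := t.toNNReal) (B := B) fun s hs x hx =>
    hB s s.coe_nonneg ((NNReal.coe_le_coe.2 hs).trans_eq (Real.coe_toNNReal t ht)) _
      (sub_ne_zero.2 fun hcx => hx (hcx ▸ hc))
  refine (measure_mono fun ω hω => ?_).trans ((measure_union_le _ _).trans (add_le_add_right h2 _))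
  by_cases hk : killed Λ ω t.toNNReal = some c
  · exact Or.inl hk
  · refine Or.inr ⟨?_, hω⟩
    rw [killed_eq_some_iff'] at hk
    push Not at hk
    have hω' : ω t.toNNReal = c := hω
    by_contra hlt
    refine hk (fun r hr => ?_) hω'
    rcases hr.eq_or_lt with h0 | hr
    · rw [h0, hω']; exact hc
    · exact mem_of_lt_exitTime ((ENNReal.coe_lt_coe.2 hr).trans_le (not_lt.1 hlt))

include hP in
theorem tendsto_exit_prob {a : Site d} (ha : a ∈ Λ) :
    Tendsto (fun t : ℝ => P a {ω | exitTime Λ ω < t.toNNReal}) (𝓝[>] 0) (𝓝 0) := by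
  have : IsProbabilityMeasure (P a) := (hP a).isProbabilityMeasure
  have hm : ∀ t : ℝ, MeasurableSet {ω : CadlagPath d | exitTime Λ ω < t.toNNReal} := fun t =>
    measurable_exitTime Λ measurableSet_Iio
  simp only [← fun t : ℝ => lintegral_indicator_one (μ := P a) (hm t)]
  rw [← lintegral_zero (μ := P a)]
  refine tendsto_lintegral_filter_of_dominated_convergence (fun _ => 1)
    (Eventually.of_forall fun t => measurable_one.indicator (hm t))
    (Eventually.of_forall fun t => ae_of_all _ fun ω => Set.indicator_le_self' (fun _ _ => zero_le) ω)
    (by simp) ?_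
  filter_upwards [(hP a).ae_start] with ω hω
  have hpos : (0 : ℝ≥0∞) < exitTime Λ ω := by
    have := (lt_exitTime_iff (Λ := Λ) (ω := ω) (t := 0)).2 fun r hr => by
      rw [nonpos_iff_eq_zero.1 hr, hω]; exact ha
    simpa using this
  have hc : Tendsto (fun t : ℝ => ((t.toNNReal : ℝ≥0) : ℝ≥0∞)) (𝓝[>] 0) (𝓝 0) := by
    have : Continuous fun t : ℝ => ((t.toNNReal : ℝ≥0) : ℝ≥0∞) := by fun_prop
    have h := this.tendsto 0
    simp only [Real.toNNReal_zero, ENNReal.coe_zero] at h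
    exact h.mono_left nhdsWithin_le_nhds
  refine tendsto_const_nhds.congr' ?_
  filter_upwards [hc.eventually (gt_mem_nhds hpos)] with t ht
  exact (Set.indicator_of_notMem (s := {ω | exitTime Λ ω < t.toNNReal})
    (fun h : exitTime Λ ω < t.toNNReal => absurd h (not_lt.2 ht.le))
    (1 : CadlagPath d → ℝ≥0∞)).symm

include hP in
theorem aliveProb_ne_top (a : Site d) (t : ℝ) (c : Site d) : aliveProb P Λ a t c ≠ ∞ := by
  have : IsProbabilityMeasure (P a) := (hP a).isProbabilityMeasure
  rw [aliveProb_eq]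
  exact measure_ne_top _ _

include hJ hP in
-- Leaving Λ before t and returning costs O(t) for the return times P(exit before t), which tends to
-- 0. The correction due to killing is thus o(t), and inside Λ the killed walk has the same rates as
-- the free one.
theorem tendsto_aliveProb_deriv {a c : Site d} (ha : a ∈ Λ) (hc : c ∈ Λ) :
    Tendsto (fun t : ℝ => ((aliveProb P Λ a t c).toReal - if c = a then 1 else 0) / t) (𝓝[>] 0)
      (𝓝 (J (c - a))) := by
  have : IsProbabilityMeasure (P a) := (hP a).isProbabilityMeasure
  obtain ⟨C, hC, ε, hε, hb⟩ := transition_le_linear hJ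
  have h1 : Tendsto (fun t : ℝ => (transition J t (c - a) - if c = a then 1 else 0) / t) (𝓝[>] 0)
      (𝓝 (J (c - a))) := by
    have h := (hasDerivAt_iff_tendsto_slope.1 (hasDerivAt_transition_zero hJ (c - a))).mono_left
      (nhdsWithin_mono (0 : ℝ) fun t (ht : 0 < t) => (ne_of_gt ht : t ≠ 0))
    refine h.congr fun t => ?_
    rw [slope_def_field, transition_zero hJ, sub_zero]
    simp only [sub_eq_zero]
  have h2 : Tendsto (fun t : ℝ => (transition J t (c - a) - if c = a then 1 else 0) / t -
      C * (P a {ω | exitTime Λ ω < t.toNNReal}).toReal) (𝓝[>] 0) (𝓝 (J (c - a))) := by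
    have := h1.sub (((ENNReal.tendsto_toReal ENNReal.zero_ne_top).comp
      (tendsto_exit_prob hP ha)).const_mul C)
    simpa using this
  refine tendsto_of_tendsto_of_tendsto_of_le_of_le' h2 h1 ?_ ?_
  · filter_upwards [Ioo_mem_nhdsGT hε] with t ht
    have h3 := le_aliveProb_add (Λ := Λ) hJ hP a ht.1.le hc (B := ENNReal.ofReal (C * t))
      fun s hs hst x hx => ENNReal.ofReal_le_ofReal ((hb s hs (hst.trans_lt ht.2) x hx).trans
        (mul_le_mul_of_nonneg_left hst hC))
    have h4 : transition J t (c - a) ≤ (aliveProb P Λ a t c).toReal +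
        C * t * (P a {ω | exitTime Λ ω < t.toNNReal}).toReal := by
      have h5 := ENNReal.toReal_mono (ENNReal.add_ne_top.2 ⟨aliveProb_ne_top hP a t c,
        ENNReal.mul_ne_top ENNReal.ofReal_ne_top (measure_ne_top _ _)⟩) h3
      rwa [ENNReal.toReal_ofReal (transition_nonneg hJ ht.1.le _), ENNReal.toReal_add
        (aliveProb_ne_top hP a t c) (ENNReal.mul_ne_top ENNReal.ofReal_ne_top (measure_ne_top _ _)),
        ENNReal.toReal_mul, ENNReal.toReal_ofReal (mul_nonneg hC ht.1.le)] at h5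
    rw [sub_le_iff_le_add, div_add' _ _ _ ht.1.ne']
    refine div_le_div_of_nonneg_right ?_ ht.1.le
    linarith
  · filter_upwards [self_mem_nhdsWithin] with t ht
    have ht' : (0 : ℝ) < t := ht
    refine div_le_div_of_nonneg_right (sub_le_sub_right ?_ _) ht'.le
    have h5 := ENNReal.toReal_mono ENNReal.ofReal_ne_top (aliveProb_le (Λ := Λ) hJ hP a ht'.le c)
    rwa [ENNReal.toReal_ofReal (transition_nonneg hJ ht'.le _)] at h5

include hJ hP in
theorem tendsto_aliveProb {a c : Site d} (ha : a ∈ Λ) (hc : c ∈ Λ) :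
    Tendsto (fun t : ℝ => aliveProb P Λ a t c) (𝓝[>] 0) (𝓝 (if c = a then 1 else 0)) := by
  have h1 := (tendsto_aliveProb_deriv hJ hP ha hc).mul
    (tendsto_id.mono_left nhdsWithin_le_nhds : Tendsto (fun t : ℝ => t) (𝓝[>] 0) (𝓝 0))
  rw [mul_zero] at h1
  have h2 := h1.add_const (if c = a then (1 : ℝ) else 0)
  rw [zero_add] at h2
  have h3 := ENNReal.tendsto_ofReal h2
  rw [show ENNReal.ofReal (if c = a then (1 : ℝ) else 0) = if c = a then 1 else 0 by
    split_ifs <;> simp] at h3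
  refine h3.congr' ?_
  filter_upwards [self_mem_nhdsWithin] with t ht
  rw [id, div_mul_cancel₀ _ (ne_of_gt ht), sub_add_cancel, ENNReal.ofReal_toReal
    (aliveProb_ne_top hP a t c)]

end ShortTime

/-! ### Averages over short intervals -/

/-- Both variables tend to 0 jointly because the averaged functions depend on s and on h - s. -/
theorem tendsto_average {F : ℝ × ℝ → ℝ≥0∞} {L : ℝ≥0∞} (hL : L ≠ ∞)
    (hF : Tendsto F (𝓝[{p : ℝ × ℝ | 0 < p.2 ∧ p.2 < p.1}] 0) (𝓝 L)) :
    Tendsto (fun h : ℝ => (∫⁻ s in Set.Ioo 0 h, F (h, s)) / ENNReal.ofReal h) (𝓝[>] 0) (𝓝 L) := by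
  rw [ENNReal.tendsto_nhds hL] at hF ⊢
  intro ε hε
  obtain ⟨δ, hδ, h⟩ := Metric.mem_nhdsWithin_iff.1 (hF ε hε)
  filter_upwards [Ioo_mem_nhdsGT hδ] with t ht
  have hb : ∀ s ∈ Set.Ioo 0 t, F (t, s) ∈ Set.Icc (L - ε) (L + ε) := by
    intro s hs
    refine h ⟨?_, hs.1, hs.2⟩
    rw [mem_ball_zero_iff, Prod.norm_def, Real.norm_eq_abs, Real.norm_eq_abs, abs_of_pos hs.1,
      abs_of_pos ht.1]
    exact max_lt ht.2 (hs.2.trans ht.2)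
  have ht0 : ENNReal.ofReal t ≠ 0 := by simpa using ht.1
  have hc : ∀ c : ℝ≥0∞, ∫⁻ _ in Set.Ioo 0 t, c = c * ENNReal.ofReal t := fun c => by
    rw [setLIntegral_const, Real.volume_Ioo, sub_zero]
  constructor
  · rw [ENNReal.le_div_iff_mul_le (Or.inl ht0) (Or.inl ENNReal.ofReal_ne_top), ← hc]
    exact setLIntegral_mono' measurableSet_Ioo fun s hs => (hb s hs).1
  · rw [ENNReal.div_le_iff_le_mul (Or.inl ht0) (Or.inl ENNReal.ofReal_ne_top), ← hc]
    exact setLIntegral_mono' measurableSet_Ioo fun s hs => (hb s hs).2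

end

noncomputable section

/-! ### The equation of the Green's function in finite volume -/

section Backward

variable {d : ℕ} {J : Site d → ℝ} {P : Site d → Measure (CadlagPath d)} {Z : WeightFamily d}
  {Λ : Finset (Site d)}

/-- The weight of a path times a function of the logarithmic derivative of the weight in the
direction of the initial point. -/
def driftAt (Z : WeightFamily d) (Λ : Finset (Site d)) (b : Site d) (g : ℝ → ℝ≥0∞) (s l : ℝ)
    (ω : CadlagPath d) : ℝ≥0∞ :=
  atPos Λ ω l b * (ENNReal.ofReal (lrY Z Λ ω s l) *
    g (logD Z Λ (localTime Λ ω s l) (posVec Λ ω s)))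

/-- The expected drift after time `u`. -/
def driftTail (P : Site d → Measure (CadlagPath d)) (Z : WeightFamily d) (Λ : Finset (Site d))
    (b : Site d) (g : ℝ → ℝ≥0∞) (u : ℝ) (c : Site d) : ℝ≥0∞ :=
  ∫⁻ l in Set.Ioi u, ∫⁻ ω, driftAt Z Λ b g 0 l ω ∂P c

theorem driftTail_mono {b : Site d} {g : ℝ → ℝ≥0∞} {u v : ℝ} (h : u ≤ v) (c : Site d) :
    driftTail P Z Λ b g v c ≤ driftTail P Z Λ b g u c :=
  lintegral_mono_set (Set.Ioi_subset_Ioi h)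

variable (hZ : SmoothWeight Z Λ) (hJ : IsJumpRate J) (hP : ∀ a, IsWalkLaw J a (P a))

include hZ in
theorem SmoothWeight.measurable_driftAt (b : Site d) {g : ℝ → ℝ≥0∞} (hg : Measurable g)
    {α : Type*} [MeasurableSpace α] {s l : α → ℝ} (hs : Measurable s) (hl : Measurable l)
    {w : α → CadlagPath d} (hw : Measurable w) :
    Measurable fun x => driftAt Z Λ b g (s x) (l x) (w x) := by
  have h1 := hZ.measurable_logD hs hl hs hw
  exact (measurable_atPos b hl hw).mul ((hZ.measurable_lrY hs hl hw).ennreal_ofReal.mul (hg.comp h1))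

/-- The weight and its derivative started at time s depend only on the shifted path, so given the
position at s they can be restarted at time 0. -/
theorem driftAt_eq_sum {b : Site d} {g : ℝ → ℝ≥0∞} (ω : CadlagPath d) {s l : ℝ} (hs : 0 ≤ s)
    (hl : s ≤ l) : driftAt Z Λ b g s l ω =
      ∑ c ∈ Λ, atPos Λ ω s c * driftAt Z Λ b g 0 (l - s) (ω.shift s.toNNReal) := by
  by_cases hk : ∃ c ∈ Λ, killed Λ ω s.toNNReal = some c
  · obtain ⟨c, hc, hk⟩ := hk
    rw [Finset.sum_eq_single c, atPos_of_eq hk, one_mul]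
    · have hl0 : 0 ≤ l - s := sub_nonneg.2 hl
      have e1 : (s.toNNReal : ℝ) = s := Real.coe_toNNReal s hs
      have h1 : killed Λ ω l.toNNReal = killed Λ (ω.shift s.toNNReal) (l - s).toNNReal := by
        rw [← killed_shift hk, ← Real.toNNReal_add hs hl0, add_sub_cancel]
      have h2 := localTime_shift hk (l' := l - s) (le_refl (0 : ℝ))
      have h3 := posVec_shift hk (le_refl (0 : ℝ))
      rw [e1, add_zero, add_sub_cancel] at h2
      rw [e1, add_zero] at h3
      unfold driftAt lrY
      rw [h2, h3]
      congr 1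
      by_cases hb : killed Λ ω l.toNNReal = some b
      · rw [atPos_of_eq hb, atPos_of_eq (h1 ▸ hb)]
      · rw [atPos_of_ne hb, atPos_of_ne (fun h => hb (h1.trans h))]
    · intro c' _ hc'
      rw [atPos_of_ne (fun h => hc' (Option.some_injective _ (h.symm.trans hk))), zero_mul]
    · exact fun h => absurd hc h
  · push Not at hk
    rw [Finset.sum_eq_zero fun c hc => by rw [atPos_of_ne (hk c hc), zero_mul]]
    rw [driftAt, atPos_of_ne, zero_mul]
    intro h
    obtain ⟨c, hc, hkc⟩ := exists_pos_of_killed hl h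
    exact hk c hc hkc

include hZ hJ hP in
theorem lintegral_driftAt (a b : Site d) {g : ℝ → ℝ≥0∞} (hg : Measurable g) {s h : ℝ} (hs : 0 ≤ s)
    (hsh : s ≤ h) :
    ∫⁻ l in Set.Ioi h, (∫⁻ ω, driftAt Z Λ b g s l ω ∂P a) =
      ∑ c ∈ Λ, aliveProb P Λ a s c * driftTail P Z Λ b g (h - s) c := by
  have hprob : ∀ a, IsProbabilityMeasure (P a) := fun a => (hP a).isProbabilityMeasure
  have hm : ∀ c : Site d, Measurable fun l : ℝ => ∫⁻ ω, driftAt Z Λ b g 0 l ω ∂P c := fun c =>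
    Measurable.lintegral_prod_right' (f := fun p : ℝ × CadlagPath d => driftAt Z Λ b g 0 p.1 p.2)
      (hZ.measurable_driftAt b hg measurable_const measurable_fst measurable_snd)
  have hm2 : ∀ c : Site d, Measurable fun l : ℝ => ∫⁻ ω, driftAt Z Λ b g 0 (l - s) ω ∂P c :=
    fun c => (hm c).comp (measurable_id.sub_const s)
  have key : ∀ l ∈ Set.Ioi h, ∫⁻ ω, driftAt Z Λ b g s l ω ∂P a =
      ∑ c ∈ Λ, aliveProb P Λ a s c * ∫⁻ ω, driftAt Z Λ b g 0 (l - s) ω ∂P c := by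
    intro l hl
    have hms : ∀ c, Measurable fun p : CadlagPath d × CadlagPath d =>
        atPos Λ p.1 s c * driftAt Z Λ b g 0 (l - s) p.2 := fun c =>
      (measurable_atPos c measurable_const measurable_fst).mul
        (hZ.measurable_driftAt b hg measurable_const measurable_const measurable_snd)
    have hms1 : ∀ c, Measurable fun ω : CadlagPath d => atPos Λ ω s c := fun c =>
      measurable_atPos (f := fun _ => s) (w := fun ω => ω) c measurable_const measurable_id
    have hms0 : Measurable fun ω : CadlagPath d => driftAt Z Λ b g 0 (l - s) ω :=
      hZ.measurable_driftAt (s := fun _ => 0) (l := fun _ => l - s) (w := fun ω => ω) b hg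
        measurable_const measurable_const measurable_id
    have hmsh : Measurable fun ω : CadlagPath d => ω.shift s.toNNReal :=
      CadlagPath.measurable_shift s.toNNReal
    have hms3 : Measurable fun ω : CadlagPath d =>
        driftAt Z Λ b g 0 (l - s) (ω.shift s.toNNReal) := by
      generalize s.toNNReal = q at hmsh
      exact hms0.comp hmsh
    have hms2 : ∀ c, Measurable fun ω : CadlagPath d =>
        atPos Λ ω s c * driftAt Z Λ b g 0 (l - s) (ω.shift s.toNNReal) := fun c =>
      (hms1 c).mul hms3
    simp only [driftAt_eq_sum _ hs (hsh.trans (le_of_lt hl))]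
    rw [lintegral_finsetSum _ fun c _ => hms2 c]
    refine Finset.sum_congr rfl fun c _ => ?_
    have h1 := markov_property hJ hP a s.toNNReal (hms c)
    have e1 : s ≤ (s.toNNReal : ℝ) := Real.le_coe_toNNReal s
    simp only [atPos_stop e1] at h1
    rw [h1, aliveProb, ← lintegral_mul_const _ (hms1 c)]
    refine lintegral_congr fun ω => ?_
    rw [lintegral_const_mul _ hms0]
    by_cases hk : killed Λ ω s.toNNReal = some c
    · rw [(killed_eq_some_iff'.1 hk).2]
    · rw [atPos_of_ne hk, zero_mul, zero_mul]
  rw [setLIntegral_congr_fun measurableSet_Ioi key, lintegral_finsetSum _ fun c _ =>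
    (hm2 c).const_mul _]
  refine Finset.sum_congr rfl fun c _ => ?_
  rw [lintegral_const_mul _ (hm2 c), driftTail]
  congr 1
  rw [← lintegral_indicator measurableSet_Ioi, ← lintegral_indicator measurableSet_Ioi,
    ← lintegral_add_right_eq_self _ s]
  refine lintegral_congr fun l => ?_
  simp only [Set.indicator_apply, Set.mem_Ioi, add_sub_cancel_right, sub_lt_iff_lt_add]

include hZ in
-- This is `lrY_sub_eq_integral` with the negative part moved to the other side, so that it can be
-- integrated in [0,∞] before finiteness is known.
theorem lrY_expansion (ω : CadlagPath d) {h l : ℝ} (hh : 0 ≤ h) (hl : h ≤ l) :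
    ENNReal.ofReal (lrY Z Λ ω 0 l) + ∫⁻ s in Set.Ioo 0 h, ENNReal.ofReal (lrY Z Λ ω s l) *
        ENNReal.ofReal (-logD Z Λ (localTime Λ ω s l) (posVec Λ ω s)) =
      ENNReal.ofReal (lrY Z Λ ω h l) + ∫⁻ s in Set.Ioo 0 h, ENNReal.ofReal (lrY Z Λ ω s l) *
        ENNReal.ofReal (logD Z Λ (localTime Λ ω s l) (posVec Λ ω s)) := by
  set f : ℝ → ℝ := fun s => lrY Z Λ ω s l * logD Z Λ (localTime Λ ω s l) (posVec Λ ω s) with hf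
  have hint : IntegrableOn f (Set.Ioo 0 h) := by
    have h1 := intervalIntegrable_posVec_sum ω hh (Λ := Λ)
      (f := fun x s => lrY Z Λ ω s l * logD Z Λ (localTime Λ ω s l) (Pi.single x 1)) (fun x =>
      ((hZ.continuousOn_lrY_left ω l).mul
        (SmoothWeight.continuousOn_comp_left ω (hZ.continuousOn_logD (Pi.single x 1)) l)).mono
          fun s hs => hs.2.trans hl)
    have h2 : IntervalIntegrable f volume 0 h := by
      refine h1.congr fun s _ => ?_
      rw [hf]
      beta_reduce
      rw [SmoothWeight.logD_posVec, Finset.mul_sum]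
      refine Finset.sum_congr rfl fun x _ => ?_
      ring
    exact ((intervalIntegrable_iff_integrableOn_Ioc_of_le hh).1 h2).mono_set Set.Ioo_subset_Ioc_self
  have e1 : ∀ s, ENNReal.ofReal (lrY Z Λ ω s l) *
      ENNReal.ofReal (logD Z Λ (localTime Λ ω s l) (posVec Λ ω s)) = ENNReal.ofReal (f s) :=
    fun s => (ENNReal.ofReal_mul (hZ.lrY_pos _ _ _).le).symm
  have e2 : ∀ s, ENNReal.ofReal (lrY Z Λ ω s l) *
      ENNReal.ofReal (-logD Z Λ (localTime Λ ω s l) (posVec Λ ω s)) = ENNReal.ofReal (-f s) :=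
    fun s => by rw [← ENNReal.ofReal_mul (hZ.lrY_pos _ _ _).le, mul_neg]
  have h3 := hZ.lrY_sub_eq_integral ω hh hl
  rw [intervalIntegral.integral_of_le hh, integral_Ioc_eq_integral_Ioo,
    integral_eq_lintegral_pos_part_sub_lintegral_neg_part hint] at h3
  have hfin1 : ∫⁻ s in Set.Ioo 0 h, ENNReal.ofReal (f s) ≠ ∞ := hint.lintegral_lt_top.ne
  have hfin2 : ∫⁻ s in Set.Ioo 0 h, ENNReal.ofReal (-f s) ≠ ∞ := hint.neg.lintegral_lt_top.ne
  simp only [e1, e2]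
  rw [← ENNReal.ofReal_toReal hfin1, ← ENNReal.ofReal_toReal hfin2,
    ← ENNReal.ofReal_add (hZ.lrY_pos _ _ _).le ENNReal.toReal_nonneg,
    ← ENNReal.ofReal_add (hZ.lrY_pos _ _ _).le ENNReal.toReal_nonneg]
  congr 1
  linarith

include hZ hP in
theorem lintegral_swap_drift (a b : Site d) {g : ℝ → ℝ≥0∞} (hg : Measurable g) (h : ℝ) :
    ∫⁻ l in Set.Ioi h, ∫⁻ ω, (∫⁻ s in Set.Ioo 0 h, driftAt Z Λ b g s l ω) ∂P a =
      ∫⁻ s in Set.Ioo 0 h, ∫⁻ l in Set.Ioi h, ∫⁻ ω, driftAt Z Λ b g s l ω ∂P a := by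
  have : IsProbabilityMeasure (P a) := (hP a).isProbabilityMeasure
  have h1 : ∀ l : ℝ, ∫⁻ ω, (∫⁻ s in Set.Ioo 0 h, driftAt Z Λ b g s l ω) ∂P a =
      ∫⁻ s in Set.Ioo 0 h, ∫⁻ ω, driftAt Z Λ b g s l ω ∂P a := by
    intro l
    refine lintegral_lintegral_swap (f := fun ω s => driftAt Z Λ b g s l ω) ?_
    have hm : Measurable fun p : CadlagPath d × ℝ => driftAt Z Λ b g p.2 l p.1 :=
      hZ.measurable_driftAt b hg measurable_snd measurable_const measurable_fst
    exact hm.aemeasurable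
  simp only [h1]
  refine lintegral_lintegral_swap (f := fun l s => ∫⁻ ω, driftAt Z Λ b g s l ω ∂P a) ?_
  have hm : Measurable fun p : (ℝ × ℝ) × CadlagPath d => driftAt Z Λ b g p.1.2 p.1.1 p.2 :=
    hZ.measurable_driftAt b hg measurable_fst.snd measurable_fst.fst measurable_snd
  have hm2 : Measurable fun p : ℝ × ℝ => ∫⁻ ω, driftAt Z Λ b g p.2 p.1 ω ∂P a :=
    hm.lintegral_prod_right'
  exact hm2.aemeasurable

/-- The expected weight at time `l`. -/
def weightAt (P : Site d → Measure (CadlagPath d)) (Z : WeightFamily d) (Λ : Finset (Site d))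
    (a b : Site d) (l : ℝ) : ℝ≥0∞ :=
  ∫⁻ ω, atPos Λ ω l b * ENNReal.ofReal (lrY Z Λ ω 0 l) ∂P a

theorem green_eq_weightAt (a b : Site d) :
    green P Z Λ 0 a b = ∫⁻ l in Set.Ioi 0, weightAt P Z Λ a b l := by
  rw [green_eq, setLIntegral_congr Ioi_ae_eq_Ici]
  simp only [zero_add]
  rfl

theorem green_eq_add (a b : Site d) {h : ℝ} (hh : 0 ≤ h) :
    green P Z Λ 0 a b = (∫⁻ l in Set.Ioo 0 h, weightAt P Z Λ a b l) +
      ∫⁻ l in Set.Ioi h, weightAt P Z Λ a b l := by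
  rw [green_eq_weightAt, ← Set.Ioc_union_Ioi_eq_Ioi hh, lintegral_union measurableSet_Ioi
    (Set.disjoint_left.2 fun x h1 h2 => absurd h1.2 (not_le.2 h2)), setLIntegral_congr Ioo_ae_eq_Ioc]

include hZ hJ hP in
-- For paths lasting longer than h, starting the weight at h instead of 0 turns the tail into the
-- killed semigroup at time h applied to G. The error is the integrated drift over (0,h), restarted
-- at each intermediate time.
theorem weightAt_tail (a b : Site d) {h : ℝ} (hh : 0 ≤ h) :
    (∫⁻ l in Set.Ioi h, weightAt P Z Λ a b l) + ∫⁻ s in Set.Ioo 0 h,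
        ∑ c ∈ Λ, aliveProb P Λ a s c *
          driftTail P Z Λ b (fun x => ENNReal.ofReal (-x)) (h - s) c =
      (∑ c ∈ Λ, aliveProb P Λ a h c * green P Z Λ 0 c b) + ∫⁻ s in Set.Ioo 0 h,
        ∑ c ∈ Λ, aliveProb P Λ a s c *
          driftTail P Z Λ b (fun x => ENNReal.ofReal x) (h - s) c := by
  have : IsProbabilityMeasure (P a) := (hP a).isProbabilityMeasure
  have hg1 : Measurable fun x : ℝ => ENNReal.ofReal x := ENNReal.measurable_ofReal
  have hg2 : Measurable fun x : ℝ => ENNReal.ofReal (-x) := ENNReal.measurable_ofReal.comp measurable_neg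
  have e1 : ∀ g : ℝ → ℝ≥0∞, Measurable g → ∫⁻ s in Set.Ioo 0 h,
      ∑ c ∈ Λ, aliveProb P Λ a s c * driftTail P Z Λ b g (h - s) c =
      ∫⁻ l in Set.Ioi h, ∫⁻ ω, (∫⁻ s in Set.Ioo 0 h, driftAt Z Λ b g s l ω) ∂P a := by
    intro g hg
    rw [lintegral_swap_drift hZ hP a b hg]
    exact setLIntegral_congr_fun measurableSet_Ioo fun s hs =>
      (lintegral_driftAt hZ hJ hP a b hg hs.1.le hs.2.le).symm
  have e2 : ∑ c ∈ Λ, aliveProb P Λ a h c * green P Z Λ 0 c b =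
      ∫⁻ l in Set.Ioi h, ∫⁻ ω, atPos Λ ω l b * ENNReal.ofReal (lrY Z Λ ω h l) ∂P a := by
    have h1 := lintegral_growth_self (Λ := Λ) hZ hJ hP a hh (F := fun _ => 1) measurable_const
      (fun _ => rfl) b
    simp only [one_mul, growth, hZ.lrY_self, div_one] at h1
    exact h1.symm
  have hmI : ∀ g : ℝ → ℝ≥0∞, Measurable g → Measurable fun p : ℝ × CadlagPath d =>
      ∫⁻ s in Set.Ioo 0 h, driftAt Z Λ b g s p.1 p.2 := by
    intro g hg
    have hm : Measurable fun p : (ℝ × CadlagPath d) × ℝ => driftAt Z Λ b g p.2 p.1.1 p.1.2 :=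
      hZ.measurable_driftAt b hg measurable_snd measurable_fst.fst measurable_fst.snd
    exact hm.lintegral_prod_right'
  have hmI2 : ∀ g : ℝ → ℝ≥0∞, Measurable g → ∀ l, Measurable fun ω : CadlagPath d =>
      ∫⁻ s in Set.Ioo 0 h, driftAt Z Λ b g s l ω := by
    intro g hg l
    have hm : Measurable fun p : CadlagPath d × ℝ => driftAt Z Λ b g p.2 l p.1 :=
      hZ.measurable_driftAt b hg measurable_snd measurable_const measurable_fst
    exact hm.lintegral_prod_right'
  have hmY : ∀ s l : ℝ, Measurable fun ω : CadlagPath d =>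
      atPos Λ ω l b * ENNReal.ofReal (lrY Z Λ ω s l) := fun s l =>
    (measurable_atPos b measurable_const measurable_id).mul
      (hZ.measurable_lrY measurable_const measurable_const measurable_id).ennreal_ofReal
  have hmJ : ∀ g : ℝ → ℝ≥0∞, Measurable g → Measurable fun l : ℝ =>
      ∫⁻ ω, (∫⁻ s in Set.Ioo 0 h, driftAt Z Λ b g s l ω) ∂P a := fun g hg =>
    (hmI g hg).lintegral_prod_right'
  rw [e1 _ hg1, e1 _ hg2, e2, ← lintegral_add_right _ (hmJ _ hg2), ← lintegral_add_right _ (hmJ _ hg1)]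
  refine setLIntegral_congr_fun measurableSet_Ioi fun l hl => ?_
  rw [weightAt, ← lintegral_add_left (hmY 0 l), ← lintegral_add_left (hmY h l)]
  refine lintegral_congr fun ω => ?_
  have hm3 : ∀ g : ℝ → ℝ≥0∞, Measurable g → Measurable fun s : ℝ => ENNReal.ofReal (lrY Z Λ ω s l) *
      g (logD Z Λ (localTime Λ ω s l) (posVec Λ ω s)) := by
    intro g hg
    have h1 := hZ.measurable_logD (f := fun s : ℝ => s) (g := fun _ : ℝ => l) (p := fun s : ℝ => s)
      (w := fun _ => ω) measurable_id measurable_const measurable_id measurable_const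
    exact (hZ.measurable_lrY (f := fun s : ℝ => s) (g := fun _ => l) (w := fun _ => ω)
      measurable_id measurable_const measurable_const).ennreal_ofReal.mul (hg.comp h1)
  unfold driftAt
  rw [lintegral_const_mul _ (hm3 _ hg1), lintegral_const_mul _ (hm3 _ hg2), ← mul_add, ← mul_add,
    lrY_expansion hZ ω hh (le_of_lt hl)]

end Backward

end

noncomputable section

/-! ### The short-time limit and the finite-volume equation -/

section FiniteVolume

variable {d : ℕ} {J : Site d → ℝ} {P : Site d → Measure (CadlagPath d)} {Z : WeightFamily d}
  {Λ : Finset (Site d)}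

variable (hZ : SmoothWeight Z Λ) (hJ : IsJumpRate J) (hP : ∀ a, IsWalkLaw J a (P a))
  (hG : GreenLeZero P Z)

theorem killed_zero {a : Site d} (ha : a ∈ Λ) {ω : CadlagPath d} (hω : ω 0 = a) :
    killed Λ ω (0 : ℝ).toNNReal = some a := by
  rw [Real.toNNReal_zero, killed_eq_some_iff']
  refine ⟨fun r hr => ?_, hω⟩
  rw [nonpos_iff_eq_zero.1 hr, hω]
  exact ha

include hZ hP in
-- For times below 1 the local times lie in the compact cube [0,1]^Λ, so the weight is bounded and
-- dominated convergence applies.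
theorem tendsto_weightAt {a : Site d} (ha : a ∈ Λ) (b : Site d) :
    Tendsto (weightAt P Z Λ a b) (𝓝[>] 0) (𝓝 (if b = a then 1 else 0)) := by
  have : IsProbabilityMeasure (P a) := (hP a).isProbabilityMeasure
  obtain ⟨M, hM⟩ := (isCompact_Icc (a := (0 : Λ → ℝ)) (b := 1)).bddAbove_image
    (hZ.contDiffOn.continuousOn.mono Set.Icc_subset_Ici_self)
  have hZ0 := hZ.pos 0 (Set.mem_Ici.2 le_rfl)
  have hb : ∀ (ω : CadlagPath d) (l : ℝ), 0 < l → l < 1 → lrY Z Λ ω 0 l ≤ M / Z Λ 0 := by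
    intro ω l h0 h1
    refine div_le_div_of_nonneg_right (hM ⟨_, ⟨localTime_nonneg Λ ω 0 l, fun x => ?_⟩, rfl⟩) hZ0.le
    have := localTime_apply_le Λ ω 0 l h0.le x
    simp only [Pi.one_apply]
    linarith
  have hm : ∀ l : ℝ, Measurable fun ω : CadlagPath d =>
      atPos Λ ω l b * ENNReal.ofReal (lrY Z Λ ω 0 l) := fun l =>
    (measurable_atPos b measurable_const measurable_id).mul
      (hZ.measurable_lrY measurable_const measurable_const measurable_id).ennreal_ofReal
  have e : (if b = a then (1 : ℝ≥0∞) else 0) = ∫⁻ _, (if b = a then (1 : ℝ≥0∞) else 0) ∂P a := by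
    simp
  rw [e]
  refine tendsto_lintegral_filter_of_dominated_convergence
    (fun _ => ENNReal.ofReal (M / Z Λ 0)) (Eventually.of_forall hm) ?_ (by simp) ?_
  · filter_upwards [Ioo_mem_nhdsGT one_pos] with l hl
    refine ae_of_all _ fun ω => ?_
    refine (mul_le_mul' (atPos_le_one ω l b) (ENNReal.ofReal_le_ofReal (hb ω l hl.1 hl.2))).trans ?_
    rw [one_mul]
  · filter_upwards [(hP a).ae_start] with ω hω
    obtain ⟨ε, hε, hk⟩ := killed_eventually_eq Λ ω 0
    have hY : Tendsto (fun l => ENNReal.ofReal (lrY Z Λ ω 0 l)) (𝓝[>] 0) (𝓝 1) := by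
      have h1 := (hZ.continuousOn_lrY_right ω 0) 0 (Set.mem_Ici.2 le_rfl)
      have h2 := ENNReal.tendsto_ofReal h1.tendsto
      rw [hZ.lrY_self, ENNReal.ofReal_one] at h2
      exact h2.mono_left (nhdsWithin_mono 0 Set.Ioi_subset_Ici_self)
    have hA : ∀ᶠ l in 𝓝[>] (0 : ℝ), atPos Λ ω l b = if b = a then 1 else 0 := by
      filter_upwards [Ioo_mem_nhdsGT hε] with l hl
      have h3 := (hk l hl.1.le (by linarith [hl.2])).trans (killed_zero ha hω)
      split_ifs with hab
      · rw [atPos_of_eq (h3.trans (by rw [hab]))]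
      · rw [atPos_of_ne]
        rw [h3]
        exact fun h => hab (Option.some_injective _ h).symm
    have h4 : Tendsto (fun l => (if b = a then (1 : ℝ≥0∞) else 0) *
        ENNReal.ofReal (lrY Z Λ ω 0 l)) (𝓝[>] 0) (𝓝 ((if b = a then 1 else 0) * 1)) :=
      ENNReal.Tendsto.const_mul hY (Or.inr (by split_ifs <;> simp))
    rw [mul_one] at h4
    refine h4.congr' ?_
    filter_upwards [hA] with l hl
    rw [hl]

include hZ hP in
theorem tendsto_driftTail {b : Site d} {g : ℝ → ℝ≥0∞} (hg : Measurable g) {c : Site d}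
    (hfin : driftTail P Z Λ b g 0 c ≠ ∞) :
    Tendsto (fun u => driftTail P Z Λ b g u c) (𝓝[>] 0) (𝓝 (driftTail P Z Λ b g 0 c)) := by
  have : IsProbabilityMeasure (P c) := (hP c).isProbabilityMeasure
  have hm : Measurable fun l : ℝ => ∫⁻ ω, driftAt Z Λ b g 0 l ω ∂P c :=
    Measurable.lintegral_prod_right' (f := fun p : ℝ × CadlagPath d => driftAt Z Λ b g 0 p.1 p.2)
      (hZ.measurable_driftAt b hg measurable_const measurable_fst measurable_snd)
  unfold driftTail at hfin ⊢
  simp only [← lintegral_indicator measurableSet_Ioi] at hfin ⊢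
  refine tendsto_lintegral_filter_of_dominated_convergence _
    (Eventually.of_forall fun u => hm.indicator measurableSet_Ioi) ?_ hfin (ae_of_all _ fun l => ?_)
  · filter_upwards [self_mem_nhdsWithin] with u hu
    exact ae_of_all _ fun l => Set.indicator_le_indicator_of_subset
      (Set.Ioi_subset_Ioi (le_of_lt hu)) (fun _ => zero_le) l
  · refine tendsto_const_nhds.congr' ?_
    by_cases hl : 0 < l
    · filter_upwards [Ioo_mem_nhdsGT hl] with u hu
      rw [Set.indicator_of_mem (Set.mem_Ioi.2 hl), Set.indicator_of_mem (Set.mem_Ioi.2 hu.2)]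
    · filter_upwards [self_mem_nhdsWithin] with u hu
      have hu' : (0 : ℝ) < u := hu
      rw [Set.indicator_of_notMem (by simpa using hl), Set.indicator_of_notMem]
      simp only [Set.mem_Ioi, not_lt] at hl ⊢
      linarith

/-- The weight of a path that ends at `b`. -/
def pathWeight (Z : WeightFamily d) (Λ : Finset (Site d)) (b : Site d) (z : ℝ × CadlagPath d) : ℝ :=
  (Set.Ioi 0).indicator (fun l => posInd Λ z.2 l b * lrY Z Λ z.2 0 l) z.1

/-- The drift of a path that ends at `b`. -/
def pathDrift (Z : WeightFamily d) (Λ : Finset (Site d)) (b : Site d) (z : ℝ × CadlagPath d) : ℝ :=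
  pathWeight Z Λ b z * logD Z Λ (localTime Λ z.2 0 z.1) (posVec Λ z.2 0)

theorem measurableSet_pos_fst : MeasurableSet {z : ℝ × CadlagPath d | 0 < z.1} :=
  measurableSet_lt measurable_const measurable_fst

include hZ in
theorem SmoothWeight.pathWeight_nonneg (b : Site d) (z : ℝ × CadlagPath d) :
    0 ≤ pathWeight Z Λ b z :=
  Set.indicator_nonneg (fun l _ => mul_nonneg (posInd_nonneg _ _ _) (hZ.lrY_pos z.2 0 l).le) z.1

include hZ in
theorem SmoothWeight.measurable_pathWeight (b : Site d) : Measurable (pathWeight Z Λ b) := by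
  have h1 : Measurable fun z : ℝ × CadlagPath d => posInd Λ z.2 z.1 b * lrY Z Λ z.2 0 z.1 :=
    (measurable_posInd b measurable_fst measurable_snd).mul
      (hZ.measurable_lrY measurable_const measurable_fst measurable_snd)
  exact h1.indicator measurableSet_pos_fst

theorem ofReal_pathWeight (b : Site d) (z : ℝ × CadlagPath d) :
    ENNReal.ofReal (pathWeight Z Λ b z) = (Set.Ioi 0).indicator (fun l =>
      atPos Λ z.2 l b * ENNReal.ofReal (lrY Z Λ z.2 0 l)) z.1 := by
  unfold pathWeight
  by_cases h : 0 < z.1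
  · rw [Set.indicator_of_mem (Set.mem_Ioi.2 h), Set.indicator_of_mem (Set.mem_Ioi.2 h),
      ENNReal.ofReal_mul (posInd_nonneg _ _ _), ofReal_posInd]
  · rw [Set.indicator_of_notMem (by simpa using h), Set.indicator_of_notMem (by simpa using h),
      ENNReal.ofReal_zero]

include hZ hP in
theorem lintegral_pathWeight (a b : Site d) :
    ∫⁻ z, ENNReal.ofReal (pathWeight Z Λ b z) ∂(volume : Measure ℝ).prod (P a) =
      green P Z Λ 0 a b := by
  have : IsProbabilityMeasure (P a) := (hP a).isProbabilityMeasure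
  rw [lintegral_prod _ (hZ.measurable_pathWeight b).ennreal_ofReal.aemeasurable, green_eq_weightAt,
    ← lintegral_indicator measurableSet_Ioi]
  refine lintegral_congr fun l => ?_
  simp only [ofReal_pathWeight]
  by_cases h : 0 < l
  · simp only [Set.indicator_of_mem (Set.mem_Ioi.2 h)]
    rfl
  · have h' : l ∉ Set.Ioi (0 : ℝ) := by simpa using h
    simp only [Set.indicator_of_notMem h', lintegral_zero]

include hZ hP in
theorem integrable_pathWeight {a b : Site d} (hfin : green P Z Λ 0 a b ≠ ∞) :
    Integrable (pathWeight Z Λ b) ((volume : Measure ℝ).prod (P a)) := by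
  refine ⟨(hZ.measurable_pathWeight b).aestronglyMeasurable, ?_⟩
  rw [hasFiniteIntegral_iff_ofReal (ae_of_all _ (hZ.pathWeight_nonneg b)),
    lintegral_pathWeight hZ hP]
  exact hfin.lt_top

include hZ hP in
theorem integral_pathWeight (a b : Site d) :
    ∫ z, pathWeight Z Λ b z ∂(volume : Measure ℝ).prod (P a) = (green P Z Λ 0 a b).toReal := by
  rw [integral_eq_lintegral_of_nonneg_ae (ae_of_all _ (hZ.pathWeight_nonneg b))
    (hZ.measurable_pathWeight b).aestronglyMeasurable, lintegral_pathWeight hZ hP]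

include hZ in
-- For k = 0 the lace has one time t, and Y_{0,t} · (Y_{0,l}/Y_{0,t}) collapses to Y_{0,l}. Only the
-- vertex function V_{0,t} is left to integrate over t.
theorem integral_remIntegrand_zero (b : Site d) (z : ℝ × CadlagPath d) :
    ∫ r : Fin (2 * 0 + 1) → ℝ, (remSet d (2 * 0 + 1)).indicator (remIntegrand Z Λ b 0 0) (z, r) =
      pathWeight Z Λ b z * (logD Z Λ (localTime Λ z.2 0 z.1) (posVec Λ z.2 0) -
        logD Z Λ 0 (posVec Λ z.2 0)) := by
  obtain ⟨l, ω⟩ := z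
  have h1 := (volume_preserving_funUnique (Fin 1) ℝ).symm.integral_comp'
    (g := fun r : Fin 1 → ℝ => (remSet d (2 * 0 + 1)).indicator (remIntegrand Z Λ b 0 0) ((l, ω), r))
  refine h1.symm.trans ?_
  have e : ∀ t : ℝ, (remSet d (2 * 0 + 1)).indicator (remIntegrand Z Λ b 0 0)
      ((l, ω), (MeasurableEquiv.funUnique (Fin 1) ℝ).symm t) =
      pathWeight Z Λ b (l, ω) * (Set.Ioo 0 l).indicator (fun t => vertexFn Z Λ ω 0 t) t := by
    intro t
    set r : Fin 1 → ℝ := (MeasurableEquiv.funUnique (Fin 1) ℝ).symm t with hr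
    have hr0 : r 0 = t := rfl
    have ht1 : timesOf r 1 = t := by rw [timesOf_succ r (k := 0) (by omega)]; exact hr0
    have hmem : ((l, ω), r) ∈ remSet d 1 ↔ t ∈ Set.Ioo 0 l := by
      simp only [remSet, incSet, Set.mem_ofPred_eq, Set.mem_Ioo, ht1]
      refine and_congr_left fun _ => ⟨fun h => hr0 ▸ h.2 0, fun h => ⟨?_, fun i => ?_⟩⟩
      · exact Subsingleton.strictMono _
      · rw [Subsingleton.elim i 0, hr0]; exact h
    by_cases ht : t ∈ Set.Ioo 0 l
    · rw [Set.indicator_of_mem (show ((l, ω), r) ∈ remSet d (2 * 0 + 1) from hmem.2 ht),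
        Set.indicator_of_mem ht, pathWeight, Set.indicator_of_mem (Set.mem_Ioi.2 (ht.1.trans ht.2))]
      rw [hZ.vertexFn_eq_vtx ω le_rfl ht.1]
      have ht1' : timesOf r (2 * 0 + 1) = t := ht1
      simp only [remIntegrand, laceValue, partialWeight, Finset.range_zero, Finset.prod_empty, one_mul,
        laceFactor, growth, mul_zero, zero_tsub, timesOf_zero, hZ.lrY_self, div_one]
      have hne := (hZ.lrY_pos ω 0 t).ne'
      rw [show timesOf r (0 + 1) = t from ht1]
      field_simp
    · rw [Set.indicator_of_notMem (fun h => ht (hmem.1 h)), Set.indicator_of_notMem ht, mul_zero]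
  simp only [e]
  rw [integral_const_mul, integral_indicator measurableSet_Ioo]
  by_cases hl : 0 < l
  · rw [← hZ.integral_vertexFn_right ω hl.le, intervalIntegral.integral_of_le hl.le,
      integral_Ioc_eq_integral_Ioo]
  · rw [pathWeight, Set.indicator_of_notMem (by simpa using hl), zero_mul, zero_mul]

include hZ hJ hP hG in
-- The path almost surely starts at a, so its drift is the constant self-loop plus the first
-- remainder. Integrability is inherited from these two pieces.
theorem integral_pathDrift {a b : Site d} (ha : a ∈ Λ) (hb : b ∈ Λ)
    (hfin : ∀ c ∈ Λ, laceMass P Z Λ a 0 c ≠ ∞) (hfin' : ∀ c ∈ Λ, green P Z Λ 0 c b ≠ ∞) :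
    Integrable (pathDrift Z Λ b) ((volume : Measure ℝ).prod (P a)) ∧
      ∫ z, pathDrift Z Λ b z ∂(volume : Measure ℝ).prod (P a) =
        selfLoop Z Λ a * (green P Z Λ 0 a b).toReal + remInt P Z Λ 0 0 a b := by
  have : IsProbabilityMeasure (P a) := (hP a).isProbabilityMeasure
  have i2 := integrable_remIntegrand hZ hJ hP hG hb (k := 0) (j := 0) (by omega) hfin hfin'
  have i1 := integrable_pathWeight hZ hP (hfin' a ha)
  have i3 : Integrable (fun z : ℝ × CadlagPath d => ∫ r : Fin (2 * 0 + 1) → ℝ,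
      (remSet d (2 * 0 + 1)).indicator (remIntegrand Z Λ b 0 0) (z, r))
      ((volume : Measure ℝ).prod (P a)) := Integrable.integral_prod_left i2
  have hR : remInt P Z Λ 0 0 a b = ∫ z, (∫ r : Fin (2 * 0 + 1) → ℝ,
      (remSet d (2 * 0 + 1)).indicator (remIntegrand Z Λ b 0 0) (z, r))
      ∂(volume : Measure ℝ).prod (P a) := integral_prod _ i2
  have hae : (fun z => selfLoop Z Λ a * pathWeight Z Λ b z + ∫ r : Fin (2 * 0 + 1) → ℝ,
      (remSet d (2 * 0 + 1)).indicator (remIntegrand Z Λ b 0 0) (z, r)) =ᵐ[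
      (volume : Measure ℝ).prod (P a)] pathDrift Z Λ b := by
    have hs : ∀ᵐ z ∂(volume : Measure ℝ).prod (P a), z.2 0 = a :=
      Measure.quasiMeasurePreserving_snd.ae (hP a).ae_start
    filter_upwards [hs] with z hz
    rw [integral_remIntegrand_zero hZ, pathDrift, selfLoop, dif_pos ha,
      posVec_of_some Λ z.2 (x := ⟨a, ha⟩) (killed_zero ha hz)]
    unfold logD
    ring
  refine ⟨((i1.const_mul _).add i3).congr hae, ?_⟩
  rw [← integral_congr_ae hae, integral_add (i1.const_mul _) i3, integral_const_mul,
    integral_pathWeight hZ hP, hR]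

include hZ hP in
theorem driftTail_zero (a b : Site d) {g : ℝ → ℝ≥0∞} (hg : Measurable g)
    (hg2 : ∀ x y, 0 ≤ y → g (x * y) = g x * ENNReal.ofReal y) (hg0 : g 0 = 0) :
    driftTail P Z Λ b g 0 a = ∫⁻ z, g (pathDrift Z Λ b z) ∂(volume : Measure ℝ).prod (P a) := by
  have : IsProbabilityMeasure (P a) := (hP a).isProbabilityMeasure
  have hm : Measurable (pathDrift Z Λ b) := (hZ.measurable_pathWeight b).mul
    (hZ.measurable_logD measurable_const measurable_fst measurable_const measurable_snd)
  have hm2 : Measurable fun z => g (pathDrift Z Λ b z) := hg.comp hm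
  rw [lintegral_prod _ hm2.aemeasurable, driftTail, ← lintegral_indicator measurableSet_Ioi]
  refine lintegral_congr fun l => ?_
  by_cases hl : 0 < l
  · rw [Set.indicator_of_mem (Set.mem_Ioi.2 hl)]
    refine lintegral_congr fun ω => ?_
    rw [pathDrift, mul_comm, hg2 _ _ (hZ.pathWeight_nonneg b _), ofReal_pathWeight,
      Set.indicator_of_mem (Set.mem_Ioi.2 hl), driftAt]
    ring
  · have h' : l ∉ Set.Ioi (0 : ℝ) := by simpa using hl
    rw [Set.indicator_of_notMem h']
    refine ((lintegral_congr fun ω => ?_).trans lintegral_zero).symm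
    rw [pathDrift, pathWeight, Set.indicator_of_notMem h', zero_mul, hg0]

include hZ hJ hP hG in
-- Split G(a,b) at time h, insert `weightAt_tail`, divide by h and let h → 0. The initial interval
-- gives 1_{a=b}, the drift terms give the self-loop and R, and the difference quotient of the alive
-- probabilities gives the rates J.
theorem green_equation {a b : Site d} (ha : a ∈ Λ) (hb : b ∈ Λ)
    (hfin : ∀ a ∈ Λ, ∀ c ∈ Λ, laceMass P Z Λ a 0 c ≠ ∞)
    (hfin' : ∀ c ∈ Λ, green P Z Λ 0 c b ≠ ∞) :
    -∑ c ∈ Λ, J (c - a) * (green P Z Λ 0 c b).toReal =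
      (if b = a then 1 else 0) + (selfLoop Z Λ a * (green P Z Λ 0 a b).toReal +
        remInt P Z Λ 0 0 a b) := by
  set gp : ℝ → ℝ≥0∞ := fun x => ENNReal.ofReal x with hgp
  set gm : ℝ → ℝ≥0∞ := fun x => ENNReal.ofReal (-x) with hgm
  have mp : Measurable gp := ENNReal.measurable_ofReal
  have mm : Measurable gm := ENNReal.measurable_ofReal.comp measurable_neg
  have ep : ∀ c, driftTail P Z Λ b gp 0 c =
      ∫⁻ z, ENNReal.ofReal (pathDrift Z Λ b z) ∂(volume : Measure ℝ).prod (P c) := fun c =>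
    driftTail_zero hZ hP c b mp (fun x y hy => ENNReal.ofReal_mul' hy) ENNReal.ofReal_zero
  have em : ∀ c, driftTail P Z Λ b gm 0 c =
      ∫⁻ z, ENNReal.ofReal (-pathDrift Z Λ b z) ∂(volume : Measure ℝ).prod (P c) := fun c =>
    driftTail_zero hZ hP c b mm (fun x y hy => by
      rw [hgm]; beta_reduce; rw [← neg_mul, ENNReal.ofReal_mul' hy]) (by simp [hgm])
  have hi := fun c (hc : c ∈ Λ) => integral_pathDrift hZ hJ hP hG hc hb (hfin c hc) hfin'
  have fp : ∀ c ∈ Λ, driftTail P Z Λ b gp 0 c ≠ ∞ := fun c hc => by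
    rw [ep]; exact (hi c hc).1.lintegral_lt_top.ne
  have fm : ∀ c ∈ Λ, driftTail P Z Λ b gm 0 c ≠ ∞ := fun c hc => by
    rw [em]; exact (hi c hc).1.neg.lintegral_lt_top.ne
  have hW : (driftTail P Z Λ b gp 0 a).toReal - (driftTail P Z Λ b gm 0 a).toReal =
      selfLoop Z Λ a * (green P Z Λ 0 a b).toReal + remInt P Z Λ 0 0 a b := by
    rw [← (hi a ha).2, integral_eq_lintegral_pos_part_sub_lintegral_neg_part (hi a ha).1, ep, em]
  rw [← hW]
  -- the limits of the three averages
  have l2 : Tendsto (fun p : ℝ × ℝ => p.2) (𝓝[{p : ℝ × ℝ | 0 < p.2 ∧ p.2 < p.1}] 0) (𝓝[>] 0) :=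
    tendsto_nhdsWithin_iff.2 ⟨(continuous_snd.tendsto (0 : ℝ × ℝ)).mono_left nhdsWithin_le_nhds,
      eventually_nhdsWithin_of_forall fun p hp => hp.1⟩
  have l1 : Tendsto (fun p : ℝ × ℝ => p.1 - p.2) (𝓝[{p : ℝ × ℝ | 0 < p.2 ∧ p.2 < p.1}] 0)
      (𝓝[>] 0) := by
    refine tendsto_nhdsWithin_iff.2 ⟨?_, eventually_nhdsWithin_of_forall fun p hp => sub_pos.2 hp.2⟩
    have := ((continuous_fst.sub continuous_snd).tendsto (0 : ℝ × ℝ))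
    rw [Pi.sub_apply, Prod.fst_zero, Prod.snd_zero, sub_zero] at this
    exact this.mono_left nhdsWithin_le_nhds
  have hA : ∀ g : ℝ → ℝ≥0∞, Measurable g → (∀ c ∈ Λ, driftTail P Z Λ b g 0 c ≠ ∞) →
      Tendsto (fun h : ℝ => (∫⁻ s in Set.Ioo 0 h, ∑ c ∈ Λ, aliveProb P Λ a s c *
        driftTail P Z Λ b g (h - s) c) / ENNReal.ofReal h) (𝓝[>] 0)
        (𝓝 (driftTail P Z Λ b g 0 a)) := by
    intro g mg fg
    refine tendsto_average (F := fun p => ∑ c ∈ Λ, aliveProb P Λ a p.2 c *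
      driftTail P Z Λ b g (p.1 - p.2) c) (fg a ha) ?_
    have e : driftTail P Z Λ b g 0 a =
        ∑ c ∈ Λ, (if c = a then 1 else 0) * driftTail P Z Λ b g 0 c := by
      simp [Finset.sum_ite_eq', ha]
    rw [e]
    refine tendsto_finsetSum _ fun c hc => ENNReal.Tendsto.mul ((tendsto_aliveProb hJ hP ha hc).comp l2)
      (Or.inr (fg c hc)) ((tendsto_driftTail hZ hP mg (fg c hc)).comp l1)
      (Or.inr (by split_ifs <;> simp))
  have hF : Tendsto (fun h : ℝ => (∫⁻ s in Set.Ioo 0 h, weightAt P Z Λ a b s) / ENNReal.ofReal h)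
      (𝓝[>] 0) (𝓝 (if b = a then 1 else 0)) :=
    tendsto_average (F := fun p => weightAt P Z Λ a b p.2) (by split_ifs <;> simp)
      ((tendsto_weightAt hZ hP ha b).comp l2)
  have fA : ∀ g : ℝ → ℝ≥0∞, (∀ c ∈ Λ, driftTail P Z Λ b g 0 c ≠ ∞) → ∀ h : ℝ,
      ∫⁻ s in Set.Ioo 0 h, ∑ c ∈ Λ, aliveProb P Λ a s c * driftTail P Z Λ b g (h - s) c ≠ ∞ := by
    intro g fg h
    have hle : ∫⁻ s in Set.Ioo 0 h, ∑ c ∈ Λ, aliveProb P Λ a s c * driftTail P Z Λ b g (h - s) c ≤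
        ∫⁻ _ in Set.Ioo 0 h, ∑ c ∈ Λ, driftTail P Z Λ b g 0 c := by
      refine setLIntegral_mono' measurableSet_Ioo fun s hs => Finset.sum_le_sum fun c _ => ?_
      have h1 : aliveProb P Λ a s c ≤ 1 := by
        have : IsProbabilityMeasure (P a) := (hP a).isProbabilityMeasure
        rw [aliveProb_eq]; exact prob_le_one
      exact (mul_le_mul' h1 (driftTail_mono (sub_nonneg.2 hs.2.le) c)).trans_eq (one_mul _)
    refine ne_top_of_le_ne_top ?_ hle
    rw [setLIntegral_const]
    exact ENNReal.mul_ne_top (ENNReal.sum_ne_top.2 fg) (by simp)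
  have toR : ∀ {X : ℝ → ℝ≥0∞} {L : ℝ≥0∞}, L ≠ ∞ →
      Tendsto (fun h => X h / ENNReal.ofReal h) (𝓝[>] 0) (𝓝 L) →
      Tendsto (fun h => (X h).toReal / h) (𝓝[>] 0) (𝓝 L.toReal) := by
    intro X L hL hX
    refine ((ENNReal.tendsto_toReal hL).comp hX).congr' ?_
    filter_upwards [self_mem_nhdsWithin] with h hh
    rw [Function.comp_apply, ENNReal.toReal_div, ENNReal.toReal_ofReal (le_of_lt hh)]
  have t1 := (toR (by split_ifs <;> simp) hF).add
    ((toR (fp a ha) (hA gp mp fp)).sub (toR (fm a ha) (hA gm mm fm)))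
  rw [show ((if b = a then (1 : ℝ≥0∞) else 0)).toReal = if b = a then (1 : ℝ) else 0 by
    split_ifs <;> simp] at t1
  have t2 : Tendsto (fun h : ℝ => -∑ c ∈ Λ, ((aliveProb P Λ a h c).toReal - if c = a then 1 else 0) / h
      * (green P Z Λ 0 c b).toReal) (𝓝[>] 0) (𝓝 (-∑ c ∈ Λ, J (c - a) * (green P Z Λ 0 c b).toReal)) :=
    (tendsto_finsetSum _ fun c hc => (tendsto_aliveProb_deriv hJ hP ha hc).mul_const _).neg
  refine tendsto_nhds_unique (t2.congr' ?_) t1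
  filter_upwards [self_mem_nhdsWithin] with h hh
  have hh0 : (0 : ℝ) < h := hh
  have k1 := green_eq_add (P := P) (Z := Z) (Λ := Λ) a b hh0.le
  have k2 := weightAt_tail hZ hJ hP a b hh0.le
  have g1 := hfin' a ha
  rw [k1] at g1
  have g2 := ENNReal.add_ne_top.1 g1
  have g3 : ∀ c ∈ Λ, aliveProb P Λ a h c * green P Z Λ 0 c b ≠ ∞ := fun c hc =>
    ENNReal.mul_ne_top (aliveProb_ne_top hP a h c) (hfin' c hc)
  have k3 := congrArg ENNReal.toReal k1
  have k4 := congrArg ENNReal.toReal k2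
  rw [ENNReal.toReal_add g2.1 g2.2] at k3
  rw [ENNReal.toReal_add g2.2 (fA gm fm h), ENNReal.toReal_add (ENNReal.sum_ne_top.2 g3) (fA gp fp h),
    ENNReal.toReal_sum g3] at k4
  simp only [ENNReal.toReal_mul] at k4
  -- Writing G(a,b) as a sum against the point mass at a matches the difference quotients of the
  -- killed semigroup.
  have k5 : ∑ c ∈ Λ, ((aliveProb P Λ a h c).toReal - if c = a then 1 else 0) / h *
      (green P Z Λ 0 c b).toReal = ((∑ c ∈ Λ, (aliveProb P Λ a h c).toReal *
        (green P Z Λ 0 c b).toReal) - (green P Z Λ 0 a b).toReal) / h := by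
    have e : (green P Z Λ 0 a b).toReal =
        ∑ c ∈ Λ, (if c = a then 1 else 0) * (green P Z Λ 0 c b).toReal := by
      simp [Finset.sum_ite_eq', ha]
    rw [e, ← Finset.sum_sub_distrib, Finset.sum_div]
    refine Finset.sum_congr rfl fun c _ => ?_
    ring
  rw [k5, ← neg_div, ← sub_div, ← add_div]
  congr 1
  linarith

end FiniteVolume

end

noncomputable section

/-! ### Covariance under automorphisms of the lattice -/

section Covariance

variable {d : ℕ} {J : Site d → ℝ} {P : Site d → Measure (CadlagPath d)} {Z : WeightFamily d}

/-- Translations of the lattice. -/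
def transAut (v : Site d) : LatticeAut d where
  toEquiv := Equiv.addLeft v
  map_rel_iff' := by
    intro x y
    show ∑ i, |(v + x) i - (v + y) i| = 1 ↔ ∑ i, |x i - y i| = 1
    simp only [Pi.add_apply, add_sub_add_left_eq_sub]

@[simp] theorem transAut_apply (v x : Site d) : transAut v x = v + x := rfl

/-- Composing T with translations on both sides yields an automorphism that fixes the origin, so
symmetry at the origin controls all differences. -/
theorem IsLatticeSymmetric.apply_sub {f : Site d → ℝ} (hf : IsLatticeSymmetric f) (T : LatticeAut d)
    (x y : Site d) : f (T y - T x) = f (y - x) := by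
  have h := hf (((transAut x).trans T).trans (transAut (-T x))) (by simp) (y - x)
  rw [← h]
  simp [neg_add_eq_sub]

theorem IsLatticeSymmetric.convPow {f : Site d → ℝ} (hf : IsLatticeSymmetric f) (n : ℕ) :
    IsLatticeSymmetric (convPow f n) := by
  induction n with
  | zero =>
    intro T hT x
    have : T x = 0 ↔ x = 0 := ⟨fun h => T.injective (h.trans hT.symm), fun h => by rw [h, hT]⟩
    simp only [_root_.convPow, this]
  | succ n ih =>
    intro T hT x
    show ∑' y, f y * _root_.convPow f n (T x - y) = ∑' y, f y * _root_.convPow f n (x - y)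
    rw [← T.toEquiv.tsum_eq fun y => f y * _root_.convPow f n (T x - y)]
    refine tsum_congr fun y => ?_
    show f (T y) * _root_.convPow f n (T x - T y) = _
    rw [hf T hT, ih.apply_sub]

theorem transition_symmetric (hJ : IsJumpRate J) (t : ℝ) : IsLatticeSymmetric (transition J t) := by
  intro T hT x
  unfold transition
  refine tsum_congr fun n => ?_
  rw [(hJ.symmetric.convPow n) T hT]

/-- The image of a path under an automorphism. -/
def CadlagPath.mapAut (T : LatticeAut d) (ω : CadlagPath d) : CadlagPath d where
  toFun t := T (ω t)
  right_continuous t := (continuous_of_discreteTopology (f := T)).continuousAt.comp_continuousWithinAt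
    (ω.right_continuous t)
  left_limit t ht := by
    obtain ⟨l, hl⟩ := ω.left_limit t ht
    exact ⟨T l, ((continuous_of_discreteTopology (f := T)).tendsto l).comp hl⟩

@[simp] theorem CadlagPath.mapAut_apply (T : LatticeAut d) (ω : CadlagPath d) (t : ℝ≥0) :
    ω.mapAut T t = T (ω t) := rfl

theorem CadlagPath.measurable_mapAut (T : LatticeAut d) :
    Measurable (CadlagPath.mapAut (d := d) T) :=
  CadlagPath.measurable_of_eval fun t =>
    (measurable_of_countable (f := T)).comp (CadlagPath.measurable_eval t)

theorem map_walkLaw (hJ : IsJumpRate J) (hP : ∀ a, IsWalkLaw J a (P a)) (T : LatticeAut d)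
    (a : Site d) : (P a).map (CadlagPath.mapAut T) = P (T a) := by
  have : IsProbabilityMeasure (P a) := (hP a).isProbabilityMeasure
  have hm := CadlagPath.measurable_mapAut T
  have : IsProbabilityMeasure ((P a).map (CadlagPath.mapAut T)) :=
    Measure.isProbabilityMeasure_map hm.aemeasurable
  refine path_measure_ext fun n t x h0 hmono => ?_
  have hS : MeasurableSet {ω : CadlagPath d | ∀ i, ω (t i) = x i} := by
    have : {ω : CadlagPath d | ∀ i, ω (t i) = x i} = ⋂ i, (fun ω : CadlagPath d => ω (t i)) ⁻¹' {x i} := by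
      ext ω; simp
    rw [this]
    exact MeasurableSet.iInter fun i => CadlagPath.measurable_eval _ (measurableSet_singleton _)
  rw [Measure.map_apply hm hS, (hP (T a)).finite_dimensional n t x h0 hmono]
  have e : CadlagPath.mapAut T ⁻¹' {ω : CadlagPath d | ∀ i, ω (t i) = x i} =
      {ω : CadlagPath d | ∀ i, ω (t i) = T.symm (x i)} := by
    ext ω
    simp only [Set.mem_preimage, Set.mem_ofPred_eq, CadlagPath.mapAut_apply]
    exact forall_congr' fun i => T.toEquiv.eq_symm_apply.symm
  rw [e, (hP a).finite_dimensional n t _ h0 hmono]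
  have e2 : T.symm (x 0) = a ↔ x 0 = T a := T.toEquiv.symm_apply_eq
  simp only [e2, (transition_symmetric hJ _).apply_sub]

theorem map_map_symm (T : LatticeAut d) (Λ : Finset (Site d)) :
    (Λ.map T.symm.toEquiv.toEmbedding).map T.toEquiv.toEmbedding = Λ := by
  ext x
  simp only [Finset.mem_map, Equiv.coe_toEmbedding]
  constructor
  · rintro ⟨_, ⟨z, hz, rfl⟩, rfl⟩
    exact (T.apply_symm_apply z).symm ▸ hz
  · exact fun hx => ⟨T.symm x, ⟨x, hx, rfl⟩, T.apply_symm_apply x⟩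

theorem killed_mapAut (T : LatticeAut d) (Λ : Finset (Site d)) (ω : CadlagPath d) (t : ℝ≥0)
    (y : Site d) : killed (Λ.map T.toEquiv.toEmbedding) (ω.mapAut T) t = some (T y) ↔
      killed Λ ω t = some y := by
  rw [killed_eq_some_iff', killed_eq_some_iff']
  refine and_congr (forall₂_congr fun r _ => ?_) T.injective.eq_iff
  exact Finset.mem_map' T.toEquiv.toEmbedding

theorem green_mapAut (hJ : IsJumpRate J) (hP : ∀ a, IsWalkLaw J a (P a)) (hZ : ∀ Λ, SmoothWeight Z Λ)
    (hcov : WeightCovariant Z) (T : LatticeAut d) (Λ : Finset (Site d)) (a b : Site d) :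
    green P Z (Λ.map T.toEquiv.toEmbedding) 0 (T a) (T b) = green P Z Λ 0 a b := by
  set Λ' := Λ.map T.toEquiv.toEmbedding with hΛ'
  simp only [green_eq, zero_add]
  refine lintegral_congr fun l => ?_
  have hm : Measurable fun ω : CadlagPath d => atPos Λ' ω l (T b) *
      ENNReal.ofReal (Z Λ' (localTime Λ' ω 0 l) / Z Λ' 0) :=
    (measurable_atPos (f := fun _ => l) (w := fun ω => ω) (T b) measurable_const measurable_id).mul
      ((hZ Λ').measurable_lrY (f := fun _ => 0) (g := fun _ => l) (w := fun ω => ω) measurable_const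
        measurable_const measurable_id).ennreal_ofReal
  rw [← map_walkLaw hJ hP T a, lintegral_map hm (CadlagPath.measurable_mapAut T)]
  refine lintegral_congr fun ω => ?_
  have h1 : atPos Λ' (ω.mapAut T) l (T b) = atPos Λ ω l b := by
    by_cases h : killed Λ ω l.toNNReal = some b
    · rw [atPos_of_eq h, atPos_of_eq ((killed_mapAut T Λ ω _ b).2 h)]
    · rw [atPos_of_ne h, atPos_of_ne (fun h' => h ((killed_mapAut T Λ ω _ b).1 h'))]
  have h2 := hcov T Λ
    (fun x => volume.real {r : ℝ | r ∈ Set.Icc 0 l ∧ killed Λ ω r.toNNReal = some x})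
    (fun x => measureReal_nonneg)
  have h3 : localTime Λ' (ω.mapAut T) 0 l = fun y => volume.real
      {r : ℝ | r ∈ Set.Icc 0 l ∧ killed Λ ω r.toNNReal = some (T.symm y.1)} := by
    ext y
    unfold localTime
    congr 1
    ext r
    refine and_congr_right fun _ => ?_
    rw [← killed_mapAut T Λ ω, T.apply_symm_apply]
  rw [h1, h3, h2]
  rfl

theorem greenInf_mapAut (hJ : IsJumpRate J) (hP : ∀ a, IsWalkLaw J a (P a))
    (hZ : ∀ Λ, SmoothWeight Z Λ) (hcov : WeightCovariant Z) (T : LatticeAut d) (a b : Site d) :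
    greenInf P Z (T a) (T b) = greenInf P Z a b := by
  refine le_antisymm (iSup_le fun Λ => ?_) (iSup_le fun Λ => ?_)
  · have h := green_mapAut hJ hP hZ hcov T (Λ.map T.symm.toEquiv.toEmbedding) a b
    rw [map_map_symm] at h
    rw [h]
    exact le_iSup (fun Λ => green P Z Λ 0 a b) _
  · rw [← green_mapAut hJ hP hZ hcov T Λ a b]
    exact le_iSup (fun Λ => green P Z Λ 0 (T a) (T b)) _

theorem greenInf_eq_sub (hJ : IsJumpRate J) (hP : ∀ a, IsWalkLaw J a (P a))
    (hZ : ∀ Λ, SmoothWeight Z Λ) (hcov : WeightCovariant Z) (a b : Site d) :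
    greenInf P Z a b = greenInf P Z 0 (b - a) := by
  rw [← greenInf_mapAut hJ hP hZ hcov (transAut (-a)) a b]
  simp [neg_add_eq_sub]

/-- Reversibility is not needed: translation invariance and the reflection x ↦ -x suffice. Only the
infinite-volume function is symmetrised this way, since a finite Λ need not be invariant. -/
theorem greenInf_symm (hJ : IsJumpRate J) (hP : ∀ a, IsWalkLaw J a (P a))
    (hZ : ∀ Λ, SmoothWeight Z Λ) (hcov : WeightCovariant Z) (a b : Site d) :
    greenInf P Z a b = greenInf P Z b a := by
  rw [greenInf_eq_sub hJ hP hZ hcov a b, greenInf_eq_sub hJ hP hZ hcov b a,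
    ← greenInf_mapAut hJ hP hZ hcov (negAut d) 0 (b - a)]
  show greenInf P Z (-0) (-(b - a)) = _
  rw [neg_zero, neg_sub]

theorem green_eq_zero_of_notMem_right {Λ : Finset (Site d)} {a b : Site d} (hb : b ∉ Λ) :
    green P Z Λ 0 a b = 0 := by
  rw [green_eq]
  refine (lintegral_congr fun l => (lintegral_congr fun ω => ?_).trans lintegral_zero).trans
    lintegral_zero
  rw [atPos_of_ne fun h => hb (mem_of_killed_eq_some h), zero_mul]

theorem green_eq_zero_of_notMem_left (hP : ∀ a, IsWalkLaw J a (P a)) {Λ : Finset (Site d)}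
    {a b : Site d} (ha : a ∉ Λ) : green P Z Λ 0 a b = 0 := by
  rw [green_eq]
  refine (lintegral_congr fun l => ?_).trans lintegral_zero
  refine (lintegral_congr_ae ?_).trans lintegral_zero
  filter_upwards [(hP a).ae_start] with ω hω
  rw [atPos_of_ne fun h => ha (hω ▸ (killed_eq_some_iff'.1 h).1 0 zero_le), zero_mul]

/-- Monotonicity in the volume is given only for points of the smaller volume; elsewhere the smaller
Green's function vanishes. -/
theorem tendsto_green (hP : ∀ a, IsWalkLaw J a (P a)) (hmono : GreenMono P Z) (a b : Site d) :
    Tendsto (fun Λ : Finset (Site d) => green P Z Λ 0 a b) atTop (𝓝 (greenInf P Z a b)) := by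
  refine tendsto_atTop_iSup fun Λ' Λ h => ?_
  by_cases ha : a ∈ Λ'
  · by_cases hb : b ∈ Λ'
    · exact hmono Λ' Λ h a ha b hb
    · rw [green_eq_zero_of_notMem_right hb]; exact zero_le
  · rw [green_eq_zero_of_notMem_left hP ha]; exact zero_le

end Covariance

end

noncomputable section

/-! ### The equation of the Green's function in infinite volume -/

section RowEquation

variable {d : ℕ} {J : Site d → ℝ} {G : Site d → Site d → ℝ} {κ p : ℝ}

/-- The equation that determines the row `ψ` at `a` of the lace expansion coefficient. -/
def RowEq (J : Site d → ℝ) (G : Site d → Site d → ℝ) (p : ℝ) (a : Site d) (ψ : Site d → ℝ) : Prop :=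
  Summable ψ ∧ ∀ b, p * G a b = (if b = a then 1 else 0) + ∑' c, Jplus J (c - a) * G c b +
    ∑' c, ψ c * G c b

theorem summable_jplus_sub (hJ : IsJumpRate J) (a : Site d) : Summable fun c => Jplus J (c - a) :=
  ((Equiv.subRight a).summable_iff (f := Jplus J)).2 hJ.zero_eq.summable

theorem summable_mul_bounded {ι : Type*} {f g : ι → ℝ} (hf : Summable f) (hg : ∀ i, |g i| ≤ κ) :
    Summable fun i => f i * g i := by
  refine Summable.of_norm_bounded (hf.abs.mul_right κ) fun i => ?_
  rw [Real.norm_eq_abs, abs_mul]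
  exact mul_le_mul_of_nonneg_left (hg i) (abs_nonneg _)

variable (hκG : ∀ x y, |G x y| ≤ κ) (hsymm : ∀ x y, G x y = G y x)

include hκG hsymm in
theorem tsum_mul_tsum_eq_zero {φ f : Site d → ℝ} (hφ : Summable φ) (hf : Summable f)
    (h : ∀ b, ∑' c, φ c * G c b = 0) : ∑' c, φ c * ∑' e, f e * G e c = 0 := by
  have hs : Summable (Function.uncurry fun c e => φ c * (f e * G e c)) := by
    have h1 : Summable fun q : Site d × Site d => |φ q.1| * |f q.2| * κ :=
      (hφ.abs.mul_of_nonneg hf.abs (fun _ => abs_nonneg _) (fun _ => abs_nonneg _)).mul_right κ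
    refine Summable.of_norm_bounded h1 fun q => ?_
    rw [Function.uncurry, Real.norm_eq_abs, abs_mul, abs_mul, ← mul_assoc]
    exact mul_le_mul_of_nonneg_left (hκG _ _) (by positivity)
  simp only [← tsum_mul_left]
  refine hs.tsum_comm.symm.trans ?_
  refine (tsum_congr fun e => ?_).trans tsum_zero
  have : ∀ c, φ c * (f e * G e c) = f e * (φ c * G c e) := fun c => by rw [hsymm e c]; ring
  simp only [this]
  rw [tsum_mul_left, h, mul_zero]

include hκG hsymm in
-- The difference φ of two solutions annihilates every column of G. The row equation at x writes the
-- point mass at x as a combination of columns of G with summable coefficients, so φ(x) = 0.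
-- Existence of some solution for each x is what makes this work; no inverse of G is needed.
theorem rowEq_unique (hJ : IsJumpRate J) (hex : ∀ x, ∃ χ, RowEq J G p x χ) {a : Site d}
    {ψ ψ' : Site d → ℝ} (h : RowEq J G p a ψ) (h' : RowEq J G p a ψ') : ψ = ψ' := by
  have hφ : Summable fun c => ψ c - ψ' c := h.1.sub h'.1
  have h0 : ∀ b, ∑' c, (ψ c - ψ' c) * G c b = 0 := by
    intro b
    have s1 := summable_mul_bounded h.1 fun c => hκG c b
    have s2 := summable_mul_bounded h'.1 fun c => hκG c b
    simp only [sub_mul]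
    rw [s1.tsum_sub s2]
    linarith [h.2 b, h'.2 b]
  funext x
  obtain ⟨χ, hχ⟩ := hex x
  -- The row equation at x, evaluated at c and multiplied by φ(c); symmetry of G turns row x into
  -- column x.
  have e : ∀ c, (ψ c - ψ' c) * (if c = x then 1 else 0) = p * ((ψ c - ψ' c) * G c x) -
      (ψ c - ψ' c) * ∑' e, Jplus J (e - x) * G e c - (ψ c - ψ' c) * ∑' e, χ e * G e c := by
    intro c
    have := hχ.2 c
    rw [hsymm c x]
    linear_combination (-(ψ c - ψ' c)) * this
  have hb : ∀ {f : Site d → ℝ}, Summable f → ∀ c, |∑' e, f e * G e c| ≤ (∑' e, |f e|) * κ := by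
    intro f hf c
    rw [← tsum_mul_right, ← Real.norm_eq_abs]
    refine tsum_of_norm_bounded (hf.abs.mul_right κ).hasSum fun e => ?_
    rw [Real.norm_eq_abs, abs_mul]
    exact mul_le_mul_of_nonneg_left (hκG _ _) (abs_nonneg _)
  have s1 := (summable_mul_bounded hφ fun c => hκG c x).mul_left p
  have s2 := summable_mul_bounded hφ (hb (summable_jplus_sub hJ x))
  have s3 := summable_mul_bounded hφ (hb hχ.1)
  have h1 : ∑' c, (ψ c - ψ' c) * (if c = x then 1 else 0) = ψ x - ψ' x := by
    rw [tsum_eq_single x fun c hc => by rw [if_neg hc, mul_zero], if_pos rfl, mul_one]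
  have h2 : ∑' c, (ψ c - ψ' c) * (if c = x then 1 else 0) = 0 := by
    simp only [e]
    rw [(s1.sub s2).tsum_sub s3, s1.tsum_sub s2, tsum_mul_left, h0,
      tsum_mul_tsum_eq_zero hκG hsymm hφ (summable_jplus_sub hJ x) h0,
      tsum_mul_tsum_eq_zero hκG hsymm hφ hχ.1 h0]
    ring
  linarith

theorem rowEq_comp_aut (hJ : IsJumpRate J) (hT : ∀ (T : LatticeAut d) x y, G (T x) (T y) = G x y)
    (T : LatticeAut d) {a : Site d} {ψ : Site d → ℝ} (h : RowEq J G p (T a) ψ) :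
    RowEq J G p a fun c => ψ (T c) := by
  refine ⟨(T.toEquiv.summable_iff (f := ψ)).2 h.1, fun b => ?_⟩
  have h1 := h.2 (T b)
  rw [hT] at h1
  rw [h1, ← T.toEquiv.tsum_eq fun c => Jplus J (c - T a) * G c (T b),
    ← T.toEquiv.tsum_eq fun c => ψ c * G c (T b)]
  have e1 : ∀ c, Jplus J (T.toEquiv c - T a) * G (T.toEquiv c) (T b) = Jplus J (c - a) * G c b :=
    fun c => by
      show Jplus J (T c - T a) * G (T c) (T b) = _
      rw [(Jplus_symmetric hJ).apply_sub, hT]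
  have e2 : ∀ c, ψ (T.toEquiv c) * G (T.toEquiv c) (T b) = ψ (T c) * G c b := fun c => by
    show ψ (T c) * G (T c) (T b) = _
    rw [hT]
  simp only [e1, e2, T.injective.eq_iff]

end RowEquation

/-! ### The infinite-volume limit of the lace coefficient -/

section InfiniteVolume

variable {d : ℕ} {J : Site d → ℝ} {P : Site d → Measure (CadlagPath d)} {Z : WeightFamily d}
  {η κ p₀ : ℝ}

variable (hd : 5 ≤ d) (hJ : IsJumpRate J) (hP : ∀ a, IsWalkLaw J a (P a))
  (hZ : ∀ Λ, SmoothWeight Z Λ) (hG : GreenLeZero P Z) (hmono : GreenMono P Z)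
  (hV : VertexBound P Z η) (hη : 0 ≤ η) (hκ : 1 ≤ κ)
  (hg : ∀ x y, greenInf P Z x y ≤ ENNReal.ofReal (κ * decay (x - y)))
  (hsmall : laceConst d κ * η ≤ 1 / 2)

include hg in
theorem green_le_decay (Λ : Finset (Site d)) (x y : Site d) :
    green P Z Λ 0 x y ≤ ENNReal.ofReal (κ * decay (x - y)) :=
  (le_iSup (fun Λ => green P Z Λ 0 x y) Λ).trans (hg x y)

include hκ hg in
theorem toReal_green_le (Λ : Finset (Site d)) (x y : Site d) : (green P Z Λ 0 x y).toReal ≤ κ := by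
  refine ENNReal.toReal_le_of_le_ofReal (zero_le_one.trans hκ) ?_
  refine (green_le_decay hg Λ x y).trans (ENNReal.ofReal_le_ofReal ?_)
  exact mul_le_of_le_one_right (zero_le_one.trans hκ) (decay_le_one _)

include hκ hg in
theorem toReal_greenInf_le (x y : Site d) : (greenInf P Z x y).toReal ≤ κ := by
  refine ENNReal.toReal_le_of_le_ofReal (zero_le_one.trans hκ) ?_
  refine (hg x y).trans (ENNReal.ofReal_le_ofReal ?_)
  exact mul_le_of_le_one_right (zero_le_one.trans hκ) (decay_le_one _)

/-- The bound on a row of the lace expansion coefficient. -/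
def rowBound (d : ℕ) (κ η : ℝ) (a c : Site d) : ℝ := 2 * laceConst d κ * η * decay (a - c) ^ 3

include hd in
theorem summable_decay_cube : Summable fun x : Site d => decay x ^ 3 := by
  refine Summable.of_nonneg_of_le (fun x => pow_nonneg (decay_nonneg x) _) (fun x => ?_)
    (summable_decay_sq hd)
  exact pow_le_pow_of_le_one (decay_nonneg x) (decay_le_one x) (by omega)

include hd in
theorem summable_rowBound (a : Site d) : Summable (rowBound d κ η a) :=
  (((Equiv.subLeft a).summable_iff (f := fun x : Site d => decay x ^ 3)).2
    (summable_decay_cube hd)).mul_left _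

include hη in
theorem rowBound_nonneg (a c : Site d) : 0 ≤ rowBound d κ η a c :=
  mul_nonneg (mul_nonneg (mul_nonneg zero_le_two laceConst_nonneg) hη) (pow_nonneg (decay_nonneg _) _)

/-- A row of the finite-volume lace expansion coefficient, extended by `0`. -/
def lacePsiRow (P : Site d → Measure (CadlagPath d)) (Z : WeightFamily d) (a : Site d)
    (Λ : Finset (Site d)) (c : Site d) : ℝ :=
  open Classical in if c ∈ Λ then lacePsi P Z Λ a c else 0

include hd hJ hP hZ hG hV hη hκ hg hsmall in
theorem abs_lacePsiRow_le (a : Site d) (Λ : Finset (Site d)) (c : Site d) :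
    |lacePsiRow P Z a Λ c| ≤ rowBound d κ η a c := by
  unfold lacePsiRow
  split_ifs with hc
  · exact abs_lacePsi_le hd (hZ Λ) hJ hP hG hV hη hκ (green_le_decay hg Λ) hsmall a hc
  · rw [abs_zero]; exact rowBound_nonneg hη a c

include hd hJ hP hZ hG hV hη hκ hg hsmall in
theorem finite_equation {Λ : Finset (Site d)} {a b : Site d} (ha : a ∈ Λ) (hb : b ∈ Λ) :
    (Jhat J - selfLoop Z Λ a) * (green P Z Λ 0 a b).toReal = (if b = a then 1 else 0) +
      ∑' c, Jplus J (c - a) * (green P Z Λ 0 c b).toReal +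
        ∑' c, lacePsiRow P Z a Λ c * (green P Z Λ 0 c b).toReal := by
  have hgΛ := green_le_decay hg Λ
  have h1 := green_equation (hZ Λ) hJ hP hG ha hb
    (fun a _ c hc => laceMass_ne_top hd (hZ Λ) hJ hP hG hV hη hκ hgΛ a 0 hc)
    (fun c _ => ((hgΛ c b).trans_lt ENNReal.ofReal_lt_top).ne)
  rw [remInt_zero_eq hd (hZ Λ) hJ hP hG hV hη hκ hgΛ hsmall a hb] at h1
  have h0 : ∀ c, c ∉ Λ → (green P Z Λ 0 c b).toReal = 0 := fun c hc => by
    rw [green_eq_zero_of_notMem_left hP hc, ENNReal.toReal_zero]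
  rw [tsum_eq_sum (s := Λ) fun c hc => by rw [h0 c hc, mul_zero],
    tsum_eq_sum (s := Λ) fun c hc => by rw [h0 c hc, mul_zero]]
  have e1 : ∑ c ∈ Λ, lacePsiRow P Z a Λ c * (green P Z Λ 0 c b).toReal =
      ∑ c ∈ Λ, lacePsi P Z Λ a c * (green P Z Λ 0 c b).toReal :=
    Finset.sum_congr rfl fun c hc => by rw [lacePsiRow, if_pos hc]
  have e2 : ∑ c ∈ Λ, J (c - a) * (green P Z Λ 0 c b).toReal = J 0 * (green P Z Λ 0 a b).toReal +
      ∑ c ∈ Λ, Jplus J (c - a) * (green P Z Λ 0 c b).toReal := by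
    have e3 : J 0 * (green P Z Λ 0 a b).toReal =
        ∑ c ∈ Λ, if c = a then J 0 * (green P Z Λ 0 c b).toReal else 0 := by
      rw [Finset.sum_ite_eq', if_pos ha]
    rw [e3, ← Finset.sum_add_distrib]
    refine Finset.sum_congr rfl fun c _ => ?_
    unfold Jplus
    by_cases hca : c = a
    · rw [if_pos hca, if_pos (sub_eq_zero.2 hca), hca, sub_self]; ring
    · rw [if_neg hca, if_neg (sub_ne_zero.2 hca), zero_add]
  rw [e1, Jhat]
  rw [e2] at h1
  linarith

include hd hJ hP hZ hG hmono hV hη hκ hg hsmall in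
-- Each entry of a row stays in a compact interval, so it converges along any ultrafilter, with no
-- subsequence to extract. The summable bound, uniform in Λ, lets the finite-volume equation pass to
-- the limit by dominated convergence.
theorem rowEq_of_ultrafilter {𝒰 : Ultrafilter (Finset (Site d))} (h𝒰 : ↑𝒰 ≤ (atTop : Filter (Finset (Site d))))
    (a : Site d) (hp : Tendsto (fun Λ : Finset (Site d) => selfLoop Z Λ a) atTop (𝓝 p₀)) :
    ∃ ψ : Site d → ℝ, (∀ c, Tendsto (fun Λ => lacePsiRow P Z a Λ c) 𝒰 (𝓝 (ψ c))) ∧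
      (∀ c, |ψ c| ≤ rowBound d κ η a c) ∧
      RowEq J (fun x y => (greenInf P Z x y).toReal) (Jhat J - p₀) a ψ := by
  have hb := abs_lacePsiRow_le hd hJ hP hZ hG hV hη hκ hg hsmall a
  have hlim : ∀ c, ∃ x ∈ Set.Icc (-rowBound d κ η a c) (rowBound d κ η a c),
      Tendsto (fun Λ => lacePsiRow P Z a Λ c) 𝒰 (𝓝 x) := by
    intro c
    obtain ⟨x, hx, hle⟩ := (isCompact_Icc (a := -rowBound d κ η a c)
      (b := rowBound d κ η a c)).ultrafilter_le_nhds (𝒰.map fun Λ => lacePsiRow P Z a Λ c) (by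
        rw [Ultrafilter.coe_map, le_principal_iff, Filter.mem_map]
        exact Filter.univ_mem' fun Λ => abs_le.1 (hb Λ c))
    exact ⟨x, hx, hle⟩
  choose ψ hψ1 hψ2 using hlim
  have hψb : ∀ c, |ψ c| ≤ rowBound d κ η a c := fun c => abs_le.2 (hψ1 c)
  have hsum := summable_rowBound (κ := κ) (η := η) hd a
  refine ⟨ψ, hψ2, hψb, Summable.of_norm_bounded hsum hψb, fun b => ?_⟩
  have hκ0 : 0 ≤ κ := zero_le_one.trans hκ
  have hgt : ∀ c, Tendsto (fun Λ : Finset (Site d) => (green P Z Λ 0 c b).toReal) 𝒰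
      (𝓝 (greenInf P Z c b).toReal) := fun c =>
    (ENNReal.tendsto_toReal (((hg c b).trans_lt ENNReal.ofReal_lt_top).ne)).comp
      ((tendsto_green hP hmono c b).mono_left h𝒰)
  have t1 : Tendsto (fun Λ : Finset (Site d) => ∑' c, Jplus J (c - a) * (green P Z Λ 0 c b).toReal) 𝒰
      (𝓝 (∑' c, Jplus J (c - a) * (greenInf P Z c b).toReal)) := by
    refine tendsto_tsum_of_dominated_convergence ((summable_jplus_sub hJ a).mul_right κ)
      (fun c => (hgt c).const_mul _) (Eventually.of_forall fun Λ c => ?_)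
    rw [Real.norm_of_nonneg (mul_nonneg (hJ.jplus_nonneg _) ENNReal.toReal_nonneg)]
    exact mul_le_mul_of_nonneg_left (toReal_green_le hκ hg Λ c b) (hJ.jplus_nonneg _)
  have t2 : Tendsto (fun Λ : Finset (Site d) => ∑' c, lacePsiRow P Z a Λ c *
      (green P Z Λ 0 c b).toReal) 𝒰 (𝓝 (∑' c, ψ c * (greenInf P Z c b).toReal)) := by
    refine tendsto_tsum_of_dominated_convergence (hsum.mul_right κ)
      (fun c => (hψ2 c).mul (hgt c)) (Eventually.of_forall fun Λ c => ?_)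
    rw [norm_mul, Real.norm_of_nonneg (ENNReal.toReal_nonneg (a := green P Z Λ 0 c b)),
      Real.norm_eq_abs]
    exact mul_le_mul (hb Λ c) (toReal_green_le hκ hg Λ c b) ENNReal.toReal_nonneg
      (rowBound_nonneg hη a c)
  have t3 := ((hp.mono_left h𝒰).const_sub (Jhat J)).mul (hgt a)
  have t4 := (t1.const_add (if b = a then (1 : ℝ) else 0)).add t2
  refine tendsto_nhds_unique (t3.congr' ?_) t4
  have hev : ∀ᶠ Λ : Finset (Site d) in 𝒰, ({a, b} : Finset (Site d)) ≤ Λ :=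
    h𝒰 (eventually_ge_atTop _)
  filter_upwards [hev] with Λ hΛ
  exact finite_equation hd hJ hP hZ hG hV hη hκ hg hsmall (hΛ (by simp)) (hΛ (by simp))

include hd hJ hP hZ hG hmono hV hη hκ hg hsmall in
/-- The infinite-volume limit of the lace expansion coefficient. -/
theorem exists_lacePsi_limit (hcov : WeightCovariant Z)
    (hp : ∀ a, Tendsto (fun Λ : Finset (Site d) => selfLoop Z Λ a) atTop (𝓝 p₀)) :
    ∃ Ψ : Site d → ℝ,
      (∀ x y, Tendsto (fun Λ : Finset (Site d) => lacePsi P Z Λ x y) atTop (𝓝 (Ψ (y - x)))) ∧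
      IsLatticeSymmetric Ψ ∧ (∀ x, |Ψ x| ≤ rowBound d κ η 0 x) ∧
      RowEq J (fun x y => (greenInf P Z x y).toReal) (Jhat J - p₀) 0 Ψ := by
  set G : Site d → Site d → ℝ := fun x y => (greenInf P Z x y).toReal with hGdef
  have hκG : ∀ x y, |G x y| ≤ κ := fun x y => by
    rw [abs_of_nonneg ENNReal.toReal_nonneg]; exact toReal_greenInf_le hκ hg x y
  have hsymm : ∀ x y, G x y = G y x := fun x y => by
    rw [hGdef]; beta_reduce; rw [greenInf_symm hJ hP hZ hcov]
  have hT : ∀ (T : LatticeAut d) x y, G (T x) (T y) = G x y := fun T x y => by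
    rw [hGdef]; beta_reduce; rw [greenInf_mapAut hJ hP hZ hcov]
  have hrow := fun (𝒰 : Ultrafilter (Finset (Site d))) (h𝒰 : ↑𝒰 ≤ (atTop : Filter (Finset (Site d)))) a =>
    rowEq_of_ultrafilter hd hJ hP hZ hG hmono hV hη hκ hg hsmall h𝒰 a (hp a)
  -- One reference ultrafilter provides a solution in every row. This supplies the existence
  -- hypothesis of the uniqueness lemma, and all other limits are compared with it.
  choose ψ hψ1 hψ2 hψ3 using hrow (Ultrafilter.of atTop) (Ultrafilter.of_le _)
  have hex : ∀ x, ∃ χ, RowEq J G (Jhat J - p₀) x χ := fun x => ⟨ψ x, hψ3 x⟩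
  have huniq : ∀ {a : Site d} {χ χ' : Site d → ℝ}, RowEq J G (Jhat J - p₀) a χ →
      RowEq J G (Jhat J - p₀) a χ' → χ = χ' := fun h h' => rowEq_unique hκG hsymm hJ hex h h'
  -- An automorphism carries solutions to solutions, so uniqueness forces invariance. Translations
  -- then reduce everything to the row at 0, and automorphisms fixing 0 give lattice symmetry.
  have haut : ∀ (T : LatticeAut d) a c, ψ (T a) (T c) = ψ a c := fun T a c =>
    congrFun (huniq (rowEq_comp_aut hJ hT T (hψ3 (T a))) (hψ3 a)) c
  refine ⟨ψ 0, fun x y => ?_, fun T hT0 x => ?_, hψ2 0, hψ3 0⟩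
  · have e : ψ 0 (y - x) = ψ x y := by
      rw [← haut (transAut x) 0 (y - x)]
      simp
    rw [e]
    -- By uniqueness every ultrafilter finer than `atTop` produces the same limit, hence the net
    -- itself converges.
    have h1 : Tendsto (fun Λ => lacePsiRow P Z x Λ y) atTop (𝓝 (ψ x y)) := by
      refine tendsto_iff_ultrafilter _ _ _ |>.2 fun 𝒰 h𝒰 => ?_
      obtain ⟨χ, h1, _, h3⟩ := hrow 𝒰 h𝒰 x
      rw [← huniq h3 (hψ3 x)]
      exact h1 y
    refine h1.congr' ?_
    filter_upwards [eventually_ge_atTop ({y} : Finset (Site d))] with Λ hΛ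
    rw [lacePsiRow, if_pos (hΛ (Finset.mem_singleton_self y))]
  · have := haut T 0 x
    rwa [hT0] at this

end InfiniteVolume

end

noncomputable section

/-! ### Choice of constants and conclusion -/

section Conclusion

variable {d : ℕ}

theorem decay_cube_eq (hd : 5 ≤ d) (x : Site d) :
    decay x ^ 3 = mnorm x ^ (-(3 * ((d : ℤ) - 2))) := by
  have h : (3 * ((d : ℤ) - 2)) = (((d - 2) * 3 : ℕ) : ℤ) := by
    push_cast [Nat.cast_sub (show 2 ≤ d by omega)]
    ring
  rw [h, zpow_neg, zpow_natCast, decay, inv_pow, pow_mul]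

/-- Positivity of g is automatic: g = 0 would force 1 - δ ≤ 0. -/
theorem lower_bound {p g S : ℝ} {δ : ℝ} (hδ : δ < 1) (hg : 0 ≤ g) (hgS : g ≤ S)
    (h : 1 - δ ≤ p * g) : (1 - δ) / S ≤ p := by
  have hg0 : 0 < g := by
    rcases hg.eq_or_lt with h0 | h0
    · rw [← h0, mul_zero] at h; linarith
    · exact h0
  have h1 : (1 - δ) / g ≤ p := (div_le_iff₀ hg0).2 h
  exact (div_le_div_of_nonneg_left (by linarith) hg0 hgS).trans h1

end Conclusion

end

theorem proposition8p7 (d : ℕ) (hd : 5 ≤ d) (J : Site d → ℝ) (hJ : IsJumpRate J)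
    (P : Site d → Measure (CadlagPath d)) (hP : ∀ a, IsWalkLaw J a (P a))
    (K : ℝ) (hK : 0 < K) :
    ∃ α : ℝ, 0 < α ∧ ∃ η₀ : ℝ, 0 < η₀ ∧ ∃ C : ℝ, 0 < C ∧
      ∀ η : ℝ, 0 < η → η < η₀ →
      ∀ (Z : WeightFamily d) (p₀ : ℝ),
        WeightPosCont Z → WeightC2 Z → WeightCovariant Z →
        GreenLeZero P Z → GreenMono P Z → VertexBound P Z η →
        InfraredBound P Z K → SelfLoopLimit P Z K p₀ →
        (∀ (Λ : Finset (Site d)) (x y : Site d), x ∈ Λ → y ∈ Λ → LacePsiConverges P Z Λ x y) ∧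
        ∃ Ψ : Site d → ℝ,
          (∀ x y : Site d,
            Tendsto (fun Λ : Finset (Site d) => lacePsi P Z Λ x y) atTop (𝓝 (Ψ (y - x)))) ∧
          IsLatticeSymmetric Ψ ∧
          (∀ x, |Ψ x| ≤ α * η * mnorm x ^ (-(3 * ((d : ℤ) - 2)))) ∧
          (∀ x, Summable (fun y => Ψ y * (greenInf P Z 0 (x - y)).toReal) ∧
            (Jhat J - p₀) * (greenInf P Z 0 x).toReal =
              (if x = 0 then 1 else 0) + conv (Jplus J) (fun z => (greenInf P Z 0 z).toReal) x +
                conv Ψ (fun z => (greenInf P Z 0 z).toReal) x) ∧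
          (1 - C * η) / (K * (freeGreen P 0).toReal) ≤ Jhat J - p₀ := by
  obtain ⟨CS, hCS, hS⟩ := freeGreen_le hJ (show 3 ≤ d by omega)
  have hfree := hS P hP
  -- The infrared bound and the decay of S give G ≤ K·CS·|||x|||^{-(d-2)}; the maximum with 1 serves
  -- the estimates that need κ ≥ 1.
  set κ : ℝ := max 1 (K * CS) with hκdef
  have hκ : 1 ≤ κ := le_max_left _ _
  have hκ0 : 0 < κ := one_pos.trans_le hκ
  have hc0 : 0 ≤ laceConst d κ := laceConst_nonneg
  have hD0 : 0 ≤ ∑' x : Site d, decay x ^ 3 := tsum_nonneg fun x => pow_nonneg (decay_nonneg x) _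
  -- The factor 2 is that of the geometric series, and it also turns αη < 1 into a ratio of at most
  -- 1/2. The summand 1 makes α positive.
  set α : ℝ := 2 * laceConst d κ + 1 with hα
  -- The first summand times η bounds |Ψ * G(0)|, through the decay of Ψ and G ≤ κ.
  set C : ℝ := α * κ * (∑' x : Site d, decay x ^ 3) + 1 with hC
  have hα0 : 0 < α := by positivity
  have hC0 : 0 < C := by positivity
  refine ⟨α, hα0, min (1 / α) (1 / C) , lt_min (by positivity) (by positivity), C, hC0, ?_⟩
  intro η hη hηlt Z p₀ hpos hC2 hcov hG hmono hV hIR hSL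
  have hηα : α * η < 1 := by
    have := (lt_min_iff.1 hηlt).1
    rwa [lt_div_iff₀ hα0, mul_comm] at this
  have hηC : C * η < 1 := by
    have := (lt_min_iff.1 hηlt).2
    rwa [lt_div_iff₀ hC0, mul_comm] at this
  have hsmall : laceConst d κ * η ≤ 1 / 2 := by
    rw [hα] at hηα
    nlinarith
  have hZ : ∀ Λ, SmoothWeight Z Λ := fun Λ => ⟨(hpos Λ).1, hC2 Λ⟩
  have hg : ∀ x y, greenInf P Z x y ≤ ENNReal.ofReal (κ * decay (x - y)) := by
    intro x y
    refine (hIR x y).trans ((mul_le_mul_right (hfree (y - x)) _).trans ?_)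
    rw [← ENNReal.ofReal_mul hK.le, ← mul_assoc, decay_sub_comm]
    exact ENNReal.ofReal_le_ofReal (mul_le_mul_of_nonneg_right (le_max_right _ _) (decay_nonneg _))
  obtain ⟨_, hp⟩ := hSL hIR
  refine ⟨fun Λ x y _ hy => lacePsiConverges hd (hZ Λ) hJ hP hG hV hη.le hκ
    (green_le_decay hg Λ) hsmall x hy, ?_⟩
  obtain ⟨Ψ, h1, h2, h3, h4⟩ := exists_lacePsi_limit hd hJ hP hZ hG hmono hV hη.le hκ hg hsmall hcov hp
  have hbound : ∀ x, |Ψ x| ≤ α * η * decay x ^ 3 := by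
    intro x
    refine (h3 x).trans ?_
    rw [rowBound, zero_sub, decay_neg]
    refine mul_le_mul_of_nonneg_right ?_ (pow_nonneg (decay_nonneg _) _)
    exact mul_le_mul_of_nonneg_right (by rw [hα]; linarith) hη.le
  have hgκ : ∀ x, |(greenInf P Z 0 x).toReal| ≤ κ := fun x => by
    rw [abs_of_nonneg ENNReal.toReal_nonneg]; exact toReal_greenInf_le hκ hg 0 x
  have hconv : ∀ f : Site d → ℝ, ∀ x, conv f (fun z => (greenInf P Z 0 z).toReal) x =
      ∑' c, f c * (greenInf P Z c x).toReal := fun f x =>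
    tsum_congr fun c => by rw [greenInf_eq_sub hJ hP hZ hcov c x]
  have heq : ∀ x, (Jhat J - p₀) * (greenInf P Z 0 x).toReal =
      (if x = 0 then 1 else 0) + conv (Jplus J) (fun z => (greenInf P Z 0 z).toReal) x +
        conv Ψ (fun z => (greenInf P Z 0 z).toReal) x := by
    intro x
    have := h4.2 x
    simp only [sub_zero] at this
    rw [hconv, hconv, this]
  refine ⟨Ψ, h1, h2, fun x => by rw [← decay_cube_eq hd]; exact hbound x, fun x =>
    ⟨summable_mul_bounded h4.1 fun y => hgκ (x - y), heq x⟩, ?_⟩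
  -- The remaining two goals are the infrared bound at the origin and the equation at x = 0, where
  -- J₊ * G ≥ 0 is discarded.
  refine lower_bound hηC (ENNReal.toReal_nonneg (a := greenInf P Z 0 0)) ?_ ?_
  · have h5 := hIR 0 0
    rw [sub_zero] at h5
    have h6 := ENNReal.toReal_mono (ENNReal.mul_ne_top ENNReal.ofReal_ne_top
      ((hfree 0).trans_lt ENNReal.ofReal_lt_top).ne) h5
    rwa [ENNReal.toReal_mul, ENNReal.toReal_ofReal hK.le] at h6
  · rw [heq 0, if_pos rfl]
    have h5 : 0 ≤ conv (Jplus J) (fun z => (greenInf P Z 0 z).toReal) 0 :=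
      tsum_nonneg fun y => mul_nonneg (hJ.jplus_nonneg y) ENNReal.toReal_nonneg
    have h6 : |conv Ψ (fun z => (greenInf P Z 0 z).toReal) 0| ≤
        α * η * (∑' x : Site d, decay x ^ 3) * κ := by
      rw [← Real.norm_eq_abs, ← tsum_mul_left, ← tsum_mul_right]
      refine tsum_of_norm_bounded
        (((summable_decay_cube hd).mul_left (α * η)).mul_right κ).hasSum fun y => ?_
      rw [Real.norm_eq_abs, abs_mul]
      exact mul_le_mul (hbound y) (hgκ _) (abs_nonneg _)
        (mul_nonneg (mul_nonneg hα0.le hη.le) (pow_nonneg (decay_nonneg _) _))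
    have h7 := (abs_le.1 h6).1
    have h8 : α * η * (∑' x : Site d, decay x ^ 3) * κ ≤ C * η := by
      rw [hC]; nlinarith
    linarith
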